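/- **Setting.** Let $D,\mathcal D\subset\mathbb R^3$ be compact and convex, $D\neq\emptyset$, $D\subset\mathcal D$, $\partial\mathcal D$ smooth, and $\mathrm{dist}(D,\partial\mathcal D)\ge\delta>0$; let $T>0$, and let $p^{\mathrm s},p^{\mathrm d}>0$ with $p^{\mathrm s}+p^{\mathrm d}\le1$, $q>0$, $\beta>0$. Write $\mathcal H^2$ for the two-dimensional Hausdorff measure and $\mathrm{vol}_{S^2}$ for the uniform probability measure on $S^2$. Let $\gamma$ be a probability measure on $\mathbb R^3$ with a smooth density $G\geq 0$ that is compactly supported in the open ball $B_{\delta/2}(0)$. For $x$ in the interior of $\mathcal D$ and $v\in S^2$ let $R(x,v)=(a,b)$, where $\partial\mathcal D\cap(x+\mathbb Rv)=\{a,b\}$ and $(b-a)/|b-a|=v$. For a finite nonnegative measure $\lambda$ on $D$ put $$A^{\mathrm s}\lambda=\frac{\lambda(D)}{\mathcal H^2(\partial\mathcal D)^2}\,(\mathcal H^2\llcorner\partial\mathcal D)\otimes(\mathcal H^2\llcorner\partial\mathcal D),\qquad A^{\mathrm d}\lambda=R_{\#}\big((\gamma*\lambda)\otimes\mathrm{vol}_{S^2}\big),$$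 and for $\rho=\mathrm dt\otimes\rho_t\in\mathcal M_+([0,T]\times D)$ put $A^{i}\rho=\mathrm dt\otimes A^{i}\rho_t$, $i\in\{\mathrm s,\mathrm d\}$. Two settings are considered. * *Continuous:* $\nu=\mathrm dt\llcorner[0,T]\otimes(\mathcal H^2\llcorner\partial\mathcal D)\otimes(\mathcal H^2\llcorner\partial\mathcal D)$ and $Z=[0,T]\times\partial\mathcal D\times\partial\mathcal D$. * *Discrete:* $[0,T)$ is divided into $N\ge1$ bins $\tau_i=[(i-1)\frac TN,i\frac TN)$ with centres $t_i$, and $\partial\mathcal D$ is partitioned into finitely many Borel sets $\Gamma_1,\dots,\Gamma_M$ with $\mathcal H^2(\Gamma_j)>0$, $\mathcal H^2(\partial\Gamma_j)=0$ (boundary relative to $\partial\mathcal D$) and chosen points $z_j\in\Gamma_j$. Then $A^{\mathrm s}$ and $A^{\mathrm d}$ are replaced by their compositions with $\mu\mapsto\sum_{i,j,k}\mu(\tau_i\times\Gamma_j\times\Gamma_k)\,\delta_{(t_i,z_j,z_k)}$, and $\nu=\sum_{i,j,k}\delta_{(t_i,z_j,z_k)}$, $Z=\{(t_i,z_j,z_k)\}$.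 In this setting $\gamma=\delta_0$ is also allowed. Put $A=p^{\mathrm s}A^{\mathrm s}+p^{\mathrm d}A^{\mathrm d}$ and $A^q=qp^{\mathrm s}A^{\mathrm s}+p^{\mathrm d}A^{\mathrm d}$. For $\rho\in\mathcal M_+([0,T]\times D)$ and $\eta\in\mathcal M([0,T]\times D)^3$ let $S(\rho,\eta)=\int|\frac{\mathrm d\eta}{\mathrm d\rho}|^2\,\mathrm d\rho$ if $\rho$ is of the form $\mathrm dt\otimes\rho_t$, $\eta\ll\rho$, and $\partial_t\rho+\mathrm{div}\,\eta=0$ on $(0,T)\times\mathbb R^3$ in the sense of distributions; let $S(\rho,\eta)=\infty$ otherwise. For a finite nonnegative Borel measure $E$ on $[0,T]\times\partial\mathcal D\times\partial\mathcal D$ with $E(Z^c)=0$ (a *measurement*; for instance a finite sum of Dirac measures) let $$J^{E,q}(\rho,\eta)=\|A\rho\|-\int\log\Big(\frac{\mathrm d(A^q\rho)}{\mathrm d\nu}\Big)\,\mathrm dE+\beta S(\rho,\eta),$$ and $J^{E,q}(\rho,\eta)=\infty$ if $S(\rho,\eta)=\infty$. Here $\|\cdot\|$ is the total mass, $\log 0=-\infty$,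 and the Radon–Nikodym derivative is evaluated through its representative that is continuous on $Z$. **Proposition (Minimizers of sequences of measurements).** In the continuous as well as in the discrete setting, let measurements $E_n$, $n\in\mathbb N$, converge weakly-* to some $E\in\mathcal M_+([0,T]\times\partial\mathcal D\times\partial\mathcal D)$, and for each $n$ let $(\rho_n,\eta_n)\in\mathcal M_+([0,T]\times D)\times\mathcal M([0,T]\times D)^3$ be a minimizer of $J^{E_n,q}$. Then a subsequence of $(\rho_n,\eta_n)$ converges weakly-* to a minimizer of $J^{E,q}$. -/

import Mathlib

open MeasureTheory Set Filter Topology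
open scoped ENNReal NNReal

noncomputable section

/-- Physical space `ℝ³` with the Euclidean norm. -/
abbrev E3 : Type := EuclideanSpace ℝ (Fin 3)

/-- Space-time points `(t, x)`. -/
abbrev SpaceTime : Type := ℝ × E3

/-- Detection events `(t, a, b)`: time and the two detection points of a photon pair. -/
abbrev Event : Type := ℝ × E3 × E3

/-- A closed set `K ⊆ ℝ³` has smooth boundary: near each boundary point it is the sublevel set
of a smooth function with nonvanishing differential. -/
def HasSmoothBoundary (K : Set E3) : Prop :=
  ∀ x ∈ frontier K, ∃ U ∈ 𝓝 x, ∃ φ : E3 → ℝ,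
    ContDiff ℝ ((⊤ : ℕ∞) : WithTop ℕ∞) φ ∧ fderiv ℝ φ x ≠ 0 ∧
      ∀ y ∈ U, y ∈ K ↔ φ y ≤ 0

/-- The scanning geometry: the region `D` containing the tracer, the body `K` on whose boundary
the detectors sit, a lower bound `δ` for the distance of `D` to `∂K`, and the measurement
time `T`. -/
structure Scanner where
  D : Set E3
  K : Set E3
  δ : ℝ
  T : ℝ
  isCompact_D : IsCompact D
  convex_D : Convex ℝ D
  nonempty_D : D.Nonempty
  isCompact_K : IsCompact K
  convex_K : Convex ℝ K
  smooth_K : HasSmoothBoundary K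
  D_subset_K : D ⊆ K
  δ_pos : 0 < δ
  δ_le_dist : ∀ x ∈ D, ∀ y ∈ frontier K, δ ≤ dist x y
  T_pos : 0 < T

/-- A positron range kernel: a smooth probability density on `ℝ³` with compact support in the
open ball of radius `δ / 2` about the origin. -/
structure PositronKernel (δ : ℝ) where
  G : E3 → ℝ
  smooth : ContDiff ℝ ((⊤ : ℕ∞) : WithTop ℕ∞) G
  nonneg : ∀ x, 0 ≤ G x
  tsupport_subset : tsupport G ⊆ Metric.ball 0 (δ / 2)
  integral_eq_one : ∫ x, G x = 1

/-- The two-dimensional Hausdorff measure restricted to the boundary of `K`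
(normalized so that it is the usual surface area). -/
def surfaceMeasure (K : Set E3) : Measure E3 :=
  (Measure.euclideanHausdorffMeasure 2 : Measure E3).restrict (frontier K)

/-- A discretization of the measurement: `N` time bins of equal length and `M` detectors `Γ j`
partitioning `∂K`, each of positive area, with `H²`-negligible boundary relative to `∂K`,
and with a marked point `z j ∈ Γ j`. -/
structure DetectorArray (K : Set E3) where
  N : ℕ
  M : ℕ
  N_pos : 0 < N
  Γ : Fin M → Set E3
  z : Fin M → E3
  measurableSet_Γ : ∀ j, MeasurableSet (Γ j)
  disjoint_Γ : Pairwise fun j k => Disjoint (Γ j) (Γ k)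
  iUnion_Γ : ⋃ j, Γ j = frontier K
  null_boundary : ∀ j, surfaceMeasure K (closure (Γ j) ∩ closure (frontier K \ Γ j)) = 0
  pos_area : ∀ j, 0 < surfaceMeasure K (Γ j)
  z_mem : ∀ j, z j ∈ Γ j

namespace DetectorArray

variable {K : Set E3}

/-- The `i`-th time bin `[i ΔT, (i + 1) ΔT)`, where `ΔT = T / N` and `i = 0, …, N - 1`. -/
def bin (d : DetectorArray K) (T : ℝ) (i : Fin d.N) : Set ℝ :=
  Ico ((i : ℝ) * (T / d.N)) (((i : ℝ) + 1) * (T / d.N))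

/-- The centre of the `i`-th time bin. -/
def binCentre (d : DetectorArray K) (T : ℝ) (i : Fin d.N) : ℝ :=
  ((i : ℝ) + 1 / 2) * (T / d.N)

/-- The event which represents time bin `i` and detector pair `(j, k)`. -/
def node (d : DetectorArray K) (T : ℝ) (i : Fin d.N) (j k : Fin d.M) : Event :=
  (d.binCentre T i, d.z j, d.z k)

/-- The discretization operator
`μ ↦ ∑ i j k, μ (τ i × Γ j × Γ k) δ_(t i, z j, z k)`. -/
def discretize (d : DetectorArray K) (T : ℝ) (μ : Measure Event) : Measure Event :=
  ∑ i, ∑ j, ∑ k, μ (d.bin T i ×ˢ d.Γ j ×ˢ d.Γ k) • Measure.dirac (d.node T i j k)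

end DetectorArray

/-- The three measurement settings: continuous measurements (with positron range), discrete
measurements with positron range, and discrete measurements with vanishing positron range. -/
inductive Setting (sc : Scanner) where
  | continuous (G : PositronKernel sc.δ)
  | discrete (G : PositronKernel sc.δ) (d : DetectorArray sc.K)
  | discreteNoRange (d : DetectorArray sc.K)

/-- The law on `ℝ³` with density `G`. -/
def PositronKernel.law {δ : ℝ} (G : PositronKernel δ) : Measure E3 :=
  volume.withDensity fun x => ENNReal.ofReal (G.G x)

namespace Setting

variable {sc : Scanner}

/-- The law of the displacement between positron emission and annihilation. -/
def rangeLaw : Setting sc → Measure E3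
  | continuous G => G.law
  | discrete G _ => G.law
  | discreteNoRange _ => Measure.dirac 0

/-- The recording of an intensity of events: unchanged in the continuous setting, and
discretized in the discrete setting. -/
def record : Setting sc → Measure Event → Measure Event
  | continuous _ => id
  | discrete _ d => d.discretize sc.T
  | discreteNoRange d => d.discretize sc.T

/-- The reference measure `ν` of a discretization, i.e. the sum of the Dirac measures at all
its nodes. -/
def nodeMeasure (d : DetectorArray sc.K) : Measure Event :=
  ∑ i, ∑ j, ∑ k, Measure.dirac (d.node sc.T i j k)

/-- The finite set of nodes of a discretization. -/
def nodeSet (d : DetectorArray sc.K) : Set Event :=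
  {e | ∃ i j k, e = d.node sc.T i j k}

/-- The reference measure `ν`: `dt ⊗ H²⌞∂K ⊗ H²⌞∂K` in the continuous setting. -/
def refMeasure : Setting sc → Measure Event
  | continuous _ => ((volume : Measure ℝ).restrict (Icc 0 sc.T)).prod
      ((surfaceMeasure sc.K).prod (surfaceMeasure sc.K))
  | discrete _ d => nodeMeasure d
  | discreteNoRange d => nodeMeasure d

/-- The closed set of events that can be recorded: `[0, T] × ∂K × ∂K` in the continuous setting,
and the nodes in the discrete setting. -/
def eventSet : Setting sc → Set Event
  | continuous _ => Icc 0 sc.T ×ˢ frontier sc.K ×ˢ frontier sc.K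
  | discrete _ d => nodeSet d
  | discreteNoRange d => nodeSet d

end Setting

/-! ### The forward operator

On the time slices `ρ_t` of `ρ = dt ⊗ ρ_t` the operators are the usual spatial ones. Here they are written
on space-time measures with the time coordinate as a spectator, which gives `dt ⊗ A ρ_t`. -/

/-- Uniform probability measure on the unit sphere. -/
def uniformSphere : Measure (Metric.sphere (0 : E3) 1) :=
  ((volume : Measure E3).toSphere univ)⁻¹ • (volume : Measure E3).toSphere

/-- The detection points `(a, b)` of a photon pair emitted at an interior point `x` of the
compact convex set `K` in direction `v`: the two points of `∂K ∩ (x + ℝ v)`, ordered such that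
`b - a` is a positive multiple of `v`. -/
def detectionPoints (K : Set E3) (x v : E3) : E3 × E3 :=
  (x + sInf {r : ℝ | x + r • v ∈ K} • v, x + sSup {r : ℝ | x + r • v ∈ K} • v)

/-- Positron range: convolution in space with the displacement law `γ`. -/
def positronRange (γ : Measure E3) (ρ : Measure SpaceTime) : Measure SpaceTime :=
  (ρ.prod γ).map fun p => (p.1.1, p.1.2 + p.2)

/-- Photon emission in uniformly distributed directions. -/
def emissionLines (ρ : Measure SpaceTime) : Measure (SpaceTime × Metric.sphere (0 : E3) 1) :=
  ρ.prod uniformSphere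

/-- Detection of photon pairs: push-forward under `(x, v) ↦ R(x, v)` at each time. -/
def detectPairs (K : Set E3) (μ : Measure (SpaceTime × Metric.sphere (0 : E3) 1)) :
    Measure Event :=
  μ.map fun p => (p.1.1, detectionPoints K p.1.2 p.2)

/-- The scattering operator before recording:
`ρ_t ↦ ρ_t(D) / H²(∂K)² • (H²⌞∂K ⊗ H²⌞∂K)` at each time, for `ρ` carried by `[0,T] × D`. -/
def scatterEvents (K : Set E3) (ρ : Measure SpaceTime) : Measure Event :=
  ((surfaceMeasure K univ) ^ 2)⁻¹ •
    (ρ.map Prod.fst).prod ((surfaceMeasure K).prod (surfaceMeasure K))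

namespace Setting

variable {sc : Scanner}

/-- The forward operator `Aˢ` of scattered photon pairs. -/
def As (st : Setting sc) (ρ : Measure SpaceTime) : Measure Event :=
  st.record (scatterEvents sc.K ρ)

/-- The forward operator `Aᵈ` of scatterless detection. -/
def Ad (st : Setting sc) (ρ : Measure SpaceTime) : Measure Event :=
  st.record (detectPairs sc.K (emissionLines (positronRange st.rangeLaw ρ)))

/-- The operator `A^q = q pˢ Aˢ + pᵈ Aᵈ`; the forward operator `A` itself is `A¹`
(attenuated pairs are not detected). -/
def Aq (st : Setting sc) (ps pd q : ℝ) (ρ : Measure SpaceTime) : Measure Event :=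
  ENNReal.ofReal (q * ps) • st.As ρ + ENNReal.ofReal pd • st.Ad ρ

end Setting

/-! ### The Benamou–Brenier functional -/

/-- `∂ₜ ρ + div η = 0` on `(0, T) × ℝ³` in the sense of distributions. -/
def ContinuityEquation (T : ℝ) (ρ : Measure SpaceTime) (η : Fin 3 → SignedMeasure SpaceTime) :
    Prop :=
  ∀ φ : SpaceTime → ℝ, ContDiff ℝ ((⊤ : ℕ∞) : WithTop ℕ∞) φ → HasCompactSupport φ →
    tsupport φ ⊆ Ioo 0 T ×ˢ univ →
    ∫ p, fderiv ℝ φ p (1, 0) ∂ρ +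
      ∑ i, ∫ᵛ p, fderiv ℝ φ p (0, EuclideanSpace.single i 1) ∂•(η i) = 0

open Classical in
/-- The Benamou–Brenier functional `S(ρ, η) = ∫ |dη/dρ|² dρ` if `ρ` is of the form `dt ⊗ ρ_t`
(i.e. its time marginal is absolutely continuous), the continuity equation holds, and `η` is
absolutely continuous with respect to `ρ`; otherwise `S(ρ, η) = ∞`. -/
def benamouBrenier (T : ℝ) (ρ : Measure SpaceTime) (η : Fin 3 → SignedMeasure SpaceTime) :
    ℝ≥0∞ :=
  if ρ.map Prod.fst ≪ volume ∧ ContinuityEquation T ρ η ∧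
      ∀ i, (η i) ≪ᵥ ρ.toENNRealVectorMeasure then
    ∫⁻ p, ENNReal.ofReal (∑ i, ((η i).rnDeriv ρ p) ^ 2) ∂ρ
  else ⊤

/-! ### The reconstruction functional -/

open Classical in
/-- The Radon–Nikodym derivative `dμ/dν` of measures concentrated on the closed set `Z`, evaluated
pointwise through its representative that is continuous on `Z` whenever there is one (which is
unique on `Z` if `ν` charges all nonempty relatively open subsets of `Z`). -/
def density {X : Type*} [TopologicalSpace X] [MeasurableSpace X] (μ ν : Measure X) (Z : Set X) :
    X → ℝ≥0∞ :=
  if h : ∃ f : X → ℝ≥0∞, ContinuousOn f Z ∧ μ = ν.withDensity f then h.choose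
  else μ.rnDeriv ν

/-- `-∫ log f dE` as an extended real number: the integral of the negative part of `log f` minus
the integral of its positive part. -/
def negLogIntegral {X : Type*} [MeasurableSpace X] (E : Measure X) (f : X → ℝ≥0∞) : EReal :=
  ((∫⁻ x, (-(f x).log).toENNReal ∂E : ℝ≥0∞) : EReal) -
    ((∫⁻ x, ((f x).log).toENNReal ∂E : ℝ≥0∞) : EReal)

open Classical in
/-- The reconstruction functional
`J^{E,q}(ρ, η) = ‖A ρ‖ - ∫ log (d(A^q ρ)/dν) dE + β S(ρ, η)`, which is `∞` if `S(ρ, η) = ∞`. -/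
def reconstructionFunctional {sc : Scanner} (st : Setting sc) (ps pd q β : ℝ)
    (E : Measure Event) (ρ : Measure SpaceTime) (η : Fin 3 → SignedMeasure SpaceTime) : EReal :=
  if benamouBrenier sc.T ρ η = ⊤ then ⊤
  else ((st.Aq ps pd 1 ρ univ : ℝ≥0∞) : EReal) +
    negLogIntegral E (density (st.Aq ps pd q ρ) st.refMeasure st.eventSet) +
    ((ENNReal.ofReal β * benamouBrenier sc.T ρ η : ℝ≥0∞) : EReal)

/-- Pairs `(ρ, η)` of a nonnegative finite measure and an `ℝ³`-valued measure (given by its three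
components), both carried by `[0, T] × D`. -/
def admissiblePairs (sc : Scanner) :
    Set (FiniteMeasure SpaceTime × (Fin 3 → SignedMeasure SpaceTime)) :=
  {p | (p.1 : Measure SpaceTime) (Icc 0 sc.T ×ˢ sc.D)ᶜ = 0 ∧
    ∀ i, (p.2 i).totalVariation (Icc 0 sc.T ×ˢ sc.D)ᶜ = 0}

/-- `(ρ, η)` minimizes `J^{E,q}` among all admissible pairs. -/
def IsMinimizer {sc : Scanner} (st : Setting sc) (ps pd q β : ℝ) (E : FiniteMeasure Event)
    (ρ : FiniteMeasure SpaceTime) (η : Fin 3 → SignedMeasure SpaceTime) : Prop :=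
  (ρ, η) ∈ admissiblePairs sc ∧
    IsMinOn (fun p : FiniteMeasure SpaceTime × (Fin 3 → SignedMeasure SpaceTime) =>
        reconstructionFunctional st ps pd q β E p.1 p.2)
      (admissiblePairs sc) (ρ, η)

/-- Weak-* convergence of a sequence of `ℝ³`-valued measures: convergence of the integrals of all
bounded continuous functions (equivalently, for measures carried by a fixed compact set, of all
continuous functions on that set). -/
def VectorWeakStarTendsto (η : ℕ → Fin 3 → SignedMeasure SpaceTime)
    (η' : Fin 3 → SignedMeasure SpaceTime) : Prop :=
  ∀ (i : Fin 3) (f : BoundedContinuousFunction SpaceTime ℝ),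
    Tendsto (fun n => ∫ᵛ p, f p ∂•(η n i)) atTop (𝓝 (∫ᵛ p, f p ∂•(η' i)))

end

open scoped ENNReal NNReal

noncomputable section

/-! ### Convex bodies with smooth boundary -/

/-! The proof is the direct method of the calculus of variations with varying data. Pairs of finite
energy are written as flows: a measure `ρ` on `[0, T] × D` with a velocity field `V` in `L²(ρ)`.
Comparing each minimizer with a resting unit mass bounds the functional from above. The density of
`A^q ρ` is at most a constant times mass plus energy (`massEnergy`), the total mass of `A ρ` is `(ps
+ pd)` times the mass of `ρ`, and a logarithm grows slower than a linear function, so mass and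
energy are bounded along the sequence (`exists_massEnergy_le`). Bounded flows are weakly compact.
The limit flux has an `L²` density by Riesz representation, and the energy is lower semicontinuous
because it is a supremum of weakly continuous functionals (`exists_subseq_tendsto_flow`).

The difficulty is the logarithmic term, in which the measurement and the density vary together.
Since `E n` may be a sum of Dirac measures, almost everywhere information on densities is useless.
What is needed is an upper bound on all of `Z`: for each `ε > 0`, eventually `f n ≤ f' + ε` there.
This is the last field of `HasEventDensity`.

In the continuous setting the bound follows from equicontinuity. The continuity equation gives `∫ ψ
dρ_t` a modulus of continuity in `t` that depends only on mass and energy, and smoothing by the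
positron kernel gives one in space. Hence the annihilation densities are equicontinuous. The change
of variables from emission point and direction to the two detection points (`lintegral_emission`,
based on the solid angle formula for smooth convex bodies) turns them into equicontinuous detection
densities. The singularity of the geometric factor at coinciding detection points is harmless,
because no annihilation happens within `δ / 2` of the boundary. In the discrete setting the bound is
the portmanteau theorem: each cell has the same intensity as its closure, since detector boundaries
have zero area and time marginals are absolutely continuous.

For the conclusion, `f n` is replaced by the fixed function `f' + ε`, whose logarithm is continuous
on the compact set `Z` and so can be tested against `E n`. Then `n → ∞`, and afterwards `ε → 0`.
Scattering bounds the event density of any flow from below by a multiple of its mass, so the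
functional converges at every competitor of positive mass. Competitors of zero mass either have
infinite value or are limits of small resting masses. -/

/-- A compact convex set with nonempty interior and smooth boundary. -/
structure SmoothBody (K : Set E3) : Prop where
  compact : IsCompact K
  convex : Convex ℝ K
  smooth : HasSmoothBoundary K
  interior_nonempty : (interior K).Nonempty

/-- `n` is an outer unit normal of `K` at `a`. -/
def IsOuterNormal (K : Set E3) (a n : E3) : Prop :=
  ‖n‖ = 1 ∧ ∀ y ∈ K, inner ℝ n (y - a) ≤ 0

open Classical in
/-- The outer unit normal of `K` at `a`. -/
def outerNormal (K : Set E3) (a : E3) : E3 :=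
  if h : ∃ n, IsOuterNormal K a n then h.choose else 0

namespace SmoothBody

variable {K : Set E3}

theorem frontier_subset (hK : SmoothBody K) : frontier K ⊆ K :=
  hK.compact.isClosed.frontier_subset

theorem isCompact_frontier (hK : SmoothBody K) : IsCompact (frontier K) :=
  hK.compact.of_isClosed_subset isClosed_frontier hK.frontier_subset

theorem mem_interior_or_frontier (_ : SmoothBody K) {x : E3} (hx : x ∈ K) :
    x ∈ interior K ∨ x ∈ frontier K := by
  by_cases h : x ∈ interior K
  · exact Or.inl h
  · exact Or.inr ⟨subset_closure hx, h⟩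

theorem inner_gradient (φ : E3 → ℝ) (a v : E3) :
    inner ℝ (gradient φ a) v = fderiv ℝ φ a v := by
  simp [gradient]

theorem gradient_ne_zero {φ : E3 → ℝ} {a : E3} (h : fderiv ℝ φ a ≠ 0) : gradient φ a ≠ 0 := by
  simpa [gradient] using h

theorem boundary_value {a : E3} (hK : SmoothBody K) (ha : a ∈ frontier K) {U : Set E3}
    (hU : U ∈ 𝓝 a) {φ : E3 → ℝ} (hφ : Continuous φ) (h : ∀ y ∈ U, y ∈ K ↔ φ y ≤ 0) :
    φ a = 0 := by
  refine le_antisymm ((h a (mem_of_mem_nhds hU)).1 (hK.frontier_subset ha)) ?_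
  by_contra! hlt
  refine ha.2 (mem_interior_iff_mem_nhds.2 ?_)
  filter_upwards [hU, hφ.continuousAt.eventually_lt continuousAt_const hlt] with y hy hy'
  exact (h y hy).2 hy'.le

/-- The derivative of a defining function is nonpositive in directions pointing into `K`. -/
theorem fderiv_le_zero {a : E3} (hK : SmoothBody K) (ha : a ∈ frontier K) {U : Set E3}
    (hU : U ∈ 𝓝 a) {φ : E3 → ℝ} (hφ : ContDiff ℝ ((⊤ : ℕ∞) : WithTop ℕ∞) φ)
    (h : ∀ y ∈ U, y ∈ K ↔ φ y ≤ 0) {y : E3} (hy : y ∈ K) : fderiv ℝ φ a (y - a) ≤ 0 := by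
  have h0 := hK.boundary_value ha hU hφ.continuous h
  have hd : HasFDerivAt φ (fderiv ℝ φ a) a := (hφ.differentiable (by simp)).differentiableAt.hasFDerivAt
  have hl : HasDerivAt (fun t : ℝ => φ (a + t • (y - a))) (fderiv ℝ φ a (y - a)) 0 := by
    have hd' : HasFDerivAt φ (fderiv ℝ φ a) (a + (0 : ℝ) • (y - a)) := by simpa using hd
    have h1 : HasDerivAt (fun t : ℝ => a + t • (y - a)) (y - a) 0 := by
      simpa using ((hasDerivAt_id (0 : ℝ)).smul_const (y - a)).const_add a
    exact hd'.comp_hasDerivAt 0 h1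
  have hev : ∀ᶠ t in 𝓝[>] (0 : ℝ), φ (a + t • (y - a)) ≤ 0 := by
    have hc : Tendsto (fun t : ℝ => a + t • (y - a)) (𝓝 0) (𝓝 a) := by
      have : Continuous fun t : ℝ => a + t • (y - a) := by fun_prop
      simpa using this.tendsto 0
    have h1 := (hc.mono_left nhdsWithin_le_nhds : Tendsto _ (𝓝[>] (0 : ℝ)) _) hU
    filter_upwards [h1, Ioc_mem_nhdsGT (zero_lt_one' ℝ)] with t ht ht'
    refine (h _ ht).1 ?_
    have := hK.convex (hK.frontier_subset ha) hy (sub_nonneg.2 ht'.2) ht'.1.le (by ring)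
    convert this using 1
    module
  have hs := (hasDerivAt_iff_tendsto_slope.1 hl).mono_left
    (nhdsWithin_mono 0 (fun t (ht : t ∈ Ioi (0 : ℝ)) => ne_of_gt ht) : 𝓝[>] (0 : ℝ) ≤ 𝓝[≠] 0)
  refine le_of_tendsto hs ?_
  filter_upwards [hev, self_mem_nhdsWithin] with t ht ht'
  have ht' : 0 < t := ht'
  simp only [slope, sub_zero, zero_smul, add_zero, h0, vsub_eq_sub, smul_eq_mul]
  exact mul_nonpos_of_nonneg_of_nonpos (inv_nonneg.2 ht'.le) ht

/-- At a boundary point the only outer unit normal is the normalized gradient of a defining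
function. -/
theorem isOuterNormal_iff {a : E3} (hK : SmoothBody K) (ha : a ∈ frontier K) {U : Set E3}
    (hU : U ∈ 𝓝 a) {φ : E3 → ℝ} (hφ : ContDiff ℝ ((⊤ : ℕ∞) : WithTop ℕ∞) φ)
    (hne : fderiv ℝ φ a ≠ 0) (h : ∀ y ∈ U, y ∈ K ↔ φ y ≤ 0) (n : E3) :
    IsOuterNormal K a n ↔ n = ‖gradient φ a‖⁻¹ • gradient φ a := by
  have hg := gradient_ne_zero hne
  have hg' : 0 < ‖gradient φ a‖ := norm_pos_iff.2 hg
  set m := ‖gradient φ a‖⁻¹ • gradient φ a with hm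
  have hm1 : ‖m‖ = 1 := by rw [hm, norm_smul, norm_inv, norm_norm, inv_mul_cancel₀ hg'.ne']
  constructor
  · rintro ⟨hn, hny⟩
    by_contra hnm
    -- If `n ≠ m`, a small step in the direction `n - m` decreases `φ` and therefore stays in `K`.
    -- But `⟪n, n - m⟫ > 0`, so this point lies on the wrong side of the plane with normal `n`.
    have hlt : inner ℝ m n < 1 := by
      have := (inner_lt_one_iff_real_of_norm_eq_one hm1 hn).2 (Ne.symm hnm)
      exact this
    have hneg : fderiv ℝ φ a (n - m) < 0 := by
      rw [← inner_gradient, show gradient φ a = ‖gradient φ a‖ • m by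
        rw [hm, smul_smul, mul_inv_cancel₀ hg'.ne', one_smul], inner_smul_left, inner_sub_right,
        real_inner_self_eq_norm_sq, hm1]
      simp only [conj_trivial]
      nlinarith
    have h0 := hK.boundary_value ha hU hφ.continuous h
    have hd : HasFDerivAt φ (fderiv ℝ φ a) a :=
      (hφ.differentiable (by simp)).differentiableAt.hasFDerivAt
    have hl : HasDerivAt (fun t : ℝ => φ (a + t • (n - m))) (fderiv ℝ φ a (n - m)) 0 := by
      have hd' : HasFDerivAt φ (fderiv ℝ φ a) (a + (0 : ℝ) • (n - m)) := by simpa using hd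
      have h1 : HasDerivAt (fun t : ℝ => a + t • (n - m)) (n - m) 0 := by
        simpa using ((hasDerivAt_id (0 : ℝ)).smul_const (n - m)).const_add a
      exact hd'.comp_hasDerivAt 0 h1
    have hs := (hasDerivAt_iff_tendsto_slope.1 hl).mono_left
      (nhdsWithin_mono 0 (fun t (ht : t ∈ Ioi (0 : ℝ)) => ne_of_gt ht) : 𝓝[>] (0 : ℝ) ≤ 𝓝[≠] 0)
    have hc : Tendsto (fun t : ℝ => a + t • (n - m)) (𝓝 0) (𝓝 a) := by
      have : Continuous fun t : ℝ => a + t • (n - m) := by fun_prop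
      simpa using this.tendsto 0
    have h1 := (hc.mono_left nhdsWithin_le_nhds : Tendsto _ (𝓝[>] (0 : ℝ)) _) hU
    obtain ⟨t, ht1, ht2, ht3⟩ :=
      ((hs.eventually_lt_const hneg).and
        ((show ∀ᶠ t : ℝ in 𝓝[>] 0, a + t • (n - m) ∈ U from h1).and self_mem_nhdsWithin)).exists
    have ht3 : 0 < t := ht3
    simp only [slope, sub_zero, zero_smul, add_zero, h0, vsub_eq_sub, smul_eq_mul] at ht1
    have : φ (a + t • (n - m)) < 0 := by
      by_contra! hc
      exact absurd ht1 (not_lt.2 (mul_nonneg (inv_nonneg.2 ht3.le) hc))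
    have := hny _ ((h _ ht2).2 this.le)
    rw [add_sub_cancel_left, inner_smul_right, inner_sub_right, real_inner_self_eq_norm_sq, hn,
      real_inner_comm] at this
    nlinarith
  · rintro rfl
    refine ⟨hm1, fun y hy => ?_⟩
    rw [hm, inner_smul_left, inner_gradient]
    exact mul_nonpos_of_nonneg_of_nonpos (by simp) (hK.fderiv_le_zero ha hU hφ h hy)

theorem isOuterNormal_outerNormal {a : E3} (hK : SmoothBody K) (ha : a ∈ frontier K) :
    IsOuterNormal K a (outerNormal K a) := by
  obtain ⟨U, hU, φ, hφ, hne, h⟩ := hK.smooth a ha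
  have hex : ∃ n, IsOuterNormal K a n := ⟨_, (hK.isOuterNormal_iff ha hU hφ hne h _).2 rfl⟩
  rw [outerNormal, dif_pos hex]
  exact hex.choose_spec

theorem eq_outerNormal {a n : E3} (hK : SmoothBody K) (ha : a ∈ frontier K)
    (hn : IsOuterNormal K a n) : n = outerNormal K a := by
  obtain ⟨U, hU, φ, hφ, hne, h⟩ := hK.smooth a ha
  rw [(hK.isOuterNormal_iff ha hU hφ hne h _).1 hn,
    (hK.isOuterNormal_iff ha hU hφ hne h _).1 (hK.isOuterNormal_outerNormal ha)]

theorem outerNormal_eq_gradient {a : E3} (hK : SmoothBody K) (ha : a ∈ frontier K) {U : Set E3}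
    (hU : U ∈ 𝓝 a) {φ : E3 → ℝ} (hφ : ContDiff ℝ ((⊤ : ℕ∞) : WithTop ℕ∞) φ)
    (hne : fderiv ℝ φ a ≠ 0) (h : ∀ y ∈ U, y ∈ K ↔ φ y ≤ 0) :
    outerNormal K a = ‖gradient φ a‖⁻¹ • gradient φ a :=
  (hK.isOuterNormal_iff ha hU hφ hne h _).1 (hK.isOuterNormal_outerNormal ha)

theorem continuousOn_outerNormal (hK : SmoothBody K) :
    ContinuousOn (outerNormal K) (frontier K) := by
  intro a ha
  obtain ⟨U, hU, φ, hφ, hne, h⟩ := hK.smooth a ha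
  have hgc : Continuous (gradient φ) := by
    unfold gradient
    exact (LinearIsometryEquiv.continuous _).comp (hφ.continuous_fderiv (by simp))
  have hfc : Continuous (fderiv ℝ φ) := hφ.continuous_fderiv (by simp)
  have hc : ContinuousAt (fun y => ‖gradient φ y‖⁻¹ • gradient φ y) a :=
    (hgc.continuousAt.norm.inv₀ (norm_ne_zero_iff.2 (gradient_ne_zero hne))).smul hgc.continuousAt
  refine hc.continuousWithinAt.congr_of_eventuallyEq ?_
    (hK.outerNormal_eq_gradient ha hU hφ hne h)
  have h1 : ∀ᶠ y in 𝓝[frontier K] a, U ∈ 𝓝 y :=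
    nhdsWithin_le_nhds (eventually_eventually_nhds.2 hU)
  have h2 : ∀ᶠ y in 𝓝[frontier K] a, fderiv ℝ φ y ≠ 0 :=
    nhdsWithin_le_nhds (hfc.continuousAt.eventually_ne hne)
  filter_upwards [h1, h2, self_mem_nhdsWithin] with y hy1 hy2 hy3
  exact hK.outerNormal_eq_gradient hy3 hy1 hφ hy2 h

/-- Near a boundary point the boundary is flat up to a small relative error. -/
theorem abs_inner_outerNormal_le {a : E3} (hK : SmoothBody K) (ha : a ∈ frontier K) {ε : ℝ}
    (hε : 0 < ε) : ∃ U ∈ 𝓝 a, ∀ y ∈ U ∩ frontier K, ∀ z ∈ U ∩ frontier K,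
      |inner ℝ (outerNormal K a) (y - z)| ≤ ε * ‖y - z‖ := by
  obtain ⟨U, hU, φ, hφ, hne, h⟩ := hK.smooth a ha
  have hg' : 0 < ‖gradient φ a‖ := norm_pos_iff.2 (gradient_ne_zero hne)
  -- Strict differentiability gives an estimate uniform in both points near `a`; ordinary
  -- differentiability would keep one of them at `a`. On the boundary `φ` vanishes at both points,
  -- so only the linear term remains.
  have hs : HasStrictFDerivAt φ (fderiv ℝ φ a) a :=
    hφ.contDiffAt.hasStrictFDerivAt (by simp)
  have hb := hs.isLittleO.bound (mul_pos hε hg')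
  rw [nhds_prod_eq] at hb
  obtain ⟨V, hV, hVb⟩ := (eventually_prod_self_iff' (r := fun x : E3 × E3 =>
    ‖φ x.1 - φ x.2 - (fderiv ℝ φ a) (x.1 - x.2)‖ ≤ ε * ‖gradient φ a‖ * ‖x.1 - x.2‖)).1 hb
  refine ⟨V ∩ interior U, inter_mem hV (interior_mem_nhds.2 hU), fun y hy z hz => ?_⟩
  have hy0 := hK.boundary_value hy.2 (mem_interior_iff_mem_nhds.1 hy.1.2) hφ.continuous h
  have hz0 := hK.boundary_value hz.2 (mem_interior_iff_mem_nhds.1 hz.1.2) hφ.continuous h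
  have := hVb y hy.1.1 z hz.1.1
  rw [hy0, hz0, sub_self, zero_sub, norm_neg, Real.norm_eq_abs, ← inner_gradient] at this
  rw [hK.outerNormal_eq_gradient ha hU hφ hne h, inner_smul_left, abs_mul]
  simp only [conj_trivial, abs_inv, abs_norm]
  rw [inv_mul_le_iff₀ hg']
  linarith

theorem norm_outerNormal {a : E3} (hK : SmoothBody K) (ha : a ∈ frontier K) :
    ‖outerNormal K a‖ = 1 := (hK.isOuterNormal_outerNormal ha).1

theorem inner_outerNormal_le {a y : E3} (hK : SmoothBody K) (ha : a ∈ frontier K) (hy : y ∈ K) :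
    inner ℝ (outerNormal K a) (y - a) ≤ 0 := (hK.isOuterNormal_outerNormal ha).2 y hy

theorem inner_outerNormal_neg {a y : E3} (hK : SmoothBody K) (ha : a ∈ frontier K)
    (hy : y ∈ interior K) : inner ℝ (outerNormal K a) (y - a) < 0 := by
  have hc : Tendsto (fun t : ℝ => y + t • outerNormal K a) (𝓝 0) (𝓝 y) := by
    have : Continuous fun t : ℝ => y + t • outerNormal K a := by fun_prop
    simpa using this.tendsto 0
  have h1 := (hc.mono_left nhdsWithin_le_nhds : Tendsto _ (𝓝[>] (0 : ℝ)) _)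
    (mem_interior_iff_mem_nhds.1 hy)
  obtain ⟨t, ht1, ht2⟩ := ((show ∀ᶠ t : ℝ in 𝓝[>] 0, y + t • outerNormal K a ∈ K from h1).and
    self_mem_nhdsWithin).exists
  have ht2 : 0 < t := ht2
  have := hK.inner_outerNormal_le ha ht1
  rw [add_sub_right_comm, inner_add_right, inner_smul_right, real_inner_self_eq_norm_sq,
    hK.norm_outerNormal ha] at this
  linarith

/-- If the midpoint were on the boundary, its supporting plane would contain both `x` and `a`, so
its normal would also be an outer normal at `a`. By uniqueness of the normal at `a`, `outerNormal K
a` would be orthogonal to `a - x`. -/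
theorem midpoint_mem_interior {a x : E3} (hK : SmoothBody K) (ha : a ∈ frontier K) (hx : x ∈ K)
    (h : 0 < inner ℝ (outerNormal K a) (a - x)) : midpoint ℝ x a ∈ interior K := by
  have hm : midpoint ℝ x a ∈ K := hK.convex.midpoint_mem hx (hK.frontier_subset ha)
  refine (hK.mem_interior_or_frontier hm).resolve_right fun hf => ?_
  obtain ⟨hn, hny⟩ := hK.isOuterNormal_outerNormal hf
  set n := outerNormal K (midpoint ℝ x a)
  have e1 : x - midpoint ℝ x a = (1 / 2 : ℝ) • (x - a) := by
    rw [midpoint_eq_smul_add]; simp only [invOf_eq_inv]; module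
  have e2 : a - midpoint ℝ x a = (-(1 / 2) : ℝ) • (x - a) := by
    rw [midpoint_eq_smul_add]; simp only [invOf_eq_inv]; module
  have h1 := hny x hx
  have h2 := hny a (hK.frontier_subset ha)
  rw [e1, inner_smul_right] at h1
  rw [e2, inner_smul_right] at h2
  have h3 : inner ℝ n (x - a) = 0 := by linarith
  have h4 : IsOuterNormal K a n := by
    refine ⟨hn, fun y hy => ?_⟩
    have := hny y hy
    have h5 : y - midpoint ℝ x a = (y - a) + (a - midpoint ℝ x a) := by abel
    rw [h5, inner_add_right, e2, inner_smul_right, h3] at this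
    linarith
  rw [← hK.eq_outerNormal ha h4, ← neg_sub, inner_neg_right, h3] at h
  simp at h

end SmoothBody
end

/-! ### Exit times and exit points of rays. -/

open scoped ENNReal NNReal

noncomputable section

/-- Largest parameter `r` with `x + r • v ∈ K`. -/
def exitTime (K : Set E3) (x v : E3) : ℝ := sSup {r : ℝ | x + r • v ∈ K}

/-- The point where the line through `x` in direction `v` leaves `K`. -/
def exitPoint (K : Set E3) (x v : E3) : E3 := x + exitTime K x v • v

theorem detectionPoints_snd (K : Set E3) (x v : E3) :
    (detectionPoints K x v).2 = exitPoint K x v := rfl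

/-- Both detection points become exit points, in opposite directions, so that only `exitPoint` has
to be studied. -/
theorem detectionPoints_fst (K : Set E3) (x v : E3) :
    (detectionPoints K x v).1 = exitPoint K x (-v) := by
  simp only [detectionPoints, exitPoint, exitTime]
  have : {r : ℝ | x + r • -v ∈ K} = -{r : ℝ | x + r • v ∈ K} := by
    ext r; simp
  rw [this, Real.sSup_neg]
  simp

/-- The ray from `x ∈ K` in the nonzero direction `v` meets the interior of `K`. -/
def EntersInterior (K : Set E3) (x v : E3) : Prop :=
  x ∈ K ∧ v ≠ 0 ∧ ∃ r : ℝ, 0 < r ∧ x + r • v ∈ interior K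

namespace SmoothBody

variable {K : Set E3}

theorem chord_bddAbove (hK : SmoothBody K) {x v : E3} (hv : v ≠ 0) :
    BddAbove {r : ℝ | x + r • v ∈ K} := by
  obtain ⟨C, hC⟩ := hK.compact.isBounded.exists_norm_le
  refine ⟨(C + ‖x‖) / ‖v‖, fun r hr => ?_⟩
  have hv' : 0 < ‖v‖ := norm_pos_iff.2 hv
  rw [le_div_iff₀ hv']
  have h1 := hC _ hr
  have h2 : ‖r • v‖ ≤ ‖x + r • v‖ + ‖x‖ := by
    simpa using norm_sub_le (x + r • v) x
  rw [norm_smul, Real.norm_eq_abs] at h2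
  nlinarith [le_abs_self r, norm_nonneg v]

theorem isClosed_chord (hK : SmoothBody K) (x v : E3) : IsClosed {r : ℝ | x + r • v ∈ K} :=
  hK.compact.isClosed.preimage (by fun_prop)

theorem exitPoint_mem (hK : SmoothBody K) {x v : E3} (hv : v ≠ 0)
    (hx : ∃ r : ℝ, x + r • v ∈ K) : exitPoint K x v ∈ K :=
  (hK.isClosed_chord x v).csSup_mem hx (hK.chord_bddAbove hv)

theorem le_exitTime (hK : SmoothBody K) {x v : E3} (hv : v ≠ 0) {r : ℝ} (hr : x + r • v ∈ K) :
    r ≤ exitTime K x v := le_csSup (hK.chord_bddAbove hv) hr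

theorem lt_exitTime (hK : SmoothBody K) {x v : E3} (hv : v ≠ 0) {r : ℝ}
    (hr : x + r • v ∈ interior K) : r < exitTime K x v := by
  have hc : Tendsto (fun t : ℝ => x + t • v) (𝓝 r) (𝓝 (x + r • v)) := by
    have : Continuous fun t : ℝ => x + t • v := by fun_prop
    exact this.tendsto r
  have h1 := (hc.mono_left nhdsWithin_le_nhds : Tendsto _ (𝓝[>] r) _)
    (mem_interior_iff_mem_nhds.1 hr)
  obtain ⟨t, ht1, ht2⟩ := ((show ∀ᶠ t : ℝ in 𝓝[>] r, x + t • v ∈ K from h1).and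
    self_mem_nhdsWithin).exists
  exact lt_of_lt_of_le ht2 (hK.le_exitTime hv ht1)

theorem exitPoint_mem_frontier (hK : SmoothBody K) {x v : E3} (hv : v ≠ 0)
    (hx : ∃ r : ℝ, x + r • v ∈ K) : exitPoint K x v ∈ frontier K :=
  (hK.mem_interior_or_frontier (hK.exitPoint_mem hv hx)).resolve_left fun h =>
    lt_irrefl _ (hK.lt_exitTime hv h)

theorem mem_of_le_exitTime (hK : SmoothBody K) {x v : E3} (hv : v ≠ 0) (hx : x ∈ K) {r : ℝ}
    (hr0 : 0 ≤ r) (hr : r ≤ exitTime K x v) : x + r • v ∈ K := by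
  have he : x + exitTime K x v • v ∈ K := hK.exitPoint_mem hv ⟨0, by simpa⟩
  rcases hr0.eq_or_lt with rfl | hr0
  · simpa
  have hE : 0 < exitTime K x v := hr0.trans_le hr
  have := hK.convex hx he (sub_nonneg.2 ((div_le_one hE).2 hr)) (by positivity : 0 ≤ r / exitTime K x v)
    (by ring)
  convert this using 1
  rw [smul_add, smul_smul, div_mul_cancel₀ _ hE.ne']
  module

theorem mem_interior_of_lt_exitTime (hK : SmoothBody K) {x v : E3} (h : EntersInterior K x v)
    {r s : ℝ} (hs : x + s • v ∈ interior K) (hr0 : s ≤ r) (hr : r < exitTime K x v) :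
    x + r • v ∈ interior K := by
  obtain ⟨hx, hv, -⟩ := h
  have he : x + exitTime K x v • v ∈ K := hK.exitPoint_mem hv ⟨0, by simpa⟩
  have hE : 0 < exitTime K x v - s := by linarith
  have := hK.convex.combo_interior_self_mem_interior hs he
    (a := (exitTime K x v - r) / (exitTime K x v - s)) (b := (r - s) / (exitTime K x v - s))
    (div_pos (by linarith) hE) (div_nonneg (by linarith) hE.le)
    (by rw [← add_div, div_eq_one_iff_eq hE.ne']; ring)
  convert this using 1
  have e1 : (exitTime K x v - r) / (exitTime K x v - s) = 1 - (r - s) / (exitTime K x v - s) := by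
    rw [eq_sub_iff_add_eq, ← add_div, div_eq_one_iff_eq hE.ne']; ring
  have e2 : r = s + (r - s) / (exitTime K x v - s) * (exitTime K x v - s) := by
    rw [div_mul_cancel₀ _ hE.ne']; ring
  rw [e1]
  conv_lhs => rw [e2]
  module

/-- The supporting plane at the exit point misses the interior, while the ray arrives there from an
interior point; hence it crosses the plane transversally. Conversely, `exitTime_eq` recognizes the
exit by transversality. -/
theorem inner_outerNormal_exitPoint (hK : SmoothBody K) {x v : E3} (h : EntersInterior K x v) :
    0 < inner ℝ (outerNormal K (exitPoint K x v)) v := by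
  obtain ⟨hx, hv, r, hr0, hr⟩ := h
  have hf : exitPoint K x v ∈ frontier K := hK.exitPoint_mem_frontier hv ⟨0, by simpa⟩
  have h1 := hK.inner_outerNormal_neg hf hr
  have h2 := hK.lt_exitTime hv hr
  have e : x + r • v - exitPoint K x v = (-(exitTime K x v - r)) • v := by
    rw [exitPoint]; module
  rw [e, inner_smul_right] at h1
  nlinarith

theorem exitTime_eq (hK : SmoothBody K) {x v : E3} {r : ℝ} (hr : x + r • v ∈ frontier K)
    (h : 0 < inner ℝ (outerNormal K (x + r • v)) v) : exitTime K x v = r := by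
  have hv : v ≠ 0 := by rintro rfl; simp at h
  refine le_antisymm (csSup_le ⟨r, hK.frontier_subset hr⟩ fun s hs => ?_)
    (hK.le_exitTime hv (hK.frontier_subset hr))
  have := hK.inner_outerNormal_le hr hs
  rw [add_sub_add_left_eq_sub, ← sub_smul, inner_smul_right] at this
  by_contra! hlt
  nlinarith

theorem exitPoint_eq (hK : SmoothBody K) {x v a : E3} {r : ℝ} (ha : a ∈ frontier K)
    (hr : a = x + r • v) (h : 0 < inner ℝ (outerNormal K a) v) : exitPoint K x v = a := by
  subst hr
  rw [exitPoint, hK.exitTime_eq ha h]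

theorem entersInterior_of_mem_interior {x v : E3} (hx : x ∈ interior K) (hv : v ≠ 0) :
    EntersInterior K x v := by
  refine ⟨interior_subset hx, hv, ?_⟩
  have hc : Tendsto (fun t : ℝ => x + t • v) (𝓝 0) (𝓝 x) := by
    have : Continuous fun t : ℝ => x + t • v := by fun_prop
    simpa using this.tendsto 0
  have h1 := (hc.mono_left nhdsWithin_le_nhds : Tendsto _ (𝓝[>] (0 : ℝ)) _)
    (isOpen_interior.mem_nhds hx)
  obtain ⟨t, ht1, ht2⟩ := ((show ∀ᶠ t : ℝ in 𝓝[>] 0, x + t • v ∈ interior K from h1).and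
    self_mem_nhdsWithin).exists
  exact ⟨t, ht2, ht1⟩

/-- From below: a point of the ray shortly before the exit is interior, so nearby rays are still in
`K` at that parameter. From above: a point shortly after the exit is in the open complement, and by
convexity a nearby ray that is outside there does not come back. The starting points may lie on the
boundary. -/
theorem continuousOn_exitTime (hK : SmoothBody K) :
    ContinuousOn (fun p : E3 × E3 => exitTime K p.1 p.2) {p | EntersInterior K p.1 p.2} := by
  rintro ⟨x, v⟩ hxv
  obtain ⟨hx, hv, r, hr0, hr⟩ := id hxv
  have hcont : ∀ c : ℝ, Tendsto (fun p : E3 × E3 => p.1 + c • p.2)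
      (𝓝[{p | EntersInterior K p.1 p.2}] (x, v)) (𝓝 (x + c • v)) := fun c => by
    have : Continuous fun p : E3 × E3 => p.1 + c • p.2 := by fun_prop
    exact (this.tendsto (x, v)).mono_left nhdsWithin_le_nhds
  refine tendsto_order.2 ⟨fun c hc => ?_, fun c hc => ?_⟩
  · obtain ⟨d, hd1, hd2⟩ := exists_between (max_lt hc (hK.lt_exitTime hv hr))
    have hd := hK.mem_interior_of_lt_exitTime hxv hr ((le_max_right _ _).trans hd1.le) hd2
    filter_upwards [hcont d (mem_interior_iff_mem_nhds.1 hd), self_mem_nhdsWithin] with p hp hp'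
    exact lt_of_lt_of_le ((le_max_left _ _).trans_lt hd1) (hK.le_exitTime hp'.2.1 hp)
  · obtain ⟨d, hd1, hd2⟩ := exists_between hc
    have hd : x + d • v ∉ K := fun h => absurd (hK.le_exitTime hv h) (not_le.2 hd1)
    filter_upwards [hcont d (hK.compact.isClosed.isOpen_compl.mem_nhds hd),
      self_mem_nhdsWithin] with p hp hp'
    refine lt_of_le_of_lt ?_ hd2
    by_contra! hlt
    exact hp (hK.mem_of_le_exitTime hp'.2.1 hp'.1
      ((hr0.le.trans (hK.lt_exitTime hv hr).le).trans hd1.le) hlt.le)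

theorem continuousOn_exitPoint (hK : SmoothBody K) :
    ContinuousOn (fun p : E3 × E3 => exitPoint K p.1 p.2) {p | EntersInterior K p.1 p.2} :=
  continuous_fst.continuousOn.add (hK.continuousOn_exitTime.smul continuous_snd.continuousOn)

end SmoothBody
end

/-! ### Area under Lipschitz maps and volume of cones. -/

open scoped ENNReal NNReal Pointwise

noncomputable section

theorem euclideanHausdorffMeasure_image_le {X Y : Type*} [MetricSpace X] [MeasurableSpace X]
    [BorelSpace X] [MetricSpace Y] [MeasurableSpace Y] [BorelSpace Y] {f : X → Y} {s : Set X}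
    {C : ℝ≥0} (hf : LipschitzOnWith C f s) (d : ℕ) :
    (Measure.euclideanHausdorffMeasure d : Measure Y) (f '' s) ≤
      (C : ℝ≥0∞) ^ d * (Measure.euclideanHausdorffMeasure d : Measure X) s := by
  simp only [Measure.euclideanHausdorffMeasure_def, Measure.smul_apply, ENNReal.smul_def,
    smul_eq_mul]
  rw [mul_left_comm]
  gcongr
  simpa using hf.hausdorffMeasure_image_le (d := (d : ℝ)) (by positivity)

theorem le_euclideanHausdorffMeasure_image {X Y : Type*} [MetricSpace X] [MeasurableSpace X]
    [BorelSpace X] [MetricSpace Y] [MeasurableSpace Y] [BorelSpace Y] {f : X → Y} {s : Set X}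
    {C : ℝ≥0} (hf : ∀ x ∈ s, ∀ y ∈ s, dist x y ≤ C * dist (f x) (f y)) (d : ℕ) :
    (Measure.euclideanHausdorffMeasure d : Measure X) s ≤
      (C : ℝ≥0∞) ^ d * (Measure.euclideanHausdorffMeasure d : Measure Y) (f '' s) := by
  rcases s.eq_empty_or_nonempty with rfl | ⟨x0, hx0⟩
  · simp
  have : Nonempty X := ⟨x0⟩
  have hinj : InjOn f s := fun x hx y hy hxy => by
    have := hf x hx y hy
    rw [hxy, dist_self, mul_zero] at this
    exact dist_le_zero.1 this
  have hL : LipschitzOnWith C (Function.invFunOn f s) (f '' s) := by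
    refine LipschitzOnWith.of_dist_le_mul ?_
    rintro _ ⟨x, hx, rfl⟩ _ ⟨y, hy, rfl⟩
    rw [hinj.leftInvOn_invFunOn hx, hinj.leftInvOn_invFunOn hy]
    exact hf x hx y hy
  have := euclideanHausdorffMeasure_image_le hL d
  rwa [hinj.leftInvOn_invFunOn.image_image] at this

/-- Volume of a truncated cone in terms of the area of a slice. -/
theorem volume_cone_inter {n : E3} (hn : ‖n‖ = 1) {C : Set E3} (hC : MeasurableSet C)
    (hsmul : ∀ z ∈ C, ∀ s : ℝ, 0 < s → s • z ∈ C) (hpos : ∀ z ∈ C, 0 < inner ℝ n z)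
    {h R : ℝ} (hh : 0 < h) (hR : 0 < R) :
    volume (C ∩ {z | inner ℝ n z < R}) =
      ENNReal.ofReal (R ^ 3 / (3 * h ^ 2)) *
        (Measure.euclideanHausdorffMeasure 2 : Measure E3) (C ∩ {z | inner ℝ n z = h}) := by
  have hn0 : n ≠ 0 := by rintro rfl; simp at hn
  have hfin : Module.finrank ℝ E3 = 3 := by simp
  have hm : MeasurableSet (C ∩ {z : E3 | inner ℝ n z < R}) :=
    hC.inter (measurableSet_lt (by fun_prop) (by fun_prop))
  have h1 := EuclideanGeometry.euclideanHausdorffMeasure_eq_lintegral (V := E3) (P := E3) 0 hn0 hm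
  rw [InnerProductSpace.euclideanHausdorffMeasure_eq_volume, hfin] at h1
  rw [h1]
  have hs : ∀ x : ℝ, ((C ∩ {z : E3 | inner ℝ n z < R}) ∩
      (AffineSubspace.mk' (x • n +ᵥ (0 : E3)) (Submodule.span ℝ {n})ᗮ : Set E3)) =
      (C ∩ {z : E3 | inner ℝ n z < R}) ∩ {z | inner ℝ n z = x} := by
    intro x
    ext z
    simp only [mem_inter_iff, SetLike.mem_coe, AffineSubspace.mem_mk', vadd_eq_add, add_zero,
      vsub_eq_sub, Submodule.mem_orthogonal_singleton_iff_inner_right, inner_sub_right,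
      inner_smul_right, real_inner_self_eq_norm_sq, hn, mem_ofPred_eq]
    rw [show x * 1 ^ 2 = x by ring, sub_eq_zero]
  set A := (Measure.euclideanHausdorffMeasure 2 : Measure E3) (C ∩ {z | inner ℝ n z = h}) with hA
  -- The slice of the cone at height `x` is the slice at height `h` dilated by `x / h`, so its area
  -- scales by `(x / h) ^ 2`. Integration over `0 < x < R` produces `R ^ 3 / (3 * h ^ 2)`.
  have hs2 : ∀ x : ℝ, (Measure.euclideanHausdorffMeasure (3 - 1) : Measure E3)
      ((C ∩ {z : E3 | inner ℝ n z < R}) ∩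
      (AffineSubspace.mk' (x • n +ᵥ (0 : E3)) (Submodule.span ℝ {n})ᗮ : Set E3)) =
      (Ioo 0 R).indicator (fun x => ENNReal.ofReal ((x / h) ^ 2) * A) x := by
    intro x
    rw [hs x]
    by_cases hx : x ∈ Ioo 0 R
    · rw [indicator_of_mem hx]
      have hxh : 0 < x / h := div_pos hx.1 hh
      have e : (C ∩ {z : E3 | inner ℝ n z < R}) ∩ {z | inner ℝ n z = x} =
          (x / h) • (C ∩ {z | inner ℝ n z = h}) := by
        ext z
        rw [mem_smul_set_iff_inv_smul_mem₀ hxh.ne']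
        simp only [mem_inter_iff, mem_ofPred_eq, inner_smul_right]
        constructor
        · rintro ⟨⟨hz, -⟩, hzx⟩
          refine ⟨hsmul z hz _ (inv_pos.2 hxh), ?_⟩
          rw [hzx, inv_div, div_mul_cancel₀ _ hx.1.ne']
        · rintro ⟨hz, hzx⟩
          have hz' := hsmul _ hz _ hxh
          rw [smul_inv_smul₀ hxh.ne'] at hz'
          have : inner ℝ n z = x := by
            rw [inv_mul_eq_iff_eq_mul₀ hxh.ne', div_mul_cancel₀ _ hh.ne'] at hzx
            exact hzx
          exact ⟨⟨hz', by rw [this]; exact hx.2⟩, this⟩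
      rw [e, Measure.euclideanHausdorffMeasure_smul₀ _ hxh.ne', ENNReal.smul_def, smul_eq_mul]
      congr 1
      rw [ENNReal.coe_pow, ENNReal.ofReal_pow hxh.le, ENNReal.ofReal,
        Real.toNNReal_eq_nnnorm_of_nonneg hxh.le]
    · rw [indicator_of_notMem hx]
      have : (C ∩ {z : E3 | inner ℝ n z < R}) ∩ {z | inner ℝ n z = x} = ∅ := by
        ext z
        simp only [mem_inter_iff, mem_ofPred_eq, mem_empty_iff_false, iff_false]
        rintro ⟨⟨hz, hzR⟩, hzx⟩
        exact hx ⟨hzx ▸ hpos z hz, hzx ▸ hzR⟩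
      rw [this, measure_empty]
  simp_rw [hs2]
  rw [lintegral_indicator measurableSet_Ioo, lintegral_mul_const _ (by fun_prop)]
  have hn' : ‖n‖ₑ = 1 := by rw [← ofReal_norm, hn, ENNReal.ofReal_one]
  rw [hn', one_mul]
  congr 1
  rw [← ofReal_integral_eq_lintegral_ofReal]
  · rw [← integral_Ioc_eq_integral_Ioo, ← intervalIntegral.integral_of_le hR.le]
    congr 1
    simp only [div_pow]
    rw [intervalIntegral.integral_div, integral_pow]
    field_simp
    ring
  · exact (Continuous.integrableOn_Icc (by fun_prop)).mono_set Ioo_subset_Icc_self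
  · exact Eventually.of_forall fun x => by positivity
end

/-! ### Solid angles of small surface patches. -/

open scoped ENNReal NNReal Pointwise

noncomputable section

/-- The open cone of directions from `x` to points of `S`. -/
def coneOver (x : E3) (S : Set E3) : Set E3 := {z | ∃ s : ℝ, 0 < s ∧ x + s • z ∈ S}

/-- Radial projection from `x` onto the plane `{y | ⟪n, y - x⟫ = h}` (translated to the origin). -/
def planeProj (n x : E3) (h : ℝ) (y : E3) : E3 := (h / inner ℝ n (y - x)) • (y - x)

theorem coneOver_inter_plane {n x : E3} {h : ℝ} (hh : 0 < h) {S : Set E3}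
    (hS : ∀ y ∈ S, 0 < inner ℝ n (y - x)) :
    coneOver x S ∩ {z | inner ℝ n z = h} = planeProj n x h '' S := by
  ext z
  constructor
  · rintro ⟨⟨s, hs, hz⟩, hzh⟩
    have hzh : inner ℝ n z = h := hzh
    refine ⟨_, hz, ?_⟩
    rw [planeProj, add_sub_cancel_left, inner_smul_right, hzh, smul_smul]
    rw [show h / (s * h) * s = 1 by field_simp, one_smul]
  · rintro ⟨y, hy, rfl⟩
    have := hS y hy
    refine ⟨⟨inner ℝ n (y - x) / h, by positivity, ?_⟩, ?_⟩
    · rw [planeProj, smul_smul, show inner ℝ n (y - x) / h * (h / inner ℝ n (y - x)) = 1 by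
        field_simp, one_smul, add_sub_cancel]
      exact hy
    · change inner ℝ n (planeProj n x h y) = h
      rw [planeProj, inner_smul_right, div_mul_cancel₀ _ this.ne']

/-- With heights `u`, `w` of `y`, `z`, the error is `(h / u - 1) • (y - z) + (h / u - h / w) • (z -
x)`. The first term is small because `u` is close to `h`, the second because `u - w = ⟪n, y - z⟫` is
small on a flat patch. The constant `8 * d` comes from `u * w ≥ h ^ 2 / 4` and `‖z - x‖ ≤ d`. So on
flat patches the radial projection is nearly an isometry. -/
theorem norm_planeProj_sub_le {n x y z : E3} {h θ d : ℝ} (hh : 0 < h) (hθ : 0 < θ)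
    (hd : ‖z - x‖ ≤ d) (hy : h / 2 ≤ inner ℝ n (y - x)) (hz : h / 2 ≤ inner ℝ n (z - x))
    (hy' : |h / inner ℝ n (y - x) - 1| ≤ θ / 2)
    (hflat : |inner ℝ n (y - z)| * (8 * d) ≤ θ * h * ‖y - z‖) :
    ‖planeProj n x h y - planeProj n x h z - (y - z)‖ ≤ θ * ‖y - z‖ := by
  set u := inner ℝ n (y - x) with hu
  set w := inner ℝ n (z - x) with hw
  have hu0 : 0 < u := by linarith
  have hw0 : 0 < w := by linarith
  have huw : inner ℝ n (y - z) = u - w := by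
    rw [hu, hw, ← inner_sub_right]; congr 1; abel
  have e : planeProj n x h y - planeProj n x h z - (y - z) =
      (h / u - 1) • (y - z) + (h / u - h / w) • (z - x) := by
    rw [planeProj, planeProj, ← hu, ← hw]; module
  rw [e]
  refine (norm_add_le _ _).trans ?_
  rw [norm_smul, norm_smul, Real.norm_eq_abs, Real.norm_eq_abs]
  have h1 : |h / u - 1| * ‖y - z‖ ≤ θ / 2 * ‖y - z‖ := by gcongr
  have h2 : |h / u - h / w| = h * |u - w| / (u * w) := by
    rw [div_sub_div _ _ hu0.ne' hw0.ne', abs_div, abs_of_pos (mul_pos hu0 hw0),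
      show h * w - u * h = -(h * (u - w)) by ring, abs_neg, abs_mul, abs_of_pos hh]
  have h3 : |h / u - h / w| * ‖z - x‖ ≤ θ / 2 * ‖y - z‖ := by
    rw [h2, ← huw]
    have hb : h ^ 2 / 4 ≤ u * w := by nlinarith
    have hd0 : 0 ≤ d := (norm_nonneg _).trans hd
    have := abs_nonneg (inner ℝ n (y - z))
    calc h * |inner ℝ n (y - z)| / (u * w) * ‖z - x‖
        ≤ h * |inner ℝ n (y - z)| / (h ^ 2 / 4) * d := by gcongr
      _ = (|inner ℝ n (y - z)| * (8 * d)) / (2 * h) := by field_simp; ring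
      _ ≤ (θ * h * ‖y - z‖) / (2 * h) := by gcongr
      _ = _ := by field_simp
  linarith

/-- Solid angle of a set `S` in terms of the area of its radial projection, when `S` is nearly
contained in a plane. -/
theorem solidAngle_bounds {n x : E3} (hn : ‖n‖ = 1) {h θ κ : ℝ} (hh : 0 < h) (hθ : 0 < θ)
    (hθ1 : θ < 1) (hκ : 0 < κ) {S : Set E3} (hC : MeasurableSet (coneOver x S))
    (hS : ∀ y ∈ S, 0 < inner ℝ n (y - x))
    (hlow : ∀ y ∈ S, (1 - θ) * κ * ‖y - x‖ ≤ inner ℝ n (y - x))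
    (hupp : ∀ y ∈ S, inner ℝ n (y - x) ≤ (1 + θ) * κ * ‖y - x‖)
    (hlip : ∀ y ∈ S, ∀ z ∈ S,
      ‖planeProj n x h y - planeProj n x h z - (y - z)‖ ≤ θ * ‖y - z‖) :
    ENNReal.ofReal ((1 - θ) ^ 5 * (κ ^ 3 / h ^ 2)) *
        (Measure.euclideanHausdorffMeasure 2 : Measure E3) S
      ≤ 3 * volume (coneOver x S ∩ Metric.ball 0 1) ∧
    3 * volume (coneOver x S ∩ Metric.ball 0 1) ≤
      ENNReal.ofReal ((1 + θ) ^ 5 * (κ ^ 3 / h ^ 2)) *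
        (Measure.euclideanHausdorffMeasure 2 : Measure E3) S := by
  have hpos : ∀ z ∈ coneOver x S, 0 < inner ℝ n z := by
    rintro z ⟨s, hs, hz⟩
    have := hS _ hz
    rw [add_sub_cancel_left, inner_smul_right] at this
    exact pos_of_mul_pos_right this hs.le
  have hsc : ∀ z ∈ coneOver x S, ∀ s : ℝ, 0 < s → s • z ∈ coneOver x S := by
    rintro z ⟨t, ht, hz⟩ s hs
    refine ⟨t / s, by positivity, ?_⟩
    rwa [smul_smul, div_mul_cancel₀ _ hs.ne']
  have hvol : ∀ R : ℝ, 0 < R → 3 * volume (coneOver x S ∩ {z | inner ℝ n z < R}) =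
      ENNReal.ofReal (R ^ 3 / h ^ 2) *
        (Measure.euclideanHausdorffMeasure 2 : Measure E3) (planeProj n x h '' S) := by
    intro R hR
    rw [volume_cone_inter hn hC hsc hpos hh hR, coneOver_inter_plane hh hS, ← mul_assoc,
      show (3 : ℝ≥0∞) = ENNReal.ofReal 3 by simp, ← ENNReal.ofReal_mul (by norm_num)]
    congr 2
    field_simp
  have hθ' : 0 < 1 - θ := by linarith
  have hle : (Measure.euclideanHausdorffMeasure 2 : Measure E3) (planeProj n x h '' S) ≤
      ENNReal.ofReal ((1 + θ) ^ 2) * (Measure.euclideanHausdorffMeasure 2 : Measure E3) S := by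
    have := euclideanHausdorffMeasure_image_le (f := planeProj n x h) (s := S)
      (C := (1 + θ).toNNReal) (LipschitzOnWith.of_dist_le_mul fun y hy z hz => ?_) 2
    · rwa [ENNReal.ofReal_pow (by positivity)]
    · rw [Real.coe_toNNReal _ (by positivity), dist_eq_norm, dist_eq_norm]
      have h1 := hlip y hy z hz
      have h2 := norm_add_le (planeProj n x h y - planeProj n x h z - (y - z)) (y - z)
      rw [sub_add_cancel] at h2
      linarith
  have hge : ENNReal.ofReal ((1 - θ) ^ 2) * (Measure.euclideanHausdorffMeasure 2 : Measure E3) S ≤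
      (Measure.euclideanHausdorffMeasure 2 : Measure E3) (planeProj n x h '' S) := by
    have := le_euclideanHausdorffMeasure_image (f := planeProj n x h) (s := S)
      (C := (1 - θ)⁻¹.toNNReal) (fun y hy z hz => ?_) 2
    · calc _ ≤ ENNReal.ofReal ((1 - θ) ^ 2) * ((((1 - θ)⁻¹.toNNReal : ℝ≥0) : ℝ≥0∞) ^ 2 * _) := by
            gcongr
        _ = _ := by
          rw [← mul_assoc]
          change ENNReal.ofReal ((1 - θ) ^ 2) * (ENNReal.ofReal (1 - θ)⁻¹) ^ 2 * _ = _
          rw [← ENNReal.ofReal_pow (by positivity), ← ENNReal.ofReal_mul (by positivity),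
            ← mul_pow, mul_inv_cancel₀ hθ'.ne', one_pow, ENNReal.ofReal_one, one_mul]
    · rw [Real.coe_toNNReal _ (by positivity), dist_eq_norm, dist_eq_norm, le_inv_mul_iff₀ hθ']
      have h1 := hlip y hy z hz
      have h2 := norm_sub_le (planeProj n x h y - planeProj n x h z)
        (planeProj n x h y - planeProj n x h z - (y - z))
      rw [sub_sub_cancel] at h2
      linarith
  -- On the cone `⟪n, z⟫` agrees with `κ * ‖z‖` up to the factors `1 ± θ`, so the unit ball is
  -- caught between the truncations at heights `(1 - θ) * κ` and `(1 + θ) * κ`. The exponent `5` is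
  -- `3` from the volume of a truncated cone plus `2` from the area distortion of the projection.
  constructor
  · have hsub : coneOver x S ∩ {z | inner ℝ n z < (1 - θ) * κ} ⊆
        coneOver x S ∩ Metric.ball 0 1 := by
      rintro z ⟨hz, hzR⟩
      refine ⟨hz, ?_⟩
      obtain ⟨s, hs, hzs⟩ := hz
      have h1 := hlow _ hzs
      rw [add_sub_cancel_left, inner_smul_right, norm_smul, Real.norm_of_nonneg hs.le] at h1
      have h2 : (1 - θ) * κ * ‖z‖ ≤ inner ℝ n z := by
        have : s * ((1 - θ) * κ * ‖z‖) ≤ s * inner ℝ n z := by linarith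
        exact le_of_mul_le_mul_left this hs
      rw [mem_ball_zero_iff]
      have h3 : inner ℝ n z < (1 - θ) * κ := hzR
      have h4 : 0 < (1 - θ) * κ := by positivity
      by_contra! h5
      nlinarith
    calc _ = ENNReal.ofReal (((1 - θ) * κ) ^ 3 / h ^ 2) * (ENNReal.ofReal ((1 - θ) ^ 2) * _) := by
          rw [← mul_assoc, ← ENNReal.ofReal_mul (by positivity)]
          congr 2; ring
      _ ≤ _ := mul_le_mul_right hge _
      _ ≤ _ := by
        rw [← hvol _ (by positivity)]
        gcongr
  · have hsub : coneOver x S ∩ Metric.ball 0 1 ⊆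
        coneOver x S ∩ {z | inner ℝ n z < (1 + θ) * κ} := by
      rintro z ⟨hz, hzR⟩
      refine ⟨hz, ?_⟩
      obtain ⟨s, hs, hzs⟩ := hz
      have h1 := hupp _ hzs
      rw [add_sub_cancel_left, inner_smul_right, norm_smul, Real.norm_of_nonneg hs.le] at h1
      have h2 : inner ℝ n z ≤ (1 + θ) * κ * ‖z‖ := by
        have : s * inner ℝ n z ≤ s * ((1 + θ) * κ * ‖z‖) := by linarith
        exact le_of_mul_le_mul_left this hs
      rw [mem_ball_zero_iff] at hzR
      have h4 : 0 < (1 + θ) * κ := by positivity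
      change inner ℝ n z < (1 + θ) * κ
      nlinarith
    calc _ ≤ 3 * volume (coneOver x S ∩ {z | inner ℝ n z < (1 + θ) * κ}) := by gcongr
      _ ≤ ENNReal.ofReal (((1 + θ) * κ) ^ 3 / h ^ 2) * (ENNReal.ofReal ((1 + θ) ^ 2) *
          (Measure.euclideanHausdorffMeasure 2 : Measure E3) S) := by
        rw [hvol _ (by positivity)]
        gcongr
      _ = _ := by
          rw [← mul_assoc, ← ENNReal.ofReal_mul (by positivity)]
          congr 2; ring

/-- Local comparison of solid angle and surface measure. -/
theorem SmoothBody.solidAngle_local {K : Set E3} (hK : SmoothBody K) {a x : E3}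
    (ha : a ∈ frontier K) (h : 0 < inner ℝ (outerNormal K a) (a - x)) {c₁ c₂ : ℝ}
    (hc₁ : c₁ < inner ℝ (outerNormal K a) (a - x) / ‖a - x‖ ^ 3)
    (hc₂ : inner ℝ (outerNormal K a) (a - x) / ‖a - x‖ ^ 3 < c₂) :
    ∃ U ∈ 𝓝 a, ∀ S ⊆ U ∩ frontier K, MeasurableSet (coneOver x S) →
      ENNReal.ofReal c₁ * surfaceMeasure K S ≤ 3 * volume (coneOver x S ∩ Metric.ball 0 1) ∧
      3 * volume (coneOver x S ∩ Metric.ball 0 1) ≤ ENNReal.ofReal c₂ * surfaceMeasure K S := by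
  set n := outerNormal K a with hn
  set H := inner ℝ n (a - x) with hH
  have hax : 0 < ‖a - x‖ := norm_pos_iff.2 fun h0 => by rw [hH, h0] at h; simp at h
  set κ := H / ‖a - x‖ with hκ
  have hκ0 : 0 < κ := by positivity
  -- `κ` is the cosine of the angle between the normal and the line of sight. With the plane at
  -- height `H`, the two constants of `solidAngle_bounds` both tend to the density `H / ‖a - x‖ ^ 3`
  -- as `θ → 0`.
  have hc : H / ‖a - x‖ ^ 3 = κ ^ 3 / H ^ 2 := by rw [hκ]; field_simp
  rw [hc] at hc₁ hc₂
  obtain ⟨θ, ⟨hθ0, hθ1⟩, hθ2, hθ3⟩ : ∃ θ : ℝ, (0 < θ ∧ θ < 1) ∧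
      c₁ < (1 - θ) ^ 5 * (κ ^ 3 / H ^ 2) ∧ (1 + θ) ^ 5 * (κ ^ 3 / H ^ 2) < c₂ := by
    have t1 : Tendsto (fun θ : ℝ => (1 - θ) ^ 5 * (κ ^ 3 / H ^ 2)) (𝓝[>] 0)
        (𝓝 (κ ^ 3 / H ^ 2)) := by
      have : Continuous fun θ : ℝ => (1 - θ) ^ 5 * (κ ^ 3 / H ^ 2) := by fun_prop
      simpa using (this.tendsto 0).mono_left nhdsWithin_le_nhds
    have t2 : Tendsto (fun θ : ℝ => (1 + θ) ^ 5 * (κ ^ 3 / H ^ 2)) (𝓝[>] 0)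
        (𝓝 (κ ^ 3 / H ^ 2)) := by
      have : Continuous fun θ : ℝ => (1 + θ) ^ 5 * (κ ^ 3 / H ^ 2) := by fun_prop
      simpa using (this.tendsto 0).mono_left nhdsWithin_le_nhds
    have h3 : ∀ᶠ θ : ℝ in 𝓝[>] 0, 0 < θ ∧ θ < 1 := Ioo_mem_nhdsGT one_pos
    exact (h3.and ((t1.eventually_const_lt hc₁).and (t2.eventually_lt_const hc₂))).exists
  set d := 2 * ‖a - x‖ with hd
  obtain ⟨U, hU, hflat⟩ := hK.abs_inner_outerNormal_le ha
    (show 0 < θ * H / (8 * d) by positivity)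
  have hcu : ContinuousAt (fun y => inner ℝ n (y - x)) a := by fun_prop
  have hcn : ContinuousAt (fun y => ‖y - x‖) a := by fun_prop
  have E1 : ∀ᶠ y in 𝓝 a, H / 2 < inner ℝ n (y - x) :=
    hcu.eventually_const_lt (by change H / 2 < H; linarith)
  have E2 : ∀ᶠ y in 𝓝 a, ‖y - x‖ < d := hcn.eventually_lt_const (by linarith)
  have E3' : ∀ᶠ y in 𝓝 a, (1 - θ) * κ * ‖y - x‖ < inner ℝ n (y - x) := by
    refine ContinuousAt.eventually_lt (by fun_prop) hcu ?_
    change (1 - θ) * κ * ‖a - x‖ < H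
    have : κ * ‖a - x‖ = H := div_mul_cancel₀ _ hax.ne'
    nlinarith
  have E4 : ∀ᶠ y in 𝓝 a, inner ℝ n (y - x) < (1 + θ) * κ * ‖y - x‖ := by
    refine ContinuousAt.eventually_lt hcu (by fun_prop) ?_
    change H < (1 + θ) * κ * ‖a - x‖
    have : κ * ‖a - x‖ = H := div_mul_cancel₀ _ hax.ne'
    nlinarith
  have E5 : ∀ᶠ y in 𝓝 a, |H / inner ℝ n (y - x) - 1| < θ / 2 := by
    have : Tendsto (fun y => |H / inner ℝ n (y - x) - 1|) (𝓝 a) (𝓝 |H / H - 1|) :=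
      ((tendsto_const_nhds.div hcu h.ne').sub_const 1).abs
    exact this.eventually_lt_const (by rw [div_self h.ne']; simpa)
  refine ⟨U ∩ {y | (H / 2 < inner ℝ n (y - x) ∧ ‖y - x‖ < d) ∧
    ((1 - θ) * κ * ‖y - x‖ < inner ℝ n (y - x) ∧ inner ℝ n (y - x) < (1 + θ) * κ * ‖y - x‖) ∧
    |H / inner ℝ n (y - x) - 1| < θ / 2}, inter_mem hU
    ((E1.and E2).and ((E3'.and E4).and E5)), fun S hS hC => ?_⟩
  have hb := solidAngle_bounds (hK.norm_outerNormal ha) h hθ0 hθ1 hκ0 hC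
    (fun y hy => by linarith [(hS hy).1.2.1.1]) (fun y hy => (hS hy).1.2.2.1.1.le)
    (fun y hy => (hS hy).1.2.2.1.2.le) (fun y hy z hz => by
      refine norm_planeProj_sub_le h hθ0 (hS hz).1.2.1.2.le (hS hy).1.2.1.1.le (hS hz).1.2.1.1.le
        (hS hy).1.2.2.2.le ?_
      have := hflat y ⟨(hS hy).1.1, (hS hy).2⟩ z ⟨(hS hz).1.1, (hS hz).2⟩
      rw [div_mul_eq_mul_div, le_div_iff₀ (by positivity)] at this
      exact this)
  rw [surfaceMeasure, Measure.restrict_eq_self _ (hS.trans inter_subset_right)]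
  exact ⟨(mul_le_mul_left (ENNReal.ofReal_le_ofReal hθ2.le) _).trans hb.1,
    hb.2.trans (mul_le_mul_left (ENNReal.ofReal_le_ofReal hθ3.le) _)⟩
end

/-! ### The solid angle as a density with respect to surface measure. -/

open scoped ENNReal NNReal Pointwise

noncomputable section

theorem measurableSet_inter_preimage_of_continuousOn {X Y : Type*} [TopologicalSpace X]
    [MeasurableSpace X] [OpensMeasurableSpace X] [TopologicalSpace Y] [MeasurableSpace Y]
    [BorelSpace Y] {f : X → Y} {s : Set X} (hs : MeasurableSet s) (hf : ContinuousOn f s)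
    {t : Set Y} (ht : MeasurableSet t) : MeasurableSet (s ∩ f ⁻¹' t) := by
  have : s ∩ f ⁻¹' t = Subtype.val '' (s.domRestrict f ⁻¹' t) := by
    ext x; simp [and_comm]
  rw [this]
  exact hs.subtype_image ((continuousOn_iff_continuous_domRestrict.1 hf).measurable ht)

/-- Two measures which are comparable at small scales with a continuous ratio `c` are related by
the density `c`. -/
theorem measure_eq_lintegral_of_local_ratio {X : Type*} [TopologicalSpace X]
    [SecondCountableTopology X] [MeasurableSpace X] [BorelSpace X] {μ ν : Measure X} {W : Set X}
    {c : X → ℝ} (hc : ContinuousOn c W) (hc0 : ∀ a ∈ W, 0 < c a)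
    (hloc : ∀ a ∈ W, ∀ c₁ c₂ : ℝ, c₁ < c a → c a < c₂ → ∃ U ∈ 𝓝 a, ∀ S ⊆ U ∩ W, MeasurableSet S →
      ENNReal.ofReal c₁ * μ S ≤ ν S ∧ ν S ≤ ENNReal.ofReal c₂ * μ S)
    {S : Set X} (hS : MeasurableSet S) (hSW : S ⊆ W) :
    ν S = ∫⁻ a in S, ENNReal.ofReal (c a) ∂μ := by
  -- One factor `q` pays for the local comparison of the measures and one for the oscillation of
  -- `c`. A countable subcover, made disjoint, adds up the local estimates, and then `q` tends to
  -- `1`. No finiteness of `μ` enters, so finiteness of the surface measure can be deduced from this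
  -- result.
  have key : ∀ q : ℝ, 1 < q →
      ν S ≤ ENNReal.ofReal (q ^ 2) * ∫⁻ a in S, ENNReal.ofReal (c a) ∂μ ∧
      ∫⁻ a in S, ENNReal.ofReal (c a) ∂μ ≤ ENNReal.ofReal (q ^ 2) * ν S := by
    intro q hq
    have hq0 : 0 < q := by linarith
    have h1 : ∀ a ∈ W, ∃ U : Set X, IsOpen U ∧ a ∈ U ∧ ∀ S ⊆ U ∩ W, MeasurableSet S →
        ν S ≤ ENNReal.ofReal (q ^ 2) * ∫⁻ a in S, ENNReal.ofReal (c a) ∂μ ∧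
        ∫⁻ a in S, ENNReal.ofReal (c a) ∂μ ≤ ENNReal.ofReal (q ^ 2) * ν S := by
      intro a ha
      have hca := hc0 a ha
      have hl : c a / q < c a := div_lt_self hca hq
      have hr : c a < q * c a := by nlinarith
      obtain ⟨U, hU, hUb⟩ := hloc a ha _ _ hl hr
      have hV : ∀ᶠ y in 𝓝[W] a, c a / q < c y ∧ c y < q * c a :=
        ((hc a ha).eventually_const_lt hl).and ((hc a ha).eventually_lt_const hr)
      obtain ⟨V, hV, hVb⟩ := (eventually_iff.trans mem_nhdsWithin_iff_exists_mem_nhds_inter).1 hV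
      obtain ⟨O, hOs, hO, haO⟩ := mem_nhds_iff.1 (inter_mem hU hV)
      refine ⟨O, hO, haO, fun S hS hSm => ?_⟩
      have hb := hUb S (fun y hy => ⟨(hOs (hS hy).1).1, (hS hy).2⟩) hSm
      have hcb : ∀ y ∈ S, c a / q < c y ∧ c y < q * c a := fun y hy =>
        hVb ⟨(hOs (hS hy).1).2, (hS hy).2⟩
      have i1 : ENNReal.ofReal (c a / q) * μ S ≤ ∫⁻ a in S, ENNReal.ofReal (c a) ∂μ := by
        rw [← setLIntegral_const]
        exact setLIntegral_mono' hSm fun y hy => ENNReal.ofReal_le_ofReal (hcb y hy).1.le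
      have i2 : ∫⁻ a in S, ENNReal.ofReal (c a) ∂μ ≤ ENNReal.ofReal (q * c a) * μ S := by
        rw [← setLIntegral_const]
        exact setLIntegral_mono' hSm fun y hy => ENNReal.ofReal_le_ofReal (hcb y hy).2.le
      have e : ENNReal.ofReal (q * c a) * μ S =
          ENNReal.ofReal (q ^ 2) * (ENNReal.ofReal (c a / q) * μ S) := by
        rw [← mul_assoc, ← ENNReal.ofReal_mul (by positivity)]
        congr 2; field_simp
      constructor
      · refine hb.2.trans ?_
        rw [e]; gcongr
      · refine i2.trans ?_
        rw [e]; exact mul_le_mul_right hb.1 _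
    choose! U hUo haU hUb using h1
    obtain ⟨t, htW, htc, hcov⟩ := TopologicalSpace.countable_cover_nhdsWithin
      (f := U) (s := W) fun a ha => mem_nhdsWithin_of_mem_nhds ((hUo a ha).mem_nhds (haU a ha))
    rcases t.eq_empty_or_nonempty with rfl | htne
    · have : S = ∅ := by
        rw [eq_empty_iff_forall_notMem]
        intro y hy
        have := hcov (hSW hy)
        simp at this
      simp [this]
    obtain ⟨f, hf⟩ := htc.exists_eq_range htne
    set V : ℕ → Set X := fun n => S ∩ disjointed (fun n => U (f n)) n with hV
    have hfW : ∀ n, f n ∈ W := fun n => htW (hf ▸ mem_range_self n)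
    have hVm : ∀ n, MeasurableSet (V n) := fun n =>
      hS.inter (MeasurableSet.disjointed (fun n => (hUo _ (hfW n)).measurableSet) n)
    have hVd : Pairwise fun i j => Disjoint (V i) (V j) := fun i j hij =>
      ((disjoint_disjointed (fun n => U (f n))) hij).mono inter_subset_right inter_subset_right
    have hVu : S = ⋃ n, V n := by
      rw [hV, ← inter_iUnion, iUnion_disjointed, eq_comm, inter_eq_left]
      intro y hy
      obtain ⟨a, ha, hya⟩ := mem_iUnion₂.1 (hcov (hSW hy))
      rw [hf] at ha
      obtain ⟨n, rfl⟩ := ha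
      exact mem_iUnion.2 ⟨n, hya⟩
    have hVb : ∀ n, _ := fun n => hUb (f n) (hfW n) (V n)
      (fun y hy => ⟨disjointed_subset (fun n => U (f n)) n hy.2, hSW hy.1⟩) (hVm n)
    have s1 : ν S = ∑' n, ν (V n) := by rw [← measure_iUnion hVd hVm, ← hVu]
    have s2 : ∫⁻ a in S, ENNReal.ofReal (c a) ∂μ = ∑' n, ∫⁻ a in V n, ENNReal.ofReal (c a) ∂μ := by
      rw [← lintegral_iUnion hVm hVd, ← hVu]
    rw [s1, s2, ← ENNReal.tsum_mul_left, ← ENNReal.tsum_mul_left]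
    exact ⟨ENNReal.tsum_le_tsum fun n => (hVb n).1, ENNReal.tsum_le_tsum fun n => (hVb n).2⟩
  have lim : ∀ A : ℝ≥0∞, Tendsto (fun q : ℝ => ENNReal.ofReal (q ^ 2) * A) (𝓝[>] 1) (𝓝 A) := by
    intro A
    have h0 : Tendsto (fun q : ℝ => ENNReal.ofReal (q ^ 2)) (𝓝[>] 1) (𝓝 1) := by
      have : Continuous fun q : ℝ => ENNReal.ofReal (q ^ 2) :=
        ENNReal.continuous_ofReal.comp (by fun_prop)
      simpa using (this.tendsto 1).mono_left nhdsWithin_le_nhds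
    simpa using ENNReal.Tendsto.mul_const h0 (b := A) (Or.inl one_ne_zero)
  refine le_antisymm (ge_of_tendsto (lim _) ?_) (ge_of_tendsto (lim _) ?_)
  · filter_upwards [self_mem_nhdsWithin] with q hq using (key q hq).1
  · filter_upwards [self_mem_nhdsWithin] with q hq using (key q hq).2

/-- Boundary points of `K` which are seen transversally from `x`. -/
def visiblePart (K : Set E3) (x : E3) : Set E3 :=
  {a | a ∈ frontier K ∧ 0 < inner ℝ (outerNormal K a) (a - x)}

/-- Density of the solid angle seen from `x` with respect to surface measure. -/
def solidAngleDensity (K : Set E3) (x a : E3) : ℝ :=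
  inner ℝ (outerNormal K a) (a - x) / ‖a - x‖ ^ 3

namespace SmoothBody

variable {K : Set E3}

theorem isOpen_entersInterior {x : E3} (hx : x ∈ K) : IsOpen {v | EntersInterior K x v} := by
  have : {v | EntersInterior K x v} =
      {0}ᶜ ∩ ⋃ r : ℝ, ⋃ _ : 0 < r, (fun v => x + r • v) ⁻¹' interior K := by
    ext v; simp [EntersInterior, hx]
  rw [this]
  exact isOpen_compl_singleton.inter (isOpen_iUnion fun r => isOpen_iUnion fun _ =>
    isOpen_interior.preimage (by fun_prop))

theorem continuousOn_exitPoint_left (hK : SmoothBody K) (x : E3) :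
    ContinuousOn (exitPoint K x) {v | EntersInterior K x v} :=
  hK.continuousOn_exitPoint.comp (f := fun v => (x, v)) (by fun_prop) fun _ hv => hv

theorem continuousOn_inner_outerNormal (hK : SmoothBody K) (x : E3) :
    ContinuousOn (fun a => inner ℝ (outerNormal K a) (a - x)) (frontier K) :=
  hK.continuousOn_outerNormal.inner (by fun_prop)

theorem measurableSet_visiblePart (hK : SmoothBody K) (x : E3) :
    MeasurableSet (visiblePart K x) :=
  measurableSet_inter_preimage_of_continuousOn isClosed_frontier.measurableSet
    (hK.continuousOn_inner_outerNormal x) measurableSet_Ioi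

theorem exitPoint_mem_visiblePart (hK : SmoothBody K) {x v : E3} (h : EntersInterior K x v) :
    exitPoint K x v ∈ visiblePart K x := by
  have h1 := hK.inner_outerNormal_exitPoint h
  obtain ⟨hx, hv, r, hr0, hr⟩ := h
  refine ⟨hK.exitPoint_mem_frontier hv ⟨r, interior_subset hr⟩, ?_⟩
  have : exitPoint K x v - x = exitTime K x v • v := by rw [exitPoint]; abel
  rw [this, inner_smul_right]
  exact mul_pos (hr0.trans (hK.lt_exitTime hv hr)) h1

/-- Transversality at `a` makes the midpoint between `x` and `a` interior, so the ray passes through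
the interior before it leaves `K` at `a`. -/
theorem entersInterior_of_mem_visiblePart (hK : SmoothBody K) {x a z : E3} (hx : x ∈ K)
    (ha : a ∈ visiblePart K x) {s : ℝ} (hs : 0 < s) (hz : x + s • z = a) :
    EntersInterior K x z ∧ exitPoint K x z = a := by
  have e : a - x = s • z := by rw [← hz]; abel
  have h2 := ha.2
  rw [e, inner_smul_right] at h2
  have h3 : 0 < inner ℝ (outerNormal K a) z := pos_of_mul_pos_right h2 hs.le
  have h4 : z ≠ 0 := by rintro rfl; simp at h3
  refine ⟨⟨hx, h4, s / 2, by positivity, ?_⟩, hK.exitPoint_eq ha.1 hz.symm h3⟩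
  have := hK.midpoint_mem_interior ha.1 hx ha.2
  rwa [midpoint_eq_smul_add, ← hz, show (⅟2 : ℝ) • (x + (x + s • z)) = x + (s / 2) • z by
    simp only [invOf_eq_inv]; module] at this

/-- Shows that the cone is a preimage under the exit map. This gives its measurability and connects
volumes of cones with the push-forward of the measure on directions. -/
theorem coneOver_eq (hK : SmoothBody K) {x : E3} (hx : x ∈ K) {S : Set E3}
    (hS : S ⊆ visiblePart K x) :
    coneOver x S = {v | EntersInterior K x v} ∩ exitPoint K x ⁻¹' S := by
  ext z
  constructor
  · rintro ⟨s, hs, hz⟩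
    obtain ⟨h1, h2⟩ := hK.entersInterior_of_mem_visiblePart hx (hS hz) hs rfl
    refine ⟨h1, ?_⟩
    rwa [mem_preimage, h2]
  · rintro ⟨⟨-, hv, r, hr0, hr⟩, hz⟩
    exact ⟨exitTime K x z, hr0.trans (hK.lt_exitTime hv hr), hz⟩

theorem measurableSet_coneOver (hK : SmoothBody K) {x : E3} (hx : x ∈ K) {S : Set E3}
    (hSm : MeasurableSet S) (hS : S ⊆ visiblePart K x) : MeasurableSet (coneOver x S) := by
  rw [hK.coneOver_eq hx hS]
  exact measurableSet_inter_preimage_of_continuousOn (isOpen_entersInterior hx).measurableSet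
    (hK.continuousOn_exitPoint_left x) hSm

/-- By its definition `toSphere` is the dimension times the volume of the radial hull in the unit
ball, and the radial hull of the directions in a cone is the cone itself. -/
theorem toSphere_coneOver (hK : SmoothBody K) {x : E3} (hx : x ∈ K) {S : Set E3}
    (hSm : MeasurableSet S) (hS : S ⊆ visiblePart K x) :
    (volume : Measure E3).toSphere {ω | (ω : E3) ∈ coneOver x S} =
      3 * volume (coneOver x S ∩ Metric.ball 0 1) := by
  rw [show {ω : Metric.sphere (0 : E3) 1 | (ω : E3) ∈ coneOver x S} =
    Subtype.val ⁻¹' coneOver x S from rfl, Measure.toSphere_apply' _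
    ((hK.measurableSet_coneOver hx hSm hS).preimage measurable_subtype_coe)]
  have h3 : ((Module.finrank ℝ E3 : ℕ) : ℝ≥0∞) = 3 := by simp
  rw [h3]
  congr 2
  ext z
  rw [Set.mem_smul]
  constructor
  · rintro ⟨r, hr, _, ⟨ω, hω, rfl⟩, rfl⟩
    obtain ⟨s, hs, h⟩ := hω
    refine ⟨⟨s / r, div_pos hs hr.1, ?_⟩, ?_⟩
    · rwa [smul_smul, div_mul_cancel₀ _ hr.1.ne']
    · rw [mem_ball_zero_iff, norm_smul, Real.norm_of_nonneg hr.1.le]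
      simpa using hr.2
  · rintro ⟨⟨s, hs, h⟩, hz⟩
    have hz0 : z ≠ 0 := by
      rintro rfl
      have := (hS h).2
      simp at this
    have hn : 0 < ‖z‖ := norm_pos_iff.2 hz0
    refine ⟨‖z‖, ⟨hn, by simpa using hz⟩, ‖z‖⁻¹ • z, ⟨⟨‖z‖⁻¹ • z, ?_⟩, ?_, rfl⟩, ?_⟩
    · simp [norm_smul, hn.ne']
    · refine ⟨s * ‖z‖, by positivity, ?_⟩
      change x + (s * ‖z‖) • ‖z‖⁻¹ • z ∈ S
      rwa [smul_smul, mul_assoc, mul_inv_cancel₀ hn.ne', mul_one]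
    · rw [smul_smul, mul_inv_cancel₀ hn.ne', one_smul]

theorem solidAngleDensity_pos {x a : E3} (ha : a ∈ visiblePart K x) :
    0 < solidAngleDensity K x a := by
  have : a - x ≠ 0 := fun h => by have := ha.2; rw [h] at this; simp at this
  have := norm_pos_iff.2 this
  exact div_pos ha.2 (by positivity)

theorem continuousOn_solidAngleDensity (hK : SmoothBody K) (x : E3) :
    ContinuousOn (solidAngleDensity K x) (visiblePart K x) := by
  refine ((hK.continuousOn_inner_outerNormal x).mono fun a ha => ha.1).div (by fun_prop) ?_
  intro a ha h0
  have := solidAngleDensity_pos ha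
  rw [solidAngleDensity, h0, div_zero] at this
  exact lt_irrefl _ this

theorem aemeasurable_exitPoint (hK : SmoothBody K) {x : E3} (hx : x ∈ K)
    (τ : Measure (Metric.sphere (0 : E3) 1)) :
    AEMeasurable (fun ω : Metric.sphere (0 : E3) 1 => exitPoint K x ω)
      (τ.restrict {ω : Metric.sphere (0 : E3) 1 | EntersInterior K x ω}) :=
  ((hK.continuousOn_exitPoint_left x).comp (f := fun ω : Metric.sphere (0 : E3) 1 => (ω : E3))
    continuous_subtype_val.continuousOn fun _ h => h).aemeasurable
    ((isOpen_entersInterior hx).preimage continuous_subtype_val).measurableSet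

/-- The image of the uniform measure on directions under the exit point map. -/
theorem map_exitPoint_toSphere (hK : SmoothBody K) {x : E3} (hx : x ∈ K) :
    (((volume : Measure E3).toSphere.restrict {ω : Metric.sphere (0 : E3) 1 | EntersInterior K x ω}).map
      fun ω : Metric.sphere (0 : E3) 1 => exitPoint K x ω) =
    ((surfaceMeasure K).restrict (visiblePart K x)).withDensity
      fun a => ENNReal.ofReal (solidAngleDensity K x a) := by
  set ν := ((volume : Measure E3).toSphere.restrict {ω : Metric.sphere (0 : E3) 1 | EntersInterior K x ω}).map
      fun ω : Metric.sphere (0 : E3) 1 => exitPoint K x ω with hν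
  have hΩ : MeasurableSet {ω : Metric.sphere (0 : E3) 1 | EntersInterior K x ω} :=
    ((isOpen_entersInterior hx).preimage continuous_subtype_val).measurableSet
  have hνS : ∀ S, MeasurableSet S → S ⊆ visiblePart K x →
      ν S = 3 * volume (coneOver x S ∩ Metric.ball 0 1) := by
    intro S hSm hS
    rw [hν, Measure.map_apply_of_aemeasurable (hK.aemeasurable_exitPoint hx _) hSm,
      Measure.restrict_apply' hΩ, ← hK.toSphere_coneOver hx hSm hS, hK.coneOver_eq hx hS]
    congr 1
    ext ω
    exact and_comm
  ext S hS
  have h1 : ν S = ν (S ∩ visiblePart K x) := by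
    rw [hν, Measure.map_apply_of_aemeasurable (hK.aemeasurable_exitPoint hx _) hS,
      Measure.map_apply_of_aemeasurable (hK.aemeasurable_exitPoint hx _)
        (hS.inter (hK.measurableSet_visiblePart x)),
      Measure.restrict_apply' hΩ, Measure.restrict_apply' hΩ]
    congr 1
    ext ω
    constructor
    · rintro ⟨h1, h2⟩
      exact ⟨⟨h1, hK.exitPoint_mem_visiblePart h2⟩, h2⟩
    · rintro ⟨⟨h1, -⟩, h2⟩
      exact ⟨h1, h2⟩
  rw [h1, withDensity_apply _ hS, Measure.restrict_restrict hS]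
  refine measure_eq_lintegral_of_local_ratio
    (hK.continuousOn_solidAngleDensity x) (fun a ha => solidAngleDensity_pos ha) ?_
    (hS.inter (hK.measurableSet_visiblePart x)) inter_subset_right
  intro a ha c₁ c₂ h₁ h₂
  obtain ⟨U, hU, hb⟩ := hK.solidAngle_local ha.1 ha.2 h₁ h₂
  refine ⟨U, hU, fun S hS hSm => ?_⟩
  have hSv : S ⊆ visiblePart K x := hS.trans inter_subset_right
  rw [hνS S hSm hSv]
  exact hb S (fun y hy => ⟨(hS hy).1, (hS hy).2.1⟩) (hK.measurableSet_coneOver hx hSm hSv)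

theorem visiblePart_of_mem_interior (hK : SmoothBody K) {x : E3} (hx : x ∈ interior K) :
    visiblePart K x = frontier K := by
  refine Subset.antisymm (fun a ha => ha.1) fun a ha => ⟨ha, ?_⟩
  have := hK.inner_outerNormal_neg ha hx
  rw [← neg_sub, inner_neg_right]
  linarith

theorem entersInterior_sphere {x : E3} (hx : x ∈ interior K) (ω : Metric.sphere (0 : E3) 1) :
    EntersInterior K x ω :=
  entersInterior_of_mem_interior hx (ne_zero_of_mem_unit_sphere ω)

theorem map_exitPoint_toSphere_of_mem_interior (hK : SmoothBody K) {x : E3}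
    (hx : x ∈ interior K) :
    ((volume : Measure E3).toSphere.map fun ω : Metric.sphere (0 : E3) 1 => exitPoint K x ω) =
      (surfaceMeasure K).withDensity fun a => ENNReal.ofReal (solidAngleDensity K x a) := by
  have h := hK.map_exitPoint_toSphere (interior_subset hx)
  rw [hK.visiblePart_of_mem_interior hx, surfaceMeasure, Measure.restrict_restrict
    isClosed_frontier.measurableSet, inter_self, ← surfaceMeasure] at h
  rwa [show {ω : Metric.sphere (0 : E3) 1 | EntersInterior K x ω} = univ from
    eq_univ_of_forall fun ω => entersInterior_sphere hx ω, Measure.restrict_univ] at h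

theorem continuous_exitPoint_sphere (hK : SmoothBody K) {x : E3} (hx : x ∈ interior K) :
    Continuous fun ω : Metric.sphere (0 : E3) 1 => exitPoint K x ω :=
  (hK.continuousOn_exitPoint_left x).comp_continuous continuous_subtype_val
    (entersInterior_sphere hx)

/-- Seen from an interior point, the solid angle density is continuous and positive on the compact
boundary, hence bounded below by a positive constant. Since the total solid angle is finite, so is
the area. -/
theorem isFiniteMeasure_surfaceMeasure (hK : SmoothBody K) :
    IsFiniteMeasure (surfaceMeasure K) := by
  obtain ⟨x, hx⟩ := hK.interior_nonempty
  have h := congrArg (fun μ => μ univ) (hK.map_exitPoint_toSphere_of_mem_interior hx)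
  rw [Measure.map_apply (hK.continuous_exitPoint_sphere hx).measurable .univ, preimage_univ,
    withDensity_apply _ .univ, Measure.restrict_univ] at h
  constructor
  rcases (frontier K).eq_empty_or_nonempty with he | hne
  · simp [surfaceMeasure, he]
  have hv := hK.visiblePart_of_mem_interior hx
  obtain ⟨a, ha, hmin⟩ := hK.isCompact_frontier.exists_isMinOn hne
    (hv ▸ hK.continuousOn_solidAngleDensity x)
  have hpos : 0 < solidAngleDensity K x a := solidAngleDensity_pos (hv.symm ▸ ha)
  have hle : ENNReal.ofReal (solidAngleDensity K x a) * surfaceMeasure K univ ≤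
      (volume : Measure E3).toSphere univ := by
    rw [h, ← lintegral_const]
    refine lintegral_mono_ae ?_
    rw [surfaceMeasure, ae_restrict_iff' isClosed_frontier.measurableSet]
    exact Eventually.of_forall fun y hy => ENNReal.ofReal_le_ofReal (hmin hy)
  by_contra! htop
  rw [top_le_iff.1 htop, ENNReal.mul_top (by simpa using hpos)] at hle
  exact absurd hle (not_le.2 (measure_lt_top _ _))

/-- The directions from an interior point that hit `V` form a nonempty open subset of the sphere,
which has positive measure. If `V` had zero area, almost no direction would hit it. -/
theorem surfaceMeasure_pos (hK : SmoothBody K) {V : Set E3} (hV : IsOpen V)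
    (hne : (V ∩ frontier K).Nonempty) : 0 < surfaceMeasure K V := by
  obtain ⟨x, hx⟩ := hK.interior_nonempty
  obtain ⟨a, haV, ha⟩ := hne
  rw [pos_iff_ne_zero]
  intro h0
  have hv : a ∈ visiblePart K x := by rw [hK.visiblePart_of_mem_interior hx]; exact ha
  have hax : a - x ≠ 0 := fun h => by have := hv.2; rw [h] at this; simp at this
  have hn := norm_pos_iff.2 hax
  have h := congrArg (fun μ => μ V) (hK.map_exitPoint_toSphere_of_mem_interior hx)
  rw [withDensity_absolutelyContinuous _ _ h0,
    Measure.map_apply (hK.continuous_exitPoint_sphere hx).measurable hV.measurableSet] at h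
  refine (hV.preimage (hK.continuous_exitPoint_sphere hx)).measure_ne_zero _
    ⟨⟨‖a - x‖⁻¹ • (a - x), by simp [norm_smul, hn.ne']⟩, ?_⟩ h
  rw [mem_preimage, (hK.entersInterior_of_mem_visiblePart (interior_subset hx) hv hn
    (by rw [smul_smul, mul_inv_cancel₀ hn.ne', one_smul, add_sub_cancel])).2]
  exact haV

end SmoothBody
end

/-! ### Change of variables from emissions to pairs of detection points. -/

open scoped ENNReal NNReal Pointwise

noncomputable section

theorem lintegral_polar {h : E3 → ℝ≥0∞} (hh : Measurable h) :
    ∫⁻ z, h z = ∫⁻ ω : Metric.sphere (0 : E3) 1,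
      (∫⁻ r in Ioi (0 : ℝ), ENNReal.ofReal (r ^ 2) * h (r • (ω : E3)))
        ∂(volume : Measure E3).toSphere := by
  have mp := (volume : Measure E3).measurePreserving_homeomorphUnitSphereProd
  have h1 : ∫⁻ z, h z = ∫⁻ z : ({0}ᶜ : Set E3), h z ∂(volume.comap Subtype.val) := by
    rw [lintegral_subtype_comap (measurableSet_singleton _).compl, restrict_compl_singleton]
  have h2 : ∀ z : ({0}ᶜ : Set E3), h z =
      (fun p : Metric.sphere (0 : E3) 1 × Ioi (0 : ℝ) => h ((p.2 : ℝ) • (p.1 : E3)))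
        (homeomorphUnitSphereProd E3 z) := by
    intro z
    have : (((homeomorphUnitSphereProd E3).symm (homeomorphUnitSphereProd E3 z) :
      ({0}ᶜ : Set E3)) : E3) = z := by rw [Homeomorph.symm_apply_apply]
    conv_lhs => rw [← this]
    rfl
  have hm : Measurable (fun p : Metric.sphere (0 : E3) 1 × Ioi (0 : ℝ) =>
      h ((p.2 : ℝ) • (p.1 : E3))) := by fun_prop
  rw [h1, lintegral_congr h2, mp.lintegral_comp hm, lintegral_prod _ hm.aemeasurable]
  refine lintegral_congr fun ω => ?_
  have hfin : Module.finrank ℝ E3 - 1 = 2 := by simp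
  rw [hfin, Measure.volumeIoiPow, lintegral_withDensity_eq_lintegral_mul _ (by fun_prop)
    (by fun_prop), ← lintegral_subtype_comap measurableSet_Ioi]
  rfl

theorem lintegral_segment {F : E3 → ℝ≥0∞} {b v : E3} {R : ℝ} (hR : 0 < R)
    (h0 : ∀ r, R ≤ r → F (b + r • v) = 0) :
    ∫⁻ r in Ioi (0 : ℝ), F (b + r • v) =
      ENNReal.ofReal R * ∫⁻ s in Ioo (0 : ℝ) 1, F (b + s • (R • v)) := by
  have himg : (fun s : ℝ => s * R) '' Ioo 0 1 = Ioo 0 R := by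
    ext r
    constructor
    · rintro ⟨s, hs, rfl⟩
      exact ⟨mul_pos hs.1 hR, by nlinarith [hs.2]⟩
    · intro hr
      exact ⟨r / R, ⟨div_pos hr.1 hR, (div_lt_one hR).2 hr.2⟩, div_mul_cancel₀ _ hR.ne'⟩
  have h1 : ∫⁻ r in Ioi (0 : ℝ), F (b + r • v) = ∫⁻ r in Ioo 0 R, F (b + r • v) := by
    rw [← Ioo_union_Ici_eq_Ioi hR, lintegral_union measurableSet_Ici
      (disjoint_left.2 fun x hx hx' => absurd hx.2 (not_lt.2 hx'))]
    rw [setLIntegral_congr_fun (g := fun _ => 0) measurableSet_Ici fun r hr => h0 r hr]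
    simp
  rw [h1, ← himg, lintegral_image_eq_lintegral_abs_deriv_mul measurableSet_Ioo
    (f' := fun _ => R) (fun x _ => by simpa using ((hasDerivAt_id x).mul_const R).hasDerivWithinAt)
    (fun x _ y _ h => mul_right_cancel₀ hR.ne' h), abs_of_pos hR,
    lintegral_const_mul' _ _ ENNReal.ofReal_ne_top]
  simp_rw [smul_smul]

theorem aemeasurable_surfaceMeasure_of_continuousOn {K : Set E3} {Y : Type*} [TopologicalSpace Y]
    [MeasurableSpace Y] [BorelSpace Y] {f : E3 → Y} (hf : ContinuousOn f (frontier K)) :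
    AEMeasurable f (surfaceMeasure K) := by
  rcases isEmpty_or_nonempty Y with hY | hY
  · exact hf.aemeasurable isClosed_frontier.measurableSet
  · exact hf.aemeasurable isClosed_frontier.measurableSet

theorem ae_mem_frontier (K : Set E3) : ∀ᵐ a ∂surfaceMeasure K, a ∈ frontier K :=
  ae_restrict_mem isClosed_frontier.measurableSet

namespace SmoothBody

variable {K : Set E3}

/-- The exit point depends only on the oriented line, not on the base point or the length of the
direction. -/
theorem exitPoint_congr (hK : SmoothBody K) {x y v w : E3} {t s : ℝ} (h : EntersInterior K x v)
    (hs : 0 < s) (hw : v = s • w) (hy : x = y + t • w) :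
    exitPoint K y w = exitPoint K x v := by
  have h1 := hK.exitPoint_mem_visiblePart h
  have h2 := hK.inner_outerNormal_exitPoint h
  refine hK.exitPoint_eq (r := t + exitTime K x v * s) h1.1 ?_ ?_
  · rw [exitPoint, hy]
    nth_rw 2 [hw]
    rw [add_assoc, smul_smul, ← add_smul, ← hy]
  · nth_rw 2 [hw] at h2
    rw [inner_smul_right] at h2
    exact pos_of_mul_pos_right h2 hs.le

theorem exitTime_pos (hK : SmoothBody K) {x v : E3} (h : EntersInterior K x v) :
    0 < exitTime K x v := by
  obtain ⟨hx, hv, r, hr0, hr⟩ := h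
  exact hr0.trans (hK.lt_exitTime hv hr)

theorem ne_of_mem_interior {x b : E3} (hx : x ∈ interior K) (hb : b ∈ frontier K) : x ≠ b := by
  rintro rfl; exact hb.2 hx

/-- Directions at an interior point parametrized by the boundary. -/
theorem lintegral_detectionPoints (hK : SmoothBody K) {x : E3} (hx : x ∈ interior K)
    {φ : E3 × E3 → ℝ≥0∞} (hφ : Measurable φ) :
    ∫⁻ ω : Metric.sphere (0 : E3) 1, φ (detectionPoints K x ω) ∂(volume : Measure E3).toSphere =
      ∫⁻ b, ENNReal.ofReal (solidAngleDensity K x b) * φ (exitPoint K x (x - b), b)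
        ∂surfaceMeasure K := by
  have hcont : ContinuousOn (fun b => (exitPoint K x (x - b), b)) (frontier K) :=
    ((hK.continuousOn_exitPoint_left x).comp (f := fun b => x - b) (by fun_prop) fun b hb =>
      entersInterior_of_mem_interior hx (sub_ne_zero.2 (ne_of_mem_interior hx hb))).prodMk
      continuousOn_id
  have hg : AEMeasurable (fun b => φ (exitPoint K x (x - b), b)) (surfaceMeasure K) :=
    hφ.comp_aemeasurable (aemeasurable_surfaceMeasure_of_continuousOn hcont)
  have hd : AEMeasurable (fun b => ENNReal.ofReal (solidAngleDensity K x b))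
      (surfaceMeasure K) := by
    have := hK.continuousOn_solidAngleDensity x
    rw [hK.visiblePart_of_mem_interior hx] at this
    exact (aemeasurable_surfaceMeasure_of_continuousOn this).ennreal_ofReal
  -- The exit point `b` determines the line through `x`, so the other detection point is the exit
  -- point in the direction `x - b`.
  have e : ∀ ω : Metric.sphere (0 : E3) 1, φ (detectionPoints K x ω) =
      (fun b => φ (exitPoint K x (x - b), b)) (exitPoint K x ω) := by
    intro ω
    have he := entersInterior_sphere hx ω
    have hR := hK.exitTime_pos he
    have hω : -(ω : E3) ≠ 0 := neg_ne_zero.2 (ne_zero_of_mem_unit_sphere ω)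
    have e1 : exitPoint K x (x - exitPoint K x ω) = exitPoint K x (-(ω : E3)) :=
      hK.exitPoint_congr (t := 0) (s := (exitTime K x ω)⁻¹) (entersInterior_of_mem_interior hx hω)
        (inv_pos.2 hR) (by
          rw [exitPoint, sub_add_cancel_left, smul_neg, smul_smul, inv_mul_cancel₀ hR.ne',
            one_smul]) (by simp)
    simp only [e1]
    rw [← detectionPoints_fst, ← detectionPoints_snd]
  rw [lintegral_congr e, ← lintegral_map' (f := fun b => φ (exitPoint K x (x - b), b))
    (g := fun ω : Metric.sphere (0 : E3) 1 => exitPoint K x ω) ?_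
    (hK.continuous_exitPoint_sphere hx).aemeasurable, hK.map_exitPoint_toSphere_of_mem_interior hx,
    lintegral_withDensity_eq_lintegral_mul₀ hd hg]
  · rfl
  · rw [hK.map_exitPoint_toSphere_of_mem_interior hx]
    exact hg.mono_ac (withDensity_absolutelyContinuous _ _)

/-- Directions at a boundary point parametrized by the boundary. -/
theorem lintegral_exitPoint (hK : SmoothBody K) {x : E3} (hx : x ∈ K)
    {g : E3 → ℝ≥0∞} (hg : Measurable g) :
    ∫⁻ ω in {ω : Metric.sphere (0 : E3) 1 | EntersInterior K x ω}, g (exitPoint K x ω)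
        ∂(volume : Measure E3).toSphere =
      ∫⁻ a, ENNReal.ofReal (solidAngleDensity K x a) * g a ∂surfaceMeasure K := by
  have hd : AEMeasurable (fun b => ENNReal.ofReal (solidAngleDensity K x b))
      ((surfaceMeasure K).restrict (visiblePart K x)) :=
    ((hK.continuousOn_solidAngleDensity x).aemeasurable
      (hK.measurableSet_visiblePart x)).ennreal_ofReal
  rw [← lintegral_map' (f := g) hg.aemeasurable (hK.aemeasurable_exitPoint hx _),
    hK.map_exitPoint_toSphere hx, lintegral_withDensity_eq_lintegral_mul₀ hd hg.aemeasurable]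
  change ∫⁻ a in _, ENNReal.ofReal (solidAngleDensity K x a) * g a ∂_ = _
  rw [← lintegral_indicator (hK.measurableSet_visiblePart x)]
  refine lintegral_congr_ae ?_
  filter_upwards [ae_mem_frontier K] with a ha
  by_cases hv : a ∈ visiblePart K x
  · rw [indicator_of_mem hv]
  -- On the invisible part the inner product is nonpositive and `ENNReal.ofReal` truncates the
  -- density to zero, so the integral may run over the whole boundary.
  · rw [indicator_of_notMem hv]
    have : inner ℝ (outerNormal K a) (a - x) ≤ 0 := by
      by_contra! h; exact hv ⟨ha, h⟩
    rw [solidAngleDensity, ENNReal.ofReal_of_nonpos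
      (div_nonpos_of_nonpos_of_nonneg this (by positivity)), zero_mul]

/-- The kernel which turns an emission density `F` into a density of detection pairs. -/
def _root_.pairKernel (K : Set E3) (F : E3 → ℝ≥0∞) (a b : E3) : ℝ≥0∞ :=
  ENNReal.ofReal (solidAngleDensity K b a) * (ENNReal.ofReal (inner ℝ (outerNormal K b) (b - a)) *
    ∫⁻ s in Ioo (0 : ℝ) 1, F (b + s • (a - b)))

open Classical in
/-- Emission from points on rays starting at a boundary point `b`. -/
theorem lintegral_rays (hK : SmoothBody K) {b : E3} (hb : b ∈ frontier K) {F : E3 → ℝ≥0∞}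
    (hF : Measurable F) (hF0 : ∀ x, x ∉ interior K → F x = 0) {φ : E3 × E3 → ℝ≥0∞}
    (hφ : Measurable φ) :
    ∫⁻ x, F x * (ENNReal.ofReal (solidAngleDensity K x b) * φ (exitPoint K x (x - b), b)) =
      ∫⁻ a, pairKernel K F a b * φ (a, b) ∂surfaceMeasure K := by
  have hbK := hK.frontier_subset hb
  have hΩ := isOpen_entersInterior hbK
  have hbi : ∀ z, b + z ∈ interior K → EntersInterior K b z := fun z hz =>
    ⟨hbK, by rintro rfl; exact hb.2 (by simpa using hz), 1, one_pos, by simpa using hz⟩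
  set e : E3 → E3 := {z | EntersInterior K b z}.piecewise (exitPoint K b) 0 with he
  have hem : Measurable e :=
    (hK.continuousOn_exitPoint_left b).measurable_piecewise continuousOn_const hΩ.measurableSet
  have heq : ∀ z, EntersInterior K b z → e z = exitPoint K b z := fun z hz =>
    piecewise_eq_of_mem _ _ _ hz
  set h : E3 → ℝ≥0∞ := fun z => F (b + z) *
    (ENNReal.ofReal (inner ℝ (outerNormal K b) (-z) / ‖-z‖ ^ 3) * φ (e z, b)) with hh
  have hhm : Measurable h := by
    refine (hF.comp (by fun_prop)).mul (Measurable.mul ?_ (hφ.comp (hem.prodMk measurable_const)))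
    fun_prop
  have s1 : ∫⁻ x, F x * (ENNReal.ofReal (solidAngleDensity K x b) *
      φ (exitPoint K x (x - b), b)) = ∫⁻ z, h z := by
    rw [← lintegral_add_left_eq_self _ b]
    refine lintegral_congr fun z => ?_
    by_cases hz : b + z ∈ interior K
    · have hE := hbi z hz
      have e1 : exitPoint K (b + z) (b + z - b) = e z := by
        rw [heq z hE]
        exact hK.exitPoint_congr (s := 1) (t := -1) hE one_pos (by simp) (by simp)
      rw [e1, hh, solidAngleDensity, sub_add_cancel_left]
    · simp [hh, hF0 _ hz]
  set g : E3 → ℝ≥0∞ := fun a => (ENNReal.ofReal (inner ℝ (outerNormal K b) (b - a)) *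
    ∫⁻ s in Ioo (0 : ℝ) 1, F (b + s • (a - b))) * φ (a, b) with hg
  have hgm : Measurable g := by
    refine Measurable.mul (Measurable.mul (by fun_prop) ?_) (hφ.comp (by fun_prop))
    have : Measurable (fun p : E3 × ℝ => F (b + p.2 • (p.1 - b))) := hF.comp (by fun_prop)
    exact this.lintegral_prod_right'
  -- In polar coordinates around `b` the Jacobian `r ^ 2` cancels the remaining power of `‖z‖` in
  -- the solid angle density, so each ray integral of `F` carries only the weight `⟪outerNormal K b,
  -- -ω⟫`, constant along the ray. Rescaling by the exit time turns it into a segment integral, and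
  -- `lintegral_exitPoint` then replaces the directions at `b` by the opposite boundary points `a`.
  rw [s1, lintegral_polar hhm]
  have s2 : ∀ ω : Metric.sphere (0 : E3) 1,
      ∫⁻ r in Ioi (0 : ℝ), ENNReal.ofReal (r ^ 2) * h (r • (ω : E3)) =
      {ω : Metric.sphere (0 : E3) 1 | EntersInterior K b ω}.indicator
        (fun ω => g (exitPoint K b ω)) ω := by
    intro ω
    have hω0 : (ω : E3) ≠ 0 := ne_zero_of_mem_unit_sphere ω
    have hωn : ‖(ω : E3)‖ = 1 := by simp
    by_cases hE : EntersInterior K b ω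
    · rw [indicator_of_mem (show ω ∈ {ω : Metric.sphere (0 : E3) 1 | EntersInterior K b ω} from hE)]
      have hR := hK.exitTime_pos hE
      have e2 : exitPoint K b ω - b = exitTime K b ω • (ω : E3) := by rw [exitPoint]; abel
      have e3 : b - exitPoint K b ω = exitTime K b ω • -(ω : E3) := by rw [exitPoint, smul_neg]; abel
      have s3 : ∫⁻ r in Ioi (0 : ℝ), ENNReal.ofReal (r ^ 2) * h (r • (ω : E3)) =
          ∫⁻ r in Ioi (0 : ℝ), (ENNReal.ofReal (inner ℝ (outerNormal K b) (-(ω : E3))) *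
            φ (exitPoint K b ω, b)) * F (b + r • (ω : E3)) := by
        refine setLIntegral_congr_fun measurableSet_Ioi fun r hr => ?_
        have hr : 0 < r := hr
        by_cases hz : b + r • (ω : E3) ∈ interior K
        · have e1 : e (r • (ω : E3)) = exitPoint K b ω := by
            rw [heq _ (hbi _ hz)]
            exact (hK.exitPoint_congr (s := r) (t := 0) (hbi _ hz) hr rfl (by simp)).symm
          simp only [hh, e1]
          rw [show -(r • (ω : E3)) = r • -(ω : E3) by simp, norm_smul, norm_neg, hωn,
            inner_smul_right, Real.norm_of_nonneg hr.le]
          rw [mul_left_comm (ENNReal.ofReal (r ^ 2)), ← mul_assoc (ENNReal.ofReal (r ^ 2)),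
            ← ENNReal.ofReal_mul (by positivity), mul_comm]
          congr 3
          field_simp
        · simp [hh, hF0 _ hz]
      rw [s3, lintegral_const_mul _ (show Measurable fun r : ℝ => F (b + r • (ω : E3)) from
        hF.comp (by fun_prop)), lintegral_segment hR fun r hr => ?_, hg]
      · simp only
        rw [e2, e3, inner_smul_right, ENNReal.ofReal_mul hR.le]
        ring
      · exact hF0 _ fun hint => absurd (hK.lt_exitTime hω0 hint) (not_lt.2 hr)
    · rw [indicator_of_notMem (show ω ∉ {ω : Metric.sphere (0 : E3) 1 | EntersInterior K b ω}
        from hE)]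
      rw [setLIntegral_congr_fun (g := fun _ => 0) measurableSet_Ioi fun r hr => ?_]
      · simp
      · have : b + r • (ω : E3) ∉ interior K := fun hint => hE ⟨hbK, hω0, r, hr, hint⟩
        simp [hh, hF0 _ this]
  rw [lintegral_congr s2, lintegral_indicator (show MeasurableSet
    {ω : Metric.sphere (0 : E3) 1 | EntersInterior K b ω} from
    (hΩ.preimage continuous_subtype_val).measurableSet), hK.lintegral_exitPoint hbK hgm]
  refine lintegral_congr fun a => ?_
  rw [pairKernel, hg]
  ring

/-- Change of variables from emission points and directions to pairs of detection points. -/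
theorem lintegral_emission (hK : SmoothBody K) {F : E3 → ℝ≥0∞}
    (hF : Measurable F) (hF0 : ∀ x, x ∉ interior K → F x = 0) {φ : E3 × E3 → ℝ≥0∞}
    (hφ : Measurable φ) :
    ∫⁻ x, F x * ∫⁻ ω : Metric.sphere (0 : E3) 1, φ (detectionPoints K x ω)
        ∂(volume : Measure E3).toSphere =
      ∫⁻ b, ∫⁻ a, pairKernel K F a b * φ (a, b) ∂surfaceMeasure K ∂surfaceMeasure K := by
  have := hK.isFiniteMeasure_surfaceMeasure
  -- Directions at `x` are first parametrized by the exit point `b`. After exchanging the integrals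
  -- `b` is fixed and `x` runs over the rays from `b`, which `lintegral_rays` parametrizes by the
  -- second point `a`.
  have s1 : ∫⁻ x, F x * ∫⁻ ω : Metric.sphere (0 : E3) 1, φ (detectionPoints K x ω)
        ∂(volume : Measure E3).toSphere = ∫⁻ x in interior K, ∫⁻ b, F x *
        (ENNReal.ofReal (solidAngleDensity K x b) * φ (exitPoint K x (x - b), b))
          ∂surfaceMeasure K := by
    rw [← lintegral_indicator isOpen_interior.measurableSet]
    refine lintegral_congr fun x => ?_
    by_cases hx : x ∈ interior K
    · rw [indicator_of_mem hx, hK.lintegral_detectionPoints hx hφ, lintegral_const_mul'']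
      have hcont : ContinuousOn (fun b => (exitPoint K x (x - b), b)) (frontier K) :=
        ((hK.continuousOn_exitPoint_left x).comp (f := fun b => x - b) (by fun_prop) fun b hb =>
          entersInterior_of_mem_interior hx (sub_ne_zero.2 (ne_of_mem_interior hx hb))).prodMk
          continuousOn_id
      have hd := hK.continuousOn_solidAngleDensity x
      rw [hK.visiblePart_of_mem_interior hx] at hd
      exact (aemeasurable_surfaceMeasure_of_continuousOn hd).ennreal_ofReal.mul
        (hφ.comp_aemeasurable (aemeasurable_surfaceMeasure_of_continuousOn hcont))
    · rw [indicator_of_notMem hx, hF0 x hx, zero_mul]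
  rw [s1, lintegral_lintegral_swap]
  · refine lintegral_congr_ae ?_
    filter_upwards [ae_mem_frontier K] with b hb
    rw [← hK.lintegral_rays hb hF hF0 hφ, ← lintegral_indicator isOpen_interior.measurableSet]
    refine lintegral_congr fun x => ?_
    by_cases hx : x ∈ interior K
    · rw [indicator_of_mem hx]
    · rw [indicator_of_notMem hx, hF0 x hx, zero_mul]
  · have hmem : ∀ᵐ p ∂(volume.restrict (interior K)).prod (surfaceMeasure K),
        p ∈ interior K ×ˢ frontier K :=
      (Measure.ae_prod_mem_iff_ae_ae_mem (isOpen_interior.measurableSet.prod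
        isClosed_frontier.measurableSet)).2 (by
          filter_upwards [ae_restrict_mem isOpen_interior.measurableSet] with x hx
          filter_upwards [ae_mem_frontier K] with b hb using ⟨hx, hb⟩)
    rw [← Measure.restrict_eq_self_of_ae_mem hmem]
    have hms : MeasurableSet (interior K ×ˢ frontier K) :=
      isOpen_interior.measurableSet.prod isClosed_frontier.measurableSet
    have c1 : ContinuousOn (fun p : E3 × E3 => (exitPoint K p.1 (p.1 - p.2), p.2))
        (interior K ×ˢ frontier K) :=
      (hK.continuousOn_exitPoint.comp (f := fun p : E3 × E3 => (p.1, p.1 - p.2)) (by fun_prop)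
        fun p hp => entersInterior_of_mem_interior hp.1
          (sub_ne_zero.2 (ne_of_mem_interior hp.1 hp.2))).prodMk (by fun_prop)
    have c2 : ContinuousOn (fun p : E3 × E3 => solidAngleDensity K p.1 p.2)
        (interior K ×ˢ frontier K) := by
      refine ((hK.continuousOn_outerNormal.comp continuousOn_snd fun p hp => hp.2).inner
        (by fun_prop)).div (by fun_prop) fun p hp => ?_
      have := norm_pos_iff.2 (sub_ne_zero.2 (ne_of_mem_interior hp.1 hp.2).symm)
      positivity
    exact (hF.comp measurable_fst).aemeasurable.mul ((c2.aemeasurable hms).ennreal_ofReal.mul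
      (hφ.comp_aemeasurable (c1.aemeasurable hms)))

end SmoothBody
end

open scoped ENNReal NNReal

noncomputable section

/-! ### Integrals against signed measures -/

section SignedIntegral

variable {X : Type*} [MeasurableSpace X]

theorem integral_dot_toSignedMeasure (μ : Measure X) [IsFiniteMeasure μ] (f : X → ℝ) :
    ∫ᵛ x, f x ∂•μ.toSignedMeasure = ∫ x, f x ∂μ := by
  rw [← VectorMeasure.integral_toSignedMeasure]
  congr 1
  ext
  simp

theorem integrable_toSignedMeasure_iff (μ : Measure X) [IsFiniteMeasure μ] (f : X → ℝ) :
    μ.toSignedMeasure.Integrable f ↔ Integrable f μ := by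
  rw [VectorMeasure.Integrable, Measure.variation_toSignedMeasure]

theorem integral_dot_sub (μ ν : Measure X) [IsFiniteMeasure μ] [IsFiniteMeasure ν] {f : X → ℝ}
    (hμ : Integrable f μ) (hν : Integrable f ν) :
    ∫ᵛ x, f x ∂•(μ.toSignedMeasure - ν.toSignedMeasure) = ∫ x, f x ∂μ - ∫ x, f x ∂ν := by
  rw [VectorMeasure.integral_sub_vectorMeasure ((integrable_toSignedMeasure_iff μ f).2 hμ)
    ((integrable_toSignedMeasure_iff ν f).2 hν), integral_dot_toSignedMeasure,
    integral_dot_toSignedMeasure]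

theorem integral_dot_withDensity {μ : Measure X} [IsFiniteMeasure μ] {v f : X → ℝ}
    (hv : Integrable v μ) (hf : Measurable f) {C : ℝ} (hC : ∀ x, |f x| ≤ C) :
    ∫ᵛ x, f x ∂•(μ.withDensityᵥ v) = ∫ x, f x * v x ∂μ := by
  have hb : ∀ (ν : Measure X) [IsFiniteMeasure ν], Integrable f ν := fun ν _ =>
    Integrable.of_bound hf.aestronglyMeasurable C (Eventually.of_forall hC)
  have h1 : IsFiniteMeasure (μ.withDensity fun x => ENNReal.ofReal (v x)) :=
    isFiniteMeasure_withDensity_ofReal hv.2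
  have h2 : IsFiniteMeasure (μ.withDensity fun x => ENNReal.ofReal (-v x)) :=
    isFiniteMeasure_withDensity_ofReal hv.neg.2
  rw [withDensityᵥ_eq_withDensity_pos_part_sub_withDensity_neg_part hv, integral_dot_sub _ _
    (hb _) (hb _), integral_withDensity_eq_integral_toReal_smul₀ hv.aemeasurable.ennreal_ofReal
    (by simp), integral_withDensity_eq_integral_toReal_smul₀ (f := fun x => ENNReal.ofReal (-v x)) hv.neg.aemeasurable.ennreal_ofReal
    (by simp), ← integral_sub]
  · refine integral_congr_ae (Eventually.of_forall fun x => ?_)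
    simp only [smul_eq_mul, ← sub_mul, ENNReal.toReal_ofReal', max_zero_sub_max_neg_zero_eq_self]
    exact mul_comm _ _
  · exact (hv.pos_part.mul_bdd hf.aestronglyMeasurable (c := C) (Eventually.of_forall hC)).congr
      (Eventually.of_forall fun x => by simp [ENNReal.toReal_ofReal'])
  · exact (hv.neg_part.mul_bdd hf.aestronglyMeasurable (c := C) (Eventually.of_forall hC)).congr
      (Eventually.of_forall fun x => by simp [ENNReal.toReal_ofReal'])

end SignedIntegral

/-! ### Flows -/

/-- `ρ` is carried by `[0, T] × D` and is transported by the square integrable velocity field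
`V`. -/
structure IsFlow (T : ℝ) (D : Set E3) (ρ : Measure SpaceTime) (V : SpaceTime → E3) : Prop where
  carried : ρ (Icc 0 T ×ˢ D)ᶜ = 0
  marginal : ρ.map Prod.fst ≪ volume
  measurable : Measurable V
  integrable_sq : Integrable (fun p => ‖V p‖ ^ 2) ρ
  continuity : ∀ φ : SpaceTime → ℝ, ContDiff ℝ ((⊤ : ℕ∞) : WithTop ℕ∞) φ → HasCompactSupport φ →
    tsupport φ ⊆ Ioo 0 T ×ˢ univ → ∫ p, fderiv ℝ φ p (1, V p) ∂ρ = 0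

/-- The vector field with the Radon–Nikodym derivatives of `η` as components. -/
def velocity (ρ : Measure SpaceTime) (η : Fin 3 → SignedMeasure SpaceTime) (p : SpaceTime) : E3 :=
  WithLp.toLp 2 fun i => (η i).rnDeriv ρ p

theorem measurable_velocity (ρ : Measure SpaceTime) (η : Fin 3 → SignedMeasure SpaceTime) :
    Measurable (velocity ρ η) :=
  (WithLp.measurable_toLp 2 _).comp
    (measurable_pi_lambda _ fun _ => SignedMeasure.measurable_rnDeriv _ _)

theorem norm_velocity_sq (ρ : Measure SpaceTime) (η : Fin 3 → SignedMeasure SpaceTime)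
    (p : SpaceTime) : ‖velocity ρ η p‖ ^ 2 = ∑ i, ((η i).rnDeriv ρ p) ^ 2 := by
  rw [EuclideanSpace.norm_sq_eq]
  simp [velocity]

/-- A bounded derivative of a compactly supported smooth function. -/
theorem exists_bound_fderiv {E : Type*} [NormedAddCommGroup E] [NormedSpace ℝ E] {φ : E → ℝ}
    (h1 : ContDiff ℝ ((⊤ : ℕ∞) : WithTop ℕ∞) φ) (h2 : HasCompactSupport φ) :
    ∃ C, ∀ p, ‖fderiv ℝ φ p‖ ≤ C := by
  obtain ⟨C, hC⟩ := (h1.continuous_fderiv (by simp)).bounded_above_of_compact_support (h2.fderiv ℝ)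
  exact ⟨C, hC⟩

theorem sum_smul_single (x : E3) : ∑ i, x i • (EuclideanSpace.single i (1 : ℝ)) = x := by
  ext j
  simp [Pi.single_apply]

theorem sum_fderiv_mul (L : SpaceTime →L[ℝ] ℝ) (x : E3) :
    L (1, 0) + ∑ i, L (0, EuclideanSpace.single i 1) * x i = L (1, x) := by
  have : ((1 : ℝ), x) = (1, 0) + ∑ i, x i • ((0 : ℝ), EuclideanSpace.single i (1 : ℝ)) := by
    ext1
    · simp [Prod.fst_sum]
    · simp only [Prod.snd_add, Prod.snd_sum, Prod.smul_snd, sum_smul_single, zero_add]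
  rw [this, map_add, map_sum]
  simp only [map_smul, smul_eq_mul, mul_comm]

theorem continuityEquation_iff_integral {T : ℝ} {ρ : Measure SpaceTime} [IsFiniteMeasure ρ]
    {η : Fin 3 → SignedMeasure SpaceTime} {V : SpaceTime → E3}
    (hV : ∀ i, Integrable (fun p => V p i) ρ) (hη : ∀ i, η i = ρ.withDensityᵥ fun p => V p i) :
    ContinuityEquation T ρ η ↔ ∀ φ : SpaceTime → ℝ, ContDiff ℝ ((⊤ : ℕ∞) : WithTop ℕ∞) φ →
      HasCompactSupport φ → tsupport φ ⊆ Ioo 0 T ×ˢ univ → ∫ p, fderiv ℝ φ p (1, V p) ∂ρ = 0 := by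
  refine forall_congr' fun φ => forall_congr' fun h1 => forall_congr' fun h2 =>
    forall_congr' fun h3 => ?_
  obtain ⟨C, hC⟩ := exists_bound_fderiv h1 h2
  have hfc : Continuous (fderiv ℝ φ) := h1.continuous_fderiv (by simp)
  have hb : ∀ w : SpaceTime, ∀ p, |fderiv ℝ φ p w| ≤ C * ‖w‖ := fun w p =>
    ((fderiv ℝ φ p).le_opNorm w).trans (by gcongr; exact hC p)
  have hcw : ∀ w : SpaceTime, Continuous fun p => fderiv ℝ φ p w := fun w =>
    hfc.clm_apply continuous_const
  have e : ∀ i, ∫ᵛ p, fderiv ℝ φ p (0, EuclideanSpace.single i 1) ∂•(η i) =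
      ∫ p, fderiv ℝ φ p (0, EuclideanSpace.single i 1) * V p i ∂ρ := fun i => by
    rw [hη i, integral_dot_withDensity (hV i) (hcw _).measurable (hb _)]
  have hint : ∀ i, Integrable (fun p => fderiv ℝ φ p (0, EuclideanSpace.single i 1) * V p i) ρ :=
    fun i => (hV i).bdd_mul (hcw _).aestronglyMeasurable (Eventually.of_forall (hb _))
  simp_rw [e]
  rw [← integral_finsetSum _ fun i _ => hint i, ← integral_add
    (Integrable.of_bound (hcw _).aestronglyMeasurable _ (Eventually.of_forall (hb _)))
    (integrable_finsetSum _ fun i _ => hint i)]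
  simp_rw [sum_fderiv_mul]

theorem eq_withDensity_velocity {ρ : Measure SpaceTime} [IsFiniteMeasure ρ]
    {η : Fin 3 → SignedMeasure SpaceTime} {i : Fin 3} (h : (η i) ≪ᵥ ρ.toENNRealVectorMeasure) :
    η i = ρ.withDensityᵥ fun p => velocity ρ η p i :=
  (SignedMeasure.withDensityᵥ_rnDeriv_eq _ _ h).symm

theorem benamouBrenier_eq {T : ℝ} {ρ : Measure SpaceTime} {η : Fin 3 → SignedMeasure SpaceTime}
    (h : benamouBrenier T ρ η ≠ ⊤) :
    benamouBrenier T ρ η = ∫⁻ p, ENNReal.ofReal (‖velocity ρ η p‖ ^ 2) ∂ρ := by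
  simp_rw [norm_velocity_sq]
  rw [benamouBrenier] at h ⊢
  split_ifs at h ⊢ with h1
  · rfl
  · exact absurd rfl h

theorem conditions_of_benamouBrenier_ne_top {T : ℝ} {ρ : Measure SpaceTime}
    {η : Fin 3 → SignedMeasure SpaceTime} (h : benamouBrenier T ρ η ≠ ⊤) :
    ρ.map Prod.fst ≪ volume ∧ ContinuityEquation T ρ η ∧
      ∀ i, (η i) ≪ᵥ ρ.toENNRealVectorMeasure := by
  rw [benamouBrenier] at h
  split_ifs at h with h1
  · exact h1
  · exact absurd rfl h

/-- The passage from admissible pairs of finite energy to flows, on which all estimates below are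
made. -/
theorem isFlow_velocity {T : ℝ} {D : Set E3} {ρ : Measure SpaceTime} [IsFiniteMeasure ρ]
    {η : Fin 3 → SignedMeasure SpaceTime} (hc : ρ (Icc 0 T ×ˢ D)ᶜ = 0)
    (h : benamouBrenier T ρ η ≠ ⊤) : IsFlow T D ρ (velocity ρ η) := by
  obtain ⟨h1, h2, h3⟩ := conditions_of_benamouBrenier_ne_top h
  refine ⟨hc, h1, measurable_velocity ρ η, ?_, ?_⟩
  · refine ⟨((measurable_velocity ρ η).norm.pow_const 2).aestronglyMeasurable, ?_⟩
    rw [hasFiniteIntegral_iff_ofReal (Eventually.of_forall fun p => by positivity),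
      ← benamouBrenier_eq h]
    exact lt_top_iff_ne_top.2 h
  · exact (continuityEquation_iff_integral (V := velocity ρ η)
      (fun i => SignedMeasure.integrable_rnDeriv _ _) fun i => eq_withDensity_velocity (h3 i)).1 h2
end

open scoped ENNReal NNReal

noncomputable section

/-! ### Time marginals of flows -/

/-- A smooth probability density with compact support in `(0, T)`. -/
structure IsTimeBump (T : ℝ) (h : ℝ → ℝ) : Prop where
  smooth : ContDiff ℝ ((⊤ : ℕ∞) : WithTop ℕ∞) h
  compact : HasCompactSupport h
  tsupport_subset : tsupport h ⊆ Ioo 0 T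
  nonneg : ∀ t, 0 ≤ h t
  integral_eq_one : ∫ t, h t = 1

theorem exists_isTimeBump {T : ℝ} (hT : 0 < T) : ∃ h, IsTimeBump T h := by
  let b : ContDiffBump (T / 2) := ⟨T / 8, T / 4, by positivity, by linarith⟩
  refine ⟨b.normed volume, b.contDiff_normed, b.hasCompactSupport_normed, ?_,
    fun t => b.nonneg_normed t, b.integral_normed⟩
  rw [b.tsupport_normed_eq]
  intro t ht
  rw [Real.closedBall_eq_Icc] at ht
  have h1 : T / 2 - T / 4 ≤ t := ht.1
  have h2 : t ≤ T / 2 + T / 4 := ht.2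
  constructor <;> linarith

theorem exists_isCompact_ordConnected {K : Set ℝ} {T : ℝ} (hK : IsCompact K)
    (h : K ⊆ Ioo 0 T) : ∃ C, IsCompact C ∧ C.OrdConnected ∧ K ⊆ C ∧ C ⊆ Ioo 0 T := by
  rcases K.eq_empty_or_nonempty with rfl | hne
  · exact ⟨∅, isCompact_empty, ordConnected_empty, subset_rfl, empty_subset _⟩
  · exact ⟨Icc (sInf K) (sSup K), isCompact_Icc, ordConnected_Icc,
      fun t ht => ⟨csInf_le hK.bddBelow ht, le_csSup hK.bddAbove ht⟩,
      fun t ht => ⟨(h (hK.sInf_mem hne)).1.trans_le ht.1, ht.2.trans_lt (h (hK.sSup_mem hne)).2⟩⟩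

/-- Zero mean makes the primitive vanish to the right of the support as well as to its left. It is
therefore again a test function on `(0, T)`, and `h` is the derivative of a test function. -/
theorem integral_Iic_of_hasCompactSupport {h : ℝ → ℝ} {T : ℝ}
    (h1 : ContDiff ℝ ((⊤ : ℕ∞) : WithTop ℕ∞) h) (h2 : HasCompactSupport h)
    (h3 : tsupport h ⊆ Ioo 0 T) (h4 : ∫ t, h t = 0) :
    ContDiff ℝ ((⊤ : ℕ∞) : WithTop ℕ∞) (fun s => ∫ t in Iic s, h t) ∧
    HasCompactSupport (fun s => ∫ t in Iic s, h t) ∧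
    tsupport (fun s => ∫ t in Iic s, h t) ⊆ Ioo 0 T ∧
    ∀ s, deriv (fun s => ∫ t in Iic s, h t) s = h s := by
  have hint : Integrable h := h1.continuous.integrable_of_hasCompactSupport h2
  have hd : ∀ s, HasDerivAt (fun s => ∫ t in Iic s, h t) (h s) s := by
    intro s
    have e : (fun s => ∫ t in Iic s, h t) = fun s => (∫ t in Iic 0, h t) + ∫ t in (0 : ℝ)..s, h t := by
      ext s
      rw [← intervalIntegral.integral_Iic_sub_Iic hint.integrableOn hint.integrableOn]
      ring
    rw [e]
    exact (intervalIntegral.integral_hasDerivAt_right (hint.intervalIntegrable)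
      (h1.continuous.stronglyMeasurableAtFilter _ _) h1.continuous.continuousAt).const_add _
  obtain ⟨C, hK, hC, hhC, hCT⟩ := exists_isCompact_ordConnected (K := tsupport h) h2 h3
  have hzero : ∀ s, s ∉ C → ∫ t in Iic s, h t = 0 := by
    intro s hs
    by_cases hl : ∃ t ∈ tsupport h, t ≤ s
    · obtain ⟨t, ht, hts⟩ := hl
      have hr : ∀ r ∈ Ioi s, h r = 0 := by
        intro r hr
        by_contra hne
        exact hs (hC.out (hhC ht) (hhC (subset_tsupport h hne)) ⟨hts, le_of_lt hr⟩)
      have := integral_add_compl (μ := volume) (measurableSet_Iic (a := s)) hint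
      rw [compl_Iic, setIntegral_congr_fun (g := fun _ => 0) measurableSet_Ioi hr, h4] at this
      simpa using this
    · push Not at hl
      rw [setIntegral_congr_fun (g := fun _ => 0) measurableSet_Iic fun t ht => ?_]
      · simp
      · by_contra hne
        exact absurd (hl t (subset_tsupport h hne)) (not_lt.2 ht)
  refine ⟨?_, HasCompactSupport.intro hK hzero, ?_, fun s => (hd s).deriv⟩
  · refine contDiff_infty_iff_deriv.2 ⟨fun s => (hd s).differentiableAt, ?_⟩
    rw [show deriv (fun s => ∫ t in Iic s, h t) = h from funext fun s => (hd s).deriv]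
    exact h1
  · refine (closure_minimal (fun s hs => ?_) hK.isClosed).trans hCT
    by_contra hn
    exact hs (hzero s hn)

/-- The power delivered to the test function `ψ` by the velocity field. -/
def drift (V : SpaceTime → E3) (ψ : E3 → ℝ) (p : SpaceTime) : ℝ := fderiv ℝ ψ p.2 (V p)

/-- The continuous version of the density of the time marginal of `ψ ρ`. -/
def timeDensity (ρ : Measure SpaceTime) (V : SpaceTime → E3) (h₀ : ℝ → ℝ) (ψ : E3 → ℝ)
    (t : ℝ) : ℝ :=
  ∫ p, h₀ p.1 * ψ p.2 ∂ρ -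
    ∫ p, ((Iic p.1).indicator 1 t - ∫ r in Iic p.1, h₀ r) * drift V ψ p ∂ρ

namespace IsTimeBump

variable {T : ℝ} {h : ℝ → ℝ}

theorem integrable (hh : IsTimeBump T h) : Integrable h :=
  hh.smooth.continuous.integrable_of_hasCompactSupport hh.compact

theorem primitive_nonneg (hh : IsTimeBump T h) (s : ℝ) : 0 ≤ ∫ r in Iic s, h r :=
  setIntegral_nonneg measurableSet_Iic fun r _ => hh.nonneg r

theorem primitive_le_one (hh : IsTimeBump T h) (s : ℝ) : ∫ r in Iic s, h r ≤ 1 := by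
  rw [← hh.integral_eq_one]
  exact setIntegral_le_integral hh.integrable (Eventually.of_forall hh.nonneg)

theorem continuous_primitive (hh : IsTimeBump T h) : Continuous fun s => ∫ r in Iic s, h r := by
  have e : (fun s => ∫ t in Iic s, h t) = fun s => (∫ t in Iic 0, h t) + ∫ t in (0 : ℝ)..s, h t := by
    ext s
    rw [← intervalIntegral.integral_Iic_sub_Iic hh.integrable.integrableOn
      hh.integrable.integrableOn]
    ring
  rw [e]
  exact continuous_const.add (intervalIntegral.continuous_primitive
    (fun a b => hh.integrable.intervalIntegrable) 0)

theorem abs_kernel_le (hh : IsTimeBump T h) (s t : ℝ) :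
    |(Iic s).indicator 1 t - ∫ r in Iic s, h r| ≤ 1 := by
  have h1 := hh.primitive_nonneg s
  have h2 := hh.primitive_le_one s
  by_cases hts : t ∈ Iic s
  · rw [indicator_of_mem hts, abs_le, Pi.one_apply]; constructor <;> linarith
  · rw [indicator_of_notMem hts, abs_le]; constructor <;> linarith

theorem measurable_kernel (hh : IsTimeBump T h) : Measurable fun q : SpaceTime × ℝ =>
    (Iic q.1.1).indicator (1 : ℝ → ℝ) q.2 - ∫ r in Iic q.1.1, h r := by
  refine Measurable.sub ?_ (hh.continuous_primitive.measurable.comp (by fun_prop))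
  have : (fun q : SpaceTime × ℝ => (Iic q.1.1).indicator (1 : ℝ → ℝ) q.2) =
      {q : SpaceTime × ℝ | q.2 ≤ q.1.1}.indicator 1 := by
    ext q; simp [indicator]
  rw [this]
  exact measurable_one.indicator (measurableSet_le (by fun_prop) (by fun_prop))

end IsTimeBump

namespace IsFlow

variable {T : ℝ} {D : Set E3} {ρ : Measure SpaceTime} [IsFiniteMeasure ρ] {V : SpaceTime → E3}
  {h₀ : ℝ → ℝ} {ψ : E3 → ℝ}

theorem integrable_norm (hf : IsFlow T D ρ V) : Integrable (fun p => ‖V p‖) ρ := by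
  refine ((integrable_const (1 : ℝ)).add hf.integrable_sq).mono'
    hf.measurable.norm.aestronglyMeasurable (Eventually.of_forall fun p => ?_)
  rw [norm_norm]
  change ‖V p‖ ≤ 1 + ‖V p‖ ^ 2
  nlinarith [sq_nonneg (‖V p‖ - 1), norm_nonneg (V p)]

theorem measurable_drift (hf : IsFlow T D ρ V) (hψ : ContDiff ℝ ((⊤ : ℕ∞) : WithTop ℕ∞) ψ) :
    Measurable (drift V ψ) := by
  have hc : Continuous (fderiv ℝ ψ) := hψ.continuous_fderiv (by simp)
  exact (isBoundedBilinearMap_apply (𝕜 := ℝ) (E := E3) (F := ℝ)).continuous.measurable.comp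
    ((hc.measurable.comp measurable_snd).prodMk hf.measurable)

theorem abs_drift_le {L : ℝ} (hL : ∀ y, ‖fderiv ℝ ψ y‖ ≤ L) (p : SpaceTime) :
    |drift V ψ p| ≤ L * ‖V p‖ :=
  ((fderiv ℝ ψ p.2).le_opNorm _).trans (by gcongr; exact hL _)

theorem integrable_drift (hf : IsFlow T D ρ V) (hψ : ContDiff ℝ ((⊤ : ℕ∞) : WithTop ℕ∞) ψ)
    (hψc : HasCompactSupport ψ) : Integrable (drift V ψ) ρ := by
  obtain ⟨L, hL⟩ := exists_bound_fderiv hψ hψc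
  exact (hf.integrable_norm.const_mul L).mono' (hf.measurable_drift hψ).aestronglyMeasurable
    (Eventually.of_forall fun p => abs_drift_le hL p)

theorem integrable_mul {θ : ℝ → ℝ} (hθ : Continuous θ) (hθc : HasCompactSupport θ)
    (hψ : Continuous ψ) (hψc : HasCompactSupport ψ) :
    Integrable (fun p : SpaceTime => θ p.1 * ψ p.2) ρ := by
  obtain ⟨A, hA⟩ := hθ.bounded_above_of_compact_support hθc
  obtain ⟨B, hB⟩ := hψ.bounded_above_of_compact_support hψc
  refine Integrable.of_bound (C := A * B) (by fun_prop) (Eventually.of_forall fun p => ?_)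
  rw [norm_mul]
  exact mul_le_mul (hA _) (hB _) (norm_nonneg _) ((norm_nonneg _).trans (hA p.1))

theorem integral_product_test (hf : IsFlow T D ρ V) {θ : ℝ → ℝ}
    (hθ : ContDiff ℝ ((⊤ : ℕ∞) : WithTop ℕ∞) θ) (hθc : HasCompactSupport θ)
    (hθs : tsupport θ ⊆ Ioo 0 T) (hψ : ContDiff ℝ ((⊤ : ℕ∞) : WithTop ℕ∞) ψ)
    (hψc : HasCompactSupport ψ) :
    ∫ p, deriv θ p.1 * ψ p.2 ∂ρ + ∫ p, θ p.1 * drift V ψ p ∂ρ = 0 := by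
  have hsub : ∀ p : SpaceTime, p ∉ tsupport θ ×ˢ tsupport ψ → θ p.1 * ψ p.2 = 0 := by
    intro p hp
    rcases not_and_or.1 (fun h => hp (mem_prod.2 h)) with h | h
    · rw [image_eq_zero_of_notMem_tsupport h, zero_mul]
    · rw [image_eq_zero_of_notMem_tsupport h, mul_zero]
  have h1 : ContDiff ℝ ((⊤ : ℕ∞) : WithTop ℕ∞) fun p : SpaceTime => θ p.1 * ψ p.2 :=
    (hθ.comp contDiff_fst).mul (hψ.comp contDiff_snd)
  have h2 : HasCompactSupport fun p : SpaceTime => θ p.1 * ψ p.2 :=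
    HasCompactSupport.intro (hθc.isCompact.prod hψc.isCompact) hsub
  have h3 : tsupport (fun p : SpaceTime => θ p.1 * ψ p.2) ⊆ Ioo 0 T ×ˢ univ := by
    refine (closure_minimal (t := tsupport θ ×ˢ tsupport ψ) (fun p hp => ?_)
      ((isClosed_tsupport _).prod (isClosed_tsupport _))).trans
      (prod_mono hθs (subset_univ _))
    by_contra hn
    exact hp (hsub p hn)
  have h4 := hf.continuity _ h1 h2 h3
  have hder : ∀ p : SpaceTime, fderiv ℝ (fun p : SpaceTime => θ p.1 * ψ p.2) p (1, V p) =
      deriv θ p.1 * ψ p.2 + θ p.1 * drift V ψ p := by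
    intro p
    have d1 : HasFDerivAt (fun p : SpaceTime => θ p.1)
        ((fderiv ℝ θ p.1).comp (ContinuousLinearMap.fst ℝ ℝ E3)) p :=
      ((hθ.differentiable (by simp)).differentiableAt.hasFDerivAt).comp p hasFDerivAt_fst
    have d2 : HasFDerivAt (fun p : SpaceTime => ψ p.2)
        ((fderiv ℝ ψ p.2).comp (ContinuousLinearMap.snd ℝ ℝ E3)) p :=
      ((hψ.differentiable (by simp)).differentiableAt.hasFDerivAt).comp p hasFDerivAt_snd
    have d3 := (d1.mul d2).fderiv
    change fderiv ℝ ((fun p : SpaceTime => θ p.1) * fun p : SpaceTime => ψ p.2) p (1, V p) = _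
    rw [d3]
    simp only [drift, add_apply, smul_apply, ContinuousLinearMap.comp_apply,
      ContinuousLinearMap.coe_fst', ContinuousLinearMap.coe_snd', smul_eq_mul,
      fderiv_eq_smul_deriv]
    ring
  simp_rw [hder] at h4
  obtain ⟨A, hA⟩ := hθ.continuous.bounded_above_of_compact_support hθc
  have i2 : Integrable (fun p : SpaceTime => θ p.1 * drift V ψ p) ρ :=
    (hf.integrable_drift hψ hψc).bdd_mul (hθ.continuous.comp continuous_fst).aestronglyMeasurable
      (Eventually.of_forall fun p => hA p.1)
  rwa [integral_add (integrable_mul (hθ.continuous_deriv (by simp)) hθc.deriv hψ.continuous hψc)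
    i2] at h4

theorem integrable_kernel_mul_drift (hf : IsFlow T D ρ V) (hh : IsTimeBump T h₀)
    (hψ : ContDiff ℝ ((⊤ : ℕ∞) : WithTop ℕ∞) ψ) (hψc : HasCompactSupport ψ) (t : ℝ) :
    Integrable (fun p : SpaceTime =>
      ((Iic p.1).indicator 1 t - ∫ r in Iic p.1, h₀ r) * drift V ψ p) ρ :=
  (hf.integrable_drift hψ hψc).bdd_mul
    (hh.measurable_kernel.comp (measurable_id.prodMk measurable_const)).aestronglyMeasurable
    (Eventually.of_forall fun p => hh.abs_kernel_le p.1 t)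

theorem integrable_kernel_prod (hf : IsFlow T D ρ V) (hh : IsTimeBump T h₀)
    (hψ : ContDiff ℝ ((⊤ : ℕ∞) : WithTop ℕ∞) ψ) (hψc : HasCompactSupport ψ) {h : ℝ → ℝ}
    (hi : Integrable h) : Integrable (fun q : SpaceTime × ℝ =>
      ((Iic q.1.1).indicator 1 q.2 - ∫ r in Iic q.1.1, h₀ r) * (drift V ψ q.1 * h q.2))
      (ρ.prod volume) :=
  ((hf.integrable_drift hψ hψc).mul_prod hi).bdd_mul hh.measurable_kernel.aestronglyMeasurable
    (Eventually.of_forall fun q => hh.abs_kernel_le q.1.1 q.2)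

theorem measurable_timeDensity (hf : IsFlow T D ρ V) (hh : IsTimeBump T h₀)
    (hψ : ContDiff ℝ ((⊤ : ℕ∞) : WithTop ℕ∞) ψ) : Measurable (timeDensity ρ V h₀ ψ) := by
  refine measurable_const.sub ?_
  have : StronglyMeasurable fun q : SpaceTime × ℝ =>
      ((Iic q.1.1).indicator (1 : ℝ → ℝ) q.2 - ∫ r in Iic q.1.1, h₀ r) * drift V ψ q.1 :=
    (hh.measurable_kernel.mul ((hf.measurable_drift hψ).comp measurable_fst)).stronglyMeasurable
  exact this.integral_prod_left'.measurable

theorem abs_timeDensity_le (hf : IsFlow T D ρ V) (hh : IsTimeBump T h₀)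
    (hψ : ContDiff ℝ ((⊤ : ℕ∞) : WithTop ℕ∞) ψ) (hψc : HasCompactSupport ψ) (t : ℝ) :
    |timeDensity ρ V h₀ ψ t| ≤ |∫ p, h₀ p.1 * ψ p.2 ∂ρ| + ∫ p, |drift V ψ p| ∂ρ := by
  refine (abs_sub _ _).trans (add_le_add le_rfl ?_)
  refine (norm_integral_le_integral_norm _).trans (integral_mono
    (hf.integrable_kernel_mul_drift hh hψ hψc t).norm (hf.integrable_drift hψ hψc).abs fun p => ?_)
  simp only [norm_mul, Real.norm_eq_abs]
  exact mul_le_of_le_one_left (abs_nonneg _) (hh.abs_kernel_le p.1 t)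

/-- Split `h = c * h₀ + g` with `c = ∫ h`, so that `g` has mean zero and a compactly supported
primitive. The continuity equation tested with this primitive times `ψ` expresses `∫ g ψ dρ` through
the drift. Fubini collects everything into one integral against `h`, and its other factor is
`timeDensity`. -/
theorem integral_mul_timeDensity (hf : IsFlow T D ρ V) (hh : IsTimeBump T h₀)
    (hψ : ContDiff ℝ ((⊤ : ℕ∞) : WithTop ℕ∞) ψ) (hψc : HasCompactSupport ψ) {h : ℝ → ℝ}
    (h1 : ContDiff ℝ ((⊤ : ℕ∞) : WithTop ℕ∞) h) (h2 : HasCompactSupport h)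
    (h3 : tsupport h ⊆ Ioo 0 T) :
    ∫ p, h p.1 * ψ p.2 ∂ρ = ∫ t, h t * timeDensity ρ V h₀ ψ t := by
  have hi : Integrable h := h1.continuous.integrable_of_hasCompactSupport h2
  set c := ∫ t, h t with hc
  set g : ℝ → ℝ := fun t => h t - c * h₀ t with hg
  have g1 : ContDiff ℝ ((⊤ : ℕ∞) : WithTop ℕ∞) g := h1.sub (contDiff_const.mul hh.smooth)
  have g2 : HasCompactSupport g := h2.sub (hh.compact.mul_left)
  have g3 : tsupport g ⊆ Ioo 0 T := by
    refine (tsupport_sub h (fun t => c * h₀ t)).trans (union_subset h3 ?_)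
    exact (tsupport_mul_subset_right).trans hh.tsupport_subset
  have g4 : ∫ t, g t = 0 := by
    rw [hg, integral_sub hi (hh.integrable.const_mul c), integral_const_mul, hh.integral_eq_one]
    simp [hc]
  obtain ⟨p1, p2, p3, p4⟩ := integral_Iic_of_hasCompactSupport g1 g2 g3 g4
  have key := hf.integral_product_test p1 p2 p3 hψ hψc
  simp_rw [p4] at key
  have e1 : ∫ p, g p.1 * ψ p.2 ∂ρ = ∫ p, h p.1 * ψ p.2 ∂ρ - c * ∫ p, h₀ p.1 * ψ p.2 ∂ρ := by
    rw [← integral_const_mul, ← integral_sub (integrable_mul h1.continuous h2 hψ.continuous hψc)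
      ((integrable_mul hh.smooth.continuous hh.compact hψ.continuous hψc).const_mul c)]
    refine integral_congr_ae (Eventually.of_forall fun p => ?_)
    simp only [hg]; ring
  have e2 : ∀ p : SpaceTime, (∫ t in Iic p.1, g t) * drift V ψ p =
      ∫ t, ((Iic p.1).indicator 1 t - ∫ r in Iic p.1, h₀ r) * (drift V ψ p * h t) := by
    intro p
    have i1 : Integrable fun t => (Iic p.1).indicator (1 : ℝ → ℝ) t * h t := by
      have := hi.indicator (measurableSet_Iic (a := p.1))
      refine this.congr (Eventually.of_forall fun t => ?_)
      by_cases ht : t ∈ Iic p.1 <;> simp [ht]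
    have : ∫ t, ((Iic p.1).indicator 1 t - ∫ r in Iic p.1, h₀ r) * (drift V ψ p * h t) =
        (∫ t, (Iic p.1).indicator (1 : ℝ → ℝ) t * h t - (∫ r in Iic p.1, h₀ r) * h t) *
          drift V ψ p := by
      rw [← integral_mul_const]
      refine integral_congr_ae (Eventually.of_forall fun t => ?_)
      ring
    rw [this, integral_sub i1 (hi.const_mul _), integral_const_mul, hg, integral_sub
      hi.integrableOn (hh.integrable.const_mul c).integrableOn, integral_const_mul]
    congr 1
    rw [mul_comm c]
    congr 1
    rw [← integral_indicator measurableSet_Iic]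
    refine integral_congr_ae (Eventually.of_forall fun t => ?_)
    by_cases ht : t ∈ Iic p.1 <;> simp [ht]
  have e3 : ∫ p, (∫ t in Iic p.1, g t) * drift V ψ p ∂ρ =
      ∫ t, h t * ∫ p, ((Iic p.1).indicator 1 t - ∫ r in Iic p.1, h₀ r) * drift V ψ p ∂ρ := by
    simp_rw [e2]
    rw [integral_integral_swap (hf.integrable_kernel_prod hh hψ hψc hi)]
    refine integral_congr_ae (Eventually.of_forall fun t => ?_)
    simp only
    rw [← integral_const_mul]
    refine integral_congr_ae (Eventually.of_forall fun p => ?_)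
    ring
  rw [e1, e3] at key
  have e4 : ∫ t, h t * timeDensity ρ V h₀ ψ t = c * ∫ p, h₀ p.1 * ψ p.2 ∂ρ -
      ∫ t, h t * ∫ p, ((Iic p.1).indicator 1 t - ∫ r in Iic p.1, h₀ r) * drift V ψ p ∂ρ := by
    simp only [timeDensity, mul_sub]
    rw [integral_sub (hi.mul_const _), integral_mul_const]
    have := (hf.integrable_kernel_prod hh hψ hψc hi).integral_prod_right
    refine this.congr (Eventually.of_forall fun t => ?_)
    simp only
    rw [← integral_const_mul]
    refine integral_congr_ae (Eventually.of_forall fun p => ?_)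
    ring
  rw [e4]
  linarith

end IsFlow
end

/-! ### Time marginals identified, with estimates in time and in the test function. -/

open scoped ENNReal NNReal

noncomputable section

namespace IsFlow

variable {T : ℝ} {D : Set E3} {ρ : Measure SpaceTime} [IsFiniteMeasure ρ] {V : SpaceTime → E3}
  {h₀ : ℝ → ℝ} {ψ : E3 → ℝ}

/-- Both densities have the same integrals against test functions on `(0, T)`, so they agree almost
everywhere there by the fundamental lemma of the calculus of variations. The end points are
negligible because the marginal is absolutely continuous. The right-hand side is thus a version of
the marginal density defined at every time. -/
theorem map_withDensity_eq (hf : IsFlow T D ρ V) (hh : IsTimeBump T h₀)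
    (hψ : ContDiff ℝ ((⊤ : ℕ∞) : WithTop ℕ∞) ψ) (hψc : HasCompactSupport ψ)
    (hψ0 : ∀ y, 0 ≤ ψ y) :
    (ρ.withDensity fun p => ENNReal.ofReal (ψ p.2)).map Prod.fst =
      (volume.restrict (Icc 0 T)).withDensity
        fun t => ENNReal.ofReal (timeDensity ρ V h₀ ψ t) := by
  obtain ⟨B, hB⟩ := hψ.continuous.bounded_above_of_compact_support hψc
  have hint : Integrable (fun p : SpaceTime => ψ p.2) ρ :=
    Integrable.of_bound (C := B) (hψ.continuous.comp continuous_snd).aestronglyMeasurable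
      (Eventually.of_forall fun p => hB p.2)
  have hmeas : Measurable fun p : SpaceTime => ENNReal.ofReal (ψ p.2) :=
    ENNReal.measurable_ofReal.comp (hψ.continuous.comp continuous_snd).measurable
  have : IsFiniteMeasure (ρ.withDensity fun p => ENNReal.ofReal (ψ p.2)) :=
    isFiniteMeasure_withDensity_ofReal hint.2
  set μ := (ρ.withDensity fun p => ENNReal.ofReal (ψ p.2)).map Prod.fst with hμ
  have hac : μ ≪ volume :=
    ((withDensity_absolutelyContinuous _ _).map measurable_fst).trans hf.marginal
  have hμi : ∀ g : ℝ → ℝ, Continuous g → ∫ t, g t ∂μ = ∫ p, g p.1 * ψ p.2 ∂ρ := by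
    intro g hg
    rw [hμ, integral_map measurable_fst.aemeasurable hg.aestronglyMeasurable,
      integral_withDensity_eq_integral_toReal_smul hmeas (Eventually.of_forall fun p => by simp)]
    refine integral_congr_ae (Eventually.of_forall fun p => ?_)
    simp only [smul_eq_mul, ENNReal.toReal_ofReal (hψ0 _)]
    ring
  set M := timeDensity ρ V h₀ ψ with hM
  have hMm : Measurable M := hf.measurable_timeDensity hh hψ
  have hMb := hf.abs_timeDensity_le hh hψ hψc
  have hr : Integrable (fun t => (μ.rnDeriv volume t).toReal) := Measure.integrable_toReal_rnDeriv
  have hMl : LocallyIntegrable M := by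
    refine (locallyIntegrable_const (|∫ p, h₀ p.1 * ψ p.2 ∂ρ| + ∫ p, |drift V ψ p| ∂ρ)).mono
      hMm.aestronglyMeasurable (Eventually.of_forall fun t => ?_)
    exact (hMb t).trans (le_abs_self _)
  have key := isOpen_Ioo.ae_eq_zero_of_integral_contDiff_smul_eq_zero (U := Ioo 0 T)
    (f := fun t => (μ.rnDeriv volume t).toReal - M t) (μ := volume)
    ((hr.locallyIntegrable.sub hMl).locallyIntegrableOn _) (fun g g1 g2 g3 => by
      have i1 : Integrable fun t => (μ.rnDeriv volume t).toReal • g t := by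
        obtain ⟨A, hA⟩ := g1.continuous.bounded_above_of_compact_support g2
        exact (hr.mul_bdd g1.continuous.aestronglyMeasurable
          (Eventually.of_forall hA))
      have i2 : Integrable fun t => g t * M t :=
        hMl.integrable_smul_left_of_hasCompactSupport g1.continuous g2
      have : ∀ t, g t • ((μ.rnDeriv volume t).toReal - M t) =
          (μ.rnDeriv volume t).toReal • g t - g t * M t := fun t => by
        simp only [smul_eq_mul]; ring
      simp_rw [this]
      rw [integral_sub i1 i2, integral_rnDeriv_smul hac, hμi g g1.continuous,
        hf.integral_mul_timeDensity hh hψ hψc g1 g2 g3, sub_self])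
  have hIcc : μ (Icc 0 T)ᶜ = 0 := by
    rw [hμ, Measure.map_apply measurable_fst measurableSet_Icc.compl]
    refine (withDensity_absolutelyContinuous _ _) ?_
    refine measure_mono_null (fun p hp => ?_) hf.carried
    exact fun h => hp h.1
  have e1 : μ = (volume.restrict (Icc 0 T)).withDensity (μ.rnDeriv volume) := by
    rw [← restrict_withDensity measurableSet_Icc, Measure.withDensity_rnDeriv_eq μ volume hac,
      Measure.restrict_eq_self_of_ae_mem]
    rw [ae_iff]; exact hIcc
  rw [e1]
  refine withDensity_congr_ae ?_
  rw [← restrict_Ioo_eq_restrict_Icc]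
  filter_upwards [ae_restrict_of_ae key, ae_restrict_mem measurableSet_Ioo,
    ae_restrict_of_ae (μ.rnDeriv_lt_top volume)] with t h1 h2 h3
  rw [← sub_eq_zero.1 (h1 h2), ENNReal.ofReal_toReal h3.ne]

theorem drift_eq_zero_of_eventually_const {p : SpaceTime} {c : ℝ}
    (h : ∀ᶠ y in 𝓝 p.2, ψ y = c) : drift V ψ p = 0 := by
  rw [drift, (show ψ =ᶠ[𝓝 p.2] fun _ => c from h).fderiv_eq]
  simp

/-- Conservation of mass: for a cut-off `ψ` equal to `1` near `D` the drift vanishes, so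
`timeDensity` does not depend on time. -/
theorem map_fst_eq (hf : IsFlow T D ρ V) (hT : 0 < T) (hD : Bornology.IsBounded D) :
    ρ.map Prod.fst = (ρ univ / ENNReal.ofReal T) • volume.restrict (Icc 0 T) := by
  obtain ⟨h₀, hh⟩ := exists_isTimeBump hT
  obtain ⟨R, hR0, hR⟩ := hD.subset_ball_lt 0 (0 : E3)
  let ψ : ContDiffBump (0 : E3) := ⟨R, R + 1, hR0, by linarith⟩
  have hcar : ∀ᵐ p ∂ρ, p.2 ∈ D := by
    rw [ae_iff]
    exact measure_mono_null (t := (Icc 0 T ×ˢ D)ᶜ) (fun p hp h => hp h.2) hf.carried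
  have h1 := hf.map_withDensity_eq hh ψ.contDiff ψ.hasCompactSupport fun y => ψ.nonneg
  have e1 : (ρ.withDensity fun p => ENNReal.ofReal (ψ p.2)) = ρ := by
    conv_rhs => rw [← withDensity_one (μ := ρ)]
    refine withDensity_congr_ae ?_
    filter_upwards [hcar] with p hp
    rw [ψ.one_of_mem_closedBall (Metric.ball_subset_closedBall (hR hp))]
    simp
  have e2 : ∀ t, timeDensity ρ V h₀ ψ t = ∫ p, h₀ p.1 * ψ p.2 ∂ρ := by
    intro t
    rw [timeDensity, sub_eq_self]
    refine integral_eq_zero_of_ae ?_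
    filter_upwards [hcar] with p hp
    rw [drift_eq_zero_of_eventually_const (c := 1), mul_zero]; · rfl
    filter_upwards [Metric.isOpen_ball.mem_nhds (hR hp)] with y hy
    exact ψ.one_of_mem_closedBall (Metric.ball_subset_closedBall hy)
  simp_rw [e1, e2] at h1
  rw [withDensity_const] at h1
  have h2 := congrArg (fun μ => μ univ) h1
  simp only [Measure.smul_apply, Measure.restrict_apply_univ, Real.volume_Icc, sub_zero,
    smul_eq_mul, Measure.map_apply measurable_fst MeasurableSet.univ, preimage_univ] at h2
  rw [h1, h2, ENNReal.mul_div_cancel_right (by simpa using hT) ENNReal.ofReal_ne_top]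

theorem measureReal_Ico_le (hf : IsFlow T D ρ V) (hT : 0 < T) (hD : Bornology.IsBounded D)
    {t t' : ℝ} (h : t ≤ t') :
    ρ.real (Prod.fst ⁻¹' Ico t t') ≤ ρ.real univ / T * (t' - t) := by
  have h1 := congrArg (fun μ => μ (Ico t t')) (hf.map_fst_eq hT hD)
  simp only [Measure.map_apply measurable_fst measurableSet_Ico, Measure.smul_apply] at h1
  have h2 : ρ (Prod.fst ⁻¹' Ico t t') ≤ ρ univ / ENNReal.ofReal T * ENNReal.ofReal (t' - t) := by
    rw [h1, smul_eq_mul, ← Real.volume_Ico]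
    gcongr
    exact Measure.restrict_le_self
  have h3 := ENNReal.toReal_mono (ENNReal.mul_ne_top (ENNReal.div_ne_top (measure_ne_top ρ _)
    (by simpa using hT)) ENNReal.ofReal_ne_top) h2
  rwa [ENNReal.toReal_mul, ENNReal.toReal_div, ENNReal.toReal_ofReal hT.le,
    ENNReal.toReal_ofReal (sub_nonneg.2 h)] at h3

theorem integral_norm_le (hf : IsFlow T D ρ V) :
    ∫ p, ‖V p‖ ∂ρ ≤ ρ.real univ + ∫ p, ‖V p‖ ^ 2 ∂ρ := by
  have := integral_mono hf.integrable_norm ((integrable_const (1 : ℝ)).add hf.integrable_sq)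
    fun p => by
      change ‖V p‖ ≤ 1 + ‖V p‖ ^ 2
      nlinarith [sq_nonneg (‖V p‖ - 1), norm_nonneg (V p)]
  refine this.trans (le_of_eq ?_)
  change ∫ p, ((1 : ℝ) + ‖V p‖ ^ 2) ∂ρ = _
  rw [integral_add (integrable_const _) hf.integrable_sq]
  simp

/-- The difference is the drift integrated over the strip `t ≤ p.1 < t'`. On the strip `‖V‖ ≤ κ⁻¹ +
κ * ‖V‖ ^ 2`, and the mass of the strip is proportional to `t' - t`. The free parameter `κ` replaces
Cauchy–Schwarz; optimizing it would give Hölder continuity of order `1 / 2`. -/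
theorem abs_timeDensity_sub_time_le (hf : IsFlow T D ρ V) (hh : IsTimeBump T h₀) (hT : 0 < T)
    (hD : Bornology.IsBounded D) (hψ : ContDiff ℝ ((⊤ : ℕ∞) : WithTop ℕ∞) ψ)
    (hψc : HasCompactSupport ψ) {L : ℝ} (hL : ∀ y, ‖fderiv ℝ ψ y‖ ≤ L) {κ : ℝ} (hκ : 0 < κ)
    {t t' : ℝ} (h : t ≤ t') :
    |timeDensity ρ V h₀ ψ t - timeDensity ρ V h₀ ψ t'| ≤
      L * (κ⁻¹ * (ρ.real univ / T * (t' - t)) + κ * ∫ p, ‖V p‖ ^ 2 ∂ρ) := by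
  have hL0 : 0 ≤ L := (norm_nonneg _).trans (hL 0)
  have e1 : timeDensity ρ V h₀ ψ t - timeDensity ρ V h₀ ψ t' =
      ∫ p, -((Prod.fst ⁻¹' Ico t t').indicator (drift V ψ) p) ∂ρ := by
    simp only [timeDensity]
    rw [sub_sub_sub_cancel_left, ← integral_sub (hf.integrable_kernel_mul_drift hh hψ hψc t')
      (hf.integrable_kernel_mul_drift hh hψ hψc t)]
    refine integral_congr_ae (Eventually.of_forall fun p => ?_)
    simp only [indicator, mem_Iic, mem_preimage, mem_Ico, Pi.one_apply]
    by_cases h1 : t ≤ p.1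
    · by_cases h2 : t' ≤ p.1
      · simp [h1, h2]
      · simp only [h1, h2, if_true, if_false, not_le.1 h2, and_self]
        ring
    · have h2 : ¬ t' ≤ p.1 := fun h3 => h1 (h.trans h3)
      simp [h1, h2]
  have hS : MeasurableSet (Prod.fst ⁻¹' Ico t t' : Set SpaceTime) :=
    measurable_fst measurableSet_Ico
  have i1 : Integrable ((Prod.fst ⁻¹' Ico t t' : Set SpaceTime).indicator fun _ => κ⁻¹) ρ :=
    (integrable_const _).indicator hS
  rw [e1]
  refine (abs_integral_le_integral_abs).trans ?_
  calc ∫ p, |-((Prod.fst ⁻¹' Ico t t').indicator (drift V ψ) p)| ∂ρ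
      ≤ ∫ p, L * ((Prod.fst ⁻¹' Ico t t' : Set SpaceTime).indicator (fun _ => κ⁻¹) p +
          κ * ‖V p‖ ^ 2) ∂ρ := by
        refine integral_mono ((hf.integrable_drift hψ hψc).indicator hS).neg.abs
          ((i1.add (hf.integrable_sq.const_mul κ)).const_mul L) fun p => ?_
        by_cases hp : p ∈ (Prod.fst ⁻¹' Ico t t' : Set SpaceTime)
        · simp only [indicator_of_mem hp, abs_neg]
          refine (abs_drift_le hL p).trans (mul_le_mul_of_nonneg_left ?_ hL0)
          have h3 : 0 ≤ κ⁻¹ * (1 - κ * ‖V p‖) ^ 2 := by positivity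
          have h4 : κ⁻¹ * (1 - κ * ‖V p‖) ^ 2 = κ⁻¹ + κ * ‖V p‖ ^ 2 - 2 * ‖V p‖ := by
            field_simp; ring
          have h5 := norm_nonneg (V p)
          linarith
        · simp only [indicator_of_notMem hp, abs_neg, abs_zero]
          positivity
    _ = L * (κ⁻¹ * ρ.real (Prod.fst ⁻¹' Ico t t') + κ * ∫ p, ‖V p‖ ^ 2 ∂ρ) := by
        rw [integral_const_mul, integral_add i1 (hf.integrable_sq.const_mul κ),
          integral_const_mul, integral_indicator_const _ hS, smul_eq_mul, mul_comm κ⁻¹]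
    _ ≤ _ := by
        gcongr
        exact hf.measureReal_Ico_le hT hD h

/-- `timeDensity` is linear in `ψ` and controlled by the `C¹` norm of `ψ`, the mass and the first
moment of the speed. It is used for translates of the positron kernel. -/
theorem abs_timeDensity_sub_le (hf : IsFlow T D ρ V) (hh : IsTimeBump T h₀) {ψ' : E3 → ℝ}
    (hψ : ContDiff ℝ ((⊤ : ℕ∞) : WithTop ℕ∞) ψ) (hψc : HasCompactSupport ψ)
    (hψ' : ContDiff ℝ ((⊤ : ℕ∞) : WithTop ℕ∞) ψ') (hψc' : HasCompactSupport ψ')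
    {H e₀ e₁ : ℝ} (hH : ∀ t, h₀ t ≤ H) (he₀ : ∀ y, |ψ y - ψ' y| ≤ e₀)
    (he₁ : ∀ y, ‖fderiv ℝ ψ y - fderiv ℝ ψ' y‖ ≤ e₁) (t : ℝ) :
    |timeDensity ρ V h₀ ψ t - timeDensity ρ V h₀ ψ' t| ≤
      H * e₀ * ρ.real univ + e₁ * ∫ p, ‖V p‖ ∂ρ := by
  have i1 := integrable_mul (ρ := ρ) hh.smooth.continuous hh.compact hψ.continuous hψc
  have i2 := integrable_mul (ρ := ρ) hh.smooth.continuous hh.compact hψ'.continuous hψc'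
  have e1 : timeDensity ρ V h₀ ψ t - timeDensity ρ V h₀ ψ' t =
      ∫ p, (h₀ p.1 * ψ p.2 - h₀ p.1 * ψ' p.2) ∂ρ -
      ∫ p, (((Iic p.1).indicator 1 t - ∫ r in Iic p.1, h₀ r) * drift V ψ p -
        ((Iic p.1).indicator 1 t - ∫ r in Iic p.1, h₀ r) * drift V ψ' p) ∂ρ := by
    rw [integral_sub i1 i2, integral_sub (hf.integrable_kernel_mul_drift hh hψ hψc t)
      (hf.integrable_kernel_mul_drift hh hψ' hψc' t)]
    simp only [timeDensity]
    ring
  rw [e1]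
  refine (abs_sub _ _).trans (add_le_add ?_ ?_)
  · rw [← Real.norm_eq_abs]
    refine (norm_integral_le_of_norm_le_const (μ := ρ) (C := H * e₀) (Eventually.of_forall fun p => ?_))
    rw [← mul_sub, norm_mul, Real.norm_eq_abs, Real.norm_eq_abs, abs_of_nonneg (hh.nonneg _)]
    exact mul_le_mul (hH _) (he₀ _) (abs_nonneg _) ((hh.nonneg p.1).trans (hH _))
  · rw [← integral_const_mul, ← Real.norm_eq_abs]
    refine norm_integral_le_of_norm_le (hf.integrable_norm.const_mul e₁)
      (Eventually.of_forall fun p => ?_)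
    rw [← mul_sub, norm_mul]
    refine (mul_le_of_le_one_left (norm_nonneg _) (hh.abs_kernel_le p.1 t)).trans ?_
    exact ((fderiv ℝ ψ p.2 - fderiv ℝ ψ' p.2).le_opNorm (V p)).trans (by gcongr; exact he₁ _)

end IsFlow

end

open scoped ENNReal NNReal

noncomputable section

/-! ### The density of the annihilation points -/

namespace PositronKernel

variable {δ : ℝ} (G : PositronKernel δ)

theorem hasCompactSupport : HasCompactSupport G.G :=
  HasCompactSupport.of_support_subset_isCompact (isCompact_closedBall (0 : E3) (δ / 2))
    ((subset_tsupport _).trans (G.tsupport_subset.trans Metric.ball_subset_closedBall))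

/-- The kernel reflected and translated by `x`. -/
def around (x y : E3) : ℝ := G.G (x - y)

theorem contDiff_around (x : E3) : ContDiff ℝ ((⊤ : ℕ∞) : WithTop ℕ∞) (G.around x) :=
  G.smooth.comp (contDiff_const.sub contDiff_id)

theorem hasCompactSupport_around (x : E3) : HasCompactSupport (G.around x) :=
  G.hasCompactSupport.comp_homeomorph (Homeomorph.subLeft x)

theorem fderiv_around (x y : E3) : fderiv ℝ (G.around x) y = -fderiv ℝ G.G (x - y) := by
  have h1 : HasFDerivAt G.G (fderiv ℝ G.G (x - y)) (x - y) :=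
    ((G.smooth.differentiable (by simp)).differentiableAt).hasFDerivAt
  have h2 : HasFDerivAt (fun y : E3 => x - y) (-ContinuousLinearMap.id ℝ E3) y :=
    (hasFDerivAt_id y).const_sub x
  have h3 := (h1.comp y h2).fderiv
  change fderiv ℝ (G.G ∘ fun y => x - y) y = _
  rw [h3]
  ext v
  simp

theorem around_nonneg (x y : E3) : 0 ≤ G.around x y := G.nonneg _

theorem exists_bound : ∃ B, 0 ≤ B ∧ (∀ y, |G.G y| ≤ B) ∧ ∀ y, ‖fderiv ℝ G.G y‖ ≤ B := by
  obtain ⟨A, hA⟩ := G.smooth.continuous.bounded_above_of_compact_support G.hasCompactSupport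
  obtain ⟨L, hL⟩ := exists_bound_fderiv G.smooth G.hasCompactSupport
  exact ⟨max A L, ((norm_nonneg _).trans (hA 0)).trans (le_max_left _ _),
    fun y => (hA y).trans (le_max_left _ _), fun y => (hL y).trans (le_max_right _ _)⟩

theorem uniformContinuous : UniformContinuous G.G :=
  G.hasCompactSupport.uniformContinuous_of_continuous G.smooth.continuous

theorem uniformContinuous_fderiv : UniformContinuous (fderiv ℝ G.G) :=
  (G.hasCompactSupport.fderiv (𝕜 := ℝ)).uniformContinuous_of_continuous
    (G.smooth.continuous_fderiv (by simp))

theorem measurable_density : Measurable fun x => ENNReal.ofReal (G.G x) :=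
  ENNReal.measurable_ofReal.comp G.smooth.continuous.measurable

theorem isProbabilityMeasure_law : IsProbabilityMeasure G.law := by
  refine ⟨?_⟩
  rw [law, withDensity_apply _ MeasurableSet.univ, Measure.restrict_univ,
    ← ofReal_integral_eq_lintegral_ofReal
      (G.smooth.continuous.integrable_of_hasCompactSupport G.hasCompactSupport)
      (Eventually.of_forall G.nonneg), G.integral_eq_one, ENNReal.ofReal_one]

theorem law_compl_ball : G.law (Metric.ball 0 (δ / 2))ᶜ = 0 := by
  rw [law, withDensity_apply _ Metric.isOpen_ball.measurableSet.compl,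
    setLIntegral_congr_fun (g := fun _ => 0) Metric.isOpen_ball.measurableSet.compl fun x hx => ?_]
  · simp
  · simp only
    rw [image_eq_zero_of_notMem_tsupport fun h => hx (G.tsupport_subset h), ENNReal.ofReal_zero]

end PositronKernel

/-- The density of the annihilation points of a flow. -/
def annihilationDensity (ρ : Measure SpaceTime) (V : SpaceTime → E3) (h₀ : ℝ → ℝ) {δ : ℝ}
    (G : PositronKernel δ) (t : ℝ) (x : E3) : ℝ :=
  timeDensity ρ V h₀ (G.around x) t

/-- The sum of mass and kinetic energy. -/
def massEnergy (ρ : Measure SpaceTime) (V : SpaceTime → E3) : ℝ :=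
  ρ.real univ + ∫ p, ‖V p‖ ^ 2 ∂ρ

theorem massEnergy_nonneg (ρ : Measure SpaceTime) (V : SpaceTime → E3) : 0 ≤ massEnergy ρ V :=
  add_nonneg measureReal_nonneg (integral_nonneg fun p => by positivity)

theorem measureReal_le_massEnergy (ρ : Measure SpaceTime) (V : SpaceTime → E3) :
    ρ.real univ ≤ massEnergy ρ V :=
  le_add_of_nonneg_right (integral_nonneg fun p => by positivity)

theorem energy_le_massEnergy (ρ : Measure SpaceTime) (V : SpaceTime → E3) :
    ∫ p, ‖V p‖ ^ 2 ∂ρ ≤ massEnergy ρ V :=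
  le_add_of_nonneg_left measureReal_nonneg

section

variable {T δ : ℝ} {D : Set E3} {h₀ : ℝ → ℝ}

theorem IsTimeBump.exists_bound (hh : IsTimeBump T h₀) : ∃ H, 0 ≤ H ∧ ∀ t, h₀ t ≤ H := by
  obtain ⟨H, hH⟩ := hh.smooth.continuous.bounded_above_of_compact_support hh.compact
  exact ⟨H, (norm_nonneg _).trans (hH 0), fun t => (le_abs_self _).trans (hH t)⟩

theorem exists_abs_annihilationDensity_le (hh : IsTimeBump T h₀) (G : PositronKernel δ) :
    ∃ C, 0 ≤ C ∧ ∀ (ρ : Measure SpaceTime) [IsFiniteMeasure ρ] (V : SpaceTime → E3),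
      IsFlow T D ρ V → ∀ t x, |annihilationDensity ρ V h₀ G t x| ≤ C * massEnergy ρ V := by
  obtain ⟨B, hB0, hB, hB'⟩ := G.exists_bound
  obtain ⟨H, hH0, hH⟩ := hh.exists_bound
  refine ⟨H * B + B, by positivity, fun ρ _ V hf t x => ?_⟩
  have h0 : timeDensity ρ V h₀ (fun _ => 0) t = 0 := by
    simp [timeDensity, drift]
  have h1 := hf.abs_timeDensity_sub_le hh (G.contDiff_around x) (G.hasCompactSupport_around x)
    (ψ' := fun _ => 0) contDiff_const HasCompactSupport.zero hH (e₀ := B) (e₁ := B)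
    (fun y => by simpa [PositronKernel.around] using hB (x - y)) (fun y => by simpa [G.fderiv_around] using hB' _) t
  rw [h0, sub_zero] at h1
  refine h1.trans ?_
  have h2 := hf.integral_norm_le
  have h3 := measureReal_le_massEnergy ρ V
  calc H * B * ρ.real univ + B * ∫ p, ‖V p‖ ∂ρ
      ≤ H * B * massEnergy ρ V + B * massEnergy ρ V := by gcongr; exact h2
    _ = _ := by ring

/-- The modulus depends on the flow only through the bound `A` on mass plus energy, which is the
equicontinuity behind the convergence of the logarithmic term. In space it comes from uniform
continuity of the kernel and its derivative, in time from `abs_timeDensity_sub_time_le`. -/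
theorem exists_modulus_annihilationDensity (hT : 0 < T) (hD : Bornology.IsBounded D)
    (hh : IsTimeBump T h₀) (G : PositronKernel δ) (A : ℝ) {ε : ℝ} (hε : 0 < ε) :
    ∃ d > 0, ∀ (ρ : Measure SpaceTime) [IsFiniteMeasure ρ] (V : SpaceTime → E3),
      IsFlow T D ρ V → massEnergy ρ V ≤ A → ∀ t t' x x', |t - t'| < d → ‖x - x'‖ < d →
        |annihilationDensity ρ V h₀ G t x - annihilationDensity ρ V h₀ G t' x'| ≤ ε := by
  wlog hA : 0 < A generalizing A
  · obtain ⟨d, hd, h⟩ := this 1 one_pos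
    exact ⟨d, hd, fun ρ _ V hf hm => h ρ V hf (hm.trans ((not_lt.1 hA).trans zero_le_one))⟩
  obtain ⟨B, hB0, hB, hB'⟩ := G.exists_bound
  obtain ⟨H, hH0, hH⟩ := hh.exists_bound
  have hBp : 0 < B + 1 := by positivity
  -- The choices make `(H + 1) * e * A = ε / 2` for the spatial error, and for the temporal error `ε
  -- / 4` from the energy term (through `κ`) and `ε / 4` from the strip term (through `d₃`).
  set κ := ε / (4 * (B + 1) * A) with hκ
  have hκ0 : 0 < κ := by positivity
  set e := ε / (2 * (H + 1) * A) with he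
  have he0 : 0 < e := by positivity
  obtain ⟨d₁, hd₁, hG₁⟩ := Metric.uniformContinuous_iff.1 G.uniformContinuous e he0
  obtain ⟨d₂, hd₂, hG₂⟩ := Metric.uniformContinuous_iff.1 G.uniformContinuous_fderiv e he0
  set d₃ := ε * κ * T / (4 * (B + 1) * A) with hd₃
  have hd₃0 : 0 < d₃ := by positivity
  refine ⟨min d₁ (min d₂ d₃), lt_min hd₁ (lt_min hd₂ hd₃0), fun ρ _ V hf hm t t' x x' ht hx => ?_⟩
  have hx1 : ‖x - x'‖ < d₁ := hx.trans_le (min_le_left _ _)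
  have hx2 : ‖x - x'‖ < d₂ := hx.trans_le ((min_le_right _ _).trans (min_le_left _ _))
  have ht3 : |t - t'| ≤ d₃ := ht.le.trans ((min_le_right _ _).trans (min_le_right _ _))
  have hmm := measureReal_le_massEnergy ρ V
  have hme := energy_le_massEnergy ρ V
  have hmn := hf.integral_norm_le
  have hm0 : 0 ≤ ρ.real univ := measureReal_nonneg
  have p1 : |annihilationDensity ρ V h₀ G t x - annihilationDensity ρ V h₀ G t x'| ≤ ε / 2 := by
    refine (hf.abs_timeDensity_sub_le hh (G.contDiff_around x) (G.hasCompactSupport_around x)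
      (G.contDiff_around x') (G.hasCompactSupport_around x') hH (e₀ := e) (e₁ := e)
      (fun y => (hG₁ ?_).le) (fun y => ?_) t).trans ?_
    · rwa [dist_eq_norm, sub_sub_sub_cancel_right]
    · rw [G.fderiv_around, G.fderiv_around, ← norm_neg, neg_sub, sub_neg_eq_add, neg_add_eq_sub,
        ← dist_eq_norm]
      refine (hG₂ ?_).le
      rwa [dist_eq_norm, sub_sub_sub_cancel_right]
    · calc H * e * ρ.real univ + e * ∫ p, ‖V p‖ ∂ρ ≤ H * e * A + e * A := by
            gcongr
            · exact hmm.trans hm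
            · exact hmn.trans hm
        _ = ε / 2 := by rw [he]; field_simp
  have p2 : ∀ s s', s ≤ s' → s' - s ≤ d₃ →
      |annihilationDensity ρ V h₀ G s x' - annihilationDensity ρ V h₀ G s' x'| ≤ ε / 2 := by
    intro s s' hs hs'
    refine (hf.abs_timeDensity_sub_time_le hh hT hD (G.contDiff_around x')
      (G.hasCompactSupport_around x') (L := B + 1) (fun y => ?_) hκ0 hs).trans ?_
    · rw [G.fderiv_around, norm_neg]
      exact (hB' _).trans (by linarith)
    · calc (B + 1) * (κ⁻¹ * (ρ.real univ / T * (s' - s)) + κ * ∫ p, ‖V p‖ ^ 2 ∂ρ)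
          ≤ (B + 1) * (κ⁻¹ * (A / T * d₃) + κ * A) := by
            gcongr
            · exact hmm.trans hm
            · exact hme.trans hm
        _ = ε / 2 := by rw [hd₃, hκ]; field_simp; norm_num
  have p3 : |annihilationDensity ρ V h₀ G t x' - annihilationDensity ρ V h₀ G t' x'| ≤ ε / 2 := by
    rcases le_total t t' with h | h
    · exact p2 t t' h (by rwa [abs_sub_comm, abs_of_nonneg (sub_nonneg.2 h)] at ht3)
    · rw [abs_sub_comm]
      exact p2 t' t h (by rwa [abs_of_nonneg (sub_nonneg.2 h)] at ht3)
  calc _ ≤ _ := abs_sub_le _ (annihilationDensity ρ V h₀ G t x') _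
    _ ≤ ε / 2 + ε / 2 := add_le_add p1 p3
    _ = ε := by ring

end

namespace IsFlow

variable {T δ : ℝ} {D : Set E3} {ρ : Measure SpaceTime} [IsFiniteMeasure ρ] {V : SpaceTime → E3}
  {h₀ : ℝ → ℝ}

theorem continuous_annihilationDensity (hf : IsFlow T D ρ V) (hT : 0 < T)
    (hD : Bornology.IsBounded D) (hh : IsTimeBump T h₀) (G : PositronKernel δ) :
    Continuous fun q : SpaceTime => annihilationDensity ρ V h₀ G q.1 q.2 := by
  refine Metric.continuous_iff.2 fun q ε hε => ?_
  obtain ⟨d, hd, h⟩ := exists_modulus_annihilationDensity hT hD hh G (massEnergy ρ V)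
    (half_pos hε)
  refine ⟨d, hd, fun q' hq' => ?_⟩
  have hq : dist q'.1 q.1 < d ∧ dist q'.2 q.2 < d := by
    rw [Prod.dist_eq] at hq'
    exact max_lt_iff.1 hq'
  rw [Real.dist_eq]
  refine (h ρ V hf le_rfl _ _ _ _ (by simpa [Real.dist_eq] using hq.1)
    (by simpa [dist_eq_norm] using hq.2)).trans_lt (half_lt_self hε)

/-- The kernel is supported in the open ball of radius `δ / 2`, so `G.around x` vanishes in a
neighbourhood of each point of `D`, and its derivative vanishes with it. The conclusion holds at
every `x` at this distance, not only almost everywhere. -/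
theorem annihilationDensity_eq_zero (hf : IsFlow T D ρ V) (G : PositronKernel δ) {x : E3}
    (hx : ∀ y ∈ D, δ / 2 ≤ dist x y) (t : ℝ) : annihilationDensity ρ V h₀ G t x = 0 := by
  have hcar : ∀ᵐ p ∂ρ, p.2 ∈ D := by
    rw [ae_iff]
    exact measure_mono_null (t := (Icc 0 T ×ˢ D)ᶜ) (fun p hp h => hp h.2) hf.carried
  have hz : ∀ y ∈ D, ∀ᶠ z in 𝓝 y, G.around x z = 0 := by
    intro y hy
    have h1 : x - y ∉ tsupport G.G := fun h => by
      have := G.tsupport_subset h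
      rw [mem_ball_zero_iff, ← dist_eq_norm] at this
      exact absurd (hx y hy) (not_le.2 this)
    have h2 : ∀ᶠ w in 𝓝 (x - y), G.G w = 0 := by
      filter_upwards [(isClosed_tsupport _).isOpen_compl.mem_nhds h1] with w hw
      exact image_eq_zero_of_notMem_tsupport hw
    exact (continuous_const.sub continuous_id).continuousAt.eventually h2
  rw [annihilationDensity, timeDensity]
  have e1 : ∫ p, h₀ p.1 * G.around x p.2 ∂ρ = 0 := by
    refine integral_eq_zero_of_ae ?_
    filter_upwards [hcar] with p hp
    rw [(hz _ hp).self_of_nhds, mul_zero]; rfl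
  have e2 : ∫ p, ((Iic p.1).indicator 1 t - ∫ r in Iic p.1, h₀ r) * drift V (G.around x) p ∂ρ
      = 0 := by
    refine integral_eq_zero_of_ae ?_
    filter_upwards [hcar] with p hp
    rw [drift_eq_zero_of_eventually_const (hz _ hp), mul_zero]; rfl
  rw [e1, e2, sub_zero]

/-- For fixed `x` the annihilations at `x` have as time marginal that of `G (x - ·) ρ`, which
`map_withDensity_eq` identifies; Fubini assembles the points `x`. -/
theorem positronRange_eq (hf : IsFlow T D ρ V) (hT : 0 < T) (hD : Bornology.IsBounded D)
    (hh : IsTimeBump T h₀) (G : PositronKernel δ) :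
    positronRange G.law ρ = ((volume.restrict (Icc 0 T)).prod volume).withDensity
      fun q => ENNReal.ofReal (annihilationDensity ρ V h₀ G q.1 q.2) := by
  have := G.isProbabilityMeasure_law
  have hFm : Measurable fun q : SpaceTime =>
      ENNReal.ofReal (annihilationDensity ρ V h₀ G q.1 q.2) :=
    ENNReal.measurable_ofReal.comp (hf.continuous_annihilationDensity hT hD hh G).measurable
  have hGm := G.measurable_density
  refine Measure.ext_of_lintegral _ fun φ hφ => ?_
  rw [positronRange, lintegral_map hφ (by fun_prop), lintegral_prod _ (by fun_prop),
    lintegral_withDensity_eq_lintegral_mul _ hFm hφ, lintegral_prod_symm _ (by fun_prop)]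
  have e1 : ∀ p : SpaceTime, ∫⁻ z, φ (p.1, p.2 + z) ∂G.law =
      ∫⁻ x, ENNReal.ofReal (G.around x p.2) * φ (p.1, x) := by
    intro p
    rw [PositronKernel.law, lintegral_withDensity_eq_lintegral_mul _ hGm (by fun_prop),
      ← lintegral_sub_right_eq_self _ p.2]
    refine lintegral_congr fun x => ?_
    simp [PositronKernel.around]
  simp only [e1]
  have hm : Measurable fun q : SpaceTime × E3 =>
      ENNReal.ofReal (G.around q.2 q.1.2) * φ (q.1.1, q.2) := by
    refine Measurable.mul (hGm.comp (by fun_prop)) (by fun_prop)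
  rw [lintegral_lintegral_swap hm.aemeasurable]
  refine lintegral_congr fun x => ?_
  have h1 := hf.map_withDensity_eq hh (G.contDiff_around x) (G.hasCompactSupport_around x)
    (G.around_nonneg x)
  have hG' : Measurable fun p : SpaceTime => ENNReal.ofReal (G.around x p.2) :=
    hGm.comp (by fun_prop)
  have hM : Measurable fun t => ENNReal.ofReal (timeDensity ρ V h₀ (G.around x) t) :=
    ENNReal.measurable_ofReal.comp (hf.measurable_timeDensity hh (G.contDiff_around x))
  have h2 := congrArg (fun μ => ∫⁻ t, φ (t, x) ∂μ) h1
  rw [lintegral_map (by fun_prop) measurable_fst,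
    lintegral_withDensity_eq_lintegral_mul _ hG' (by fun_prop),
    lintegral_withDensity_eq_lintegral_mul _ hM (by fun_prop)] at h2
  exact h2

end IsFlow

end

open scoped ENNReal NNReal Pointwise

noncomputable section

/-! ### The detection operator -/

namespace Scanner

variable (sc : Scanner)

/-- The ball of radius `δ` around `x` misses the boundary and is connected. Its centre is interior,
hence so is the whole ball. -/
theorem add_mem_interior {x z : E3} (hx : x ∈ sc.D) (hz : ‖z‖ < sc.δ) :
    x + z ∈ interior sc.K := by
  have hxi : x ∈ interior sc.K := by
    by_contra hn
    have : x ∈ frontier sc.K := ⟨subset_closure (sc.D_subset_K hx), hn⟩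
    have h1 := sc.δ_le_dist x hx x this
    rw [dist_self] at h1
    exact absurd sc.δ_pos (not_lt.2 h1)
  have hsub : Metric.ball x sc.δ ⊆ interior sc.K ∪ sc.Kᶜ := by
    intro y hy
    by_contra hn
    have hyK : y ∈ sc.K := by
      by_contra h
      exact hn (Or.inr h)
    have : y ∈ frontier sc.K := ⟨subset_closure hyK, fun h => hn (Or.inl h)⟩
    have h1 := sc.δ_le_dist x hx y this
    rw [dist_comm] at h1
    exact absurd (Metric.mem_ball.1 hy) (not_lt.2 h1)
  refine (convex_ball x sc.δ).isPreconnected.subset_left_of_subset_union isOpen_interior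
    sc.isCompact_K.isClosed.isOpen_compl
    (disjoint_compl_right.mono_left interior_subset) hsub
    ⟨x, Metric.mem_ball_self sc.δ_pos, hxi⟩ ?_
  simpa [Metric.mem_ball] using hz

theorem mem_interior {x : E3} (hx : x ∈ sc.D) : x ∈ interior sc.K := by
  simpa using sc.add_mem_interior hx (z := 0) (by simpa using sc.δ_pos)

theorem body : SmoothBody sc.K :=
  ⟨sc.isCompact_K, sc.convex_K, sc.smooth_K,
    sc.nonempty_D.imp fun _ hx => sc.mem_interior hx⟩

end Scanner

instance : IsProbabilityMeasure uniformSphere :=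
  ⟨by rw [uniformSphere, Measure.smul_apply, smul_eq_mul, ENNReal.inv_mul_cancel]
      · rw [Ne, Measure.measure_univ_eq_zero]
        exact Measure.toSphere_ne_zero _
      · exact measure_ne_top _ _⟩

theorem toSphere_map_neg :
    ((volume : Measure E3).toSphere.map fun ω : Metric.sphere (0 : E3) 1 => -ω) =
      (volume : Measure E3).toSphere := by
  ext s hs
  have hm : Measurable fun ω : Metric.sphere (0 : E3) 1 => -ω := continuous_neg.measurable
  rw [Measure.map_apply hm hs, Measure.toSphere_apply' _ (hm hs), Measure.toSphere_apply' _ hs]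
  congr 1
  rw [← Measure.measure_neg]
  congr 1
  have : (Subtype.val '' ((fun ω : Metric.sphere (0 : E3) 1 => -ω) ⁻¹' s) : Set E3) =
      -(Subtype.val '' s) := by
    ext x
    constructor
    · rintro ⟨ω, hω, rfl⟩
      exact ⟨-ω, hω, rfl⟩
    · rintro ⟨ω, hω, h⟩
      refine ⟨-ω, by simpa using hω, ?_⟩
      rw [show ((-ω : Metric.sphere (0 : E3) 1) : E3) = -(ω : E3) from rfl, h, neg_neg]
  rw [this, Set.smul_neg, neg_neg]

/-- The detection event of a photon pair which is emitted in direction `ω` after a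
displacement. -/
def photonEvent (K : Set E3) (p : (SpaceTime × E3) × Metric.sphere (0 : E3) 1) : Event :=
  (p.1.1.1, detectionPoints K (p.1.1.2 + p.1.2) p.2)

/-- The intensity of scatterless detections. -/
def detected (K : Set E3) (γ : Measure E3) (ρ : Measure SpaceTime) : Measure Event :=
  detectPairs K (emissionLines (positronRange γ ρ))

theorem SmoothBody.continuousOn_detectionPoints {K : Set E3} (hK : SmoothBody K) :
    ContinuousOn (fun p : E3 × E3 => detectionPoints K p.1 p.2)
      {p | p.1 ∈ interior K ∧ p.2 ≠ 0} := by
  have h1 : ContinuousOn (fun p : E3 × E3 => exitPoint K p.1 (-p.2))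
      {p | p.1 ∈ interior K ∧ p.2 ≠ 0} :=
    hK.continuousOn_exitPoint.comp (f := fun p : E3 × E3 => (p.1, -p.2)) (by fun_prop)
      fun p hp => entersInterior_of_mem_interior hp.1 (neg_ne_zero.2 hp.2)
  have h2 : ContinuousOn (fun p : E3 × E3 => exitPoint K p.1 p.2)
      {p | p.1 ∈ interior K ∧ p.2 ≠ 0} :=
    hK.continuousOn_exitPoint.mono fun p hp => entersInterior_of_mem_interior hp.1 hp.2
  refine (h1.prodMk h2).congr fun p _ => ?_
  exact Prod.ext (detectionPoints_fst K _ _) rfl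

theorem sphere_ne_zero (ω : Metric.sphere (0 : E3) 1) : (ω : E3) ≠ 0 := by
  intro h
  have := norm_eq_of_mem_sphere ω
  rw [h, norm_zero] at this
  exact zero_ne_one this

theorem SmoothBody.continuousOn_photonEvent {K : Set E3} (hK : SmoothBody K) :
    ContinuousOn (photonEvent K) {p | p.1.1.2 + p.1.2 ∈ interior K} := by
  refine ContinuousOn.prodMk (by fun_prop) ?_
  exact hK.continuousOn_detectionPoints.comp
    (f := fun p : (SpaceTime × E3) × Metric.sphere (0 : E3) 1 => (p.1.1.2 + p.1.2, (p.2 : E3)))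
    (by fun_prop) fun p hp => ⟨hp, sphere_ne_zero _⟩

theorem isOpen_emissionDomain (K : Set E3) :
    IsOpen {p : (SpaceTime × E3) × Metric.sphere (0 : E3) 1 | p.1.1.2 + p.1.2 ∈ interior K} :=
  isOpen_interior.preimage (by fun_prop)

namespace Scanner

variable (sc : Scanner) {γ : Measure E3} [IsProbabilityMeasure γ] {ρ : Measure SpaceTime}
  [IsFiniteMeasure ρ]

theorem ae_mem_interior (hγ : γ (Metric.ball 0 (sc.δ / 2))ᶜ = 0)
    (hρ : ρ (Icc 0 sc.T ×ˢ sc.D)ᶜ = 0) :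
    ∀ᵐ p ∂ρ.prod γ, p.1.2 + p.2 ∈ interior sc.K := by
  have hm : MeasurableSet {p : SpaceTime × E3 | p.1.2 + p.2 ∈ interior sc.K} :=
    (isOpen_interior.preimage (by fun_prop)).measurableSet
  have h1 : ∀ᵐ p ∂ρ, p ∈ Icc 0 sc.T ×ˢ sc.D := by rw [ae_iff]; exact hρ
  have h2 : ∀ᵐ z ∂γ, z ∈ Metric.ball (0 : E3) (sc.δ / 2) := by rw [ae_iff]; exact hγ
  refine (Measure.ae_prod_mem_iff_ae_ae_mem hm).2 ?_
  filter_upwards [h1] with p hp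
  filter_upwards [h2] with z hz
  refine sc.add_mem_interior hp.2 ?_
  have := sc.δ_pos
  rw [mem_ball_zero_iff] at hz
  linarith

/-- The detection map is shown to be continuous only over interior emission points. These carry the
whole measure, because displacements are shorter than `δ / 2`, and this gives almost everywhere
measurability. -/
theorem ae_mem_emissionDomain (hγ : γ (Metric.ball 0 (sc.δ / 2))ᶜ = 0)
    (hρ : ρ (Icc 0 sc.T ×ˢ sc.D)ᶜ = 0) :
    ∀ᵐ p ∂(ρ.prod γ).prod uniformSphere, p.1.1.2 + p.1.2 ∈ interior sc.K :=
  (Measure.ae_prod_mem_iff_ae_ae_mem (isOpen_emissionDomain sc.K).measurableSet).2 (by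
    filter_upwards [sc.ae_mem_interior hγ hρ] with p hp using Eventually.of_forall fun _ => hp)

theorem aemeasurable_photonEvent (hγ : γ (Metric.ball 0 (sc.δ / 2))ᶜ = 0)
    (hρ : ρ (Icc 0 sc.T ×ˢ sc.D)ᶜ = 0) :
    AEMeasurable (photonEvent sc.K) ((ρ.prod γ).prod uniformSphere) := by
  rw [← Measure.restrict_eq_self_of_ae_mem (sc.ae_mem_emissionDomain hγ hρ)]
  exact sc.body.continuousOn_photonEvent.aemeasurable (isOpen_emissionDomain sc.K).measurableSet

theorem detected_eq (hγ : γ (Metric.ball 0 (sc.δ / 2))ᶜ = 0)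
    (hρ : ρ (Icc 0 sc.T ×ˢ sc.D)ᶜ = 0) :
    detected sc.K γ ρ = ((ρ.prod γ).prod uniformSphere).map (photonEvent sc.K) := by
  have hm1 : Measurable fun p : SpaceTime × E3 => (p.1.1, p.1.2 + p.2) := by fun_prop
  have e1 : emissionLines (positronRange γ ρ) = ((ρ.prod γ).prod uniformSphere).map
      (Prod.map (fun p : SpaceTime × E3 => (p.1.1, p.1.2 + p.2)) id) := by
    rw [emissionLines, positronRange, ← Measure.map_prod_map _ _ hm1 measurable_id, Measure.map_id]
  rw [detected, detectPairs, e1, AEMeasurable.map_map_of_aemeasurable]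
  · rfl
  · rw [← e1]
    have hdom : MeasurableSet {p : SpaceTime × Metric.sphere (0 : E3) 1 |
        p.1.2 ∈ interior sc.K} := (isOpen_interior.preimage (by fun_prop)).measurableSet
    have hae : ∀ᵐ p ∂emissionLines (positronRange γ ρ), p.1.2 ∈ interior sc.K := by
      rw [e1]
      refine (ae_map_iff (hm1.prodMap measurable_id).aemeasurable hdom).2 ?_
      exact sc.ae_mem_emissionDomain hγ hρ
    rw [← Measure.restrict_eq_self_of_ae_mem hae]
    refine ContinuousOn.aemeasurable (ContinuousOn.prodMk (by fun_prop) ?_) hdom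
    exact sc.body.continuousOn_detectionPoints.comp
      (f := fun p : SpaceTime × Metric.sphere (0 : E3) 1 => (p.1.2, (p.2 : E3)))
      (by fun_prop) fun p hp => ⟨hp, sphere_ne_zero _⟩
  · exact (hm1.prodMap measurable_id).aemeasurable

theorem detected_univ (hγ : γ (Metric.ball 0 (sc.δ / 2))ᶜ = 0)
    (hρ : ρ (Icc 0 sc.T ×ˢ sc.D)ᶜ = 0) : detected sc.K γ ρ univ = ρ univ := by
  rw [sc.detected_eq hγ hρ, Measure.map_apply_of_aemeasurable (sc.aemeasurable_photonEvent hγ hρ)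
    .univ, preimage_univ, ← univ_prod_univ, Measure.prod_prod, ← univ_prod_univ, Measure.prod_prod,
    measure_univ (μ := γ), measure_univ (μ := uniformSphere), mul_one, mul_one]

theorem lintegral_detected (hγ : γ (Metric.ball 0 (sc.δ / 2))ᶜ = 0)
    (hρ : ρ (Icc 0 sc.T ×ˢ sc.D)ᶜ = 0) {φ : Event → ℝ≥0∞} (hφ : Measurable φ) :
    ∫⁻ e, φ e ∂detected sc.K γ ρ = ∫⁻ p, ∫⁻ ω : Metric.sphere (0 : E3) 1,
      φ (p.1.1, detectionPoints sc.K (p.1.2 + p.2) ω) ∂uniformSphere ∂ρ.prod γ := by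
  have hm := sc.aemeasurable_photonEvent hγ hρ
  rw [sc.detected_eq hγ hρ, lintegral_map' hφ.aemeasurable hm,
    lintegral_prod (fun p => φ (photonEvent sc.K p)) (hφ.comp_aemeasurable hm)]
  rfl

theorem aemeasurable_lintegral_detectionPoints {μ : Measure SpaceTime} [SFinite μ]
    (hae : ∀ᵐ q ∂μ, q.2 ∈ interior sc.K) {φ : Event → ℝ≥0∞} (hφ : Measurable φ)
    (τ : Measure (Metric.sphere (0 : E3) 1)) [SFinite τ] :
    AEMeasurable (fun q : SpaceTime => ∫⁻ ω : Metric.sphere (0 : E3) 1,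
      φ (q.1, detectionPoints sc.K q.2 ω) ∂τ) μ := by
  have hdom' : MeasurableSet {p : SpaceTime × Metric.sphere (0 : E3) 1 |
      p.1.2 ∈ interior sc.K} := (isOpen_interior.preimage (by fun_prop)).measurableSet
  have hae' : ∀ᵐ p ∂μ.prod τ, p.1.2 ∈ interior sc.K :=
    (Measure.ae_prod_mem_iff_ae_ae_mem hdom').2 (by
      filter_upwards [hae] with p hp using Eventually.of_forall fun _ => hp)
  refine AEMeasurable.lintegral_prod_right' (μ := μ) (ν := τ)
    (f := fun p : SpaceTime × Metric.sphere (0 : E3) 1 =>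
      φ (p.1.1, detectionPoints sc.K p.1.2 p.2)) ?_
  rw [← Measure.restrict_eq_self_of_ae_mem hae']
  refine hφ.comp_aemeasurable
    (ContinuousOn.aemeasurable (ContinuousOn.prodMk (by fun_prop) ?_) hdom')
  exact sc.body.continuousOn_detectionPoints.comp
    (f := fun p : SpaceTime × Metric.sphere (0 : E3) 1 => (p.1.2, (p.2 : E3)))
    (by fun_prop) fun p hp => ⟨hp, sphere_ne_zero _⟩

theorem ae_positronRange_mem_interior (hγ : γ (Metric.ball 0 (sc.δ / 2))ᶜ = 0)
    (hρ : ρ (Icc 0 sc.T ×ˢ sc.D)ᶜ = 0) :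
    ∀ᵐ q ∂positronRange γ ρ, q.2 ∈ interior sc.K :=
  (ae_map_iff (by fun_prop) (isOpen_interior.preimage (by fun_prop)).measurableSet).2
    (sc.ae_mem_interior hγ hρ)

theorem lintegral_detected_of_positronRange (hγ : γ (Metric.ball 0 (sc.δ / 2))ᶜ = 0)
    (hρ : ρ (Icc 0 sc.T ×ˢ sc.D)ᶜ = 0) {φ : Event → ℝ≥0∞} (hφ : Measurable φ) :
    ∫⁻ e, φ e ∂detected sc.K γ ρ = ∫⁻ q, ∫⁻ ω : Metric.sphere (0 : E3) 1,
      φ (q.1, detectionPoints sc.K q.2 ω) ∂uniformSphere ∂positronRange γ ρ := by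
  have hm1 : Measurable fun p : SpaceTime × E3 => (p.1.1, p.1.2 + p.2) := by fun_prop
  rw [sc.lintegral_detected hγ hρ hφ]
  have : IsFiniteMeasure (positronRange γ ρ) := by
    rw [positronRange]; infer_instance
  have hg := sc.aemeasurable_lintegral_detectionPoints (sc.ae_positronRange_mem_interior hγ hρ) hφ
    uniformSphere
  rw [positronRange] at hg ⊢
  rw [lintegral_map' hg hm1.aemeasurable]

theorem integral_detected (hγ : γ (Metric.ball 0 (sc.δ / 2))ᶜ = 0)
    (hρ : ρ (Icc 0 sc.T ×ˢ sc.D)ᶜ = 0) (φ : BoundedContinuousFunction Event ℝ) :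
    ∫ e, φ e ∂detected sc.K γ ρ =
      ∫ p, ∫ q, φ (photonEvent sc.K ((p, q.1), q.2)) ∂γ.prod uniformSphere ∂ρ := by
  have hm := sc.aemeasurable_photonEvent hγ hρ
  have hi : Integrable (fun p => φ (photonEvent sc.K p)) ((ρ.prod γ).prod uniformSphere) :=
    Integrable.of_bound (φ.continuous.measurable.comp_aemeasurable hm).aestronglyMeasurable ‖φ‖
      (Eventually.of_forall fun p => φ.norm_coe_le_norm _)
  have hp := measurePreserving_prodAssoc ρ γ uniformSphere
  rw [sc.detected_eq hγ hρ, integral_map hm φ.continuous.aestronglyMeasurable]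
  have h2 := hp.integral_comp' (f := MeasurableEquiv.prodAssoc)
    (fun p : SpaceTime × (E3 × Metric.sphere (0 : E3) 1) =>
      φ (photonEvent sc.K ((p.1, p.2.1), p.2.2)))
  have h3 := (hp.integrable_comp_emb MeasurableEquiv.prodAssoc.measurableEmbedding (g := fun p :
    SpaceTime × (E3 × Metric.sphere (0 : E3) 1) => φ (photonEvent sc.K ((p.1, p.2.1), p.2.2)))).1 hi
  rw [← integral_prod _ h3, ← h2]
  rfl

/-- Averaging a test function over displacements and directions yields, by dominated convergence, a
continuous function of the emission point. Weak convergence of `ρ` can be tested with it, which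
makes detection weakly continuous. -/
theorem continuousOn_emissionMean (hγ : γ (Metric.ball 0 (sc.δ / 2))ᶜ = 0)
    (φ : BoundedContinuousFunction Event ℝ) :
    ContinuousOn (fun p => ∫ q, φ (photonEvent sc.K ((p, q.1), q.2)) ∂γ.prod uniformSphere)
      (Icc 0 sc.T ×ˢ sc.D) := by
  have hz : ∀ᵐ q ∂γ.prod uniformSphere, q.1 ∈ Metric.ball (0 : E3) (sc.δ / 2) :=
    Measure.ae_prod_mem_iff_ae_ae_mem (s := {q : E3 × Metric.sphere (0 : E3) 1 |
      q.1 ∈ Metric.ball (0 : E3) (sc.δ / 2)}) (measurable_fst Metric.isOpen_ball.measurableSet)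
      |>.2 (by
        have h2 : ∀ᵐ z ∂γ, z ∈ Metric.ball (0 : E3) (sc.δ / 2) := by rw [ae_iff]; exact hγ
        filter_upwards [h2] with z hz using Eventually.of_forall fun _ => hz)
  have hδ := sc.δ_pos
  have hin : ∀ p ∈ Icc 0 sc.T ×ˢ sc.D, ∀ z ∈ Metric.ball (0 : E3) (sc.δ / 2),
      p.2 + z ∈ interior sc.K := fun p hp z hz => by
    rw [mem_ball_zero_iff] at hz
    exact sc.add_mem_interior hp.2 (by linarith)
  refine continuousOn_of_dominated (bound := fun _ => ‖φ‖) (fun p hp => ?_)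
    (fun p _ => Eventually.of_forall fun q => φ.norm_coe_le_norm _) (integrable_const _) ?_
  · have hc : ContinuousOn (fun q : E3 × Metric.sphere (0 : E3) 1 =>
        φ (photonEvent sc.K ((p, q.1), q.2))) {q | q.1 ∈ Metric.ball (0 : E3) (sc.δ / 2)} :=
      φ.continuous.comp_continuousOn (sc.body.continuousOn_photonEvent.comp
        (f := fun q : E3 × Metric.sphere (0 : E3) 1 => ((p, q.1), q.2)) (by fun_prop)
        fun q hq => hin p hp _ hq)
    have := (hc.aemeasurable (μ := γ.prod uniformSphere)
      (measurable_fst Metric.isOpen_ball.measurableSet)).aestronglyMeasurable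
    rwa [Measure.restrict_eq_self_of_ae_mem (s := {q : E3 × Metric.sphere (0 : E3) 1 |
      q.1 ∈ Metric.ball (0 : E3) (sc.δ / 2)}) hz] at this
  · filter_upwards [hz] with q hq
    exact φ.continuous.comp_continuousOn (sc.body.continuousOn_photonEvent.comp
      (f := fun p : SpaceTime => ((p, q.1), q.2)) (by fun_prop) fun p hp => hin p hp _ hq)

end Scanner

/-- Weak convergence of measures carried by a closed set can be tested with bounded functions
which are continuous on that set. -/
theorem tendsto_integral_of_continuousOn {X : Type*} [TopologicalSpace X] [NormalSpace X]
    [MeasurableSpace X] [OpensMeasurableSpace X] {ρ : ℕ → FiniteMeasure X} {ρ' : FiniteMeasure X}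
    (hlim : Tendsto ρ atTop (𝓝 ρ')) {s : Set X} (hs : IsClosed s)
    (hρ : ∀ n, (ρ n : Measure X) sᶜ = 0) (hρ' : (ρ' : Measure X) sᶜ = 0) {f : X → ℝ}
    (hf : ContinuousOn f s) {C : ℝ} (hC : ∀ x ∈ s, |f x| ≤ C) :
    Tendsto (fun n => ∫ x, f x ∂(ρ n : Measure X)) atTop (𝓝 (∫ x, f x ∂(ρ' : Measure X))) := by
  let g : BoundedContinuousFunction s ℝ :=
    BoundedContinuousFunction.ofNormedAddCommGroup (s.domRestrict f)
      (continuousOn_iff_continuous_domRestrict.1 hf) C fun x => hC x x.2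
  obtain ⟨h, -, hh⟩ := BoundedContinuousFunction.exists_norm_eq_domRestrict_eq_of_closed g hs
  have heq : ∀ x ∈ s, h x = f x := fun x hx => DFunLike.congr_fun hh (⟨x, hx⟩ : s)
  have hint : ∀ μ : Measure X, μ sᶜ = 0 → ∫ x, h x ∂μ = ∫ x, f x ∂μ := fun μ hμ => by
    have : ∀ᵐ x ∂μ, x ∈ s := by rw [ae_iff]; exact hμ
    refine integral_congr_ae ?_
    filter_upwards [this] with x hx using heq x hx
  have := FiniteMeasure.tendsto_iff_forall_integral_tendsto.1 hlim h
  simpa only [hint _ (hρ _), hint _ hρ'] using this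

namespace Scanner

variable (sc : Scanner) {γ : Measure E3} [IsProbabilityMeasure γ]

theorem tendsto_integral_detected (hγ : γ (Metric.ball 0 (sc.δ / 2))ᶜ = 0)
    {ρ : ℕ → FiniteMeasure SpaceTime} {ρ' : FiniteMeasure SpaceTime}
    (hlim : Tendsto ρ atTop (𝓝 ρ'))
    (hρ : ∀ n, (ρ n : Measure SpaceTime) (Icc 0 sc.T ×ˢ sc.D)ᶜ = 0)
    (hρ' : (ρ' : Measure SpaceTime) (Icc 0 sc.T ×ˢ sc.D)ᶜ = 0)
    (φ : BoundedContinuousFunction Event ℝ) :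
    Tendsto (fun n => ∫ e, φ e ∂detected sc.K γ (ρ n : Measure SpaceTime)) atTop
      (𝓝 (∫ e, φ e ∂detected sc.K γ (ρ' : Measure SpaceTime))) := by
  simp only [sc.integral_detected hγ (hρ _), sc.integral_detected hγ hρ']
  refine tendsto_integral_of_continuousOn hlim (isClosed_Icc.prod sc.isCompact_D.isClosed) hρ hρ'
    (sc.continuousOn_emissionMean hγ φ) (C := ‖φ‖) fun p _ => ?_
  refine (norm_integral_le_of_norm_le_const
    (Eventually.of_forall fun q => φ.norm_coe_le_norm _)).trans (le_of_eq ?_)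
  simp

variable {ρ : Measure SpaceTime} [IsFiniteMeasure ρ]

/-- From every interior point the exit point has a distribution that is absolutely continuous with
respect to area. The first detection point is the exit point in the opposite direction, and the
measure on directions is invariant under the antipodal map. -/
theorem detected_fst_null (hγ : γ (Metric.ball 0 (sc.δ / 2))ᶜ = 0)
    (hρ : ρ (Icc 0 sc.T ×ˢ sc.D)ᶜ = 0) {N : Set E3} (hN : MeasurableSet N)
    (h0 : surfaceMeasure sc.K N = 0) : detected sc.K γ ρ {e | e.2.1 ∈ N} = 0 := by
  have hs : MeasurableSet {e : Event | e.2.1 ∈ N} := (measurable_fst.comp measurable_snd) hN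
  rw [← lintegral_indicator_one hs, sc.lintegral_detected hγ hρ (measurable_one.indicator hs)]
  refine (lintegral_congr_ae ?_).trans lintegral_zero
  filter_upwards [sc.ae_mem_interior hγ hρ] with p hp
  rw [uniformSphere, lintegral_smul_measure]
  have hc := sc.body.continuous_exitPoint_sphere hp
  have h1 := congrArg (fun μ => μ N) (sc.body.map_exitPoint_toSphere_of_mem_interior hp)
  simp only [withDensity_absolutelyContinuous _ _ h0] at h1
  rw [← toSphere_map_neg, Measure.map_map hc.measurable continuous_neg.measurable,
    Measure.map_apply (hc.comp continuous_neg).measurable hN] at h1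
  refine mul_eq_zero.2 (Or.inr ?_)
  have h2 : MeasurableSet ((fun ω : Metric.sphere (0 : E3) 1 =>
      exitPoint sc.K (p.1.2 + p.2) ω) ∘ (fun ω => -ω) ⁻¹' N) :=
    (hc.comp continuous_neg).measurable hN
  rw [← lintegral_indicator_one h2] at h1
  rw [← h1]
  refine lintegral_congr fun ω => ?_
  have e := detectionPoints_fst sc.K (p.1.2 + p.2) ω
  by_cases hω : exitPoint sc.K (p.1.2 + p.2) (-ω) ∈ N
  · rw [indicator_of_mem (by rw [mem_ofPred_eq]; exact e ▸ hω), indicator_of_mem (by exact hω)]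
    rfl
  · rw [indicator_of_notMem (by rw [mem_ofPred_eq]; exact e ▸ hω),
      indicator_of_notMem (by exact hω)]

theorem detected_snd_null (hγ : γ (Metric.ball 0 (sc.δ / 2))ᶜ = 0)
    (hρ : ρ (Icc 0 sc.T ×ˢ sc.D)ᶜ = 0) {N : Set E3} (hN : MeasurableSet N)
    (h0 : surfaceMeasure sc.K N = 0) : detected sc.K γ ρ {e | e.2.2 ∈ N} = 0 := by
  have hs : MeasurableSet {e : Event | e.2.2 ∈ N} := (measurable_snd.comp measurable_snd) hN
  rw [← lintegral_indicator_one hs, sc.lintegral_detected hγ hρ (measurable_one.indicator hs)]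
  refine (lintegral_congr_ae ?_).trans lintegral_zero
  filter_upwards [sc.ae_mem_interior hγ hρ] with p hp
  rw [uniformSphere, lintegral_smul_measure]
  have hc := sc.body.continuous_exitPoint_sphere hp
  have h1 := congrArg (fun μ => μ N) (sc.body.map_exitPoint_toSphere_of_mem_interior hp)
  simp only [withDensity_absolutelyContinuous _ _ h0] at h1
  rw [Measure.map_apply hc.measurable hN] at h1
  refine mul_eq_zero.2 (Or.inr ?_)
  have h2 : MeasurableSet ((fun ω : Metric.sphere (0 : E3) 1 =>
      exitPoint sc.K (p.1.2 + p.2) ω) ⁻¹' N) := hc.measurable hN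
  rw [← lintegral_indicator_one h2] at h1
  rw [← h1]
  refine lintegral_congr fun ω => ?_
  simp only [indicator, mem_ofPred_eq, mem_preimage, detectionPoints_snd]
  rfl

theorem detected_time (hγ : γ (Metric.ball 0 (sc.δ / 2))ᶜ = 0)
    (hρ : ρ (Icc 0 sc.T ×ˢ sc.D)ᶜ = 0) {N : Set ℝ} (hN : MeasurableSet N) :
    detected sc.K γ ρ {e | e.1 ∈ N} = ρ.map Prod.fst N := by
  have hs : MeasurableSet {e : Event | e.1 ∈ N} := measurable_fst hN
  have hs' : MeasurableSet (Prod.fst ⁻¹' N : Set SpaceTime) := measurable_fst hN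
  rw [← lintegral_indicator_one hs, sc.lintegral_detected hγ hρ (measurable_one.indicator hs),
    lintegral_prod _ (by
      have : Measurable fun p : SpaceTime × E3 =>
          (Prod.fst ⁻¹' N : Set SpaceTime).indicator (1 : SpaceTime → ℝ≥0∞) p.1 :=
        (measurable_one.indicator hs').comp measurable_fst
      refine this.aemeasurable.congr (Eventually.of_forall fun p => ?_)
      have e : ∀ ω : Metric.sphere (0 : E3) 1, ({e : Event | e.1 ∈ N}.indicator
          (1 : Event → ℝ≥0∞)) (p.1.1, detectionPoints sc.K (p.1.2 + p.2) ω) =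
          (Prod.fst ⁻¹' N : Set SpaceTime).indicator (1 : SpaceTime → ℝ≥0∞) p.1 := fun ω => by
        rfl
      simp [e]), Measure.map_apply measurable_fst hN, ← lintegral_indicator_one hs']
  refine lintegral_congr fun p => ?_
  have e : ∀ (z : E3) (ω : Metric.sphere (0 : E3) 1), ({e : Event | e.1 ∈ N}.indicator
      (1 : Event → ℝ≥0∞)) (p.1, detectionPoints sc.K (p.2 + z) ω) =
      (Prod.fst ⁻¹' N : Set SpaceTime).indicator (1 : SpaceTime → ℝ≥0∞) p := fun z ω => by
    rfl
  simp [e]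

end Scanner
end

open scoped ENNReal NNReal

noncomputable section

/-! ### Continuous densities -/

/-- `density` picks some continuous representative. Any two agree almost everywhere, and the set
where they differ is relatively open in `Z`, so it is empty if `ν` charges nonempty relatively open
sets. -/
theorem density_eq_of_continuousOn {X : Type*} [TopologicalSpace X] [MeasurableSpace X]
    [BorelSpace X] {ν : Measure X} [SigmaFinite ν] {Z : Set X} (hZ : IsClosed Z) (hν : ν Zᶜ = 0)
    (hpos : ∀ U, IsOpen U → (U ∩ Z).Nonempty → ν (U ∩ Z) ≠ 0) {f : X → ℝ≥0∞}
    (hf : ContinuousOn f Z) {x : X} (hx : x ∈ Z) : density (ν.withDensity f) ν Z x = f x := by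
  have h : ∃ g : X → ℝ≥0∞, ContinuousOn g Z ∧ ν.withDensity f = ν.withDensity g := ⟨f, hf, rfl⟩
  rw [density, dif_pos h]
  obtain ⟨h1, h2⟩ := h.choose_spec
  set g := h.choose
  have hZν : ν.restrict Z = ν := Measure.restrict_eq_self_of_ae_mem (by rw [ae_iff]; exact hν)
  have hfm : AEMeasurable f ν := by
    rw [← hZν]; exact hf.aemeasurable hZ.measurableSet
  have hgm : AEMeasurable g ν := by
    rw [← hZν]; exact h1.aemeasurable hZ.measurableSet
  have hae := (withDensity_eq_iff_of_sigmaFinite hfm hgm).1 h2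
  by_contra hne
  have hcl : ContinuousOn (fun y => (g y, f y)) Z := h1.prodMk hf
  obtain ⟨U, hU, hUZ⟩ := continuousOn_iff'.1 hcl _ (isClosed_diagonal (X := ℝ≥0∞)).isOpen_compl
  refine hpos U hU ⟨x, hUZ ▸ ⟨fun he => hne he, hx⟩⟩ ?_
  rw [← hUZ]
  exact measure_mono_null (t := {y | f y = g y}ᶜ) (fun y hy he => hy.1 (Eq.symm he))
    (mem_ae_iff.1 hae)

/-- For equicontinuous densities weak convergence is uniform. A tent function around `z` compares `f
n z` with `f' z` up to oscillations, and finitely many such points suffice by compactness. Only the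
upper bound is needed for the logarithmic term. -/
theorem eventually_le_add_of_equicontinuous {X : Type*} [MetricSpace X]
    [MeasurableSpace X] [BorelSpace X] {ν : Measure X} [IsFiniteMeasure ν] {Z : Set X}
    (hZ : IsCompact Z) (hν : ν Zᶜ = 0)
    (hpos : ∀ U, IsOpen U → (U ∩ Z).Nonempty → ν (U ∩ Z) ≠ 0) {f : ℕ → X → ℝ} {f' : X → ℝ}
    (hf : ∀ n, ContinuousOn (f n) Z) (hf' : ContinuousOn f' Z)
    (hequi : ∀ ε > 0, ∃ d > 0, ∀ n, ∀ x ∈ Z, ∀ y ∈ Z, dist x y < d → |f n x - f n y| ≤ ε)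
    (hlim : ∀ φ : BoundedContinuousFunction X ℝ,
      Tendsto (fun n => ∫ x, φ x * f n x ∂ν) atTop (𝓝 (∫ x, φ x * f' x ∂ν)))
    {ε : ℝ} (hε : 0 < ε) : ∀ᶠ n in atTop, ∀ x ∈ Z, f n x ≤ f' x + ε := by
  set e := ε / 6 with he
  have he0 : 0 < e := by positivity
  obtain ⟨d₁, hd₁, h1⟩ := hequi e he0
  obtain ⟨d₂, hd₂, h2⟩ := Metric.uniformContinuousOn_iff.1
    (hZ.uniformContinuousOn_of_continuous hf') e he0
  set d := min d₁ d₂ with hd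
  have hd0 : 0 < d := lt_min hd₁ hd₂
  have hZν : ν.restrict Z = ν := Measure.restrict_eq_self_of_ae_mem (by rw [ae_iff]; exact hν)
  have hint : ∀ (φ : BoundedContinuousFunction X ℝ) (g : X → ℝ), ContinuousOn g Z →
      Integrable (fun x => φ x * g x) ν := fun φ g hg => by
    rw [← hZν]
    exact (φ.continuous.continuousOn.mul hg).integrableOn_compact hZ
  have hae : ∀ᵐ x ∂ν, x ∈ Z := by rw [ae_iff]; exact hν
  have local_le : ∀ z ∈ Z, ∀ᶠ n in atTop, f n z ≤ f' z + 4 * e := by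
    intro z hz
    let φ : BoundedContinuousFunction X ℝ :=
      BoundedContinuousFunction.ofNormedAddCommGroup (fun x => max 0 (d - dist x z))
        (by fun_prop) d fun x => by
          rw [Real.norm_eq_abs, abs_of_nonneg (le_max_left _ _)]
          exact max_le hd0.le (sub_le_self _ dist_nonneg)
    have hφ0 : ∀ x, 0 ≤ φ x := fun x => le_max_left _ _
    have hφd : ∀ x, ¬ dist x z < d → φ x = 0 := fun x hx =>
      max_eq_left (by linarith [not_lt.1 hx])
    have hφi : Integrable φ ν := by
      simpa using hint φ (fun _ => 1) continuousOn_const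
    have hc : 0 < ∫ x, φ x ∂ν := by
      rw [integral_pos_iff_support_of_nonneg hφ0 hφi]
      refine lt_of_lt_of_le (pos_iff_ne_zero.2 (hpos (Metric.ball z d) Metric.isOpen_ball
        ⟨z, Metric.mem_ball_self hd0, hz⟩)) (measure_mono fun x hx => ?_)
      have : 0 < d - dist x z := sub_pos.2 hx.1
      exact (lt_max_of_lt_right this).ne'
    have hlow : ∀ n, (∫ x, φ x ∂ν) * (f n z - e) ≤ ∫ x, φ x * f n x ∂ν := fun n => by
      rw [← integral_mul_const]
      refine integral_mono_ae (hφi.mul_const _) (hint φ _ (hf n)) ?_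
      filter_upwards [hae] with x hx
      by_cases hxd : dist x z < d
      · have := (abs_le.1 (h1 n x hx z hz (hxd.trans_le (min_le_left _ _)))).1
        exact mul_le_mul_of_nonneg_left (by linarith) (hφ0 x)
      · simp [hφd x hxd]
    have hup : ∫ x, φ x * f' x ∂ν ≤ (∫ x, φ x ∂ν) * (f' z + e) := by
      rw [← integral_mul_const]
      refine integral_mono_ae (hint φ _ hf') (hφi.mul_const _) ?_
      filter_upwards [hae] with x hx
      by_cases hxd : dist x z < d
      · have := h2 x hx z hz (hxd.trans_le (min_le_right _ _))
        rw [Real.dist_eq] at this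
        exact mul_le_mul_of_nonneg_left (by linarith [(abs_lt.1 this).2]) (hφ0 x)
      · simp [hφd x hxd]
    have hev := (hlim φ).eventually_lt_const
      (show ∫ x, φ x * f' x ∂ν < ∫ x, φ x * f' x ∂ν + (∫ x, φ x ∂ν) * e by
        have := mul_pos hc he0; linarith)
    filter_upwards [hev] with n hn
    have h3 : (∫ x, φ x ∂ν) * (f n z - e) < (∫ x, φ x ∂ν) * (f' z + 2 * e) := by
      have := hlow n
      nlinarith
    have := lt_of_mul_lt_mul_left h3 hc.le
    linarith
  obtain ⟨t, htZ, ht⟩ := hZ.elim_nhds_subcover (fun z => Metric.ball z d)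
    fun z _ => Metric.ball_mem_nhds z hd0
  have hall : ∀ᶠ n in atTop, ∀ z ∈ t, f n z ≤ f' z + 4 * e :=
    (t.eventually_all).2 fun z hz => local_le z (htZ z hz)
  filter_upwards [hall] with n hn x hx
  obtain ⟨z, hzt, hxz⟩ := mem_iUnion₂.1 (ht hx)
  have hxz' : dist x z < d := hxz
  have a1 := (abs_le.1 (h1 n x hx z (htZ z hzt) (hxz'.trans_le (min_le_left _ _)))).2
  have a2 := h2 x hx z (htZ z hzt) (hxz'.trans_le (min_le_right _ _))
  rw [Real.dist_eq] at a2
  have a3 := hn z hzt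
  have a4 := (abs_lt.1 a2).1
  have : ε = 6 * e := by rw [he]; ring
  linarith

end

open scoped ENNReal NNReal

noncomputable section

/-! ### The density of detections -/

/-- The geometric factor of a pair of detection points, cut off at distance `r`. -/
def pairFactor (K : Set E3) (r : ℝ) (a b : E3) : ℝ :=
  inner ℝ (outerNormal K a) (a - b) * inner ℝ (outerNormal K b) (b - a) / max ‖a - b‖ r ^ 3

/-- The mean of `f` on the segment between `a` and `b`. -/
def chordMean (f : E3 → ℝ) (a b : E3) : ℝ := ∫ s in (0 : ℝ)..1, f (b + s • (a - b))

theorem SmoothBody.inner_outerNormal_sub_nonneg {K : Set E3} (hK : SmoothBody K) {a b : E3}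
    (ha : a ∈ frontier K) (hb : b ∈ K) : 0 ≤ inner ℝ (outerNormal K a) (a - b) := by
  have := hK.inner_outerNormal_le ha hb
  rw [← neg_sub, inner_neg_right]
  linarith

theorem SmoothBody.continuousOn_pairFactor {K : Set E3} (hK : SmoothBody K) {r : ℝ} (hr : 0 < r) :
    ContinuousOn (fun p : E3 × E3 => pairFactor K r p.1 p.2) (frontier K ×ˢ frontier K) := by
  refine ContinuousOn.div (ContinuousOn.mul ?_ ?_) (by fun_prop) fun p _ =>
    (pow_pos (lt_max_of_lt_right hr) 3).ne'
  · exact (hK.continuousOn_outerNormal.comp continuousOn_fst fun p hp => hp.1).inner (by fun_prop)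
  · exact (hK.continuousOn_outerNormal.comp continuousOn_snd fun p hp => hp.2).inner (by fun_prop)

theorem SmoothBody.pairFactor_nonneg {K : Set E3} (hK : SmoothBody K) {r : ℝ} (hr : 0 < r)
    {a b : E3} (ha : a ∈ frontier K) (hb : b ∈ frontier K) : 0 ≤ pairFactor K r a b :=
  div_nonneg (mul_nonneg (hK.inner_outerNormal_sub_nonneg ha (hK.frontier_subset hb))
    (hK.inner_outerNormal_sub_nonneg hb (hK.frontier_subset ha)))
    (pow_nonneg (hr.le.trans (le_max_right _ _)) 3)

theorem chordMean_nonneg {f : E3 → ℝ} (hf : ∀ x, 0 ≤ f x) (a b : E3) : 0 ≤ chordMean f a b :=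
  intervalIntegral.integral_nonneg zero_le_one fun _ _ => hf _

theorem chordMean_le {f : E3 → ℝ} (hc : Continuous f) {C : ℝ} (hf : ∀ x, f x ≤ C) (a b : E3) :
    chordMean f a b ≤ C := by
  have h := intervalIntegral.integral_mono_on (μ := volume) (a := 0) (b := 1) zero_le_one
    (Continuous.intervalIntegrable (u := fun s : ℝ => f (b + s • (a - b)))
      (hc.comp (by fun_prop)) _ _)
    (intervalIntegrable_const (c := C)) fun s _ => hf _
  simpa [chordMean] using h

theorem abs_chordMean_sub_le {f g : E3 → ℝ} (hf : Continuous f) (hg : Continuous g) {ε d : ℝ}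
    {a b a' b' : E3} (ha : ‖a - a'‖ < d) (hb : ‖b - b'‖ < d)
    (h : ∀ x y, ‖x - y‖ < d → |f x - g y| ≤ ε) :
    |chordMean f a b - chordMean g a' b'| ≤ ε := by
  have i1 : IntervalIntegrable (fun s : ℝ => f (b + s • (a - b))) volume 0 1 :=
    Continuous.intervalIntegrable (hf.comp (by fun_prop)) _ _
  have i2 : IntervalIntegrable (fun s : ℝ => g (b' + s • (a' - b'))) volume 0 1 :=
    Continuous.intervalIntegrable (hg.comp (by fun_prop)) _ _
  rw [chordMean, chordMean, ← intervalIntegral.integral_sub i1 i2, ← Real.norm_eq_abs]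
  have := intervalIntegral.norm_integral_le_of_norm_le_const (a := (0 : ℝ)) (b := 1) (C := ε)
    (f := fun s => f (b + s • (a - b)) - g (b' + s • (a' - b'))) fun s hs => by
      rw [uIoc_of_le zero_le_one] at hs
      refine h _ _ ?_
      have e : b + s • (a - b) - (b' + s • (a' - b')) = (1 - s) • (b - b') + s • (a - a') := by
        module
      rw [e]
      have hs1 : 0 ≤ 1 - s := by linarith [hs.2]
      calc ‖(1 - s) • (b - b') + s • (a - a')‖ ≤ (1 - s) * ‖b - b'‖ + s * ‖a - a'‖ := by
            refine (norm_add_le _ _).trans (le_of_eq ?_)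
            rw [norm_smul, norm_smul, Real.norm_of_nonneg hs1, Real.norm_of_nonneg hs.1.le]
        _ < (1 - s) * d + s * d :=
            add_lt_add_of_le_of_lt (mul_le_mul_of_nonneg_left hb.le hs1)
              (mul_lt_mul_of_pos_left ha hs.1)
        _ = d := by ring
  simpa using this

theorem lintegral_segment_eq_chordMean {f : E3 → ℝ} (hf : Continuous f) (hf0 : ∀ x, 0 ≤ f x)
    (a b : E3) : ∫⁻ s in Ioo (0 : ℝ) 1, ENNReal.ofReal (f (b + s • (a - b))) =
      ENNReal.ofReal (chordMean f a b) := by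
  rw [chordMean, intervalIntegral.integral_of_le zero_le_one, ofReal_integral_eq_lintegral_ofReal,
    restrict_Ioo_eq_restrict_Ioc]
  · exact (Continuous.integrableOn_Icc (hf.comp (by fun_prop))).mono_set Ioc_subset_Icc_self
  · exact Eventually.of_forall fun s => hf0 _

/-- The positive part of the density of annihilation points. -/
def posDensity (ρ : Measure SpaceTime) (V : SpaceTime → E3) (h₀ : ℝ → ℝ) {δ : ℝ}
    (G : PositronKernel δ) (t : ℝ) (x : E3) : ℝ :=
  max (annihilationDensity ρ V h₀ G t x) 0

/-- The density of the scatterless detections. -/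
def detectionDensity (K : Set E3) (ρ : Measure SpaceTime) (V : SpaceTime → E3) (h₀ : ℝ → ℝ)
    {δ : ℝ} (G : PositronKernel δ) (e : Event) : ℝ :=
  pairFactor K (δ / 2) e.2.1 e.2.2 * chordMean (posDensity ρ V h₀ G e.1) e.2.1 e.2.2

theorem posDensity_nonneg (ρ : Measure SpaceTime) (V : SpaceTime → E3) (h₀ : ℝ → ℝ) {δ : ℝ}
    (G : PositronKernel δ) (t : ℝ) (x : E3) : 0 ≤ posDensity ρ V h₀ G t x := le_max_right _ _

/-- `ENNReal.ofReal` truncates anyway, so the signed density may be replaced by its positive part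
and its own nonnegativity need not be established. -/
theorem ofReal_posDensity (ρ : Measure SpaceTime) (V : SpaceTime → E3) (h₀ : ℝ → ℝ) {δ : ℝ}
    (G : PositronKernel δ) (t : ℝ) (x : E3) : ENNReal.ofReal (posDensity ρ V h₀ G t x) =
      ENNReal.ofReal (annihilationDensity ρ V h₀ G t x) := by
  rw [posDensity, ENNReal.ofReal_max, ENNReal.ofReal_zero, max_eq_left zero_le]

namespace Scanner

variable (sc : Scanner) {h₀ : ℝ → ℝ}

theorem half_le_dist {a x : E3} (ha : a ∈ frontier sc.K) (hx : ‖x - a‖ ≤ sc.δ / 2) :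
    ∀ y ∈ sc.D, sc.δ / 2 ≤ dist x y := by
  intro y hy
  have h1 := sc.δ_le_dist y hy a ha
  have h2 := dist_triangle_left y a x
  rw [dist_eq_norm x a] at h2
  linarith

theorem half_le_dist_of_notMem {x : E3} (hx : x ∉ interior sc.K) :
    ∀ y ∈ sc.D, sc.δ / 2 ≤ dist x y := by
  intro y hy
  by_contra hlt
  refine hx ?_
  have := sc.add_mem_interior hy (z := x - y) (by
    rw [← dist_eq_norm]
    have := sc.δ_pos
    linarith)
  simpa using this

variable {ρ : Measure SpaceTime} [IsFiniteMeasure ρ] {V : SpaceTime → E3}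

theorem continuous_posDensity (hf : IsFlow sc.T sc.D ρ V) (hh : IsTimeBump sc.T h₀)
    (G : PositronKernel sc.δ) : Continuous fun q : SpaceTime => posDensity ρ V h₀ G q.1 q.2 :=
  (hf.continuous_annihilationDensity sc.T_pos sc.isCompact_D.isBounded hh G).max continuous_const

theorem continuous_posDensity_time (hf : IsFlow sc.T sc.D ρ V) (hh : IsTimeBump sc.T h₀)
    (G : PositronKernel sc.δ) (t : ℝ) : Continuous (posDensity ρ V h₀ G t) :=
  (sc.continuous_posDensity hf hh G).comp (f := fun x : E3 => (t, x)) (by fun_prop)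

/-- The cut-off in `pairFactor` costs nothing. If `a` and `b` are closer than `δ / 2`, the whole
chord lies within `δ / 2` of the boundary, where nothing annihilates, and both sides vanish;
otherwise the cut-off is inactive. It removes the singularity on the diagonal. -/
theorem pairKernel_eq (hf : IsFlow sc.T sc.D ρ V) (hh : IsTimeBump sc.T h₀)
    (G : PositronKernel sc.δ) (t : ℝ) {a b : E3} (ha : a ∈ frontier sc.K)
    (hb : b ∈ frontier sc.K) :
    pairKernel sc.K (fun x => ENNReal.ofReal (annihilationDensity ρ V h₀ G t x)) a b =
      ENNReal.ofReal (detectionDensity sc.K ρ V h₀ G (t, a, b)) := by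
  have hδ := sc.δ_pos
  have i1 := sc.body.inner_outerNormal_sub_nonneg ha (sc.body.frontier_subset hb)
  have i2 := sc.body.inner_outerNormal_sub_nonneg hb (sc.body.frontier_subset ha)
  have hcm : ∫⁻ s in Ioo (0 : ℝ) 1,
      ENNReal.ofReal (annihilationDensity ρ V h₀ G t (b + s • (a - b))) =
      ENNReal.ofReal (chordMean (posDensity ρ V h₀ G t) a b) := by
    rw [← lintegral_segment_eq_chordMean (sc.continuous_posDensity_time hf hh G t)
      (fun x => le_max_right _ _)]
    simp_rw [ofReal_posDensity]
  rw [pairKernel, hcm, detectionDensity, pairFactor]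
  rcases le_or_gt (sc.δ / 2) ‖a - b‖ with h | h
  · rw [max_eq_left h, solidAngleDensity, ← ENNReal.ofReal_mul i2, ← ENNReal.ofReal_mul
      (div_nonneg i1 (by positivity))]
    congr 1
    ring
  · have : chordMean (posDensity ρ V h₀ G t) a b = 0 := by
      rw [chordMean]
      refine (intervalIntegral.integral_congr (g := fun _ => (0 : ℝ)) fun s hs => ?_).trans
        (by simp)
      rw [uIcc_of_le zero_le_one] at hs
      have : annihilationDensity ρ V h₀ G t (b + s • (a - b)) = 0 := by
        refine hf.annihilationDensity_eq_zero G (sc.half_le_dist hb ?_) t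
        rw [add_sub_cancel_left, norm_smul, Real.norm_of_nonneg hs.1]
        nlinarith [hs.2, norm_nonneg (a - b)]
      simp [posDensity, this]
    simp [this]

/-- The geometric factor is one fixed function, uniformly continuous on the compact set `∂K × ∂K`.
The flow enters only through the chord mean, which is bounded by `C * A` and inherits the modulus of
the annihilation density. -/
theorem exists_modulus_detectionDensity (hh : IsTimeBump sc.T h₀) (G : PositronKernel sc.δ)
    (A : ℝ) {ε : ℝ} (hε : 0 < ε) :
    ∃ d > 0, ∀ (ρ : Measure SpaceTime) [IsFiniteMeasure ρ] (V : SpaceTime → E3),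
      IsFlow sc.T sc.D ρ V → massEnergy ρ V ≤ A →
      ∀ e ∈ Icc 0 sc.T ×ˢ frontier sc.K ×ˢ frontier sc.K,
      ∀ e' ∈ Icc 0 sc.T ×ˢ frontier sc.K ×ˢ frontier sc.K, dist e e' < d →
        |detectionDensity sc.K ρ V h₀ G e - detectionDensity sc.K ρ V h₀ G e'| ≤ ε := by
  wlog hA : 0 < A generalizing A
  · obtain ⟨d, hd, h⟩ := this 1 one_pos
    exact ⟨d, hd, fun ρ _ V hf hm => h ρ V hf (hm.trans ((not_lt.1 hA).trans zero_le_one))⟩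
  have hδ := sc.δ_pos
  have hcp := sc.body.isCompact_frontier.prod sc.body.isCompact_frontier
  have hpc := sc.body.continuousOn_pairFactor (half_pos hδ)
  obtain ⟨B, hB⟩ := hcp.exists_bound_of_continuousOn hpc
  obtain ⟨C, hC0, hC⟩ := exists_abs_annihilationDensity_le (D := sc.D) hh G
  have hB1 : 0 < |B| + 1 := by positivity
  obtain ⟨d₁, hd₁, h1⟩ := exists_modulus_annihilationDensity (D := sc.D) sc.T_pos
    sc.isCompact_D.isBounded hh G A (ε := ε / (2 * (|B| + 1))) (by positivity)
  obtain ⟨d₂, hd₂, h2⟩ := Metric.uniformContinuousOn_iff.1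
    (hcp.uniformContinuousOn_of_continuous hpc) (ε / (2 * (C * A + 1))) (by positivity)
  refine ⟨min d₁ d₂, lt_min hd₁ hd₂, fun ρ _ V hf hm e he e' he' hd => ?_⟩
  have hde : dist e.1 e'.1 < d₁ ∧ dist e.2.1 e'.2.1 < d₁ ∧ dist e.2.2 e'.2.2 < d₁ := by
    have := hd.trans_le (min_le_left _ _)
    rw [Prod.dist_eq, Prod.dist_eq] at this
    simpa using this
  have hde2 : dist e.2 e'.2 < d₂ := by
    have := hd.trans_le (min_le_right _ _)
    rw [Prod.dist_eq] at this
    exact (max_lt_iff.1 this).2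
  have hFb : ∀ t x, posDensity ρ V h₀ G t x ≤ C * A := fun t x =>
    max_le ((le_abs_self _).trans ((hC ρ V hf t x).trans (by gcongr))) (by positivity)
  have k1 : |chordMean (posDensity ρ V h₀ G e.1) e.2.1 e.2.2 -
      chordMean (posDensity ρ V h₀ G e'.1) e'.2.1 e'.2.2| ≤ ε / (2 * (|B| + 1)) := by
    refine abs_chordMean_sub_le (d := d₁) (sc.continuous_posDensity_time hf hh G _)
      (sc.continuous_posDensity_time hf hh G _) ?_ ?_ fun x y hxy => ?_
    · rw [← dist_eq_norm]; exact hde.2.1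
    · rw [← dist_eq_norm]; exact hde.2.2
    · refine (abs_max_sub_max_le_abs _ _ _).trans (h1 ρ V hf hm _ _ _ _ ?_ hxy)
      rw [← Real.dist_eq]; exact hde.1
  have k2 := h2 e.2 he.2 e'.2 he'.2 hde2
  rw [Real.dist_eq] at k2
  have k3 : |pairFactor sc.K (sc.δ / 2) e.2.1 e.2.2| ≤ |B| := (hB e.2 he.2).trans (le_abs_self B)
  have k4 : |chordMean (posDensity ρ V h₀ G e'.1) e'.2.1 e'.2.2| ≤ C * A := by
    rw [abs_of_nonneg (chordMean_nonneg (posDensity_nonneg _ _ _ _ _) _ _)]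
    exact chordMean_le (sc.continuous_posDensity_time hf hh G _) (hFb _) _ _
  rw [detectionDensity, detectionDensity]
  set p := pairFactor sc.K (sc.δ / 2) e.2.1 e.2.2
  set p' := pairFactor sc.K (sc.δ / 2) e'.2.1 e'.2.2
  set m := chordMean (posDensity ρ V h₀ G e.1) e.2.1 e.2.2
  set m' := chordMean (posDensity ρ V h₀ G e'.1) e'.2.1 e'.2.2
  calc |p * m - p' * m'| = |p * (m - m') + (p - p') * m'| := by ring_nf
    _ ≤ |p| * |m - m'| + |p - p'| * |m'| := by
        rw [← abs_mul, ← abs_mul]; exact abs_add_le _ _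
    _ ≤ (|B| + 1) * (ε / (2 * (|B| + 1))) + ε / (2 * (C * A + 1)) * (C * A + 1) := by
        gcongr
        · linarith
        · linarith
    _ = ε := by
        have : C * A + 1 ≠ 0 := by positivity
        field_simp; ring

theorem continuousOn_detectionDensity (hf : IsFlow sc.T sc.D ρ V) (hh : IsTimeBump sc.T h₀)
    (G : PositronKernel sc.δ) : ContinuousOn (detectionDensity sc.K ρ V h₀ G)
      (Icc 0 sc.T ×ˢ frontier sc.K ×ˢ frontier sc.K) := by
  refine Metric.continuousOn_iff.2 fun e he ε hε => ?_
  obtain ⟨d, hd, h⟩ := sc.exists_modulus_detectionDensity hh G (massEnergy ρ V) (half_pos hε)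
  refine ⟨d, hd, fun e' he' hde => ?_⟩
  rw [Real.dist_eq]
  exact (h ρ V hf le_rfl e' he' e he hde).trans_lt (half_lt_self hε)

theorem detectionDensity_nonneg (ρ : Measure SpaceTime) (V : SpaceTime → E3) (h₀ : ℝ → ℝ)
    (G : PositronKernel sc.δ) {e : Event} (he : e ∈ Icc 0 sc.T ×ˢ frontier sc.K ×ˢ frontier sc.K) :
    0 ≤ detectionDensity sc.K ρ V h₀ G e :=
  mul_nonneg (sc.body.pairFactor_nonneg (half_pos sc.δ_pos) he.2.1 he.2.2)
    (chordMean_nonneg (posDensity_nonneg _ _ _ _ _) _ _)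

theorem exists_detectionDensity_le (hh : IsTimeBump sc.T h₀) (G : PositronKernel sc.δ) :
    ∃ C, 0 ≤ C ∧ ∀ (ρ : Measure SpaceTime) [IsFiniteMeasure ρ] (V : SpaceTime → E3),
      IsFlow sc.T sc.D ρ V → ∀ e ∈ Icc 0 sc.T ×ˢ frontier sc.K ×ˢ frontier sc.K,
        detectionDensity sc.K ρ V h₀ G e ≤ C * massEnergy ρ V := by
  have hδ := sc.δ_pos
  obtain ⟨B, hB⟩ := (sc.body.isCompact_frontier.prod
    sc.body.isCompact_frontier).exists_bound_of_continuousOn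
    (sc.body.continuousOn_pairFactor (half_pos hδ))
  obtain ⟨C, hC0, hC⟩ := exists_abs_annihilationDensity_le (D := sc.D) hh G
  refine ⟨|B| * C, by positivity, fun ρ _ V hf e he => ?_⟩
  have hm := massEnergy_nonneg ρ V
  rw [mul_assoc]
  refine mul_le_mul ((le_abs_self _).trans ((hB e.2 he.2).trans (le_abs_self B)))
    (chordMean_le (sc.continuous_posDensity_time hf hh G _) (fun x => max_le
      ((le_abs_self _).trans (hC ρ V hf _ x)) (by positivity)) _ _)
    (chordMean_nonneg (posDensity_nonneg _ _ _ _ _) _ _) (abs_nonneg _)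

theorem ae_prod_mem : ∀ᵐ e ∂((volume : Measure ℝ).restrict (Icc 0 sc.T)).prod
    ((surfaceMeasure sc.K).prod (surfaceMeasure sc.K)),
      e ∈ Icc 0 sc.T ×ˢ frontier sc.K ×ˢ frontier sc.K := by
  have := sc.body.isFiniteMeasure_surfaceMeasure
  have hm : MeasurableSet (frontier sc.K) := isClosed_frontier.measurableSet
  refine (Measure.ae_prod_mem_iff_ae_ae_mem (measurableSet_Icc.prod (hm.prod hm))).2 ?_
  have h2 : ∀ᵐ p ∂(surfaceMeasure sc.K).prod (surfaceMeasure sc.K),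
      p ∈ frontier sc.K ×ˢ frontier sc.K :=
    (Measure.ae_prod_mem_iff_ae_ae_mem (hm.prod hm)).2 (by
      filter_upwards [ae_mem_frontier sc.K] with a ha
      filter_upwards [ae_mem_frontier sc.K] with b hb using ⟨ha, hb⟩)
  filter_upwards [ae_restrict_mem measurableSet_Icc] with t ht
  filter_upwards [h2] with p hp using ⟨ht, hp⟩

-- At each time `lintegral_emission` is applied to the annihilation density. The constant factor
-- normalizes the measure on the sphere to the uniform probability measure.
set_option maxHeartbeats 800000 in
theorem detected_eq_withDensity (hf : IsFlow sc.T sc.D ρ V) (hh : IsTimeBump sc.T h₀)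
    (G : PositronKernel sc.δ) :
    detected sc.K G.law ρ = (((volume : Measure ℝ).restrict (Icc 0 sc.T)).prod
      ((surfaceMeasure sc.K).prod (surfaceMeasure sc.K))).withDensity fun e =>
        ((volume : Measure E3).toSphere univ)⁻¹ *
          ENNReal.ofReal (detectionDensity sc.K ρ V h₀ G e) := by
  have := sc.body.isFiniteMeasure_surfaceMeasure
  have := G.isProbabilityMeasure_law
  have hc : ((volume : Measure E3).toSphere univ)⁻¹ ≠ ⊤ := by
    rw [Ne, ENNReal.inv_eq_top, Measure.measure_univ_eq_zero]
    exact Measure.toSphere_ne_zero _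
  set c := ((volume : Measure E3).toSphere univ)⁻¹ with hcdef
  set σ := surfaceMeasure sc.K with hσ
  have hbd := sc.isCompact_D.isBounded
  have hFm : Measurable fun q : SpaceTime =>
      ENNReal.ofReal (annihilationDensity ρ V h₀ G q.1 q.2) :=
    ENNReal.measurable_ofReal.comp
      (hf.continuous_annihilationDensity sc.T_pos hbd hh G).measurable
  have hF0 : ∀ t x, x ∉ interior sc.K →
      ENNReal.ofReal (annihilationDensity ρ V h₀ G t x) = 0 := fun t x hx => by
    rw [hf.annihilationDensity_eq_zero G (sc.half_le_dist_of_notMem hx), ENNReal.ofReal_zero]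
  have hdc := sc.continuousOn_detectionDensity hf hh G
  have hm : MeasurableSet (frontier sc.K) := isClosed_frontier.measurableSet
  have hdm : AEMeasurable (fun e => c * ENNReal.ofReal (detectionDensity sc.K ρ V h₀ G e))
      (((volume : Measure ℝ).restrict (Icc 0 sc.T)).prod (σ.prod σ)) := by
    refine AEMeasurable.const_mul (AEMeasurable.ennreal_ofReal ?_) _
    rw [← Measure.restrict_eq_self_of_ae_mem sc.ae_prod_mem]
    exact hdc.aemeasurable (measurableSet_Icc.prod (hm.prod hm))
  refine Measure.ext_of_lintegral _ fun φ hφ => ?_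
  have hdom : MeasurableSet {q : SpaceTime | q.2 ∈ interior sc.K} :=
    (isOpen_interior.preimage (by fun_prop)).measurableSet
  set g : SpaceTime → ℝ≥0∞ := fun q => ∫⁻ ω : Metric.sphere (0 : E3) 1,
    φ (q.1, detectionPoints sc.K q.2 ω) ∂(volume : Measure E3).toSphere with hg
  have e1 : ∀ q : SpaceTime, ∫⁻ ω : Metric.sphere (0 : E3) 1,
      φ (q.1, detectionPoints sc.K q.2 ω) ∂uniformSphere = c * g q := fun q => by
    rw [uniformSphere, lintegral_smul_measure, smul_eq_mul]
  have hposr := sc.ae_positronRange_mem_interior G.law_compl_ball hf.carried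
  have hfin : IsFiniteMeasure (positronRange G.law ρ) := by
    rw [positronRange]; infer_instance
  have hgm := sc.aemeasurable_lintegral_detectionPoints hposr hφ (volume : Measure E3).toSphere
  rw [sc.lintegral_detected_of_positronRange G.law_compl_ball hf.carried hφ]
  simp_rw [e1]
  rw [lintegral_const_mul' _ _ hc]
  rw [hf.positronRange_eq sc.T_pos hbd hh G] at hgm ⊢
  have hprod : AEMeasurable (fun q : SpaceTime =>
      ENNReal.ofReal (annihilationDensity ρ V h₀ G q.1 q.2) * g q)
      ((volume.restrict (Icc 0 sc.T)).prod volume) := by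
    -- The annihilation density vanishes off the interior, so it is enough that `g` is measurable
    -- over interior points.
    have hz : (fun q : SpaceTime => ENNReal.ofReal (annihilationDensity ρ V h₀ G q.1 q.2) * g q) =
        {q : SpaceTime | q.2 ∈ interior sc.K}.indicator fun q =>
          ENNReal.ofReal (annihilationDensity ρ V h₀ G q.1 q.2) * g q := by
      ext q
      by_cases hq : q ∈ {q : SpaceTime | q.2 ∈ interior sc.K}
      · rw [indicator_of_mem hq]
      · rw [indicator_of_notMem hq, hF0 _ _ hq, zero_mul]
    rw [hz, aemeasurable_indicator_iff hdom]
    exact hFm.aemeasurable.mul (sc.aemeasurable_lintegral_detectionPoints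
      (μ := ((volume.restrict (Icc 0 sc.T)).prod volume).restrict
        {q : SpaceTime | q.2 ∈ interior sc.K}) (ae_restrict_mem hdom) hφ _)
  rw [lintegral_withDensity_eq_lintegral_mul₀' hFm.aemeasurable hgm]
  change c * ∫⁻ q : SpaceTime, ENNReal.ofReal (annihilationDensity ρ V h₀ G q.1 q.2) * g q ∂_ = _
  rw [lintegral_prod _ hprod, ← lintegral_const_mul' _ _ hc,
    lintegral_withDensity_eq_lintegral_mul₀ hdm hφ.aemeasurable,
    lintegral_prod _ (hdm.mul hφ.aemeasurable)]
  refine lintegral_congr_ae ?_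
  filter_upwards [ae_restrict_mem measurableSet_Icc] with t ht
  have h1 := sc.body.lintegral_emission
    (F := fun x => ENNReal.ofReal (annihilationDensity ρ V h₀ G t x))
    (hFm.comp (measurable_prodMk_left (x := t))) (hF0 t) (φ := fun p => φ (t, p))
    (hφ.comp measurable_prodMk_left)
  simp only [hg]
  rw [h1]
  have hs : AEMeasurable (fun p : E3 × E3 =>
      ENNReal.ofReal (detectionDensity sc.K ρ V h₀ G (t, p)) * φ (t, p)) (σ.prod σ) := by
    refine AEMeasurable.mul (AEMeasurable.ennreal_ofReal ?_)
      (hφ.comp measurable_prodMk_left).aemeasurable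
    have h2 : ∀ᵐ p ∂σ.prod σ, p ∈ frontier sc.K ×ˢ frontier sc.K :=
      (Measure.ae_prod_mem_iff_ae_ae_mem (hm.prod hm)).2 (by
        filter_upwards [ae_mem_frontier sc.K] with a ha
        filter_upwards [ae_mem_frontier sc.K] with b hb using ⟨ha, hb⟩)
    rw [← Measure.restrict_eq_self_of_ae_mem h2]
    exact (hdc.comp (f := fun p : E3 × E3 => (t, p)) (by fun_prop)
      fun p hp => ⟨ht, hp⟩).aemeasurable (hm.prod hm)
  simp only [Pi.mul_apply, mul_assoc]
  rw [lintegral_const_mul' _ _ hc, lintegral_prod_symm _ hs]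
  congr 1
  refine lintegral_congr_ae ?_
  filter_upwards [ae_mem_frontier sc.K] with b hb
  refine lintegral_congr_ae ?_
  filter_upwards [ae_mem_frontier sc.K] with a ha
  rw [sc.pairKernel_eq hf hh G t ha hb]

end Scanner
end

open scoped ENNReal NNReal

noncomputable section

namespace Setting

variable {sc : Scanner}

/-! ### The reference measure -/

theorem nodeSet_eq_range (d : DetectorArray sc.K) : nodeSet d =
    range fun p : Fin d.N × Fin d.M × Fin d.M => d.node sc.T p.1 p.2.1 p.2.2 := by
  ext e
  simp only [nodeSet, mem_ofPred_eq, mem_range, Prod.exists]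
  constructor
  · rintro ⟨i, j, k, h⟩; exact ⟨i, j, k, h.symm⟩
  · rintro ⟨i, j, k, h⟩; exact ⟨i, j, k, h.symm⟩

theorem node_mem_nodeSet (d : DetectorArray sc.K) (i : Fin d.N) (j k : Fin d.M) :
    d.node sc.T i j k ∈ nodeSet d := ⟨i, j, k, rfl⟩

theorem isCompact_nodeSet (d : DetectorArray sc.K) : IsCompact (nodeSet d) := by
  rw [nodeSet_eq_range]
  exact (finite_range _).isCompact

theorem nodeMeasure_compl (d : DetectorArray sc.K) : nodeMeasure d (nodeSet d)ᶜ = 0 := by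
  have h := (isCompact_nodeSet d).isClosed.measurableSet.compl
  simp only [nodeMeasure, Measure.finsetSum_apply, Measure.dirac_apply' _ h]
  refine Finset.sum_eq_zero fun i _ => Finset.sum_eq_zero fun j _ =>
    Finset.sum_eq_zero fun k _ => ?_
  exact indicator_of_notMem (not_not.2 (node_mem_nodeSet d i j k)) _

theorem one_le_nodeMeasure (d : DetectorArray sc.K) {s : Set Event} {i : Fin d.N} {j k : Fin d.M}
    (h : d.node sc.T i j k ∈ s) : 1 ≤ nodeMeasure d s := by
  simp only [nodeMeasure, Measure.finsetSum_apply]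
  refine le_trans ?_ (Finset.single_le_sum (f := fun i => ∑ j, ∑ k,
    Measure.dirac (d.node sc.T i j k) s) (fun _ _ => zero_le) (Finset.mem_univ i))
  refine le_trans ?_ (Finset.single_le_sum (f := fun j => ∑ k,
    Measure.dirac (d.node sc.T i j k) s) (fun _ _ => zero_le) (Finset.mem_univ j))
  refine le_trans ?_ (Finset.single_le_sum (f := fun k =>
    Measure.dirac (d.node sc.T i j k) s) (fun _ _ => zero_le) (Finset.mem_univ k))
  rw [Measure.dirac_apply_of_mem h]

theorem isCompact_eventSet (st : Setting sc) : IsCompact st.eventSet := by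
  cases st with
  | continuous G =>
    exact isCompact_Icc.prod
      (sc.body.isCompact_frontier.prod sc.body.isCompact_frontier)
  | discrete G d => exact isCompact_nodeSet d
  | discreteNoRange d => exact isCompact_nodeSet d

instance isFiniteMeasure_nodeMeasure (d : DetectorArray sc.K) :
    IsFiniteMeasure (nodeMeasure d) := by
  rw [nodeMeasure]; infer_instance

instance isFiniteMeasure_refMeasure (st : Setting sc) : IsFiniteMeasure st.refMeasure := by
  have := sc.body.isFiniteMeasure_surfaceMeasure
  cases st with
  | continuous G => rw [refMeasure]; infer_instance
  | discrete G d => exact isFiniteMeasure_nodeMeasure d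
  | discreteNoRange d => exact isFiniteMeasure_nodeMeasure d

theorem refMeasure_compl (st : Setting sc) : st.refMeasure st.eventSetᶜ = 0 := by
  cases st with
  | continuous G => exact sc.ae_prod_mem
  | discrete G d => exact nodeMeasure_compl d
  | discreteNoRange d => exact nodeMeasure_compl d

theorem volume_restrict_Icc_pos {T t : ℝ} (hT : 0 < T) (ht : t ∈ Icc 0 T) {I : Set ℝ}
    (hI : IsOpen I) (htI : t ∈ I) : 0 < volume.restrict (Icc 0 T) I := by
  rw [Measure.restrict_apply hI.measurableSet]
  have hcl : t ∈ closure (Ioo 0 T) := by rwa [closure_Ioo hT.ne]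
  obtain ⟨s, hs⟩ := mem_closure_iff.1 hcl I hI htI
  exact ((hI.inter isOpen_Ioo).measure_pos volume ⟨s, hs⟩).trans_le
    (measure_mono (inter_subset_inter_right _ Ioo_subset_Icc_self))

theorem refMeasure_pos (st : Setting sc) {U : Set Event} (hU : IsOpen U)
    (hne : (U ∩ st.eventSet).Nonempty) : st.refMeasure (U ∩ st.eventSet) ≠ 0 := by
  have := sc.body.isFiniteMeasure_surfaceMeasure
  have hd : ∀ d : DetectorArray sc.K, (U ∩ nodeSet d).Nonempty →
      nodeMeasure d (U ∩ nodeSet d) ≠ 0 := by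
    rintro d ⟨e, heU, i, j, k, rfl⟩
    exact (zero_lt_one.trans_le
      (one_le_nodeMeasure d (s := U ∩ nodeSet d) ⟨heU, node_mem_nodeSet d i j k⟩)).ne'
  cases st with
  | discrete G d => exact hd d hne
  | discreteNoRange d => exact hd d hne
  | continuous G =>
    obtain ⟨⟨t, a, b⟩, heU, ht, ha, hb⟩ := hne
    rw [measure_inter_conull ((continuous G).refMeasure_compl)]
    obtain ⟨I, W, hI, htI, hW, haW, hIW⟩ :=
      mem_nhds_prod_iff'.1 (hU.mem_nhds heU)
    obtain ⟨A, B, hA, haA, hB, hbB, hAB⟩ := mem_nhds_prod_iff'.1 (hW.mem_nhds haW)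
    have hsub : I ×ˢ A ×ˢ B ⊆ U := (prod_mono subset_rfl hAB).trans hIW
    refine (lt_of_lt_of_le ?_ (measure_mono hsub)).ne'
    rw [refMeasure, Measure.prod_prod, Measure.prod_prod]
    exact ENNReal.mul_pos (volume_restrict_Icc_pos sc.T_pos ht hI htI).ne'
      (ENNReal.mul_pos (sc.body.surfaceMeasure_pos hA ⟨a, haA, ha⟩).ne'
        (sc.body.surfaceMeasure_pos hB ⟨b, hbB, hb⟩).ne').ne'

/-- The intensity `A^q ρ` of the flow `(ρ, V)` has the density `f ρ V` with respect to the
reference measure, and this density depends in a controlled way on the flow. -/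
structure HasEventDensity (st : Setting sc) (ps pd q : ℝ)
    (f : Measure SpaceTime → (SpaceTime → E3) → Event → ℝ) : Prop where
  eq_withDensity : ∀ (ρ : Measure SpaceTime) [IsFiniteMeasure ρ] (V : SpaceTime → E3),
    IsFlow sc.T sc.D ρ V →
    st.Aq ps pd q ρ = st.refMeasure.withDensity fun e => ENNReal.ofReal (f ρ V e)
  continuousOn : ∀ (ρ : Measure SpaceTime) [IsFiniteMeasure ρ] (V : SpaceTime → E3),
    IsFlow sc.T sc.D ρ V → ContinuousOn (f ρ V) st.eventSet
  exists_lower : ∃ c > 0, ∀ (ρ : Measure SpaceTime) [IsFiniteMeasure ρ] (V : SpaceTime → E3),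
    IsFlow sc.T sc.D ρ V → ∀ e ∈ st.eventSet, c * ρ.real univ ≤ f ρ V e
  exists_upper : ∃ C, 0 ≤ C ∧
    ∀ (ρ : Measure SpaceTime) [IsFiniteMeasure ρ] (V : SpaceTime → E3),
      IsFlow sc.T sc.D ρ V → ∀ e ∈ st.eventSet, f ρ V e ≤ C * massEnergy ρ V
  eventually_le : ∀ (ρ : ℕ → FiniteMeasure SpaceTime) (V : ℕ → SpaceTime → E3)
    (ρ' : FiniteMeasure SpaceTime) (V' : SpaceTime → E3) (A : ℝ),
    (∀ n, IsFlow sc.T sc.D (ρ n) (V n)) → (∀ n, massEnergy (ρ n) (V n) ≤ A) →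
    IsFlow sc.T sc.D ρ' V' → Tendsto ρ atTop (𝓝 ρ') → ∀ ε > 0,
      ∀ᶠ n in atTop, ∀ e ∈ st.eventSet, f (ρ n) (V n) e ≤ f ρ' V' e + ε

theorem HasEventDensity.density_eq {st : Setting sc} {ps pd q : ℝ}
    {f : Measure SpaceTime → (SpaceTime → E3) → Event → ℝ} (h : st.HasEventDensity ps pd q f)
    {ρ : Measure SpaceTime} [IsFiniteMeasure ρ] {V : SpaceTime → E3}
    (hf : IsFlow sc.T sc.D ρ V) {e : Event} (he : e ∈ st.eventSet) :
    density (st.Aq ps pd q ρ) st.refMeasure st.eventSet e = ENNReal.ofReal (f ρ V e) := by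
  rw [h.eq_withDensity ρ V hf]
  exact density_eq_of_continuousOn st.isCompact_eventSet.isClosed st.refMeasure_compl
    (fun U hU hne => st.refMeasure_pos hU hne)
    (ENNReal.continuous_ofReal.comp_continuousOn (h.continuousOn ρ V hf)) he

theorem tendsto_mass {ρ : ℕ → FiniteMeasure SpaceTime} {ρ' : FiniteMeasure SpaceTime}
    (h : Tendsto ρ atTop (𝓝 ρ')) : Tendsto (fun n => (ρ n : Measure SpaceTime).real univ) atTop
      (𝓝 ((ρ' : Measure SpaceTime).real univ)) := by
  have := (NNReal.continuous_coe.tendsto _).comp (FiniteMeasure.continuous_mass.tendsto ρ' |>.comp h)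
  exact this

theorem isProbabilityMeasure_rangeLaw (st : Setting sc) :
    IsProbabilityMeasure st.rangeLaw := by
  cases st with
  | continuous G => exact G.isProbabilityMeasure_law
  | discrete G d => exact G.isProbabilityMeasure_law
  | discreteNoRange d => rw [rangeLaw]; infer_instance

theorem rangeLaw_compl_ball (st : Setting sc) :
    st.rangeLaw (Metric.ball 0 (sc.δ / 2))ᶜ = 0 := by
  cases st with
  | continuous G => exact G.law_compl_ball
  | discrete G d => exact G.law_compl_ball
  | discreteNoRange d =>
    rw [rangeLaw, Measure.dirac_apply' _ Metric.isOpen_ball.measurableSet.compl]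
    exact indicator_of_notMem (not_not.2 (Metric.mem_ball_self (half_pos sc.δ_pos))) _

end Setting

/-! ### Scattered events and the event density in the continuous setting. -/

namespace Scanner

variable (sc : Scanner)

theorem surfaceMeasure_univ_pos : 0 < surfaceMeasure sc.K univ := by
  refine sc.body.surfaceMeasure_pos isOpen_univ ?_
  rw [univ_inter]
  have := sc.body.isFiniteMeasure_surfaceMeasure
  have hne : sc.K ≠ univ := fun h => noncompact_univ E3 (h ▸ sc.isCompact_K)
  exact nonempty_frontier_iff.2 ⟨sc.nonempty_D.mono sc.D_subset_K, hne⟩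

variable {ρ : Measure SpaceTime} [IsFiniteMeasure ρ] {V : SpaceTime → E3}

theorem scatterEvents_eq (hf : IsFlow sc.T sc.D ρ V) : scatterEvents sc.K ρ =
    (((surfaceMeasure sc.K univ) ^ 2)⁻¹ * (ρ univ / ENNReal.ofReal sc.T)) •
      ((volume : Measure ℝ).restrict (Icc 0 sc.T)).prod
        ((surfaceMeasure sc.K).prod (surfaceMeasure sc.K)) := by
  have := sc.body.isFiniteMeasure_surfaceMeasure
  rw [scatterEvents, hf.map_fst_eq sc.T_pos sc.isCompact_D.isBounded, Measure.prod_smul_left,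
    smul_smul]

theorem scatterEvents_univ (ρ : Measure SpaceTime) [IsFiniteMeasure ρ] :
    scatterEvents sc.K ρ univ = ρ univ := by
  have := sc.body.isFiniteMeasure_surfaceMeasure
  rw [scatterEvents, Measure.smul_apply, ← univ_prod_univ, Measure.prod_prod, ← univ_prod_univ,
    Measure.prod_prod, Measure.map_apply measurable_fst .univ, preimage_univ, smul_eq_mul,
    mul_left_comm, ← sq, ENNReal.inv_mul_cancel, mul_one]
  · exact pow_ne_zero 2 sc.surfaceMeasure_univ_pos.ne'
  · exact ENNReal.pow_ne_top (measure_ne_top _ _)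

end Scanner

namespace Setting

variable {sc : Scanner}

/-- The density of the recorded events in the continuous setting. -/
def continuousDensity (G : PositronKernel sc.δ) (h₀ : ℝ → ℝ) (ps pd q : ℝ)
    (ρ : Measure SpaceTime) (V : SpaceTime → E3) (e : Event) : ℝ :=
  q * ps / ((surfaceMeasure sc.K).real univ ^ 2 * sc.T) * ρ.real univ +
    pd / (volume : Measure E3).toSphere.real univ * detectionDensity sc.K ρ V h₀ G e

/-- Scattering contributes a constant proportional to the mass, which alone gives the lower bound.
The eventual upper bound combines convergence of the masses with
`eventually_le_add_of_equicontinuous` for the detection densities, whose weak convergence is the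
weak continuity of the detection operator. -/
theorem hasEventDensity_continuous (G : PositronKernel sc.δ) {h₀ : ℝ → ℝ}
    (hh : IsTimeBump sc.T h₀) {ps pd q : ℝ} (hps : 0 < ps) (hpd : 0 < pd) (hq : 0 < q) :
    (continuous G).HasEventDensity ps pd q (continuousDensity G h₀ ps pd q) := by
  have hσf := sc.body.isFiniteMeasure_surfaceMeasure
  have := G.isProbabilityMeasure_law
  have hT := sc.T_pos
  have hσ : 0 < (surfaceMeasure sc.K).real univ :=
    ENNReal.toReal_pos sc.surfaceMeasure_univ_pos.ne' (measure_ne_top _ _)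
  have hω0 : (volume : Measure E3).toSphere univ ≠ 0 := by
    rw [Ne, Measure.measure_univ_eq_zero]
    exact Measure.toSphere_ne_zero _
  have hω : 0 < (volume : Measure E3).toSphere.real univ :=
    ENNReal.toReal_pos hω0 (measure_ne_top _ _)
  have hc1 : 0 < q * ps / ((surfaceMeasure sc.K).real univ ^ 2 * sc.T) := by positivity
  have hc2 : 0 < pd / (volume : Measure E3).toSphere.real univ := by positivity
  have hcω : ((volume : Measure E3).toSphere univ)⁻¹ =
      ENNReal.ofReal ((volume : Measure E3).toSphere.real univ)⁻¹ := by
    rw [ENNReal.ofReal_inv_of_pos hω, measureReal_def, ENNReal.ofReal_toReal (measure_ne_top _ _)]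
  refine ⟨fun ρ _ V hf => ?_, fun ρ _ V hf => ?_, ⟨_, hc1, fun ρ _ V hf e he => ?_⟩, ?_, ?_⟩
  · change ENNReal.ofReal (q * ps) • scatterEvents sc.K ρ + ENNReal.ofReal pd •
      detected sc.K G.law ρ = (((volume : Measure ℝ).restrict (Icc 0 sc.T)).prod
      ((surfaceMeasure sc.K).prod (surfaceMeasure sc.K))).withDensity _
    set ν := ((volume : Measure ℝ).restrict (Icc 0 sc.T)).prod
      ((surfaceMeasure sc.K).prod (surfaceMeasure sc.K)) with hν
    rw [sc.scatterEvents_eq hf, sc.detected_eq_withDensity hf hh G, ← withDensity_smul' _ _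
      ENNReal.ofReal_ne_top, smul_smul, ← withDensity_const, ← withDensity_add_left
      measurable_const]
    refine withDensity_congr_ae ?_
    filter_upwards [sc.ae_prod_mem] with e he
    have hd0 := sc.detectionDensity_nonneg ρ V h₀ G he
    simp only [Pi.add_apply, Pi.smul_apply, smul_eq_mul]
    have e1 : ((surfaceMeasure sc.K univ) ^ 2)⁻¹ =
        ENNReal.ofReal ((surfaceMeasure sc.K).real univ ^ 2)⁻¹ := by
      rw [ENNReal.ofReal_inv_of_pos (by positivity), ENNReal.ofReal_pow hσ.le, measureReal_def,
        ENNReal.ofReal_toReal (measure_ne_top _ _)]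
    have e2 : ρ univ / ENNReal.ofReal sc.T = ENNReal.ofReal (ρ.real univ / sc.T) := by
      rw [ENNReal.ofReal_div_of_pos hT, measureReal_def, ENNReal.ofReal_toReal (measure_ne_top _ _)]
    rw [e1, e2, hcω, ← ENNReal.ofReal_mul (by positivity), ← ENNReal.ofReal_mul (by positivity),
      ← ENNReal.ofReal_mul (by positivity), ← ENNReal.ofReal_mul hpd.le, ← ENNReal.ofReal_add
      (by positivity) (by positivity), continuousDensity]
    congr 1
    field_simp
  · exact continuousOn_const.add
      (continuousOn_const.mul (sc.continuousOn_detectionDensity hf hh G))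
  · have := sc.detectionDensity_nonneg ρ V h₀ G he
    exact le_add_of_nonneg_right (mul_nonneg hc2.le this)
  · obtain ⟨C, hC0, hC⟩ := sc.exists_detectionDensity_le hh G
    refine ⟨q * ps / ((surfaceMeasure sc.K).real univ ^ 2 * sc.T) +
      pd / (volume : Measure E3).toSphere.real univ * C, by positivity, fun ρ _ V hf e he => ?_⟩
    rw [add_mul, mul_assoc _ C]
    exact add_le_add (mul_le_mul_of_nonneg_left (measureReal_le_massEnergy ρ V) hc1.le)
      (mul_le_mul_of_nonneg_left (hC ρ V hf e he) hc2.le)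
  · intro ρ V ρ' V' A hf hA hf' hlim ε hε
    have key := eventually_le_add_of_equicontinuous (ν := (continuous G).refMeasure)
      (Z := (continuous G).eventSet) (continuous G).isCompact_eventSet
      (continuous G).refMeasure_compl (fun U hU hne => (continuous G).refMeasure_pos hU hne)
      (f := fun n => detectionDensity sc.K (ρ n) (V n) h₀ G)
      (f' := detectionDensity sc.K ρ' V' h₀ G)
      (fun n => sc.continuousOn_detectionDensity (hf n) hh G)
      (sc.continuousOn_detectionDensity hf' hh G) (fun ε hε => by
        obtain ⟨d, hd, h⟩ := sc.exists_modulus_detectionDensity hh G A hε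
        exact ⟨d, hd, fun n x hx y hy hxy => h _ _ (hf n) (hA n) x hx y hy hxy⟩) (fun φ => by
        have hint : ∀ (ρ : Measure SpaceTime) [IsFiniteMeasure ρ] (V : SpaceTime → E3),
            IsFlow sc.T sc.D ρ V → ∫ e, φ e ∂detected sc.K G.law ρ =
              ((volume : Measure E3).toSphere.real univ)⁻¹ *
              ∫ e, φ e * detectionDensity sc.K ρ V h₀ G e ∂(continuous G).refMeasure := by
          intro ρ _ V hf
          rw [sc.detected_eq_withDensity hf hh G, integral_withDensity_eq_integral_toReal_smul₀,
            ← integral_const_mul]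
          · refine integral_congr_ae ?_
            filter_upwards [sc.ae_prod_mem] with e he
            rw [ENNReal.toReal_mul, ENNReal.toReal_ofReal
              (sc.detectionDensity_nonneg ρ V h₀ G he), hcω, ENNReal.toReal_ofReal
              (by positivity), smul_eq_mul]
            ring
          · refine AEMeasurable.const_mul (AEMeasurable.ennreal_ofReal ?_) _
            rw [← Measure.restrict_eq_self_of_ae_mem sc.ae_prod_mem]
            exact (sc.continuousOn_detectionDensity hf hh G).aemeasurable
              (continuous G).isCompact_eventSet.isClosed.measurableSet
          · refine Eventually.of_forall fun e => ?_
            rw [hcω]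
            exact ENNReal.mul_lt_top ENNReal.ofReal_lt_top ENNReal.ofReal_lt_top
        have h1 := sc.tendsto_integral_detected G.law_compl_ball hlim
          (fun n => (hf n).carried) hf'.carried φ
        simp only [hint _ _ (hf _), hint _ _ hf'] at h1
        have h2 := h1.const_mul ((volume : Measure E3).toSphere.real univ)
        simpa only [mul_inv_cancel_left₀ hω.ne'] using h2)
      (ε := ε / 2 / (pd / (volume : Measure E3).toSphere.real univ)) (by positivity)
    have hm : ∀ᶠ n in atTop, q * ps / ((surfaceMeasure sc.K).real univ ^ 2 * sc.T) *
        (ρ n : Measure SpaceTime).real univ <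
        q * ps / ((surfaceMeasure sc.K).real univ ^ 2 * sc.T) *
        (ρ' : Measure SpaceTime).real univ + ε / 2 :=
      ((tendsto_mass hlim).const_mul _).eventually_lt_const (by linarith)
    filter_upwards [key, hm] with n h1 h2 e he
    have h3 := mul_le_mul_of_nonneg_left (h1 e he) hc2.le
    rw [mul_add, mul_div_cancel₀ _ hc2.ne'] at h3
    simp only [continuousDensity]
    linarith

end Setting
end

open scoped ENNReal NNReal

noncomputable section

/-! ### Discrete measurements -/

namespace DetectorArray

variable {K : Set E3} (d : DetectorArray K)

/-- The events recorded at a node. -/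
def cell (T : ℝ) (i : Fin d.N) (j k : Fin d.M) : Set Event := d.bin T i ×ˢ d.Γ j ×ˢ d.Γ k

theorem measurableSet_cell (T : ℝ) (i : Fin d.N) (j k : Fin d.M) :
    MeasurableSet (d.cell T i j k) :=
  measurableSet_Ico.prod ((d.measurableSet_Γ j).prod (d.measurableSet_Γ k))

theorem node_injective {T : ℝ} (hT : 0 < T) {i i' : Fin d.N} {j j' k k' : Fin d.M}
    (h : d.node T i j k = d.node T i' j' k') : i = i' ∧ j = j' ∧ k = k' := by
  simp only [node, Prod.mk.injEq] at h
  obtain ⟨h1, h2, h3⟩ := h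
  have hz : ∀ j j', d.z j = d.z j' → j = j' := fun j j' h => by
    by_contra hne
    exact disjoint_left.1 (d.disjoint_Γ hne) (d.z_mem j) (h ▸ d.z_mem j')
  have hN : (0 : ℝ) < d.N := Nat.cast_pos.2 d.N_pos
  refine ⟨?_, hz _ _ h2, hz _ _ h3⟩
  have h4 := mul_right_cancel₀ (div_pos hT hN).ne' h1
  have h5 : ((i : ℕ) : ℝ) = ((i' : ℕ) : ℝ) := by linarith
  exact Fin.ext (Nat.cast_injective h5)

theorem discretize_singleton {T : ℝ} (hT : 0 < T) (μ : Measure Event) (i : Fin d.N)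
    (j k : Fin d.M) : d.discretize T μ {d.node T i j k} = μ (d.cell T i j k) := by
  simp only [discretize, Measure.finsetSum_apply, Measure.smul_apply,
    Measure.dirac_apply' _ (measurableSet_singleton _), smul_eq_mul]
  rw [Finset.sum_eq_single i, Finset.sum_eq_single j, Finset.sum_eq_single k]
  · simp [cell]
  · intro k' _ hk'
    rw [indicator_of_notMem, mul_zero]
    exact fun h => hk' (d.node_injective hT h).2.2
  · simp
  · intro j' _ hj'
    refine Finset.sum_eq_zero fun k' _ => ?_
    rw [indicator_of_notMem, mul_zero]
    exact fun h => hj' (d.node_injective hT h).2.1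
  · simp
  · intro i' _ hi'
    refine Finset.sum_eq_zero fun j' _ => Finset.sum_eq_zero fun k' _ => ?_
    rw [indicator_of_notMem, mul_zero]
    exact fun h => hi' (d.node_injective hT h).1
  · simp

theorem discretize_smul_add (T : ℝ) (a b : ℝ≥0∞) (μ μ' : Measure Event) :
    a • d.discretize T μ + b • d.discretize T μ' = d.discretize T (a • μ + b • μ') := by
  simp only [discretize, Finset.smul_sum, ← Finset.sum_add_distrib, smul_smul, ← add_smul]
  rfl

theorem disjoint_bin {T : ℝ} (hT : 0 < T) {i i' : Fin d.N} (h : i ≠ i') :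
    Disjoint (d.bin T i) (d.bin T i') := by
  wlog hlt : i < i' generalizing i i'
  · exact (this h.symm (lt_of_le_of_ne (not_lt.1 hlt) h.symm)).symm
  rw [disjoint_left]
  intro t ht ht'
  have hN : (0 : ℝ) < d.N := Nat.cast_pos.2 d.N_pos
  have h1 : ((i : ℕ) : ℝ) + 1 ≤ ((i' : ℕ) : ℝ) := by
    exact_mod_cast hlt
  have h2 := mul_le_mul_of_nonneg_right h1 (div_pos hT hN).le
  exact absurd (ht.2.trans_le h2) (not_lt.2 ht'.1)

theorem iUnion_bin {T : ℝ} (hT : 0 < T) : ⋃ i, d.bin T i = Ico 0 T := by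
  have hN : (0 : ℝ) < d.N := Nat.cast_pos.2 d.N_pos
  have hτ := div_pos hT hN
  ext t
  simp only [mem_iUnion, bin, mem_Ico]
  constructor
  · rintro ⟨i, h1, h2⟩
    refine ⟨(by positivity : (0 : ℝ) ≤ (i : ℝ) * (T / d.N)).trans h1, h2.trans_le ?_⟩
    have : ((i : ℕ) : ℝ) + 1 ≤ d.N := by exact_mod_cast i.2
    calc ((i : ℝ) + 1) * (T / d.N) ≤ d.N * (T / d.N) := by gcongr
      _ = T := by field_simp
  · rintro ⟨h1, h2⟩
    have h3 : 0 ≤ t / (T / d.N) := by positivity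
    have h4 : t / (T / d.N) < d.N := by
      rw [div_lt_iff₀ hτ]; field_simp; exact h2
    refine ⟨⟨⌊t / (T / d.N)⌋₊, (Nat.floor_lt h3).2 h4⟩, ?_, ?_⟩
    · rw [← le_div_iff₀ hτ]; exact Nat.floor_le h3
    · rw [← div_lt_iff₀ hτ]; exact Nat.lt_floor_add_one _

/-- The cells partition `[0, T) × ∂K × ∂K`. The bins are half open, so the final time `T` belongs to
none of them and has to be a null set of `μ`. -/
theorem discretize_univ {T : ℝ} (hT : 0 < T) {μ : Measure Event}
    (hμ : μ (Ico 0 T ×ˢ frontier K ×ˢ frontier K)ᶜ = 0) : d.discretize T μ univ = μ univ := by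
  have h1 : μ univ = μ (⋃ p : Fin d.N × Fin d.M × Fin d.M, d.cell T p.1 p.2.1 p.2.2) := by
    have : (⋃ p : Fin d.N × Fin d.M × Fin d.M, d.cell T p.1 p.2.1 p.2.2) =
        Ico 0 T ×ˢ frontier K ×ˢ frontier K := by
      rw [← d.iUnion_bin hT, ← d.iUnion_Γ]
      ext e
      simp only [cell, mem_iUnion, mem_prod, Prod.exists]
      constructor
      · rintro ⟨i, j, k, h1, h2, h3⟩; exact ⟨⟨i, h1⟩, ⟨j, h2⟩, ⟨k, h3⟩⟩
      · rintro ⟨⟨i, h1⟩, ⟨j, h2⟩, ⟨k, h3⟩⟩; exact ⟨i, j, k, h1, h2, h3⟩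
    rw [this, ← univ_inter (Ico 0 T ×ˢ _), measure_inter_conull hμ]
  rw [h1, measure_iUnion, tsum_fintype, Fintype.sum_prod_type]
  · simp only [Fintype.sum_prod_type, discretize, Measure.finsetSum_apply, Measure.smul_apply,
      measure_univ, smul_eq_mul, mul_one]
    rfl
  · intro p p' hne
    rw [Function.onFun, disjoint_left]
    rintro e ⟨h1, h2, h3⟩ ⟨h1', h2', h3'⟩
    have e1 : p.1 = p'.1 := by
      by_contra h
      exact disjoint_left.1 (d.disjoint_bin hT h) h1 h1'
    have e2 : p.2.1 = p'.2.1 := by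
      by_contra h
      exact disjoint_left.1 (d.disjoint_Γ h) h2 h2'
    have e3 : p.2.2 = p'.2.2 := by
      by_contra h
      exact disjoint_left.1 (d.disjoint_Γ h) h3 h3'
    exact hne (Prod.ext e1 (Prod.ext e2 e3))
  · exact fun p => d.measurableSet_cell T _ _ _

end DetectorArray

namespace Setting

variable {sc : Scanner} (d : DetectorArray sc.K)

/-- Distinct indices give distinct nodes, so `nodeMeasure d` counts each node once and the density
at a node is the mass of that point. -/
theorem discretize_eq_withDensity (μ : Measure Event) [IsFiniteMeasure μ] :
    d.discretize sc.T μ = (nodeMeasure d).withDensity fun e =>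
      ENNReal.ofReal (d.discretize sc.T μ {e}).toReal := by
  ext s hs
  rw [withDensity_apply _ hs, ← lintegral_indicator hs, nodeMeasure]
  simp only [lintegral_finsetSum_measure, lintegral_dirac]
  simp only [DetectorArray.discretize, Measure.finsetSum_apply, Measure.smul_apply,
    Measure.dirac_apply' _ hs]
  refine Finset.sum_congr rfl fun i _ => Finset.sum_congr rfl fun j _ =>
    Finset.sum_congr rfl fun k _ => ?_
  by_cases h : d.node sc.T i j k ∈ s
  · rw [indicator_of_mem h, indicator_of_mem h]
    have := d.discretize_singleton sc.T_pos μ i j k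
    simp only [DetectorArray.discretize, Measure.finsetSum_apply, Measure.smul_apply] at this
    rw [this, ENNReal.ofReal_toReal (measure_ne_top _ _), DetectorArray.cell]
    simp
  · rw [indicator_of_notMem h, indicator_of_notMem h, smul_zero]

end Setting

namespace Scanner

variable (sc : Scanner) (d : DetectorArray sc.K) {γ : Measure E3} [IsProbabilityMeasure γ]
  {ρ : Measure SpaceTime} [IsFiniteMeasure ρ] {V : SpaceTime → E3}

theorem isFiniteMeasure_detected (hγ : γ (Metric.ball 0 (sc.δ / 2))ᶜ = 0)
    (hρ : ρ (Icc 0 sc.T ×ˢ sc.D)ᶜ = 0) : IsFiniteMeasure (detected sc.K γ ρ) :=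
  ⟨by rw [sc.detected_univ hγ hρ]; exact measure_lt_top _ _⟩

/-- Closing a cell adds only the right end point of the time bin and the relative boundaries of the
two detectors. All three are null, the first since the time marginal is absolutely continuous, the
others since detection points have no mass on sets of zero area. This is the continuity set
condition of the portmanteau theorem. -/
theorem detected_closure_cell (hγ : γ (Metric.ball 0 (sc.δ / 2))ᶜ = 0)
    (hf : IsFlow sc.T sc.D ρ V) (i : Fin d.N) (j k : Fin d.M) :
    detected sc.K γ ρ (closure (d.cell sc.T i j k)) = detected sc.K γ ρ (d.cell sc.T i j k) := by
  have hN : (0 : ℝ) < d.N := Nat.cast_pos.2 d.N_pos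
  have hτ := div_pos sc.T_pos hN
  refine le_antisymm ?_ (measure_mono subset_closure)
  set t₁ := ((i : ℝ) + 1) * (sc.T / d.N) with ht₁
  set Γ' : Fin d.M → Set E3 := fun j => closure (d.Γ j) ∩ closure (frontier sc.K \ d.Γ j) with hΓ'
  have hsub : closure (d.cell sc.T i j k) ⊆ d.cell sc.T i j k ∪ ({e | e.1 ∈ ({t₁} : Set ℝ)} ∪
      ({e | e.2.1 ∈ Γ' j} ∪ {e | e.2.2 ∈ Γ' k})) := by
    have hG : ∀ j, closure (d.Γ j) ⊆ d.Γ j ∪ Γ' j := by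
      intro j a ha
      by_cases h : a ∈ d.Γ j
      · exact Or.inl h
      · refine Or.inr ⟨ha, subset_closure ⟨?_, h⟩⟩
        have : d.Γ j ⊆ frontier sc.K := d.iUnion_Γ ▸ subset_iUnion d.Γ j
        exact closure_minimal this isClosed_frontier ha
    rintro ⟨t, a, b⟩ he
    rw [DetectorArray.cell, closure_prod_eq, closure_prod_eq, DetectorArray.bin, closure_Ico
      (by nlinarith)] at he
    obtain ⟨ht, ha, hb⟩ := he
    rcases hG j ha with ha' | ha'
    · rcases hG k hb with hb' | hb'
      · rcases ht.2.lt_or_eq with ht' | ht'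
        · exact Or.inl ⟨⟨ht.1, ht'⟩, ha', hb'⟩
        · exact Or.inr (Or.inl ht')
      · exact Or.inr (Or.inr (Or.inr hb'))
    · exact Or.inr (Or.inr (Or.inl ha'))
  have hΓm : ∀ j, MeasurableSet (Γ' j) := fun j =>
    (isClosed_closure.inter isClosed_closure).measurableSet
  have n1 : detected sc.K γ ρ {e | e.1 ∈ ({t₁} : Set ℝ)} = 0 := by
    rw [sc.detected_time hγ hf.carried (measurableSet_singleton _)]
    exact hf.marginal (by simp)
  have n2 := sc.detected_fst_null hγ hf.carried (hΓm j) (d.null_boundary j)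
  have n3 := sc.detected_snd_null hγ hf.carried (hΓm k) (d.null_boundary k)
  calc detected sc.K γ ρ (closure (d.cell sc.T i j k)) ≤ _ := measure_mono hsub
    _ ≤ detected sc.K γ ρ (d.cell sc.T i j k) + 0 := by
      refine (measure_union_le _ _).trans (add_le_add le_rfl ?_)
      exact le_of_eq (measure_union_null n1 (measure_union_null n2 n3))
    _ = _ := add_zero _

theorem detected_compl (hγ : γ (Metric.ball 0 (sc.δ / 2))ᶜ = 0)
    (hf : IsFlow sc.T sc.D ρ V) :
    detected sc.K γ ρ (Ico 0 sc.T ×ˢ frontier sc.K ×ˢ frontier sc.K)ᶜ = 0 := by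
  have hsub : (Ico 0 sc.T ×ˢ frontier sc.K ×ˢ frontier sc.K)ᶜ ⊆
      {e : Event | e.1 ∈ (Ico 0 sc.T)ᶜ} ∪
        ({e | e.2.1 ∈ (frontier sc.K)ᶜ} ∪ {e | e.2.2 ∈ (frontier sc.K)ᶜ}) := by
    intro e he
    by_contra hn
    simp only [mem_union, mem_ofPred_eq, not_or, mem_compl_iff, not_not] at hn
    exact he ⟨hn.1, hn.2.1, hn.2.2⟩
  have hσ : surfaceMeasure sc.K (frontier sc.K)ᶜ = 0 := ae_mem_frontier sc.K
  have hm : MeasurableSet (frontier sc.K)ᶜ := isClosed_frontier.measurableSet.compl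
  refine measure_mono_null hsub (measure_union_null ?_ (measure_union_null
    (sc.detected_fst_null hγ hf.carried hm hσ) (sc.detected_snd_null hγ hf.carried hm hσ)))
  rw [sc.detected_time hγ hf.carried measurableSet_Ico.compl,
    hf.map_fst_eq sc.T_pos sc.isCompact_D.isBounded, Measure.smul_apply,
    Measure.restrict_apply measurableSet_Ico.compl]
  have : (Ico 0 sc.T)ᶜ ∩ Icc 0 sc.T ⊆ {sc.T} := fun t ht =>
    le_antisymm ht.2.2 (not_lt.1 fun h => ht.1 ⟨ht.2.1, h⟩)
  rw [measure_mono_null this (by simp), smul_zero]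

theorem scatterEvents_compl (hf : IsFlow sc.T sc.D ρ V) :
    scatterEvents sc.K ρ (Ico 0 sc.T ×ˢ frontier sc.K ×ˢ frontier sc.K)ᶜ = 0 := by
  have := sc.body.isFiniteMeasure_surfaceMeasure
  rw [sc.scatterEvents_eq hf, ← restrict_Ico_eq_restrict_Icc, Measure.smul_apply]
  refine smul_eq_zero_of_right _ ?_
  have hm : MeasurableSet (frontier sc.K) := isClosed_frontier.measurableSet
  refine (Measure.ae_prod_mem_iff_ae_ae_mem (measurableSet_Ico.prod (hm.prod hm))).2 ?_
  have h2 : ∀ᵐ p ∂(surfaceMeasure sc.K).prod (surfaceMeasure sc.K),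
      p ∈ frontier sc.K ×ˢ frontier sc.K :=
    (Measure.ae_prod_mem_iff_ae_ae_mem (hm.prod hm)).2 (by
      filter_upwards [ae_mem_frontier sc.K] with a ha
      filter_upwards [ae_mem_frontier sc.K] with b hb using ⟨ha, hb⟩)
  filter_upwards [ae_restrict_mem measurableSet_Ico] with t ht
  filter_upwards [h2] with p hp using ⟨ht, hp⟩

/-- The intensity of scatterless detections as a finite measure. -/
def finiteDetected (hγ : γ (Metric.ball 0 (sc.δ / 2))ᶜ = 0)
    (hρ : ρ (Icc 0 sc.T ×ˢ sc.D)ᶜ = 0) : FiniteMeasure Event :=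
  ⟨detected sc.K γ ρ, sc.isFiniteMeasure_detected hγ hρ⟩

theorem tendsto_detected (hγ : γ (Metric.ball 0 (sc.δ / 2))ᶜ = 0)
    {ρ : ℕ → FiniteMeasure SpaceTime} {ρ' : FiniteMeasure SpaceTime}
    (hlim : Tendsto ρ atTop (𝓝 ρ'))
    (hρ : ∀ n, (ρ n : Measure SpaceTime) (Icc 0 sc.T ×ˢ sc.D)ᶜ = 0)
    (hρ' : (ρ' : Measure SpaceTime) (Icc 0 sc.T ×ˢ sc.D)ᶜ = 0) :
    Tendsto (fun n => sc.finiteDetected hγ (hρ n)) atTop (𝓝 (sc.finiteDetected hγ hρ')) :=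
  FiniteMeasure.tendsto_iff_forall_integral_tendsto.2 fun φ =>
    sc.tendsto_integral_detected hγ hlim hρ hρ' φ

theorem eventually_detected_cell_le (hγ : γ (Metric.ball 0 (sc.δ / 2))ᶜ = 0)
    {ρ : ℕ → FiniteMeasure SpaceTime} {ρ' : FiniteMeasure SpaceTime}
    (hlim : Tendsto ρ atTop (𝓝 ρ'))
    (hρ : ∀ n, (ρ n : Measure SpaceTime) (Icc 0 sc.T ×ˢ sc.D)ᶜ = 0)
    (hf : IsFlow sc.T sc.D ρ' V) (i : Fin d.N) (j k : Fin d.M) {ε : ℝ} (hε : 0 < ε) :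
    ∀ᶠ n in atTop, (detected sc.K γ (ρ n : Measure SpaceTime)).real (d.cell sc.T i j k) ≤
      (detected sc.K γ (ρ' : Measure SpaceTime)).real (d.cell sc.T i j k) + ε := by
  have h1 := FiniteMeasure.limsup_measure_closed_le_of_tendsto
    (sc.tendsto_detected hγ hlim hρ hf.carried) (isClosed_closure (s := d.cell sc.T i j k))
  have hfin := sc.isFiniteMeasure_detected hγ hf.carried
  change limsup (fun n => detected sc.K γ (ρ n : Measure SpaceTime) (closure (d.cell sc.T i j k)))
    atTop ≤ detected sc.K γ (ρ' : Measure SpaceTime) (closure (d.cell sc.T i j k)) at h1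
  rw [sc.detected_closure_cell d hγ hf] at h1
  have hε' : ENNReal.ofReal ε ≠ 0 := by simpa using hε
  have h2 := eventually_lt_of_limsup_lt (h1.trans_lt
    (ENNReal.lt_add_right (measure_ne_top _ _) hε'))
  filter_upwards [h2] with n hn
  have h3 := ENNReal.toReal_mono (ENNReal.add_ne_top.2 ⟨measure_ne_top _ _, ENNReal.ofReal_ne_top⟩)
    ((measure_mono subset_closure).trans hn.le)
  rwa [ENNReal.toReal_add (measure_ne_top _ _) ENNReal.ofReal_ne_top,
    ENNReal.toReal_ofReal hε.le] at h3

theorem scatterEvents_cell (hf : IsFlow sc.T sc.D ρ V) (i : Fin d.N) (j k : Fin d.M) :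
    (scatterEvents sc.K ρ).real (d.cell sc.T i j k) = ρ.real univ *
      (((surfaceMeasure sc.K).real univ ^ 2 * sc.T)⁻¹ *
        (((volume : Measure ℝ).restrict (Icc 0 sc.T)).prod
        ((surfaceMeasure sc.K).prod (surfaceMeasure sc.K))).real (d.cell sc.T i j k)) := by
  rw [sc.scatterEvents_eq hf, measureReal_def, Measure.smul_apply, smul_eq_mul, ENNReal.toReal_mul,
    ENNReal.toReal_mul, ENNReal.toReal_inv, ENNReal.toReal_pow, ENNReal.toReal_div,
    ENNReal.toReal_ofReal sc.T_pos.le, ← measureReal_def, ← measureReal_def, ← measureReal_def,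
    mul_inv]
  ring

theorem prod_cell_pos (i : Fin d.N) (j k : Fin d.M) :
    0 < (((volume : Measure ℝ).restrict (Icc 0 sc.T)).prod
      ((surfaceMeasure sc.K).prod (surfaceMeasure sc.K))) (d.cell sc.T i j k) := by
  have := sc.body.isFiniteMeasure_surfaceMeasure
  have hN : (0 : ℝ) < d.N := Nat.cast_pos.2 d.N_pos
  have hτ := div_pos sc.T_pos hN
  rw [DetectorArray.cell, Measure.prod_prod, Measure.prod_prod]
  refine ENNReal.mul_pos ?_ (ENNReal.mul_pos (d.pos_area j).ne' (d.pos_area k).ne').ne'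
  have hc : d.binCentre sc.T i ∈ Ioo ((i : ℝ) * (sc.T / d.N)) (((i : ℝ) + 1) * (sc.T / d.N)) := by
    rw [DetectorArray.binCentre]
    constructor <;> nlinarith
  have hI : d.binCentre sc.T i ∈ Ico 0 sc.T := by
    rw [← d.iUnion_bin sc.T_pos]
    exact mem_iUnion.2 ⟨i, Ioo_subset_Ico_self hc⟩
  exact ((Setting.volume_restrict_Icc_pos sc.T_pos (Ico_subset_Icc_self hI) isOpen_Ioo hc).trans_le
    (measure_mono Ioo_subset_Ico_self)).ne'

end Scanner

theorem exists_pos_le_of_finite {ι : Type*} [Finite ι] {g : ι → ℝ} (hg : ∀ i, 0 < g i) :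
    ∃ c > 0, ∀ i, c ≤ g i := by
  cases isEmpty_or_nonempty ι
  · exact ⟨1, one_pos, fun i => isEmptyElim i⟩
  · obtain ⟨i, hi⟩ := Finite.exists_min g
    exact ⟨g i, hg i, hi⟩

namespace Setting

variable {sc : Scanner}

/-- The number of recorded events at a point. -/
def eventCount (st : Setting sc) (ps pd q : ℝ) (ρ : Measure SpaceTime) (_ : SpaceTime → E3)
    (e : Event) : ℝ := (st.Aq ps pd q ρ {e}).toReal

/-- Continuity on the finite node set is automatic. The lower bound is again scattering alone, now
as a minimum of finitely many positive weights, and the eventual upper bound is the portmanteau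
theorem on closed cells together with convergence of the masses. -/
theorem hasEventDensity_discrete (st : Setting sc) (d : DetectorArray sc.K)
    (hrec : st.record = d.discretize sc.T) (href : st.refMeasure = nodeMeasure d)
    (hset : st.eventSet = nodeSet d) {ps pd q : ℝ} (hps : 0 < ps) (hpd : 0 < pd) (hq : 0 < q) :
    st.HasEventDensity ps pd q (st.eventCount ps pd q) := by
  have hσf := sc.body.isFiniteMeasure_surfaceMeasure
  have := st.isProbabilityMeasure_rangeLaw
  have hγ := st.rangeLaw_compl_ball
  have hT := sc.T_pos
  have hσ : 0 < (surfaceMeasure sc.K).real univ :=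
    ENNReal.toReal_pos sc.surfaceMeasure_univ_pos.ne' (measure_ne_top _ _)
  set μ : Measure SpaceTime → Measure Event := fun ρ => ENNReal.ofReal (q * ps) •
    scatterEvents sc.K ρ + ENNReal.ofReal pd • detected sc.K st.rangeLaw ρ with hμ
  have hAq : ∀ ρ, st.Aq ps pd q ρ = d.discretize sc.T (μ ρ) := fun ρ => by
    rw [Aq, As, Ad, hrec, DetectorArray.discretize_smul_add]
    rfl
  have hfs : ∀ (ρ : Measure SpaceTime) [IsFiniteMeasure ρ], IsFiniteMeasure (scatterEvents sc.K ρ) :=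
    fun ρ _ => ⟨by rw [sc.scatterEvents_univ]; exact measure_lt_top _ _⟩
  have hfin : ∀ (ρ : Measure SpaceTime) [IsFiniteMeasure ρ] (V : SpaceTime → E3),
      IsFlow sc.T sc.D ρ V → IsFiniteMeasure (μ ρ) := fun ρ _ V hf => by
    have := sc.isFiniteMeasure_detected hγ hf.carried
    have := hfs ρ
    have := Measure.smul_finite (scatterEvents sc.K ρ) (ENNReal.ofReal_ne_top (r := q * ps))
    have := Measure.smul_finite (detected sc.K st.rangeLaw ρ) (ENNReal.ofReal_ne_top (r := pd))
    rw [hμ]; infer_instance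
  have hval : ∀ (ρ : Measure SpaceTime) [IsFiniteMeasure ρ] (V : SpaceTime → E3),
      IsFlow sc.T sc.D ρ V → ∀ i j k, st.eventCount ps pd q ρ V (d.node sc.T i j k) =
        q * ps * (scatterEvents sc.K ρ).real (d.cell sc.T i j k) +
          pd * (detected sc.K st.rangeLaw ρ).real (d.cell sc.T i j k) := by
    intro ρ _ V hf i j k
    have := sc.isFiniteMeasure_detected hγ hf.carried
    have := hfs ρ
    rw [eventCount, hAq, d.discretize_singleton hT, hμ, Measure.add_apply, Measure.smul_apply,
      Measure.smul_apply, smul_eq_mul, smul_eq_mul, ENNReal.toReal_add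
      (ENNReal.mul_ne_top ENNReal.ofReal_ne_top (measure_ne_top _ _))
      (ENNReal.mul_ne_top ENNReal.ofReal_ne_top (measure_ne_top _ _)), ENNReal.toReal_mul,
      ENNReal.toReal_mul, ENNReal.toReal_ofReal (by positivity), ENNReal.toReal_ofReal hpd.le]
    rfl
  -- `w p` is the scattering contribution to the count in a cell per unit mass of `ρ`.
  set w : Fin d.N × Fin d.M × Fin d.M → ℝ := fun p => q * ps *
    (((surfaceMeasure sc.K).real univ ^ 2 * sc.T)⁻¹ *
      (((volume : Measure ℝ).restrict (Icc 0 sc.T)).prod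
      ((surfaceMeasure sc.K).prod (surfaceMeasure sc.K))).real (d.cell sc.T p.1 p.2.1 p.2.2)) with hw
  have hw0 : ∀ p, 0 < w p := fun p => by
    have : 0 < (((volume : Measure ℝ).restrict (Icc 0 sc.T)).prod
      ((surfaceMeasure sc.K).prod (surfaceMeasure sc.K))).real (d.cell sc.T p.1 p.2.1 p.2.2) :=
      ENNReal.toReal_pos (sc.prod_cell_pos d _ _ _).ne' (measure_ne_top _ _)
    positivity
  refine ⟨fun ρ _ V hf => ?_, fun ρ _ V hf => ?_, ?_, ⟨q * ps + pd, by positivity, ?_⟩, ?_⟩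
  · have := hfin ρ V hf
    rw [href, hAq]
    conv_lhs => rw [discretize_eq_withDensity d (μ ρ)]
    simp only [eventCount, hAq]
  · rw [hset, nodeSet_eq_range]
    exact (finite_range _).continuousOn _
  · obtain ⟨c, hc, hcw⟩ := exists_pos_le_of_finite hw0
    refine ⟨c, hc, fun ρ _ V hf e he => ?_⟩
    rw [hset] at he
    obtain ⟨i, j, k, rfl⟩ := he
    rw [hval ρ V hf, sc.scatterEvents_cell d hf]
    have h1 := mul_le_mul_of_nonneg_right (hcw (i, j, k)) (measureReal_nonneg (μ := ρ) (s := univ))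
    have h2 : 0 ≤ pd * (detected sc.K st.rangeLaw ρ).real (d.cell sc.T i j k) := by positivity
    rw [hw] at h1
    simp only at h1
    linarith
  · intro ρ _ V hf e he
    rw [hset] at he
    obtain ⟨i, j, k, rfl⟩ := he
    have := sc.isFiniteMeasure_detected hγ hf.carried
    have := hfs ρ
    rw [hval ρ V hf, add_mul]
    have hm := measureReal_le_massEnergy ρ V
    refine add_le_add (mul_le_mul_of_nonneg_left (le_trans ?_ hm) (by positivity))
      (mul_le_mul_of_nonneg_left (le_trans ?_ hm) hpd.le)
    · refine (measureReal_mono (subset_univ _)).trans (le_of_eq ?_)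
      rw [measureReal_def, sc.scatterEvents_univ]; rfl
    · refine (measureReal_mono (subset_univ _)).trans (le_of_eq ?_)
      rw [measureReal_def, sc.detected_univ hγ hf.carried]; rfl
  · intro ρ V ρ' V' A hf hA hf' hlim ε hε
    have hn : ∀ p : Fin d.N × Fin d.M × Fin d.M, ∀ᶠ n in atTop,
        st.eventCount ps pd q (ρ n) (V n) (d.node sc.T p.1 p.2.1 p.2.2) ≤
        st.eventCount ps pd q ρ' V' (d.node sc.T p.1 p.2.1 p.2.2) + ε := by
      rintro ⟨i, j, k⟩
      have h1 := sc.eventually_detected_cell_le d hγ hlim (fun n => (hf n).carried) hf' i j k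
        (ε := ε / 2 / pd) (by positivity)
      have h2 : ∀ᶠ n in atTop, w (i, j, k) * (ρ n : Measure SpaceTime).real univ <
          w (i, j, k) * (ρ' : Measure SpaceTime).real univ + ε / 2 :=
        ((tendsto_mass hlim).const_mul _).eventually_lt_const (by linarith)
      filter_upwards [h1, h2] with n h1 h2
      rw [hval _ _ (hf n), hval _ _ hf', sc.scatterEvents_cell d (hf n),
        sc.scatterEvents_cell d hf']
      have h3 := mul_le_mul_of_nonneg_left h1 hpd.le
      rw [mul_add, mul_div_cancel₀ _ hpd.ne'] at h3
      rw [hw] at h2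
      simp only at h2
      linarith
    filter_upwards [eventually_all.2 hn] with n hn e he
    rw [hset] at he
    obtain ⟨i, j, k, rfl⟩ := he
    exact hn (i, j, k)

theorem exists_hasEventDensity (st : Setting sc) {ps pd q : ℝ} (hps : 0 < ps) (hpd : 0 < pd)
    (hq : 0 < q) : ∃ f, st.HasEventDensity ps pd q f := by
  obtain ⟨h₀, hh⟩ := exists_isTimeBump sc.T_pos
  cases st with
  | continuous G => exact ⟨_, hasEventDensity_continuous G hh hps hpd hq⟩
  | discrete G d => exact ⟨_, hasEventDensity_discrete _ d rfl rfl rfl hps hpd hq⟩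
  | discreteNoRange d => exact ⟨_, hasEventDensity_discrete _ d rfl rfl rfl hps hpd hq⟩

theorem Aq_univ (st : Setting sc) {ps pd q : ℝ} (hps : 0 < ps) (hpd : 0 < pd) (hq : 0 < q)
    {ρ : Measure SpaceTime} [IsFiniteMeasure ρ] {V : SpaceTime → E3} (hf : IsFlow sc.T sc.D ρ V) :
    st.Aq ps pd q ρ univ = ENNReal.ofReal (q * ps + pd) * ρ univ := by
  have := st.isProbabilityMeasure_rangeLaw
  have hγ := st.rangeLaw_compl_ball
  have h1 : st.As ρ univ = ρ univ := by
    rw [As, ← sc.scatterEvents_univ ρ]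
    cases st with
    | continuous G => rfl
    | discrete G d => exact d.discretize_univ sc.T_pos (sc.scatterEvents_compl hf)
    | discreteNoRange d => exact d.discretize_univ sc.T_pos (sc.scatterEvents_compl hf)
  have h2 : st.Ad ρ univ = ρ univ := by
    rw [Ad, ← sc.detected_univ hγ hf.carried]
    cases st with
    | continuous G => rfl
    | discrete G d => exact d.discretize_univ sc.T_pos (sc.detected_compl hγ hf)
    | discreteNoRange d => exact d.discretize_univ sc.T_pos (sc.detected_compl hγ hf)
  rw [Aq, Measure.add_apply, Measure.smul_apply, Measure.smul_apply, h1, h2, smul_eq_mul,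
    smul_eq_mul, ENNReal.ofReal_add (by positivity) hpd.le, add_mul]

end Setting
end

open scoped ENNReal NNReal

noncomputable section

/-! ### Weak limits of measures and of square integrable vector fields -/

section

variable {X : Type*} [MetricSpace X] [CompleteSpace X] [SecondCountableTopology X]
  [MeasurableSpace X] [BorelSpace X]

/-- The compactness theorem for tight families concerns probability measures, so the mass and the
normalized measure are extracted separately. The zero measure gets a Dirac measure as its
normalization. -/
theorem exists_normalization {K : Set X} (hne : K.Nonempty) (μ : FiniteMeasure X)
    (hμ : (μ : Measure X) Kᶜ = 0) (hK : MeasurableSet K) : ∃ p : ProbabilityMeasure X,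
    (p : Measure X) Kᶜ = 0 ∧ μ = μ.mass • p.toFiniteMeasure := by
  obtain ⟨x, hx⟩ := hne
  have : Nonempty X := ⟨x⟩
  by_cases h0 : μ = 0
  · refine ⟨⟨Measure.dirac x, inferInstance⟩, ?_, ?_⟩
    · change Measure.dirac x Kᶜ = 0
      rw [Measure.dirac_apply' _ hK.compl]
      exact indicator_of_notMem (not_not.2 hx) _
    · simp [h0]
  · refine ⟨μ.normalize, ?_, μ.self_eq_mass_smul_normalize⟩
    rw [μ.toMeasure_normalize_eq_of_nonzero h0]
    simp [hμ]

theorem exists_subseq_tendsto_finiteMeasure {K : Set X} (hK : IsCompact K) (hne : K.Nonempty)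
    {C : ℝ≥0} (μ : ℕ → FiniteMeasure X) (hC : ∀ n, (μ n).mass ≤ C)
    (hμ : ∀ n, (μ n : Measure X) Kᶜ = 0) :
    ∃ (k : ℕ → ℕ) (μ' : FiniteMeasure X), StrictMono k ∧
      Tendsto (fun n => μ (k n)) atTop (𝓝 μ') := by
  choose p hp hpm using fun n => exists_normalization hne (μ n) (hμ n) hK.measurableSet
  set S : Set (ProbabilityMeasure X) := {q | (q : Measure X) Kᶜ = 0} with hS
  have htight : IsTightMeasureSet {((q : ProbabilityMeasure X) : Measure X) | q ∈ S} := by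
    rw [isTightMeasureSet_iff_exists_isCompact_measure_compl_le]
    refine fun ε _ => ⟨K, hK, ?_⟩
    rintro _ ⟨q, hq, rfl⟩
    rw [show (q : Measure X) Kᶜ = 0 from hq]
    exact zero_le
  obtain ⟨q, -, k₁, hk₁, hq⟩ := (isCompact_closure_of_isTightMeasureSet htight).tendsto_subseq
    (x := p) fun n => subset_closure (hp n)
  obtain ⟨m, -, k₂, hk₂, hm⟩ := (isCompact_Icc (a := (0 : ℝ≥0)) (b := C)).tendsto_subseq
    (x := fun n => (μ (k₁ n)).mass) fun n => ⟨zero_le, hC _⟩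
  refine ⟨k₁ ∘ k₂, m • q.toFiniteMeasure, hk₁.comp hk₂, ?_⟩
  have h1 : Tendsto (fun n => (p (k₁ (k₂ n))).toFiniteMeasure) atTop (𝓝 q.toFiniteMeasure) :=
    (ProbabilityMeasure.toFiniteMeasure_continuous.tendsto q).comp
      (hq.comp hk₂.tendsto_atTop)
  have h2 := hm.smul h1
  refine h2.congr fun n => ?_
  exact (hpm _).symm

theorem exists_subseq_tendsto_family {ι : Type*} (s : Finset ι) {K : Set X} (hK : IsCompact K)
    (hne : K.Nonempty) {C : ℝ≥0} (μ : ℕ → ι → FiniteMeasure X) (hC : ∀ n i, (μ n i).mass ≤ C)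
    (hμ : ∀ n i, (μ n i : Measure X) Kᶜ = 0) :
    ∃ k : ℕ → ℕ, StrictMono k ∧ ∀ i ∈ s, ∃ μ' : FiniteMeasure X,
      Tendsto (fun n => μ (k n) i) atTop (𝓝 μ') := by
  classical
  induction s using Finset.induction_on with
  | empty => exact ⟨id, strictMono_id, by simp⟩
  | insert a s _ ih =>
    obtain ⟨k, hk, h⟩ := ih
    obtain ⟨k', μ', hk', h'⟩ := exists_subseq_tendsto_finiteMeasure hK hne
      (fun n => μ (k n) a) (fun n => hC _ _) fun n => hμ _ _
    refine ⟨k ∘ k', hk.comp hk', fun i hi => ?_⟩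
    rcases Finset.mem_insert.1 hi with rfl | hi
    · exact ⟨μ', h'⟩
    · obtain ⟨μ'', h''⟩ := h i hi
      exact ⟨μ'', h''.comp hk'.tendsto_atTop⟩

end

section

variable {X : Type*} [TopologicalSpace X] [SecondCountableTopology X] [T2Space X]
  [MeasurableSpace X] [BorelSpace X]

open BoundedContinuousFunction

theorem norm_toLp_sq (ρ : Measure X) [IsFiniteMeasure ρ] (φ : X →ᵇ ℝ) :
    ‖φ.toLp 2 ρ ℝ‖ ^ 2 = ∫ x, φ x * φ x ∂ρ := by
  rw [← real_inner_self_eq_norm_sq, L2.inner_def]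
  refine integral_congr_ae ?_
  filter_upwards [φ.coeFn_toLp (p := 2) ρ ℝ] with x hx
  rw [hx]; rfl

/-- Pointwise `2 * b * V - b ^ 2 ≤ V ^ 2`; integrate and pass to the limit on both sides. This is
the dual form of the kinetic energy, in which everything on the left is weakly continuous. -/
theorem two_mul_sum_sub_le_of_tendsto {ρ : ℕ → FiniteMeasure X} {ρ' : FiniteMeasure X}
    (hρ : Tendsto ρ atTop (𝓝 ρ')) {V : ℕ → X → E3} (hV : ∀ n, Measurable (V n))
    (hi : ∀ n, Integrable (fun x => ‖V n x‖ ^ 2) (ρ n : Measure X)) {s : ℝ}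
    (hs : Tendsto (fun n => ∫ x, ‖V n x‖ ^ 2 ∂(ρ n : Measure X)) atTop (𝓝 s))
    {l : Fin 3 → (X →ᵇ ℝ) →ₗ[ℝ] ℝ}
    (hl : ∀ i (φ : X →ᵇ ℝ),
      Tendsto (fun n => ∫ x, φ x * V n x i ∂(ρ n : Measure X)) atTop (𝓝 (l i φ)))
    (b : Fin 3 → X →ᵇ ℝ) :
    ∑ i, (2 * l i (b i) - ∫ x, b i x * b i x ∂(ρ' : Measure X)) ≤ s := by
  refine le_of_tendsto_of_tendsto' (tendsto_finsetSum Finset.univ fun i _ =>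
    ((hl i (b i)).const_mul 2).sub
      (FiniteMeasure.tendsto_iff_forall_integral_tendsto.1 hρ (b i * b i))) hs fun n => ?_
  have hVi : ∀ i, Measurable fun x => V n x i := fun i => by
    have := hV n
    fun_prop
  have h1 : ∀ i, Integrable (fun x => b i x * V n x i) (ρ n : Measure X) := fun i => by
    have hn : Integrable (fun x => V n x i) (ρ n : Measure X) := by
      refine ((integrable_const (1 : ℝ)).add (hi n)).mono' (hVi i).aestronglyMeasurable
        (Eventually.of_forall fun x => ?_)
      have := PiLp.norm_apply_le (V n x) i
      change ‖V n x i‖ ≤ 1 + ‖V n x‖ ^ 2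
      nlinarith [sq_nonneg (‖V n x‖ - 1), norm_nonneg (V n x)]
    exact hn.bdd_mul (b i).continuous.aestronglyMeasurable
      (Eventually.of_forall fun x => (b i).norm_coe_le_norm x)
  have h2 : ∀ i, Integrable (fun x => b i x * b i x) (ρ n : Measure X) := fun i =>
    (b i * b i).integrable _
  have h4 : ∀ i, Integrable (fun x => 2 * (b i x * V n x i) - b i x * b i x)
      (ρ n : Measure X) := fun i => ((h1 i).const_mul 2).sub (h2 i)
  have h3 : ∑ i, (2 * ∫ x, b i x * V n x i ∂(ρ n : Measure X) -
      ∫ x, (b i * b i) x ∂(ρ n : Measure X)) =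
      ∫ x, ∑ i, (2 * (b i x * V n x i) - b i x * b i x) ∂(ρ n : Measure X) := by
    rw [integral_finsetSum _ fun i _ => h4 i]
    refine Finset.sum_congr rfl fun i _ => ?_
    rw [integral_sub ((h1 i).const_mul 2) (h2 i), integral_const_mul]
    rfl
  rw [h3]
  refine integral_mono (integrable_finsetSum _ fun i _ => h4 i)
    (hi n) fun x => ?_
  rw [EuclideanSpace.norm_sq_eq]
  refine Finset.sum_le_sum fun i _ => ?_
  rw [Real.norm_eq_abs, sq_abs]
  nlinarith [sq_nonneg (b i x - V n x i)]

/-- Weak limits of square integrable vector fields have square integrable densities. -/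
theorem exists_density_of_tendsto [NormalSpace X] [R1Space X] {ρ : ℕ → FiniteMeasure X}
    {ρ' : FiniteMeasure X} [(ρ' : Measure X).WeaklyRegular]
    (hρ : Tendsto ρ atTop (𝓝 ρ')) {V : ℕ → X → E3} (hV : ∀ n, Measurable (V n))
    (hi : ∀ n, Integrable (fun x => ‖V n x‖ ^ 2) (ρ n : Measure X)) {s : ℝ}
    (hs : Tendsto (fun n => ∫ x, ‖V n x‖ ^ 2 ∂(ρ n : Measure X)) atTop (𝓝 s))
    {l : Fin 3 → (X →ᵇ ℝ) →ₗ[ℝ] ℝ}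
    (hl : ∀ i (φ : X →ᵇ ℝ),
      Tendsto (fun n => ∫ x, φ x * V n x i ∂(ρ n : Measure X)) atTop (𝓝 (l i φ))) :
    ∃ v : Fin 3 → Lp ℝ 2 (ρ' : Measure X),
      (∀ i (φ : X →ᵇ ℝ), ∫ x, φ x * v i x ∂(ρ' : Measure X) = l i φ) ∧
      ∑ i, ∫ x, v i x ^ 2 ∂(ρ' : Measure X) ≤ s := by
  have key := two_mul_sum_sub_le_of_tendsto hρ hV hi hs hl
  set e : (X →ᵇ ℝ) →L[ℝ] Lp ℝ 2 (ρ' : Measure X) :=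
    BoundedContinuousFunction.toLp 2 (ρ' : Measure X) ℝ with he
  have hdense : DenseRange e :=
    BoundedContinuousFunction.toLp_denseRange ℝ (ρ' : Measure X) ℝ (by simp)
  have hnorm : ∀ φ, ‖e φ‖ ^ 2 = ∫ x, φ x * φ x ∂(ρ' : Measure X) := norm_toLp_sq _
  -- Testing with `r • φ` in a single component gives a quadratic polynomial in `r` that is
  -- nonnegative; its discriminant yields the bound. Hence `l i` extends to `L²(ρ')`, and Riesz
  -- representation produces the density `v i`.
  have hbound : ∀ i φ, ‖l i φ‖ ≤ √s * ‖e φ‖ := by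
    intro i φ
    have hq : ∀ r : ℝ, 0 ≤ ‖e φ‖ ^ 2 * (r * r) + (-2 * l i φ) * r + s := by
      intro r
      have h1 := key (Pi.single i (r • φ))
      rw [Finset.sum_eq_single i] at h1
      · simp only [Pi.single_eq_same, map_smul, smul_eq_mul] at h1
        have h2 : ∫ x, (r • φ) x * (r • φ) x ∂(ρ' : Measure X) = r * r * ‖e φ‖ ^ 2 := by
          rw [hnorm, ← integral_const_mul]
          refine integral_congr_ae (Eventually.of_forall fun x => ?_)
          simp only [BoundedContinuousFunction.coe_smul, smul_eq_mul]
          ring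
        rw [h2] at h1
        linarith
      · intro j _ hj
        simp [Pi.single_eq_of_ne hj]
      · simp
    have h3 := discrim_le_zero hq
    rw [discrim] at h3
    have h4 : l i φ ^ 2 ≤ s * ‖e φ‖ ^ 2 := by nlinarith
    rw [Real.norm_eq_abs, ← Real.sqrt_sq (norm_nonneg (e φ)), ← Real.sqrt_mul' _ (sq_nonneg _)]
    exact Real.abs_le_sqrt h4
  set L : Fin 3 → Lp ℝ 2 (ρ' : Measure X) →L[ℝ] ℝ := fun i =>
    (l i).extendOfNorm e.toLinearMap with hL
  have hLe : ∀ i φ, L i (e φ) = l i φ := fun i φ =>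
    LinearMap.extendOfNorm_eq (e := e.toLinearMap) hdense ⟨√s, hbound i⟩ φ
  set v : Fin 3 → Lp ℝ 2 (ρ' : Measure X) := fun i =>
    (InnerProductSpace.toDual ℝ (Lp ℝ 2 (ρ' : Measure X))).symm (L i) with hv
  have hvl : ∀ i φ, inner ℝ (v i) (e φ) = l i φ := fun i φ => by
    rw [hv, InnerProductSpace.toDual_symm_apply, hLe]
  refine ⟨v, fun i φ => ?_, ?_⟩
  · rw [← hvl, L2.inner_def]
    refine integral_congr_ae ?_
    filter_upwards [φ.coeFn_toLp (p := 2) (ρ' : Measure X) ℝ] with x hx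
    rw [he, hx]; rfl
  · have hsq : ∀ i, ∫ x, v i x ^ 2 ∂(ρ' : Measure X) = 2 * inner ℝ (v i) (v i) - ‖v i‖ ^ 2 := by
      intro i
      rw [real_inner_self_eq_norm_sq, two_mul, add_sub_cancel_right,
        ← real_inner_self_eq_norm_sq, L2.inner_def]
      refine integral_congr_ae (Eventually.of_forall fun x => ?_)
      simp [sq]
    -- The dual expression `2 * ⟪v, b⟫ - ‖b‖ ^ 2` attains the energy `‖v‖ ^ 2` at `b = v`, which is
    -- approximated by continuous functions simultaneously in all components.
    have hseq : ∀ i, ∃ u : ℕ → X →ᵇ ℝ, Tendsto (fun n => e (u n)) atTop (𝓝 (v i)) := by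
      intro i
      obtain ⟨w, hw, hlim⟩ := mem_closure_iff_seq_limit.1 (hdense (v i))
      choose u hu using hw
      exact ⟨u, by simpa only [hu] using hlim⟩
    choose u hu using hseq
    simp_rw [hsq]
    refine le_of_tendsto' (tendsto_finsetSum Finset.univ fun i _ =>
      ((tendsto_const_nhds.inner (hu i)).const_mul 2).sub ((hu i).norm.pow 2)) fun n => ?_
    simp_rw [hvl, hnorm]
    exact key fun i => u i n

end
end

open scoped ENNReal NNReal

noncomputable section

/-! ### Weak compactness of flows -/

/-- The portmanteau inequality on the closed set `Z`, combined with convergence of the total masses.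
-/
theorem measure_compl_eq_zero_of_tendsto {X : Type*} [TopologicalSpace X] [HasOuterApproxClosed X]
    [MeasurableSpace X] [BorelSpace X] [OpensMeasurableSpace X] {μ : ℕ → FiniteMeasure X}
    {μ' : FiniteMeasure X}
    (h : Tendsto μ atTop (𝓝 μ')) {Z : Set X} (hZ : IsClosed Z)
    (hμ : ∀ n, (μ n : Measure X) Zᶜ = 0) : (μ' : Measure X) Zᶜ = 0 := by
  have h1 := FiniteMeasure.limsup_measure_closed_le_of_tendsto h hZ
  have h2 : ∀ n, (μ n : Measure X) Z = ((μ n).mass : ℝ≥0∞) := fun n => by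
    rw [FiniteMeasure.ennreal_mass, ← measure_add_measure_compl hZ.measurableSet, hμ, add_zero]
  have h3 : Tendsto (fun n => ((μ n).mass : ℝ≥0∞)) atTop (𝓝 (μ'.mass : ℝ≥0∞)) :=
    ENNReal.tendsto_coe.2 ((FiniteMeasure.continuous_mass.tendsto _).comp h)
  simp_rw [h2] at h1
  rw [h3.limsup_eq, FiniteMeasure.ennreal_mass] at h1
  rw [measure_compl hZ.measurableSet (measure_ne_top _ _), tsub_eq_zero_of_le h1]

namespace IsFlow

variable {T : ℝ} {D : Set E3} {ρ : Measure SpaceTime} {V : SpaceTime → E3} [IsFiniteMeasure ρ]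

theorem integrable_apply (hf : IsFlow T D ρ V) (i : Fin 3) : Integrable (fun p => V p i) ρ := by
  have := hf.measurable
  refine hf.integrable_norm.mono' (by fun_prop) (Eventually.of_forall fun p => ?_)
  exact PiLp.norm_apply_le (V p) i

/-- The flux of a flow. -/
def _root_.flux (ρ : Measure SpaceTime) (V : SpaceTime → E3) (i : Fin 3) :
    SignedMeasure SpaceTime :=
  ρ.withDensityᵥ fun p => V p i

theorem flux_absolutelyContinuous (i : Fin 3) :
    flux ρ V i ≪ᵥ ρ.toENNRealVectorMeasure :=
  Measure.withDensityᵥ_absolutelyContinuous _ _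

theorem velocity_flux (hf : IsFlow T D ρ V) : velocity ρ (flux ρ V) =ᵐ[ρ] V := by
  have h : ∀ i, (fun p => velocity ρ (flux ρ V) p i) =ᵐ[ρ] fun p => V p i := fun i => by
    refine Integrable.ae_eq_of_withDensityᵥ_eq (SignedMeasure.integrable_rnDeriv _ _)
      (hf.integrable_apply i) ?_
    exact (eq_withDensity_velocity (flux_absolutelyContinuous i)).symm
  filter_upwards [ae_all_iff.2 h] with p hp
  ext i
  exact hp i

theorem benamouBrenier_flux (hf : IsFlow T D ρ V) :
    benamouBrenier T ρ (flux ρ V) = ENNReal.ofReal (∫ p, ‖V p‖ ^ 2 ∂ρ) := by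
  have h1 : ρ.map Prod.fst ≪ volume ∧ ContinuityEquation T ρ (flux ρ V) ∧
      ∀ i, (flux ρ V i) ≪ᵥ ρ.toENNRealVectorMeasure :=
    ⟨hf.marginal, (continuityEquation_iff_integral hf.integrable_apply fun _ => rfl).2
      hf.continuity, flux_absolutelyContinuous⟩
  rw [benamouBrenier, if_pos h1, ofReal_integral_eq_lintegral_ofReal hf.integrable_sq
    (Eventually.of_forall fun p => by positivity)]
  refine lintegral_congr_ae ?_
  filter_upwards [hf.velocity_flux] with p hp
  rw [← norm_velocity_sq, hp]

theorem totalVariation_flux (hf : IsFlow T D ρ V) (i : Fin 3) :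
    (flux ρ V i).totalVariation (Icc 0 T ×ˢ D)ᶜ = 0 :=
  (SignedMeasure.absolutelyContinuous_ennreal_iff _ _).1 (flux_absolutelyContinuous i)
    (by
      simpa using hf.carried)

end IsFlow

theorem benamouBrenier_eq_ofReal {T : ℝ} {D : Set E3} {ρ : Measure SpaceTime} [IsFiniteMeasure ρ]
    {η : Fin 3 → SignedMeasure SpaceTime} (hc : ρ (Icc 0 T ×ˢ D)ᶜ = 0)
    (h : benamouBrenier T ρ η ≠ ⊤) :
    benamouBrenier T ρ η = ENNReal.ofReal (∫ p, ‖velocity ρ η p‖ ^ 2 ∂ρ) := by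
  rw [benamouBrenier_eq h, ofReal_integral_eq_lintegral_ofReal (isFlow_velocity hc h).integrable_sq
    (Eventually.of_forall fun p => by positivity)]

/-- The measure with density `max (c V_i) 0`. -/
def fluxPart (ρ : Measure SpaceTime) (V : SpaceTime → E3) (i : Fin 3) (c : ℝ) :
    Measure SpaceTime :=
  ρ.withDensity fun p => ENNReal.ofReal (c * V p i)

theorem IsFlow.fluxPart_univ_le {T : ℝ} {D : Set E3} {ρ : Measure SpaceTime}
    {V : SpaceTime → E3} [IsFiniteMeasure ρ] (hf : IsFlow T D ρ V) (i : Fin 3) {c : ℝ}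
    (hc : |c| ≤ 1) : fluxPart ρ V i c univ ≤ ENNReal.ofReal (massEnergy ρ V) := by
  rw [fluxPart, withDensity_apply _ MeasurableSet.univ, Measure.restrict_univ]
  refine le_trans (lintegral_mono fun p => ?_)
    ((ofReal_integral_eq_lintegral_ofReal hf.integrable_norm
      (Eventually.of_forall fun p => norm_nonneg _)).symm.le.trans
      (ENNReal.ofReal_le_ofReal hf.integral_norm_le))
  refine ENNReal.ofReal_le_ofReal ?_
  calc c * V p i ≤ |c * V p i| := le_abs_self _
    _ = |c| * |V p i| := abs_mul _ _
    _ ≤ 1 * ‖V p‖ := by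
        gcongr
        exact PiLp.norm_apply_le (V p) i
    _ = ‖V p‖ := one_mul _

theorem IsFlow.integral_mul_eq {T : ℝ} {D : Set E3} {ρ : Measure SpaceTime}
    {V : SpaceTime → E3} [IsFiniteMeasure ρ] (hf : IsFlow T D ρ V) (i : Fin 3)
    (φ : BoundedContinuousFunction SpaceTime ℝ) :
    ∫ p, φ p * V p i ∂ρ = ∫ p, φ p ∂(fluxPart ρ V i 1) - ∫ p, φ p ∂(fluxPart ρ V i (-1)) := by
  have hV := hf.measurable
  have hm : ∀ c : ℝ, Measurable fun p => c * V p i := fun c => by fun_prop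
  have e : ∀ c : ℝ, ∫ p, φ p ∂(fluxPart ρ V i c) = ∫ p, max (c * V p i) 0 * φ p ∂ρ := fun c => by
    rw [fluxPart, integral_withDensity_eq_integral_toReal_smul (hm c).ennreal_ofReal
      (Eventually.of_forall fun p => ENNReal.ofReal_lt_top)]
    simp_rw [ENNReal.toReal_ofReal', smul_eq_mul]
  have hi : ∀ c : ℝ, Integrable (fun p => max (c * V p i) 0 * φ p) ρ := fun c => by
    have h1 : Integrable (fun p => max (c * V p i) 0) ρ :=
      ((hf.integrable_apply i).const_mul c).pos_part
    exact h1.mul_bdd φ.continuous.aestronglyMeasurable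
      (Eventually.of_forall fun x => φ.norm_coe_le_norm x)
  rw [e, e, ← integral_sub (hi _) (hi _)]
  refine integral_congr_ae (Eventually.of_forall fun p => ?_)
  have : max (1 * V p i) 0 - max (-1 * V p i) 0 = V p i := by
    rcases le_total 0 (V p i) with h | h
    · rw [max_eq_left (by linarith), max_eq_right (by linarith)]; ring
    · rw [max_eq_right (by linarith), max_eq_left (by linarith)]; ring
  change φ p * V p i = max (1 * V p i) 0 * φ p - max (-1 * V p i) 0 * φ p
  rw [← sub_mul, this, mul_comm]

/-- Integration of bounded continuous functions against the difference of two measures. -/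
def integralDiff {X : Type*} [TopologicalSpace X] [MeasurableSpace X] [OpensMeasurableSpace X]
    (a b : FiniteMeasure X) : BoundedContinuousFunction X ℝ →ₗ[ℝ] ℝ where
  toFun φ := ∫ x, φ x ∂(a : Measure X) - ∫ x, φ x ∂(b : Measure X)
  map_add' φ ψ := by
    simp only [BoundedContinuousFunction.coe_add, Pi.add_apply]
    rw [integral_add (φ.integrable _) (ψ.integrable _),
      integral_add (φ.integrable _) (ψ.integrable _)]
    ring
  map_smul' c φ := by
    simp only [BoundedContinuousFunction.coe_smul, smul_eq_mul, integral_const_mul,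
      RingHom.id_apply]
    ring

end

/-! ### Limits of time marginals and compactness of flows. -/

open scoped ENNReal NNReal

noncomputable section

/-- Absolute continuity of time marginals is not stable under weak limits. Being a multiple of the
uniform measure on `[0, T]` is, since only the mass varies. -/
theorem map_fst_eq_of_tendsto {T : ℝ} (hT : 0 < T) {ρ : ℕ → FiniteMeasure SpaceTime}
    {ρ' : FiniteMeasure SpaceTime} (hρ : Tendsto ρ atTop (𝓝 ρ'))
    (h : ∀ n, (ρ n : Measure SpaceTime).map Prod.fst =
      ((ρ n : Measure SpaceTime) univ / ENNReal.ofReal T) • volume.restrict (Icc 0 T)) :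
    (ρ' : Measure SpaceTime).map Prod.fst =
      ((ρ' : Measure SpaceTime) univ / ENNReal.ofReal T) • volume.restrict (Icc 0 T) := by
  have hfin : IsFiniteMeasure (((ρ' : Measure SpaceTime) univ / ENNReal.ofReal T) •
      (volume.restrict (Icc 0 T) : Measure ℝ)) :=
    Measure.smul_finite _ (ENNReal.div_ne_top (measure_ne_top _ _) (by simpa using hT))
  refine ext_of_forall_integral_eq_of_IsFiniteMeasure fun φ => ?_
  have hm : ∀ ν : FiniteMeasure SpaceTime,
      ∫ t, φ t ∂((ν : Measure SpaceTime).map Prod.fst) =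
        ∫ p, φ p.1 ∂(ν : Measure SpaceTime) := fun ν =>
    integral_map measurable_fst.aemeasurable φ.continuous.aestronglyMeasurable
  have hs : ∀ ν : FiniteMeasure SpaceTime,
      ∫ t, φ t ∂(((ν : Measure SpaceTime) univ / ENNReal.ofReal T) •
        (volume.restrict (Icc 0 T) : Measure ℝ)) =
      (ν.mass : ℝ) / T * ∫ t in Icc 0 T, φ t := fun ν => by
    rw [integral_smul_measure, ENNReal.toReal_div, ENNReal.toReal_ofReal hT.le, smul_eq_mul,
      ← FiniteMeasure.ennreal_mass, ENNReal.coe_toReal]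
  have hl : Tendsto (fun n => ∫ p, φ p.1 ∂(ρ n : Measure SpaceTime)) atTop
      (𝓝 (∫ p, φ p.1 ∂(ρ' : Measure SpaceTime))) :=
    FiniteMeasure.tendsto_iff_forall_integral_tendsto.1 hρ
      (φ.compContinuous ⟨Prod.fst, continuous_fst⟩)
  have hmass : Tendsto (fun n => ((ρ n).mass : ℝ)) atTop (𝓝 (ρ'.mass : ℝ)) :=
    NNReal.tendsto_coe.2 ((FiniteMeasure.continuous_mass.tendsto _).comp hρ)
  rw [hm, hs]
  refine tendsto_nhds_unique hl (((hmass.div_const T).mul_const _).congr fun n => ?_)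
  rw [← hs, ← h, hm]

/-- The values of a flux functional, collected from the positive and the negative part. -/
theorem exists_subseq_tendsto_flux {T : ℝ} {D : Set E3} (hD : IsCompact D) (hne : D.Nonempty)
    (hT : 0 < T) {ρ : ℕ → FiniteMeasure SpaceTime} {V : ℕ → SpaceTime → E3}
    (hf : ∀ n, IsFlow T D (ρ n : Measure SpaceTime) (V n)) {A : ℝ}
    (hA : ∀ n, massEnergy (ρ n : Measure SpaceTime) (V n) ≤ A) :
    ∃ (k : ℕ → ℕ) (ρ' : FiniteMeasure SpaceTime)
      (l : Fin 3 → BoundedContinuousFunction SpaceTime ℝ →ₗ[ℝ] ℝ), StrictMono k ∧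
      Tendsto (fun n => ρ (k n)) atTop (𝓝 ρ') ∧
      ∀ i φ, Tendsto (fun n => ∫ p, φ p * V (k n) p i ∂(ρ (k n) : Measure SpaceTime)) atTop
        (𝓝 (l i φ)) := by
  have hK : IsCompact (Icc 0 T ×ˢ D) := isCompact_Icc.prod hD
  have hKne : (Icc 0 T ×ˢ D).Nonempty := (nonempty_Icc.2 hT.le).prod hne
  have hfin : ∀ n i (c : ℝ), |c| ≤ 1 → IsFiniteMeasure (fluxPart (ρ n) (V n) i c) :=
    fun n i c hc => ⟨((hf n).fluxPart_univ_le i hc).trans_lt ENNReal.ofReal_lt_top⟩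
  let F : ℕ → Fin 3 → Bool → FiniteMeasure SpaceTime := fun n i b =>
    ⟨fluxPart (ρ n) (V n) i (if b then 1 else -1), hfin n i _ (by cases b <;> simp)⟩
  -- `none` stands for the measure itself and `some (i, b)` for the positive or negative part of the
  -- `i`-th flux component, so that one extraction makes all seven measures converge.
  let μ : ℕ → Option (Fin 3 × Bool) → FiniteMeasure SpaceTime := fun n o =>
    o.elim (ρ n) fun x => F n x.1 x.2
  have hmass : ∀ n o, (μ n o).mass ≤ A.toNNReal := fun n o => by
    rw [← ENNReal.coe_le_coe, FiniteMeasure.ennreal_mass]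
    change _ ≤ ENNReal.ofReal A
    cases o with
    | none =>
      change (ρ n : Measure SpaceTime) univ ≤ _
      rw [← ofReal_measureReal]
      exact ENNReal.ofReal_le_ofReal ((measureReal_le_massEnergy _ _).trans (hA n))
    | some x =>
      exact ((hf n).fluxPart_univ_le x.1 (by cases x.2 <;> simp)).trans
        (ENNReal.ofReal_le_ofReal (hA n))
  have hcar : ∀ n o, (μ n o : Measure SpaceTime) (Icc 0 T ×ˢ D)ᶜ = 0 := fun n o => by
    cases o with
    | none => exact (hf n).carried
    | some x => exact withDensity_absolutelyContinuous _ _ (hf n).carried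
  obtain ⟨k, hk, h⟩ := exists_subseq_tendsto_family Finset.univ hK hKne μ hmass hcar
  choose! μ' hμ' using h
  refine ⟨k, μ' none, fun i => integralDiff (μ' (some (i, true))) (μ' (some (i, false))), hk,
    hμ' none (Finset.mem_univ _), fun i φ => ?_⟩
  have h1 := FiniteMeasure.tendsto_iff_forall_integral_tendsto.1
    (hμ' (some (i, true)) (Finset.mem_univ _)) φ
  have h2 := FiniteMeasure.tendsto_iff_forall_integral_tendsto.1
    (hμ' (some (i, false)) (Finset.mem_univ _)) φ
  refine (h1.sub h2).congr fun n => ?_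
  rw [(hf (k n)).integral_mul_eq i φ]
  rfl

/-- Flows with bounded mass and energy are weakly sequentially compact, and the energy is lower
semicontinuous. -/
theorem exists_subseq_tendsto_flow {T : ℝ} {D : Set E3} (hD : IsCompact D) (hne : D.Nonempty)
    (hT : 0 < T) {ρ : ℕ → FiniteMeasure SpaceTime} {V : ℕ → SpaceTime → E3}
    (hf : ∀ n, IsFlow T D (ρ n : Measure SpaceTime) (V n)) {A : ℝ}
    (hA : ∀ n, massEnergy (ρ n : Measure SpaceTime) (V n) ≤ A) :
    ∃ (k : ℕ → ℕ) (ρ' : FiniteMeasure SpaceTime) (V' : SpaceTime → E3) (s : ℝ), StrictMono k ∧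
      Tendsto (fun n => ρ (k n)) atTop (𝓝 ρ') ∧
      VectorWeakStarTendsto (fun n => flux (ρ (k n)) (V (k n))) (flux ρ' V') ∧
      IsFlow T D (ρ' : Measure SpaceTime) V' ∧
      Tendsto (fun n => ∫ p, ‖V (k n) p‖ ^ 2 ∂(ρ (k n) : Measure SpaceTime)) atTop (𝓝 s) ∧
      ∫ p, ‖V' p‖ ^ 2 ∂(ρ' : Measure SpaceTime) ≤ s := by
  obtain ⟨k₁, ρ', l, hk₁, hρ₁, hl₁⟩ := exists_subseq_tendsto_flux hD hne hT hf hA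
  obtain ⟨s, -, k₂, hk₂, hs⟩ := (isCompact_Icc (a := 0) (b := A)).tendsto_subseq
    (x := fun n => ∫ p, ‖V (k₁ n) p‖ ^ 2 ∂(ρ (k₁ n) : Measure SpaceTime)) fun n =>
      ⟨integral_nonneg fun p => by positivity, (energy_le_massEnergy _ _).trans (hA _)⟩
  have hρ := hρ₁.comp hk₂.tendsto_atTop
  have hl : ∀ i φ, Tendsto (fun n => ∫ p, φ p * V (k₁ (k₂ n)) p i
      ∂(ρ (k₁ (k₂ n)) : Measure SpaceTime)) atTop (𝓝 (l i φ)) := fun i φ =>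
    (hl₁ i φ).comp hk₂.tendsto_atTop
  obtain ⟨v, hv, hvs⟩ := exists_density_of_tendsto hρ (fun n => (hf _).measurable)
    (fun n => (hf _).integrable_sq) hs hl
  have hvm : ∀ i, Measurable (v i) := fun i => (Lp.stronglyMeasurable (v i)).measurable
  have hv2 : ∀ i, Integrable (fun p => v i p ^ 2) (ρ' : Measure SpaceTime) := fun i =>
    (Lp.memLp (v i)).integrable_sq
  have hv1 : ∀ i, Integrable (v i) (ρ' : Measure SpaceTime) := fun i =>
    (Lp.memLp (v i)).integrable (by norm_num)
  set V' : SpaceTime → E3 := fun p => WithLp.toLp 2 fun i => v i p with hV'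
  have hV'n : ∀ p, ‖V' p‖ ^ 2 = ∑ i, v i p ^ 2 := fun p => by
    rw [EuclideanSpace.norm_sq_eq]
    simp [hV']
  have hb : ∀ φ : BoundedContinuousFunction SpaceTime ℝ, ∀ x, |φ x| ≤ ‖φ‖ := fun φ x =>
    φ.norm_coe_le_norm x
  have hη : VectorWeakStarTendsto
      (fun n => flux (ρ (k₁ (k₂ n))) (V (k₁ (k₂ n)))) (flux ρ' V') := fun i φ => by
    have h1 : ∫ᵛ p, φ p ∂•(flux ρ' V' i) = l i φ := by
      rw [flux, integral_dot_withDensity (hv1 i) φ.continuous.measurable (hb φ), ← hv]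
    rw [h1]
    refine (hl i φ).congr fun n => ?_
    exact (integral_dot_withDensity ((hf _).integrable_apply i) φ.continuous.measurable
      (hb φ)).symm
  -- The equation is linear in the measure and the flux, and the derivatives of a test function are
  -- bounded and continuous, so it survives the weak limit.
  have hcont : ContinuityEquation T ρ' (flux ρ' V') := fun φ h1 h2 h3 => by
    obtain ⟨C, hC⟩ := exists_bound_fderiv h1 h2
    have hw : ∀ w : SpaceTime, ∃ g : BoundedContinuousFunction SpaceTime ℝ,
        ∀ p, g p = fderiv ℝ φ p w := fun w =>
      ⟨BoundedContinuousFunction.ofNormedAddCommGroup (fun p => fderiv ℝ φ p w)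
        ((h1.continuous_fderiv (by simp)).clm_apply continuous_const) (C * ‖w‖) fun p =>
          ((fderiv ℝ φ p).le_opNorm w).trans (by gcongr; exact hC p), fun p => rfl⟩
    choose g hg using hw
    have h4 : ∀ n, ∫ p, fderiv ℝ φ p (1, 0) ∂(ρ (k₁ (k₂ n)) : Measure SpaceTime) +
        ∑ i, ∫ᵛ p, fderiv ℝ φ p (0, EuclideanSpace.single i 1)
          ∂•(flux (ρ (k₁ (k₂ n))) (V (k₁ (k₂ n))) i) = 0 := fun n =>
      (continuityEquation_iff_integral (hf _).integrable_apply fun _ => rfl).2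
        (hf _).continuity φ h1 h2 h3
    simp_rw [← hg] at h4 ⊢
    refine tendsto_nhds_unique ((FiniteMeasure.tendsto_iff_forall_integral_tendsto.1 hρ _).add
      (tendsto_finsetSum _ fun i _ => hη i _)) ?_
    exact tendsto_const_nhds.congr fun n => (h4 n).symm
  refine ⟨k₁ ∘ k₂, ρ', V', s, hk₁.comp hk₂, hρ, hη, ⟨?_, ?_, ?_, ?_, ?_⟩, hs, ?_⟩
  · exact measure_compl_eq_zero_of_tendsto hρ (isClosed_Icc.prod hD.isClosed)
      fun n => (hf _).carried
  · rw [map_fst_eq_of_tendsto hT hρ fun n => (hf _).map_fst_eq hT hD.isBounded]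
    exact (Measure.smul_absolutelyContinuous).trans Measure.restrict_le_self.absolutelyContinuous
  · exact (WithLp.measurable_toLp 2 _).comp (measurable_pi_lambda _ hvm)
  · simp_rw [hV'n]
    exact integrable_finsetSum _ fun i _ => hv2 i
  · exact (continuityEquation_iff_integral hv1 fun _ => rfl).1 hcont
  · simp_rw [hV'n]
    rw [integral_finsetSum _ fun i _ => hv2 i]
    exact hvs

end

open scoped ENNReal NNReal

noncomputable section

/-! ### Logarithmic integrals -/

section NegLog

variable {X : Type*} [MeasurableSpace X] {E : Measure X}

theorem negLogIntegral_anti {f g : X → ℝ≥0∞} (h : f ≤ᵐ[E] g) :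
    negLogIntegral E g ≤ negLogIntegral E f := by
  refine EReal.sub_le_sub ?_ ?_
  · refine EReal.coe_ennreal_le_coe_ennreal_iff.2 (lintegral_mono_ae ?_)
    filter_upwards [h] with x hx
    exact EReal.toENNReal_le_toENNReal (EReal.neg_le_neg_iff.2 (ENNReal.log_le_log hx))
  · refine EReal.coe_ennreal_le_coe_ennreal_iff.2 (lintegral_mono_ae ?_)
    filter_upwards [h] with x hx
    exact EReal.toENNReal_le_toENNReal (ENNReal.log_le_log hx)

theorem negLogIntegral_congr {f g : X → ℝ≥0∞} (h : f =ᵐ[E] g) :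
    negLogIntegral E f = negLogIntegral E g :=
  le_antisymm (negLogIntegral_anti h.symm.le) (negLogIntegral_anti h.le)

theorem negLogIntegral_zero {f : X → ℝ≥0∞} : negLogIntegral (0 : Measure X) f = 0 := by
  simp [negLogIntegral]

theorem negLogIntegral_eq_top {f : X → ℝ≥0∞} (h : f =ᵐ[E] 0) (hE : E ≠ 0) :
    negLogIntegral E f = ⊤ := by
  rw [negLogIntegral_congr h]
  simp [negLogIntegral, hE, ENNReal.top_mul]

theorem negLogIntegral_ofReal {h : X → ℝ} (hp : ∀ᵐ x ∂E, 0 < h x)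
    (hi : Integrable (fun x => Real.log (h x)) E) :
    negLogIntegral E (fun x => ENNReal.ofReal (h x)) = ((-∫ x, Real.log (h x) ∂E : ℝ) : EReal) := by
  have e1 : ∫⁻ x, (-(ENNReal.ofReal (h x)).log).toENNReal ∂E =
      ∫⁻ x, ENNReal.ofReal (-Real.log (h x)) ∂E := lintegral_congr_ae <| by
    filter_upwards [hp] with x hx
    rw [ENNReal.log_ofReal_of_pos hx, ← EReal.coe_neg, EReal.real_coe_toENNReal]
  have e2 : ∫⁻ x, ((ENNReal.ofReal (h x)).log).toENNReal ∂E =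
      ∫⁻ x, ENNReal.ofReal (Real.log (h x)) ∂E := lintegral_congr_ae <| by
    filter_upwards [hp] with x hx
    rw [ENNReal.log_ofReal_of_pos hx, EReal.real_coe_toENNReal]
  have f1 : ∫⁻ x, ENNReal.ofReal (-Real.log (h x)) ∂E ≠ ⊤ := hi.neg.lintegral_lt_top.ne
  have f2 : ∫⁻ x, ENNReal.ofReal (Real.log (h x)) ∂E ≠ ⊤ := hi.lintegral_lt_top.ne
  rw [negLogIntegral, e1, e2, integral_eq_lintegral_pos_part_sub_lintegral_neg_part hi, neg_sub,
    EReal.coe_sub, EReal.coe_ennreal_toReal f1, EReal.coe_ennreal_toReal f2]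

end NegLog

/-! ### A stationary competitor -/

/-- There is a flow of total mass `c` which is at rest. -/
theorem exists_stationary_flow {T : ℝ} (hT : 0 < T) {D : Set E3} (hD : MeasurableSet D)
    (hne : D.Nonempty) {c : ℝ} (hc : 0 ≤ c) :
    ∃ ρ : FiniteMeasure SpaceTime, (ρ : Measure SpaceTime).real univ = c ∧
      IsFlow T D (ρ : Measure SpaceTime) fun _ => 0 := by
  obtain ⟨x, hx⟩ := hne
  set μ : Measure ℝ := ENNReal.ofReal (c / T) • (volume : Measure ℝ).restrict (Icc 0 T) with hμ
  have hμf : IsFiniteMeasure μ := Measure.smul_finite _ ENNReal.ofReal_ne_top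
  have hg : Measurable fun t : ℝ => (t, x) := by fun_prop
  have hνf : IsFiniteMeasure (μ.map fun t => (t, x)) := Measure.isFiniteMeasure_map _ _
  refine ⟨⟨μ.map fun t => (t, x), hνf⟩, ?_, ?_, ?_, measurable_const, by simp, ?_⟩
  · change (μ.map fun t => (t, x)).real univ = c
    rw [map_measureReal_apply hg MeasurableSet.univ, preimage_univ, hμ, measureReal_def]
    simp [ENNReal.toReal_ofReal (div_nonneg hc hT.le), ENNReal.toReal_ofReal hT.le, hT.ne']
  · change (μ.map fun t => (t, x)) _ = 0
    rw [Measure.map_apply hg (measurableSet_Icc.prod hD).compl, hμ, Measure.smul_apply]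
    have : (fun t : ℝ => (t, x)) ⁻¹' (Icc 0 T ×ˢ D)ᶜ = (Icc 0 T)ᶜ := by
      ext t
      simp [hx]
    rw [this, Measure.restrict_apply measurableSet_Icc.compl]
    simp
  · change (μ.map fun t => (t, x)).map Prod.fst ≪ volume
    rw [Measure.map_map measurable_fst hg]
    change μ.map id ≪ volume
    rw [Measure.map_id, hμ]
    exact Measure.smul_absolutelyContinuous.trans
      Measure.restrict_le_self.absolutelyContinuous
  · intro φ h1 _ h3
    change ∫ p, fderiv ℝ φ p (1, 0) ∂(μ.map fun t => (t, x)) = 0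
    have hc1 : Continuous fun p => fderiv ℝ φ p (1, 0) :=
      (h1.continuous_fderiv (by simp)).clm_apply continuous_const
    rw [integral_map hg.aemeasurable hc1.aestronglyMeasurable, hμ, integral_smul_measure,
      integral_Icc_eq_integral_Ioc, ← intervalIntegral.integral_of_le hT.le]
    have hd : ∀ t : ℝ, HasDerivAt (fun t : ℝ => φ (t, x)) (fderiv ℝ φ (t, x) (1, 0)) t := fun t =>
      ((h1.differentiable (by simp)) (t, x)).hasFDerivAt.comp_hasDerivAt t
        ((hasDerivAt_id t).prodMk (hasDerivAt_const t x))
    have hz : ∀ t : ℝ, t ∉ Ioo 0 T → φ (t, x) = 0 := fun t ht =>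
      image_eq_zero_of_notMem_tsupport fun h => ht (h3 h).1
    rw [intervalIntegral.integral_eq_sub_of_hasDerivAt (fun t _ => hd t)
      ((hc1.comp (by fun_prop)).intervalIntegrable _ _), hz T (by simp), hz 0 (by simp)]
    simp

end

open scoped ENNReal NNReal

noncomputable section

/-! ### The reconstruction functional in terms of the event density -/

theorem exists_subseq_tendsto_admissible {sc : Scanner} {ρ : ℕ → FiniteMeasure SpaceTime}
    {η : ℕ → Fin 3 → SignedMeasure SpaceTime} (hadm : ∀ n, (ρ n, η n) ∈ admissiblePairs sc)
    (hS : ∀ n, benamouBrenier sc.T (ρ n) (η n) ≠ ⊤) {A : ℝ}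
    (hA : ∀ n, massEnergy (ρ n : Measure SpaceTime) (velocity (ρ n) (η n)) ≤ A) :
    ∃ (k : ℕ → ℕ) (ρ' : FiniteMeasure SpaceTime) (η' : Fin 3 → SignedMeasure SpaceTime) (s : ℝ),
      StrictMono k ∧ Tendsto (fun n => ρ (k n)) atTop (𝓝 ρ') ∧
      VectorWeakStarTendsto (fun n => η (k n)) η' ∧ (ρ', η') ∈ admissiblePairs sc ∧
      benamouBrenier sc.T ρ' η' ≠ ⊤ ∧
      Tendsto (fun n => ∫ p, ‖velocity (ρ (k n)) (η (k n)) p‖ ^ 2 ∂(ρ (k n) : Measure SpaceTime))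
        atTop (𝓝 s) ∧
      ∫ p, ‖velocity ρ' η' p‖ ^ 2 ∂(ρ' : Measure SpaceTime) ≤ s := by
  obtain ⟨k, ρ', V', s, hk, hρ, hη, hf, hs, hle⟩ := exists_subseq_tendsto_flow sc.isCompact_D
    sc.nonempty_D sc.T_pos (fun n => isFlow_velocity (hadm n).1 (hS n)) hA
  have he : ∀ n, flux (ρ n) (velocity (ρ n) (η n)) = η n := fun n => funext fun i =>
    (eq_withDensity_velocity ((conditions_of_benamouBrenier_ne_top (hS n)).2.2 i)).symm
  simp_rw [he] at hη
  refine ⟨k, ρ', flux ρ' V', s, hk, hρ, hη, ⟨hf.carried, hf.totalVariation_flux⟩, ?_, hs, ?_⟩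
  · rw [hf.benamouBrenier_flux]
    exact ENNReal.ofReal_ne_top
  · refine le_trans (le_of_eq (integral_congr_ae ?_)) hle
    filter_upwards [hf.velocity_flux] with p hp
    rw [hp]

section LogIntegral

variable {X : Type*} [TopologicalSpace X] [MeasurableSpace X] [OpensMeasurableSpace X] {Z : Set X}
  {g : X → ℝ} {c : ℝ}

theorem exists_abs_log_le (hZ : IsCompact Z) (hg : ContinuousOn g Z) (hc : 0 < c)
    (hcg : ∀ e ∈ Z, c ≤ g e) : ∃ C, ∀ e ∈ Z, |Real.log (g e)| ≤ C :=
  hZ.exists_bound_of_continuousOn (hg.log fun e he => (hc.trans_le (hcg e he)).ne')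

theorem ae_mem_of_compl {E : Measure X} (hE : E Zᶜ = 0) : ∀ᵐ e ∂E, e ∈ Z := hE

theorem integrable_log_of_continuousOn {E : Measure X} [IsFiniteMeasure E] [T2Space X]
    (hE : E Zᶜ = 0) (hZ : IsCompact Z)
    (hg : ContinuousOn g Z) (hc : 0 < c) (hcg : ∀ e ∈ Z, c ≤ g e) :
    Integrable (fun e => Real.log (g e)) E := by
  obtain ⟨C, hC⟩ := exists_abs_log_le hZ hg hc hcg
  have hm : AEStronglyMeasurable (fun e => Real.log (g e)) E := by
    have h1 := (hg.log fun e he => (hc.trans_le (hcg e he)).ne').aemeasurable (μ := E)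
      hZ.isClosed.measurableSet
    rw [Measure.restrict_eq_self_of_ae_mem (ae_mem_of_compl hE)] at h1
    exact h1.aestronglyMeasurable
  exact Integrable.of_bound hm C ((ae_mem_of_compl hE).mono fun e he => hC e he)

theorem negLogIntegral_of_continuousOn {E : Measure X} [IsFiniteMeasure E] [T2Space X]
    (hE : E Zᶜ = 0) (hZ : IsCompact Z)
    (hg : ContinuousOn g Z) (hc : 0 < c) (hcg : ∀ e ∈ Z, c ≤ g e) :
    negLogIntegral E (fun e => ENNReal.ofReal (g e)) =
      ((-∫ e, Real.log (g e) ∂E : ℝ) : EReal) :=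
  negLogIntegral_ofReal ((ae_mem_of_compl hE).mono fun e he => hc.trans_le (hcg e he))
    (integrable_log_of_continuousOn hE hZ hg hc hcg)

end LogIntegral

namespace Setting.HasEventDensity

variable {sc : Scanner} {st : Setting sc} {ps pd q β : ℝ}
  {f : Measure SpaceTime → (SpaceTime → E3) → Event → ℝ} {E : Measure Event} [IsFiniteMeasure E]
  {ρ : Measure SpaceTime} [IsFiniteMeasure ρ] {η : Fin 3 → SignedMeasure SpaceTime}

/-- The value of the reconstruction functional for a real event density `g` that is bounded away
from zero. -/
def _root_.realFunctional (ps pd β : ℝ) (E : Measure Event) (g : Event → ℝ) (m s : ℝ) : ℝ :=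
  (ps + pd) * m + -∫ e, Real.log (g e) ∂E + β * s

theorem functional_eq (h : st.HasEventDensity ps pd q f) (hps : 0 < ps) (hpd : 0 < pd)
    (hβ : 0 < β) (hE : E st.eventSetᶜ = 0) (hc : ρ (Icc 0 sc.T ×ˢ sc.D)ᶜ = 0)
    (hS : benamouBrenier sc.T ρ η ≠ ⊤) :
    reconstructionFunctional st ps pd q β E ρ η = (((ps + pd) * ρ.real univ : ℝ) : EReal) +
      negLogIntegral E (fun e => ENNReal.ofReal (f ρ (velocity ρ η) e)) +
      ((β * ∫ p, ‖velocity ρ η p‖ ^ 2 ∂ρ : ℝ) : EReal) := by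
  have hf := isFlow_velocity hc hS
  have hm : (0 : ℝ) ≤ ρ.real univ := measureReal_nonneg
  have hs : 0 ≤ ∫ p, ‖velocity ρ η p‖ ^ 2 ∂ρ := integral_nonneg fun p => by positivity
  rw [reconstructionFunctional, if_neg hS, benamouBrenier_eq_ofReal hc hS,
    ← ENNReal.ofReal_mul hβ.le, st.Aq_univ hps hpd one_pos hf, one_mul, ← ofReal_measureReal,
    ← ENNReal.ofReal_mul (by positivity), EReal.coe_ennreal_ofReal, EReal.coe_ennreal_ofReal,
    max_eq_left (by positivity), max_eq_left (by positivity), negLogIntegral_congr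
      (g := fun e => ENNReal.ofReal (f ρ (velocity ρ η) e))
      ((ae_mem_of_compl hE).mono fun e he => h.density_eq hf he)]

/-- Replacing the event density by a larger function bounded away from zero lowers the functional
and makes it real. Coercivity uses a constant as `g`, lower semicontinuity uses the limit density
plus `ε`. -/
theorem realFunctional_le (h : st.HasEventDensity ps pd q f) (hps : 0 < ps) (hpd : 0 < pd)
    (hβ : 0 < β) (hE : E st.eventSetᶜ = 0) (hc : ρ (Icc 0 sc.T ×ˢ sc.D)ᶜ = 0)
    (hS : benamouBrenier sc.T ρ η ≠ ⊤) {g : Event → ℝ} (hg : ContinuousOn g st.eventSet) {c : ℝ}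
    (hc0 : 0 < c) (hcg : ∀ e ∈ st.eventSet, c ≤ g e)
    (hfg : ∀ e ∈ st.eventSet, f ρ (velocity ρ η) e ≤ g e) :
    (realFunctional ps pd β E g (ρ.real univ) (∫ p, ‖velocity ρ η p‖ ^ 2 ∂ρ) : EReal) ≤
      reconstructionFunctional st ps pd q β E ρ η := by
  rw [h.functional_eq hps hpd hβ hE hc hS, realFunctional, EReal.coe_add, EReal.coe_add,
    ← negLogIntegral_of_continuousOn hE st.isCompact_eventSet hg hc0 hcg]
  gcongr
  exact negLogIntegral_anti ((ae_mem_of_compl hE).mono fun e he =>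
    ENNReal.ofReal_le_ofReal (hfg e he))

theorem exists_pos_le (h : st.HasEventDensity ps pd q f) {V : SpaceTime → E3}
    (hf : IsFlow sc.T sc.D ρ V) (hm : 0 < ρ.real univ) :
    ∃ c > 0, ∀ e ∈ st.eventSet, c ≤ f ρ V e := by
  obtain ⟨c, hc, hl⟩ := h.exists_lower
  exact ⟨c * ρ.real univ, by positivity, hl ρ V hf⟩

theorem functional_eq_realFunctional (h : st.HasEventDensity ps pd q f) (hps : 0 < ps)
    (hpd : 0 < pd) (hβ : 0 < β) (hE : E st.eventSetᶜ = 0) (hc : ρ (Icc 0 sc.T ×ˢ sc.D)ᶜ = 0)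
    (hS : benamouBrenier sc.T ρ η ≠ ⊤) (hm : 0 < ρ.real univ) :
    reconstructionFunctional st ps pd q β E ρ η =
      (realFunctional ps pd β E (f ρ (velocity ρ η)) (ρ.real univ)
        (∫ p, ‖velocity ρ η p‖ ^ 2 ∂ρ) : EReal) := by
  have hf := isFlow_velocity hc hS
  obtain ⟨c, hc0, hcg⟩ := h.exists_pos_le hf hm
  rw [h.functional_eq hps hpd hβ hE hc hS, realFunctional, EReal.coe_add, EReal.coe_add,
    ← negLogIntegral_of_continuousOn hE st.isCompact_eventSet (h.continuousOn ρ _ hf) hc0 hcg]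

theorem eq_zero_of_mass_eq_zero (h : st.HasEventDensity ps pd q f) {V : SpaceTime → E3}
    (hf : IsFlow sc.T sc.D ρ V) (hm : ρ.real univ = 0) :
    ∀ e ∈ st.eventSet, f ρ V e = 0 := by
  intro e he
  obtain ⟨c, hc, hl⟩ := h.exists_lower
  obtain ⟨C, hC, hu⟩ := h.exists_upper
  have h1 := hl ρ V hf e he
  have h2 := hu ρ V hf e he
  have h3 : ρ = 0 := by
    rw [← Measure.measure_univ_eq_zero]
    exact (measureReal_eq_zero_iff).1 hm
  have h4 : massEnergy ρ V = 0 := by simp [massEnergy, h3]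
  rw [h4, mul_zero] at h2
  rw [hm, mul_zero] at h1
  exact le_antisymm h2 h1

theorem functional_eq_top (h : st.HasEventDensity ps pd q f) (hps : 0 < ps)
    (hpd : 0 < pd) (hβ : 0 < β) (hE : E st.eventSetᶜ = 0) (hE0 : E ≠ 0)
    (hc : ρ (Icc 0 sc.T ×ˢ sc.D)ᶜ = 0)
    (hS : benamouBrenier sc.T ρ η ≠ ⊤) (hm : ρ.real univ = 0) :
    reconstructionFunctional st ps pd q β E ρ η = ⊤ := by
  have hf := isFlow_velocity hc hS
  rw [h.functional_eq hps hpd hβ hE hc hS, negLogIntegral_eq_top _ hE0, EReal.coe_add_top,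
    EReal.top_add_coe]
  refine (ae_mem_of_compl hE).mono fun e he => ?_
  simp [h.eq_zero_of_mass_eq_zero hf hm e he]

/-- The functional without measurements. -/
theorem functional_zero (h : st.HasEventDensity ps pd q f) (hps : 0 < ps) (hpd : 0 < pd)
    (hβ : 0 < β) (hc : ρ (Icc 0 sc.T ×ˢ sc.D)ᶜ = 0)
    (hS : benamouBrenier sc.T ρ η ≠ ⊤) :
    reconstructionFunctional st ps pd q β 0 ρ η =
      (((ps + pd) * ρ.real univ + β * ∫ p, ‖velocity ρ η p‖ ^ 2 ∂ρ : ℝ) : EReal) := by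
  rw [h.functional_eq hps hpd hβ (by simp) hc hS, negLogIntegral_zero, add_zero, EReal.coe_add]

end Setting.HasEventDensity

theorem tendsto_realFunctional {Z : Set Event} (hZ : IsCompact Z) {E : ℕ → FiniteMeasure Event}
    {E' : FiniteMeasure Event} (hlim : Tendsto E atTop (𝓝 E'))
    (hE : ∀ n, (E n : Measure Event) Zᶜ = 0) (hE' : (E' : Measure Event) Zᶜ = 0)
    {g : Event → ℝ} (hg : ContinuousOn g Z) {c : ℝ} (hc : 0 < c) (hcg : ∀ e ∈ Z, c ≤ g e)
    (ps pd β : ℝ) {m s : ℕ → ℝ} {m' s' : ℝ} (hm : Tendsto m atTop (𝓝 m'))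
    (hs : Tendsto s atTop (𝓝 s')) :
    Tendsto (fun n => realFunctional ps pd β (E n) g (m n) (s n)) atTop
      (𝓝 (realFunctional ps pd β E' g m' s')) := by
  obtain ⟨C, hC⟩ := exists_abs_log_le hZ hg hc hcg
  exact ((hm.const_mul _).add (tendsto_integral_of_continuousOn hlim hZ.isClosed hE hE'
    (hg.log fun e he => (hc.trans_le (hcg e he)).ne') hC).neg).add (hs.const_mul _)

/-- A coercivity estimate. -/
theorem exists_bound_of_sub_log_le {a : ℝ} (ha : 0 < a) {B : ℝ} (hB : 0 ≤ B) {C : ℝ} (hC : 0 ≤ C)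
    (J : ℝ) : ∃ A, ∀ x b, 0 ≤ x → 0 ≤ b → b ≤ B → a * x - b * Real.log (1 + C * x) ≤ J → x ≤ A := by
  -- The tangent bound `log y ≤ y - 1` at `y = (1 + C * x) / t` makes the logarithm affine in `x`.
  -- This `t` is large enough for the slope `B * C / t` to be at most `a / 2`, so half of the linear
  -- term survives.
  set t : ℝ := 1 + 2 * B * C / a with ht
  have ht1 : 1 ≤ t := le_add_of_nonneg_right (by positivity)
  have ht0 : 0 < t := by linarith
  have hlt : 0 ≤ Real.log t := Real.log_nonneg ht1
  refine ⟨2 / a * (J + B * (1 + Real.log t)), fun x b hx hb hbB h => ?_⟩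
  have h1 : Real.log (1 + C * x) ≤ (1 + C * x) / t + Real.log t := by
    have hy : 0 < (1 + C * x) / t := by positivity
    have := Real.log_le_sub_one_of_pos hy
    rw [Real.log_div (by positivity) ht0.ne'] at this
    linarith
  have h2 : 0 ≤ Real.log (1 + C * x) :=
    Real.log_nonneg (le_add_of_nonneg_right (mul_nonneg hC hx))
  have h3 : b * Real.log (1 + C * x) ≤ B * ((1 + C * x) / t + Real.log t) := by gcongr
  have h4 : B * (C * x / t) ≤ a / 2 * x := by
    have : B * C / t ≤ a / 2 := by
      rw [div_le_iff₀ ht0, ht]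
      have : a / 2 * (1 + 2 * B * C / a) = a / 2 + B * C := by field_simp
      rw [this]
      linarith
    calc B * (C * x / t) = B * C / t * x := by ring
      _ ≤ a / 2 * x := by gcongr
  have h5 : B * (1 / t) ≤ B := by
    rw [mul_one_div]
    exact div_le_self hB ht1
  have h6 : B * ((1 + C * x) / t + Real.log t) = B * (1 / t) + B * (C * x / t) +
      B * Real.log t := by ring
  have h7 : a / 2 * x ≤ J + B * (1 + Real.log t) := by linarith
  calc x = 2 / a * (a / 2 * x) := by field_simp
    _ ≤ _ := by gcongr

end

open scoped ENNReal NNReal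

noncomputable section

/-! ### Stability of minimizers -/

theorem exists_stationary_admissible (sc : Scanner) {c : ℝ} (hc : 0 ≤ c) :
    ∃ (ρ : FiniteMeasure SpaceTime) (η : Fin 3 → SignedMeasure SpaceTime),
      (ρ, η) ∈ admissiblePairs sc ∧ benamouBrenier sc.T ρ η ≠ ⊤ ∧
      (ρ : Measure SpaceTime).real univ = c ∧
      ∫ p, ‖velocity ρ η p‖ ^ 2 ∂(ρ : Measure SpaceTime) = 0 := by
  obtain ⟨ρ, hm, hf⟩ := exists_stationary_flow sc.T_pos sc.isCompact_D.isClosed.measurableSet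
    sc.nonempty_D hc
  refine ⟨ρ, flux ρ fun _ => 0, ⟨hf.carried, hf.totalVariation_flux⟩, ?_, hm, ?_⟩
  · rw [hf.benamouBrenier_flux]
    exact ENNReal.ofReal_ne_top
  · rw [integral_eq_zero_of_ae]
    filter_upwards [hf.velocity_flux] with p hp
    simp [hp]

namespace Setting.HasEventDensity

variable {sc : Scanner} {st : Setting sc} {ps pd q β : ℝ}
  {f : Measure SpaceTime → (SpaceTime → E3) → Event → ℝ}

/-- For positive mass the event density is continuous and bounded away from zero on the compact
event set, so its logarithm can be tested against the weakly convergent measurements. -/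
theorem tendsto_functional (h : st.HasEventDensity ps pd q f)
    {E : ℕ → FiniteMeasure Event} {E' : FiniteMeasure Event}
    (hE : ∀ n, (E n : Measure Event) st.eventSetᶜ = 0)
    (hE' : (E' : Measure Event) st.eventSetᶜ = 0)
    (hlim : Tendsto E atTop (𝓝 E')) {ρ : Measure SpaceTime} [IsFiniteMeasure ρ]
    {V : SpaceTime → E3} (hf : IsFlow sc.T sc.D ρ V) (hm : 0 < ρ.real univ) (m s : ℝ) :
    Tendsto (fun n => realFunctional ps pd β (E n) (f ρ V) m s) atTop
      (𝓝 (realFunctional ps pd β E' (f ρ V) m s)) := by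
  obtain ⟨c, hc, hcf⟩ := h.exists_pos_le hf hm
  exact tendsto_realFunctional st.isCompact_eventSet hlim hE hE' (h.continuousOn ρ V hf) hc hcf
    ps pd β tendsto_const_nhds tendsto_const_nhds

/-- A resting unit mass bounds the minimal values by a constant `J`. From below, the event density
is at most `1 + C * x` with `x` the mass plus energy, and the remaining terms are at least `min (ps
+ pd) β * x`. The estimate `exists_bound_of_sub_log_le` then bounds `x`; the summand `1` keeps the
argument of the logarithm away from zero. -/
theorem exists_massEnergy_le (h : st.HasEventDensity ps pd q f) (hps : 0 < ps) (hpd : 0 < pd)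
    (hβ : 0 < β) {E : ℕ → FiniteMeasure Event} {E' : FiniteMeasure Event}
    (hE : ∀ n, (E n : Measure Event) st.eventSetᶜ = 0)
    (hE' : (E' : Measure Event) st.eventSetᶜ = 0)
    (hlim : Tendsto E atTop (𝓝 E'))
    {ρ : ℕ → FiniteMeasure SpaceTime} {η : ℕ → Fin 3 → SignedMeasure SpaceTime}
    (hmin : ∀ n, IsMinimizer st ps pd q β (E n) (ρ n) (η n)) :
    ∃ A, ∀ n, benamouBrenier sc.T (ρ n) (η n) ≠ ⊤ ∧
      massEnergy (ρ n : Measure SpaceTime) (velocity (ρ n) (η n)) ≤ A := by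
  obtain ⟨ρ₀, η₀, hadm₀, hS₀, hm₀, -⟩ := exists_stationary_admissible sc zero_le_one
  have hm₀' : 0 < (ρ₀ : Measure SpaceTime).real univ := by rw [hm₀]; exact one_pos
  obtain ⟨J, hJ⟩ := (h.tendsto_functional (β := β) hE hE' hlim (isFlow_velocity hadm₀.1 hS₀) hm₀'
    ((ρ₀ : Measure SpaceTime).real univ)
    (∫ p, ‖velocity ρ₀ η₀ p‖ ^ 2 ∂(ρ₀ : Measure SpaceTime))).bddAbove_range
  obtain ⟨B, hB⟩ := ((NNReal.tendsto_coe.2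
    ((FiniteMeasure.continuous_mass.tendsto _).comp hlim)).bddAbove_range :
      BddAbove (range fun n => ((E n).mass : ℝ)))
  obtain ⟨C, hC, hu⟩ := h.exists_upper
  have hB' : ∀ n, ((E n).mass : ℝ) ≤ B := fun n => hB ⟨n, rfl⟩
  obtain ⟨A, hA⟩ := exists_bound_of_sub_log_le (lt_min (add_pos hps hpd) hβ)
    ((NNReal.coe_nonneg _).trans (hB' 0)) hC J
  have hle : ∀ n, reconstructionFunctional st ps pd q β (E n) (ρ n) (η n) ≤ (J : EReal) :=
    fun n => ((hmin n).2 hadm₀).trans <| by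
      change reconstructionFunctional st ps pd q β (E n) ρ₀ η₀ ≤ _
      rw [h.functional_eq_realFunctional hps hpd hβ (hE n) hadm₀.1 hS₀ hm₀']
      exact EReal.coe_le_coe_iff.2 (hJ ⟨n, rfl⟩)
  refine ⟨A, fun n => ?_⟩
  have hS : benamouBrenier sc.T (ρ n) (η n) ≠ ⊤ := fun hS => by
    have := hle n
    rw [reconstructionFunctional, if_pos hS] at this
    exact (EReal.coe_lt_top J).not_ge this
  refine ⟨hS, hA _ (E n).mass (massEnergy_nonneg _ _) (NNReal.coe_nonneg _) (hB' n) ?_⟩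
  have hf := isFlow_velocity (hmin n).1.1 hS
  set x := massEnergy (ρ n : Measure SpaceTime) (velocity (ρ n) (η n)) with hx
  have h1 := (h.realFunctional_le hps hpd hβ (hE n) (hmin n).1.1 hS
    (g := fun _ => 1 + C * x) continuousOn_const one_pos
    (fun e _ => le_add_of_nonneg_right (mul_nonneg hC (massEnergy_nonneg _ _)))
    fun e he => (hu _ _ hf e he).trans (by rw [← hx]; linarith)).trans (hle n)
  rw [EReal.coe_le_coe_iff, realFunctional, integral_const, smul_eq_mul] at h1
  have h2 : (E n : Measure Event).real univ = ((E n).mass : ℝ) := rfl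
  rw [h2] at h1
  have h3 : min (ps + pd) β * x ≤ (ps + pd) * (ρ n : Measure SpaceTime).real univ +
      β * ∫ p, ‖velocity (ρ n) (η n) p‖ ^ 2 ∂(ρ n : Measure SpaceTime) := by
    rw [hx, massEnergy, mul_add]
    gcongr
    · exact min_le_left _ _
    · exact min_le_right _ _
  linarith

/-- Lower semicontinuity along minimizers, with a regularized logarithm. -/
theorem realFunctional_add_le (h : st.HasEventDensity ps pd q f) (hps : 0 < ps) (hpd : 0 < pd)
    (hβ : 0 < β) {E : ℕ → FiniteMeasure Event} {E' : FiniteMeasure Event}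
    (hE : ∀ n, (E n : Measure Event) st.eventSetᶜ = 0)
    (hE' : (E' : Measure Event) st.eventSetᶜ = 0)
    (hlim : Tendsto E atTop (𝓝 E'))
    {ρ : ℕ → FiniteMeasure SpaceTime} {η : ℕ → Fin 3 → SignedMeasure SpaceTime}
    (hmin : ∀ n, IsMinimizer st ps pd q β (E n) (ρ n) (η n))
    (hS : ∀ n, benamouBrenier sc.T (ρ n) (η n) ≠ ⊤) {A : ℝ}
    (hA : ∀ n, massEnergy (ρ n : Measure SpaceTime) (velocity (ρ n) (η n)) ≤ A)
    {ρ' : FiniteMeasure SpaceTime} {V' : SpaceTime → E3}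
    (hf' : IsFlow sc.T sc.D (ρ' : Measure SpaceTime) V')
    (hρ : Tendsto ρ atTop (𝓝 ρ')) {s : ℝ}
    (hs : Tendsto (fun n => ∫ p, ‖velocity (ρ n) (η n) p‖ ^ 2 ∂(ρ n : Measure SpaceTime))
      atTop (𝓝 s))
    {ρ₀ : FiniteMeasure SpaceTime} {η₀ : Fin 3 → SignedMeasure SpaceTime}
    (hadm₀ : (ρ₀, η₀) ∈ admissiblePairs sc) (hS₀ : benamouBrenier sc.T ρ₀ η₀ ≠ ⊤)
    (hm₀ : 0 < (ρ₀ : Measure SpaceTime).real univ) {ε : ℝ} (hε : 0 < ε) :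
    realFunctional ps pd β E' (fun e => f ρ' V' e + ε) ((ρ' : Measure SpaceTime).real univ) s ≤
      realFunctional ps pd β E' (f ρ₀ (velocity ρ₀ η₀)) ((ρ₀ : Measure SpaceTime).real univ)
        (∫ p, ‖velocity ρ₀ η₀ p‖ ^ 2 ∂(ρ₀ : Measure SpaceTime)) := by
  have hpos : ∀ e ∈ st.eventSet, ε ≤ f ρ' V' e + ε := fun e he => by
    obtain ⟨c, hc, hl⟩ := h.exists_lower
    have h1 := hl ρ' V' hf' e he
    have h2 : 0 ≤ c * (ρ' : Measure SpaceTime).real univ := mul_nonneg hc.le measureReal_nonneg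
    linarith
  have hcont : ContinuousOn (fun e => f ρ' V' e + ε) st.eventSet :=
    (h.continuousOn _ V' hf').add continuousOn_const
  -- Both sides are limits of functionals with a fixed event density and varying measurement `E n`;
  -- for large `n` the minimal value for `E n` stands between them. The `ε` absorbs the error in the
  -- upper bound of the densities and keeps the logarithm finite even if the limit has no mass.
  refine le_of_tendsto_of_tendsto (tendsto_realFunctional st.isCompact_eventSet hlim hE hE' hcont hε
    hpos ps pd β (tendsto_mass hρ) hs) (h.tendsto_functional hE hE' hlim
      (isFlow_velocity hadm₀.1 hS₀) hm₀ _ _) ?_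
  filter_upwards [h.eventually_le ρ (fun n => velocity (ρ n) (η n)) ρ' V' A
    (fun n => isFlow_velocity (hmin n).1.1 (hS n)) hA hf' hρ ε hε] with n hn
  rw [← EReal.coe_le_coe_iff,
    ← h.functional_eq_realFunctional hps hpd hβ (hE n) hadm₀.1 hS₀ hm₀]
  exact (h.realFunctional_le hps hpd hβ (hE n) (hmin n).1.1 (hS n) hcont hε hpos hn).trans
    ((hmin n).2 hadm₀)

/-- Removes `ε`. If `E ≠ 0` and the mass were zero, the density would vanish and the term `-E.real
univ * log ε` would be unbounded as `ε → 0`, contrary to the bound by `r`; so the limit keeps some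
mass. Then the density is at least some `c > 0`, and `log (f + ε) ≤ log f + ε / c`. -/
theorem functional_le_of_forall (h : st.HasEventDensity ps pd q f) (hps : 0 < ps) (hpd : 0 < pd)
    (hβ : 0 < β) {E : Measure Event} [IsFiniteMeasure E] (hE : E st.eventSetᶜ = 0)
    {ρ : Measure SpaceTime} [IsFiniteMeasure ρ] {η : Fin 3 → SignedMeasure SpaceTime}
    (hc : ρ (Icc 0 sc.T ×ˢ sc.D)ᶜ = 0) (hS : benamouBrenier sc.T ρ η ≠ ⊤) {r : ℝ}
    (hr : ∀ ε > 0, realFunctional ps pd β E (fun e => f ρ (velocity ρ η) e + ε) (ρ.real univ)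
      (∫ p, ‖velocity ρ η p‖ ^ 2 ∂ρ) ≤ r) :
    reconstructionFunctional st ps pd q β E ρ η ≤ (r : EReal) := by
  have hf := isFlow_velocity hc hS
  set m := ρ.real univ with hm
  set s := ∫ p, ‖velocity ρ η p‖ ^ 2 ∂ρ with hs
  rcases eq_or_ne E 0 with rfl | hE0
  · rw [h.functional_zero hps hpd hβ hc hS, EReal.coe_le_coe_iff]
    have := hr 1 one_pos
    simpa [realFunctional] using this
  rcases (measureReal_nonneg : 0 ≤ ρ.real univ).eq_or_lt with h0 | h0
  · exfalso
    have hE1 : 0 < E.real univ :=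
      ENNReal.toReal_pos (by simpa using hE0) (measure_ne_top _ _)
    have hz := h.eq_zero_of_mass_eq_zero hf h0.symm
    have hlog : ∀ ε > 0, (ps + pd) * m + -(E.real univ * Real.log ε) + β * s ≤ r := fun ε hε => by
      have h1 := hr ε hε
      have h2 : ∫ e, Real.log (f ρ (velocity ρ η) e + ε) ∂E = E.real univ * Real.log ε := by
        rw [← smul_eq_mul, ← integral_const]
        exact integral_congr_ae ((ae_mem_of_compl hE).mono fun e he => by simp [hz e he])
      rwa [realFunctional, h2] at h1
    -- With `ε = exp y` the inequality `hlog` becomes `r + 1 ≤ r`.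
    set y : ℝ := ((ps + pd) * m + β * s - r - 1) / E.real univ with hy
    have h1 := hlog (Real.exp y) (Real.exp_pos _)
    rw [Real.log_exp, hy, mul_div_cancel₀ _ hE1.ne'] at h1
    linarith
  · rw [h.functional_eq_realFunctional hps hpd hβ hE hc hS h0, EReal.coe_le_coe_iff]
    obtain ⟨c, hc0, hcf⟩ := h.exists_pos_le hf h0
    have hcont := h.continuousOn ρ _ hf
    have key : ∀ ε > 0, realFunctional ps pd β E (f ρ (velocity ρ η)) m s ≤
        r + ε * (E.real univ / c) := fun ε hε => by
      have h1 := hr ε hε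
      have i1 := integrable_log_of_continuousOn hE st.isCompact_eventSet hcont hc0 hcf
      have i2 := integrable_log_of_continuousOn hE st.isCompact_eventSet
        (hcont.add continuousOn_const) (g := fun e => f ρ (velocity ρ η) e + ε) hc0
        fun e he => (hcf e he).trans (le_add_of_nonneg_right hε.le)
      have h2 : ∫ e, Real.log (f ρ (velocity ρ η) e + ε) ∂E ≤
          ∫ e, (Real.log (f ρ (velocity ρ η) e) + ε / c) ∂E := by
        refine integral_mono_ae i2 (i1.add (integrable_const _))
          ((ae_mem_of_compl hE).mono fun e he => ?_)
        have hpos : 0 < f ρ (velocity ρ η) e := hc0.trans_le (hcf e he)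
        have h3 := Real.log_le_sub_one_of_pos
          (x := (f ρ (velocity ρ η) e + ε) / f ρ (velocity ρ η) e) (by positivity)
        rw [Real.log_div (by positivity) hpos.ne', add_div, div_self hpos.ne'] at h3
        have h4 : ε / f ρ (velocity ρ η) e ≤ ε / c := by
          gcongr
          exact hcf e he
        change Real.log (f ρ (velocity ρ η) e + ε) ≤ Real.log (f ρ (velocity ρ η) e) + ε / c
        linarith
      rw [integral_add i1 (integrable_const _), integral_const, smul_eq_mul] at h2
      rw [realFunctional] at h1 ⊢
      have h5 : E.real univ * (ε / c) = ε * (E.real univ / c) := by ring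
      linarith
    have ht : Tendsto (fun ε : ℝ => r + ε * (E.real univ / c)) (𝓝[>] 0) (𝓝 r) := by
      have : Tendsto (fun ε : ℝ => r + ε * (E.real univ / c)) (𝓝 0)
          (𝓝 (r + 0 * (E.real univ / c))) :=
        (by fun_prop : Continuous fun ε : ℝ => r + ε * (E.real univ / c)).tendsto 0
      rw [zero_mul, add_zero] at this
      exact this.mono_left nhdsWithin_le_nhds
    exact ge_of_tendsto ht (by filter_upwards [self_mem_nhdsWithin] with ε hε using key ε hε)

/-- A pair whose functional is bounded by that of all competitors of positive mass is a
minimizer. -/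
theorem isMinimizer_of_forall (h : st.HasEventDensity ps pd q f) (hps : 0 < ps) (hpd : 0 < pd)
    (hβ : 0 < β) {E : FiniteMeasure Event} (hE : (E : Measure Event) st.eventSetᶜ = 0)
    {ρ : FiniteMeasure SpaceTime} {η : Fin 3 → SignedMeasure SpaceTime}
    (hadm : (ρ, η) ∈ admissiblePairs sc)
    (hle : ∀ (ρ₀ : FiniteMeasure SpaceTime) (η₀ : Fin 3 → SignedMeasure SpaceTime),
      (ρ₀, η₀) ∈ admissiblePairs sc → benamouBrenier sc.T ρ₀ η₀ ≠ ⊤ →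
      0 < (ρ₀ : Measure SpaceTime).real univ →
      reconstructionFunctional st ps pd q β E ρ η ≤
        reconstructionFunctional st ps pd q β E ρ₀ η₀) :
    IsMinimizer st ps pd q β E ρ η := by
  refine ⟨hadm, ?_⟩
  rintro ⟨ρ₀, η₀⟩ hadm₀
  change reconstructionFunctional st ps pd q β E ρ η ≤
    reconstructionFunctional st ps pd q β E ρ₀ η₀
  by_cases hS₀ : benamouBrenier sc.T ρ₀ η₀ = ⊤
  · rw [reconstructionFunctional.eq_def st ps pd q β E ρ₀, if_pos hS₀]
    exact le_top
  rcases (measureReal_nonneg : 0 ≤ (ρ₀ : Measure SpaceTime).real univ).eq_or_lt with h0 | h0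
  -- Competitors without mass: if `E ≠ 0` their value is infinite. If `E = 0` their value is
  -- nonnegative, and resting masses `c → 0` are competitors of positive mass whose values tend to
  -- zero.
  · by_cases hE0 : (E : Measure Event) = 0
    · rw [hE0] at hle ⊢
      have hnn : (0 : EReal) ≤ reconstructionFunctional st ps pd q β 0 ρ₀ η₀ := by
        rw [h.functional_zero hps hpd hβ hadm₀.1 hS₀, ← EReal.coe_zero, EReal.coe_le_coe_iff]
        have : 0 ≤ ∫ p, ‖velocity ρ₀ η₀ p‖ ^ 2 ∂(ρ₀ : Measure SpaceTime) :=
          integral_nonneg fun p => by positivity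
        have h1 : (0 : ℝ) ≤ (ρ₀ : Measure SpaceTime).real univ := measureReal_nonneg
        positivity
      refine le_trans ?_ hnn
      have hc : ∀ c : ℝ, 0 < c →
          reconstructionFunctional st ps pd q β 0 ρ η ≤ (((ps + pd) * c : ℝ) : EReal) := by
        intro c hc
        obtain ⟨ρ₁, η₁, hadm₁, hS₁, hm₁, hs₁⟩ := exists_stationary_admissible sc hc.le
        have := hle ρ₁ η₁ hadm₁ hS₁ (by rwa [hm₁])
        rwa [h.functional_zero hps hpd hβ hadm₁.1 hS₁, hm₁, hs₁, mul_zero, add_zero] at this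
      have ht : Tendsto (fun c : ℝ => (((ps + pd) * c : ℝ) : EReal)) (𝓝[>] 0) (𝓝 0) := by
        have : Tendsto (fun c : ℝ => (((ps + pd) * c : ℝ) : EReal)) (𝓝 0)
            (𝓝 (((ps + pd) * 0 : ℝ) : EReal)) :=
          (continuous_coe_real_ereal.comp (continuous_const.mul continuous_id)).tendsto 0
        rw [mul_zero, EReal.coe_zero] at this
        exact this.mono_left nhdsWithin_le_nhds
      exact ge_of_tendsto ht (by filter_upwards [self_mem_nhdsWithin] with c h1 using hc c h1)
    · rw [h.functional_eq_top hps hpd hβ hE hE0 hadm₀.1 hS₀ h0.symm]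
      exact le_top
  · exact hle ρ₀ η₀ hadm₀ hS₀ h0

end Setting.HasEventDensity

theorem mainTheorem5 (sc : Scanner) (st : Setting sc) (ps pd q β : ℝ)
    (hps : 0 < ps) (hpd : 0 < pd) (hp : ps + pd ≤ 1) (hq : 0 < q) (hβ : 0 < β)
    (E : ℕ → FiniteMeasure Event) (E' : FiniteMeasure Event)
    (hE : ∀ n, (E n : Measure Event) st.eventSetᶜ = 0)
    (hE' : (E' : Measure Event) (Icc 0 sc.T ×ˢ frontier sc.K ×ˢ frontier sc.K)ᶜ = 0)
    (hlim : Tendsto E atTop (𝓝 E'))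
    (ρ : ℕ → FiniteMeasure SpaceTime) (η : ℕ → Fin 3 → SignedMeasure SpaceTime)
    (hmin : ∀ n, IsMinimizer st ps pd q β (E n) (ρ n) (η n)) :
    ∃ (k : ℕ → ℕ) (ρ' : FiniteMeasure SpaceTime) (η' : Fin 3 → SignedMeasure SpaceTime),
      StrictMono k ∧
      Tendsto (fun n => ρ (k n)) atTop (𝓝 ρ') ∧
      VectorWeakStarTendsto (fun n => η (k n)) η' ∧
      IsMinimizer st ps pd q β E' ρ' η' := by
  obtain ⟨f, h⟩ := st.exists_hasEventDensity hps hpd hq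
  have hE₁ : (E' : Measure Event) st.eventSetᶜ = 0 :=
    measure_compl_eq_zero_of_tendsto hlim st.isCompact_eventSet.isClosed hE
  obtain ⟨A, hA⟩ := h.exists_massEnergy_le hps hpd hβ hE hE₁ hlim hmin
  obtain ⟨k, ρ', η', s, hk, hρ, hη, hadm, hS, hs, hle⟩ := exists_subseq_tendsto_admissible
    (fun n => (hmin n).1) (fun n => (hA n).1) fun n => (hA n).2
  refine ⟨k, ρ', η', hk, hρ, hη, h.isMinimizer_of_forall hps hpd hβ hE₁ hadm
    fun ρ₀ η₀ hadm₀ hS₀ hm₀ => ?_⟩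
  rw [h.functional_eq_realFunctional hps hpd hβ hE₁ hadm₀.1 hS₀ hm₀]
  refine h.functional_le_of_forall hps hpd hβ hE₁ hadm.1 hS fun ε hε => ?_
  refine le_trans ?_ (h.realFunctional_add_le hps hpd hβ (fun n => hE (k n)) hE₁
    (hlim.comp hk.tendsto_atTop) (fun n => hmin (k n)) (fun n => (hA (k n)).1)
    (fun n => (hA (k n)).2) (isFlow_velocity hadm.1 hS) hρ hs hadm₀ hS₀ hm₀ hε)
  -- The two sides differ only in the energy, and the energy of the limit is at most the limit `s`
  -- of the energies.
  rw [realFunctional, realFunctional]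
  gcongr

end
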